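/- \textbf{Setting.} Let $G$ be a connected reductive affine algebraic group over $\mathbb{C}$ (reductive: every finite-dimensional rational representation is completely reducible), with Lie algebra $\mathfrak g$. Let $\mathsf W=\operatorname{Spec}R$ be a connected smooth affine symplectic variety over $\mathbb{C}$ with an algebraic $G$-action and a flat $G$-equivariant moment map $\mathsf W\to\mathfrak g^*$, i.e. a $G$-equivariant linear map $\mu^{cl}:\mathfrak g\to R$ such that $\{\mu^{cl}(z),-\}$ is the infinitesimal action of $z\in\mathfrak g$ on $R$. Let $\mathsf A$ be a filtered quantization of this data: a $\mathbb{C}$-algebra with an exhaustive increasing filtration $0=F_{-1}\subseteq F_0\subseteq F_1\subseteq\cdots$ and an isomorphism of Poisson algebras $\operatorname{gr}\mathsf A\cong R$ (the bracket on $\operatorname{gr}\mathsf A$ being induced by commutators, $[F_i,F_j]\subseteq F_{i+j-1}$); a rational $G$-action on $\mathsf A$ by algebra automorphisms that preserves the filtration and makes this isomorphism equivariant; and a $G$-equivariant Lie algebra map $\mu:\mathfrak g\to F_1\subseteq\mathsf A$ whose symbol of degree $1$ is $\mu^{cl}$, and such that $[\mu(z),-]$ is the infinitesimal action of $z$ on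 $\mathsf A$. Let $c:\mathfrak g\to\mathbb{C}$ be a Lie algebra character and $\chi:G\to\mathbb{G}_m$ a character of $G$. \textbf{Categories.} $(\mathsf A,G)\text{-mod}$ is the category of left $\mathsf A$-modules $M$ with a rational $G$-action such that $g(am)=(g\cdot a)(gm)$, and $\operatorname{sap}_c:(\mathsf A,G,c)\text{-mod}\hookrightarrow(\mathsf A,G)\text{-mod}$ is the inclusion of the full subcategory of modules on which, for every $z\in\mathfrak g$, the derivative of the $G$-action equals multiplication by $\mu(z)+c(z)$. The singular support $SS(M)\subseteq\mathsf W$ of an $\mathsf A$-module $M$ is the union, over its finitely generated submodules $N$, of the supports of $\operatorname{gr}N$ for good filtrations on $N$. The unstable locus $\mathsf W^{uns}$ is the set of common zeros of all functions $f$ on $\mathsf W$ with $f(gx)=\chi(g)^{\ell}f(x)$ for some $\ell\ge 1$. Let $\pi_c:(\mathsf A,G,c)\text{-mod}\to\mathcal E_{\mathfrak X}(c)\text{-mod}$ be the Serre quotient by the full subcategory of modules $M$ with $SS(M)\subseteq\mathsf W^{uns}$, and let $D(\mathcal E_{\mathfrak X}(c))$ be the unbounded derived category of $\mathcal E_{\mathfrak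 X}(c)\text{-mod}$ (the microlocal derived category). The exact functors $\operatorname{sap}_c$ and $\pi_c$ induce functors of unbounded derived categories, denoted by the same symbols. \textbf{Proposition.} The unbounded derived categories $D((\mathsf A,G)\text{-mod})$, $D((\mathsf A,G,c)\text{-mod})$ and $D(\mathcal E_{\mathfrak X}(c))$ have small coproducts, and there are adjoint pairs $$\mathbb L\Phi_c: D((\mathsf A,G)\text{-mod})\leftrightarrows D((\mathsf A,G,c)\text{-mod}):\operatorname{sap}_c,\qquad \pi_c: D((\mathsf A,G,c)\text{-mod})\leftrightarrows D(\mathcal E_{\mathfrak X}(c)):\mathbb R\Gamma_c,$$ where $\mathbb L\Phi_c$ is the left derived functor of a left adjoint $\Phi_c$ of $\operatorname{sap}_c$ and $\mathbb R\Gamma_c$ is the right derived functor of a right adjoint $\Gamma_c$ of $\pi_c$ (at the level of abelian categories). Moreover: \begin{enumerate} \item The right adjoints $\operatorname{sap}_c$ and $\mathbb R\Gamma_c$ preserve all small colimits (in particular small coproducts). \item $D(\mathcal E_{\mathfrak X}(c))$ is compactly generated: it has a small set of compact objects $S$ such that every object $X$ with $\operatorname{Hom}(s,X[n])=0$ for all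 $s\in S$, $n\in\mathbb Z$, is zero. \end{enumerate} -/

import Mathlib

open CategoryTheory Limits

universe u w w₁ w₂ w₃

noncomputable section

namespace Microlocal

/-! ### Complex affine algebraic groups -/

/-- A structure of affine algebraic group over `ℂ` on the group `G` of its points: a finitely
generated algebra of functions on `G` whose maximal spectrum is `G`, such that multiplication and
inversion are morphisms of affine varieties. -/
class AffineAlgebraicGroup (G : Type u) [Group G] where
  coord : Subalgebra ℂ (G → ℂ)
  fg : coord.FG
  eval_bijective : Function.Bijective
    (fun g : G => ((Pi.evalAlgHom ℂ (fun _ : G => ℂ) g).comp coord.val : coord →ₐ[ℂ] ℂ))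
  mul_regular : ∀ f ∈ coord, ∃ (n : ℕ) (a b : Fin n → coord),
    ∀ x y, f (x * y) = ∑ i, (a i).1 x * (b i).1 y
  inv_regular : ∀ f ∈ coord, (fun x => f x⁻¹) ∈ coord

section Group

variable (G : Type u) [Group G] [AffineAlgebraicGroup G]

/-- The algebra `ℂ[G]` of regular functions. -/
abbrev CoordRing : Type u := (AffineAlgebraicGroup.coord (G := G))

variable {G}

lemma leftTranslate_mem (g : G) (f : CoordRing G) :
    (fun x => f.1 (g * x)) ∈ AffineAlgebraicGroup.coord (G := G) := by
  obtain ⟨n, a, b, h⟩ := AffineAlgebraicGroup.mul_regular f.1 f.2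
  have : (fun x => f.1 (g * x)) = ∑ i, (a i).1 g • (b i).1 := by
    funext x; simp [h]
  rw [this]
  exact Subalgebra.sum_mem _ fun i _ => Subalgebra.smul_mem _ (b i).2 _

lemma rightTranslate_mem (g : G) (f : CoordRing G) :
    (fun x => f.1 (x * g)) ∈ AffineAlgebraicGroup.coord (G := G) := by
  obtain ⟨n, a, b, h⟩ := AffineAlgebraicGroup.mul_regular f.1 f.2
  have : (fun x => f.1 (x * g)) = ∑ i, (b i).1 g • (a i).1 := by
    funext x; simp [h, mul_comm]
  rw [this]
  exact Subalgebra.sum_mem _ fun i _ => Subalgebra.smul_mem _ (a i).2 _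

/-- `f ↦ (x ↦ f (g * x))`. -/
def leftTranslate (g : G) : CoordRing G →ₐ[ℂ] CoordRing G where
  toFun f := ⟨fun x => f.1 (g * x), leftTranslate_mem g f⟩
  map_one' := rfl
  map_mul' _ _ := rfl
  map_zero' := rfl
  map_add' _ _ := rfl
  commutes' _ := rfl

/-- `f ↦ (x ↦ f (x * g))`. -/
def rightTranslate (g : G) : CoordRing G →ₐ[ℂ] CoordRing G where
  toFun f := ⟨fun x => f.1 (x * g), rightTranslate_mem g f⟩
  map_one' := rfl
  map_mul' _ _ := rfl
  map_zero' := rfl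
  map_add' _ _ := rfl
  commutes' _ := rfl

variable (G) in
/-- The Lie algebra `𝔤` of `G`: left-invariant derivations of `ℂ[G]`. -/
def LieAlg : LieSubalgebra ℂ (Derivation ℂ (CoordRing G) (CoordRing G)) where
  carrier := {D | ∀ (g : G) (f : CoordRing G), D (leftTranslate g f) = leftTranslate g (D f)}
  add_mem' {D E} hD hE g f := by simp [hD g f, hE g f]
  zero_mem' g f := by simp
  smul_mem' c D hD g f := by simp [hD g f]
  lie_mem' {D E} hD hE g f := by
    have hD' : ∀ g f, D (leftTranslate g f) = leftTranslate g (D f) := hD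
    have hE' : ∀ g f, E (leftTranslate g f) = leftTranslate g (E f) := hE
    simp [Derivation.commutator_apply, hD', hE']

/-- The tangent vector at the identity given by `z ∈ 𝔤`. -/
def atOne (z : LieAlg G) : CoordRing G →ₗ[ℂ] ℂ where
  toFun f := (z.1 f).1 1
  map_add' f h := by simp
  map_smul' c f := by simp

lemma rightTranslate_comp (g : G) (f : CoordRing G) :
    rightTranslate g (rightTranslate g⁻¹ f) = f :=
  Subtype.ext (funext fun x => congrArg f.1 (by simp [mul_assoc]))

lemma leftTranslate_rightTranslate (g h : G) (f : CoordRing G) :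
    leftTranslate g (rightTranslate h f) = rightTranslate h (leftTranslate g f) :=
  Subtype.ext (funext fun x => congrArg f.1 (by simp [mul_assoc]))

/-- The adjoint action of `G` on `𝔤`. -/
def Ad (g : G) (z : LieAlg G) : LieAlg G where
  val := Derivation.mk'
    ((rightTranslate g).toLinearMap ∘ₗ (z.1 : CoordRing G →ₗ[ℂ] CoordRing G) ∘ₗ
      (rightTranslate g⁻¹).toLinearMap)
    (fun a b => by
      change rightTranslate g (z.1 (rightTranslate g⁻¹ (a * b))) =
        a * rightTranslate g (z.1 (rightTranslate g⁻¹ b)) +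
          b * rightTranslate g (z.1 (rightTranslate g⁻¹ a))
      rw [map_mul, Derivation.leibniz, map_add, smul_eq_mul, smul_eq_mul, map_mul, map_mul,
        rightTranslate_comp, rightTranslate_comp])
  property := by
    have hz : ∀ g f, z.1 (leftTranslate g f) = leftTranslate g (z.1 f) := z.2
    intro h f
    change rightTranslate g (z.1 (rightTranslate g⁻¹ (leftTranslate h f))) =
      leftTranslate h (rightTranslate g (z.1 (rightTranslate g⁻¹ f)))
    rw [← leftTranslate_rightTranslate, hz, leftTranslate_rightTranslate]

/-! ### Rational representations and their derivatives -/

section Rational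

variable {V : Type*} [AddCommGroup V] [Module ℂ V]

/-- `g ↦ ρ g v` is the regular `V`-valued function `∑ fᵢ ⊗ wᵢ` on `G`. -/
def IsExpansion (ρ : Representation ℂ G V) (v : V) {n : ℕ} (f : Fin n → CoordRing G)
    (w : Fin n → V) : Prop :=
  ∀ g, ρ g v = ∑ i, (f i).1 g • w i

/-- A representation of `G` is rational if it is a union of finite-dimensional algebraic
subrepresentations; equivalently, all its orbit maps are regular. -/
def IsRational (ρ : Representation ℂ G V) : Prop :=
  ∀ v, ∃ (n : ℕ) (f : Fin n → CoordRing G) (w : Fin n → V), IsExpansion ρ v f w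

/-- The derivative of a rational representation: the action of `z ∈ 𝔤` on `V` obtained by
applying the tangent vector of `z` at the identity to the orbit map `g ↦ ρ g v`. -/
def infAct {ρ : Representation ℂ G V} (hρ : IsRational ρ) (z : LieAlg G) (v : V) : V :=
  ∑ i, atOne z ((hρ v).choose_spec.choose i) • (hρ v).choose_spec.choose_spec.choose i

lemma expansion_unique {ρ : Representation ℂ G V} {v : V} {n m : ℕ}
    {f : Fin n → CoordRing G} {w : Fin n → V} {f' : Fin m → CoordRing G} {w' : Fin m → V}
    (h : IsExpansion ρ v f w) (h' : IsExpansion ρ v f' w') (z : LieAlg G) :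
    ∑ i, atOne z (f i) • w i = ∑ i, atOne z (f' i) • w' i := by
  rw [← sub_eq_zero, ← Module.forall_dual_apply_eq_zero_iff ℂ]
  intro l
  have key : ∑ i, l (w i) • f i = ∑ i, l (w' i) • f' i := by
    apply Subtype.ext
    funext g
    have := congrArg l ((h g).symm.trans (h' g))
    simpa [mul_comm] using this
  have := congrArg (atOne z) key
  simp only [map_sum, map_smul, smul_eq_mul] at this
  simp [mul_comm, this]

/-- The derivative does not depend on the chosen expansion of the orbit map. -/
lemma infAct_eq {ρ : Representation ℂ G V} (hρ : IsRational ρ) {v : V} {n : ℕ}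
    {f : Fin n → CoordRing G} {w : Fin n → V} (h : IsExpansion ρ v f w) (z : LieAlg G) :
    infAct hρ z v = ∑ i, atOne z (f i) • w i :=
  expansion_unique (hρ v).choose_spec.choose_spec.choose_spec h z

lemma IsExpansion.add {ρ : Representation ℂ G V} {v v' : V} {n m : ℕ}
    {f : Fin n → CoordRing G} {w : Fin n → V} {f' : Fin m → CoordRing G} {w' : Fin m → V}
    (h : IsExpansion ρ v f w) (h' : IsExpansion ρ v' f' w') :
    IsExpansion ρ (v + v') (Fin.append f f') (Fin.append w w') := fun g => by
  rw [map_add, h g, h' g, Fin.sum_univ_add]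
  simp

lemma infAct_add {ρ : Representation ℂ G V} (hρ : IsRational ρ) (z : LieAlg G) (v v' : V) :
    infAct hρ z (v + v') = infAct hρ z v + infAct hρ z v' := by
  obtain ⟨n, f, w, h⟩ := hρ v
  obtain ⟨m, f', w', h'⟩ := hρ v'
  rw [infAct_eq hρ h, infAct_eq hρ h', infAct_eq hρ (h.add h'), Fin.sum_univ_add]
  simp

end Rational

variable (G) in
/-- `G` is reductive: every finite-dimensional rational representation is completely reducible
(over `ℂ` this is the usual definition of a reductive group in invariant theory, and it is
equivalent to the triviality of the unipotent radical). -/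
def IsReductive : Prop :=
  ∀ (n : ℕ) (ρ : Representation ℂ G (Fin n → ℂ)), IsRational ρ →
    ∀ U : Submodule ℂ (Fin n → ℂ), (∀ g, ∀ x ∈ U, ρ g x ∈ U) →
      ∃ U' : Submodule ℂ (Fin n → ℂ), (∀ g, ∀ x ∈ U', ρ g x ∈ U') ∧ IsCompl U U'

end Group

/-! ### Affine symplectic varieties -/

section Symplectic

variable (R : Type u) [CommRing R] [Algebra ℂ R]

/-- A symplectic form on the smooth affine variety `Spec R`: a closed nondegenerate alternating
form on the vector fields. -/
structure SymplecticForm where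
  form : Derivation ℂ R R →ₗ[R] Module.Dual R (Derivation ℂ R R)
  alternating : ∀ X, form X X = 0
  nondegenerate : Function.Bijective form
  closed : ∀ X Y Z, X (form Y Z) + Y (form Z X) + Z (form X Y)
    - form ⁅X, Y⁆ Z - form ⁅Y, Z⁆ X - form ⁅Z, X⁆ Y = 0

variable {R}

/-- The differential `df`, as the linear form `Y ↦ Y f` on vector fields. -/
def differential (f : R) : Module.Dual R (Derivation ℂ R R) where
  toFun Y := Y f
  map_add' _ _ := rfl
  map_smul' _ _ := rfl

/-- The Hamiltonian vector field `X_f`, defined by `ω(X_f, -) = df`. -/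
def SymplecticForm.hamiltonian (ω : SymplecticForm R) (f : R) : Derivation ℂ R R :=
  (LinearEquiv.ofBijective ω.form ω.nondegenerate).symm (differential f)

/-- The Poisson bracket `{f, h} = X_f h`. -/
def SymplecticForm.poisson (ω : SymplecticForm R) (f h : R) : R := ω.hamiltonian f h

end Symplectic

section Hamiltonian

variable (G : Type u) [Group G] [AffineAlgebraicGroup G]
variable (R : Type u) [CommRing R] [Algebra ℂ R] [MulSemiringAction G R] [SMulCommClass G ℂ R]

/-- A symplectic form on `W = Spec R`, for a rational action of `G` on `R`, with a `G`-equivariant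
moment map `W → 𝔤*`, given by its comorphism `𝔤 → R`.  The action on functions is
`(g • f)(x) = f (g⁻¹ x)`. -/
structure HamiltonianSpace where
  symp : SymplecticForm R
  rational : IsRational (Representation.ofDistribMulAction ℂ G R)
  moment : LieAlg G →ₗ[ℂ] R
  moment_equivariant : ∀ g z, moment (Ad g z) = g • moment z
  moment_poisson : ∀ z f, symp.poisson (moment z) f = infAct rational z f

variable {G R}

/-- The moment map `W → 𝔤* = Spec (Sym 𝔤)` is flat. -/
def HamiltonianSpace.IsFlat (W : HamiltonianSpace G R) : Prop :=
  (SymmetricAlgebra.lift W.moment).toRingHom.Flat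

/-- `f (g x) = χ(g) f(x)`. -/
def IsSemiInvariant (χ : G →* ℂˣ) (f : R) : Prop :=
  ∀ g : G, g⁻¹ • f = (χ g : ℂ) • f

variable (R) in
/-- The `χ`-unstable locus of `W = Spec R`: the common zeros of all `χ^ℓ`-semi-invariants,
`ℓ ≥ 1`. -/
def unstableLocus (χ : G →* ℂˣ) : Set (PrimeSpectrum R) :=
  {p | ∀ ℓ : ℕ, 1 ≤ ℓ → ∀ f : R, IsSemiInvariant (χ ^ ℓ) f → f ∈ p.asIdeal}

/-- A filtered quantization of `W`.  The filtration is `F i`, with `F i = 0` for `i < 0`, and the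
isomorphism `gr A ≅ R = ℂ[W]` of Poisson algebras is given by the symbol maps `F i → R`, which
have kernel `F (i - 1)` and whose images decompose `R` as a direct sum. -/
structure FilteredQuantization (W : HamiltonianSpace G R)
    (A : Type u) [Ring A] [Algebra ℂ A] [MulSemiringAction G A] [SMulCommClass G ℂ A] where
  F : ℤ → Submodule ℂ A
  mono : Monotone F
  neg : ∀ i < 0, F i = ⊥
  exhaustive : ∀ a, ∃ i, a ∈ F i
  one_mem : (1 : A) ∈ F 0
  mul_mem : ∀ {i j a b}, a ∈ F i → b ∈ F j → a * b ∈ F (i + j)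
  symbol : ∀ i, F i →ₗ[ℂ] R
  symbol_eq_zero_iff : ∀ i (a : F i), symbol i a = 0 ↔ a.1 ∈ F (i - 1)
  symbol_isInternal : DirectSum.IsInternal fun i => LinearMap.range (symbol i)
  symbol_one : symbol 0 ⟨1, one_mem⟩ = 1
  symbol_mul : ∀ i j (a : F i) (b : F j),
    symbol (i + j) ⟨a.1 * b.1, mul_mem a.2 b.2⟩ = symbol i a * symbol j b
  symbol_commutator : ∀ i j (a : F i) (b : F j), ∃ h : a.1 * b.1 - b.1 * a.1 ∈ F (i + j - 1),
    symbol (i + j - 1) ⟨a.1 * b.1 - b.1 * a.1, h⟩ = W.symp.poisson (symbol i a) (symbol j b)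
  rational : IsRational (Representation.ofDistribMulAction ℂ G A)
  smul_mem : ∀ (g : G) {i a}, a ∈ F i → g • a ∈ F i
  symbol_smul : ∀ (g : G) i (a : F i), symbol i ⟨g • a.1, smul_mem g a.2⟩ = g • symbol i a
  moment : LieAlg G →ₗ[ℂ] A
  moment_lie : ∀ y z, moment ⁅y, z⁆ = moment y * moment z - moment z * moment y
  moment_equivariant : ∀ g z, moment (Ad g z) = g • moment z
  moment_mem : ∀ z, moment z ∈ F 1
  symbol_moment : ∀ z, symbol 1 ⟨moment z, moment_mem z⟩ = W.moment z
  moment_commutator : ∀ z a, moment z * a - a * moment z = infAct rational z a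

end Hamiltonian

/-! ### Equivariant modules

A module over the smash product `SkewMonoidAlgebra A G` (in which `g a = (g • a) g`) is an
`A`-module `M` with a linear `G`-action satisfying `g (a m) = (g • a) (g m)`; morphisms of such
modules are the `G`-equivariant `A`-linear maps. -/

section Modules

set_option linter.unusedSectionVars false

variable {G : Type u} [Group G] [AffineAlgebraicGroup G]
variable {A : Type u} [Ring A] [Algebra ℂ A] [MulSemiringAction G A] [SMulCommClass G ℂ A]

instance instModuleA (M : ModuleCat.{u} (SkewMonoidAlgebra A G)) : Module A M :=
  Module.compHom M (SkewMonoidAlgebra.singleOneRingHom (k := A) (G := G))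

instance instModuleC (M : ModuleCat.{u} (SkewMonoidAlgebra A G)) : Module ℂ M :=
  Module.compHom M (algebraMap ℂ A)

instance instTower (M : ModuleCat.{u} (SkewMonoidAlgebra A G)) : IsScalarTower ℂ A M :=
  ⟨fun c a m => by
    rw [Algebra.smul_def, mul_smul]; rfl⟩

lemma smulA_def (M : ModuleCat.{u} (SkewMonoidAlgebra A G)) (a : A) (m : M) :
    a • m = SkewMonoidAlgebra.single (1 : G) a • m := rfl

lemma smulC_def (M : ModuleCat.{u} (SkewMonoidAlgebra A G)) (c : ℂ) (m : M) :
    c • m = (algebraMap ℂ A c) • m := rfl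

/-- The `G`-action on an `A`-module with compatible `G`-action. -/
def repOf (M : ModuleCat.{u} (SkewMonoidAlgebra A G)) : Representation ℂ G M where
  toFun g :=
    { toFun := fun m => SkewMonoidAlgebra.single g (1 : A) • m
      map_add' := fun x y => smul_add _ x y
      map_smul' := fun c m => by
        simp only [smulC_def, smulA_def, ← mul_smul, SkewMonoidAlgebra.single_mul_single,
          RingHom.id_apply]
        simp [Algebra.algebraMap_eq_smul_one, smul_comm g c (1 : A)] }
  map_one' := by ext m; exact one_smul _ m
  map_mul' g h := by
    ext m
    simp [← mul_smul, SkewMonoidAlgebra.single_mul_single]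

/-- A morphism is `A`-linear. -/
lemma hom_smulA {M N : ModuleCat.{u} (SkewMonoidAlgebra A G)} (f : M ⟶ N) (a : A) (m : M) :
    f.hom (a • m) = a • f.hom m := f.hom.map_smul _ m

/-- A morphism, as a `ℂ`-linear map. -/
def homC {M N : ModuleCat.{u} (SkewMonoidAlgebra A G)} (f : M ⟶ N) : M →ₗ[ℂ] N where
  toFun := f.hom
  map_add' := f.hom.map_add
  map_smul' _ m := f.hom.map_smul _ m

/-- A morphism is `G`-equivariant. -/
lemma homC_repOf {M N : ModuleCat.{u} (SkewMonoidAlgebra A G)} (f : M ⟶ N) (g : G) (m : M) :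
    homC f (repOf M g m) = repOf N g (homC f m) := f.hom.map_smul _ m


lemma infAct_hom {M N : ModuleCat.{u} (SkewMonoidAlgebra A G)} (f : M ⟶ N)
    (hM : IsRational (repOf M)) (hN : IsRational (repOf N)) (z : LieAlg G) (m : M) :
    homC f (infAct hM z m) = infAct hN z (homC f m) := by
  obtain ⟨n, a, w, h⟩ := hM m
  rw [infAct_eq hM h z, infAct_eq (f := a) (w := fun i => homC f (w i)) hN _ z]
  · simp
  · intro g
    rw [← homC_repOf, h g]
    simp

lemma homC_injective {M N : ModuleCat.{u} (SkewMonoidAlgebra A G)} (f : M ⟶ N) [Mono f] :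
    Function.Injective (homC f) := (ModuleCat.mono_iff_injective f).1 inferInstance

lemma homC_surjective {M N : ModuleCat.{u} (SkewMonoidAlgebra A G)} (f : M ⟶ N) [Epi f] :
    Function.Surjective (homC f) := (ModuleCat.epi_iff_surjective f).1 inferInstance

lemma isRational_of_mono {M N : ModuleCat.{u} (SkewMonoidAlgebra A G)} (f : M ⟶ N) [Mono f]
    (hN : IsRational (repOf N)) : IsRational (repOf M) := by
  obtain ⟨r, hr⟩ := (homC f).exists_leftInverse_of_injective
    (LinearMap.ker_eq_bot.2 (homC_injective f))
  have hr' : ∀ m, r (homC f m) = m := fun m => LinearMap.congr_fun hr m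
  intro m
  obtain ⟨n, a, w, h⟩ := hN (homC f m)
  refine ⟨n, a, fun i => r (w i), fun g => ?_⟩
  rw [← hr' (repOf M g m), homC_repOf, h g]
  simp

lemma isRational_of_epi {M N : ModuleCat.{u} (SkewMonoidAlgebra A G)} (f : M ⟶ N) [Epi f]
    (hM : IsRational (repOf M)) : IsRational (repOf N) := by
  intro x
  obtain ⟨m, rfl⟩ := homC_surjective f x
  obtain ⟨n, a, w, h⟩ := hM m
  refine ⟨n, a, fun i => homC f (w i), fun g => ?_⟩
  rw [← homC_repOf, h g]
  simp

/-- A condition on modules that is inherited by a finite sum of submodules which satisfy it is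
closed under finite products. -/
lemma closedUnderFiniteProducts_of_biprod {C : Type*} [Category C] [Abelian C]
    (P : ObjectProperty C) [P.ContainsZero] [P.IsClosedUnderIsomorphisms]
    (h : ∀ ⦃X X₁ X₂ : C⦄ (i₁ : X₁ ⟶ X) (i₂ : X₂ ⟶ X) (p₁ : X ⟶ X₁) (p₂ : X ⟶ X₂),
      p₁ ≫ i₁ + p₂ ≫ i₂ = 𝟙 X → P X₁ → P X₂ → P X) : P.IsClosedUnderFiniteProducts := by
  have : P.IsClosedUnderBinaryProducts := by
    refine .mk' ?_
    rintro _ ⟨F, hF⟩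
    let e : limit F ≅ F.obj ⟨WalkingPair.left⟩ ⊞ F.obj ⟨WalkingPair.right⟩ :=
      HasLimit.isoOfNatIso (diagramIsoPair F) ≪≫ (biprod.isoProd _ _).symm
    refine P.prop_of_iso e.symm (h biprod.inl biprod.inr biprod.fst biprod.snd ?_ (hF _) (hF _))
    exact biprod.total
  exact .mk'

variable (G A) in
/-- Weak `G`-equivariance: the `G`-action is rational. -/
def weaklyEquivariant : ObjectProperty (ModuleCat.{u} (SkewMonoidAlgebra A G)) :=
  fun M => IsRational (repOf M)

instance : (weaklyEquivariant G A).IsClosedUnderSubobjects where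
  prop_of_mono f _ h := isRational_of_mono f h

instance : (weaklyEquivariant G A).IsClosedUnderQuotients where
  prop_of_epi f _ h := isRational_of_epi f h

instance : (weaklyEquivariant G A).ContainsZero where
  exists_zero := ⟨ModuleCat.of _ PUnit, ModuleCat.isZero_of_subsingleton _,
    fun _ => ⟨0, Fin.elim0, Fin.elim0, fun _ => Subsingleton.elim (α := PUnit) _ _⟩⟩

lemma isRational_of_sum {X X₁ X₂ : ModuleCat.{u} (SkewMonoidAlgebra A G)}
    (i₁ : X₁ ⟶ X) (i₂ : X₂ ⟶ X) (p₁ : X ⟶ X₁) (p₂ : X ⟶ X₂) (hid : p₁ ≫ i₁ + p₂ ≫ i₂ = 𝟙 X)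
    (h₁ : IsRational (repOf X₁)) (h₂ : IsRational (repOf X₂)) : IsRational (repOf X) := by
  intro x
  have hx : homC i₁ (homC p₁ x) + homC i₂ (homC p₂ x) = x :=
    congrArg (fun f : X ⟶ X => f.hom x) hid
  have key : ∀ {Y : ModuleCat.{u} (SkewMonoidAlgebra A G)} (i : Y ⟶ X) {n : ℕ} {y : Y}
      {a : Fin n → CoordRing G} {w : Fin n → Y}, IsExpansion (repOf Y) y a w →
      IsExpansion (repOf X) (homC i y) a (fun k => homC i (w k)) := by
    intro Y i n y a w h g
    rw [← homC_repOf, h g]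
    simp
  obtain ⟨n₁, a₁, w₁, e₁⟩ := h₁ (homC p₁ x)
  obtain ⟨n₂, a₂, w₂, e₂⟩ := h₂ (homC p₂ x)
  rw [← hx]
  exact ⟨_, _, _, (key i₁ e₁).add (key i₂ e₂)⟩

instance : (weaklyEquivariant G A).IsClosedUnderFiniteProducts :=
  closedUnderFiniteProducts_of_biprod _ fun _ _ _ i₁ i₂ p₁ p₂ hid h₁ h₂ =>
    isRational_of_sum i₁ i₂ p₁ p₂ hid h₁ h₂

variable (G A) in
/-- The category `(A,G)-mod` of weakly `G`-equivariant `A`-modules. -/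
abbrev WeakMod := (weaklyEquivariant G A).FullSubcategory

section Quantization

variable {R : Type u} [CommRing R] [Algebra ℂ R] [MulSemiringAction G R] [SMulCommClass G ℂ R]
variable {W : HamiltonianSpace G R}

/-- `(G,c)`-equivariance: weak equivariance together with the vanishing of
`γ_{M,c}(z) = α(z) - (μ(z) + c(z))` for all `z ∈ 𝔤`, where `α` is the derivative of the
`G`-action. -/
def twistedEquivariant (Q : FilteredQuantization W A) (c : LieAlgebra.LieCharacter ℂ (LieAlg G)) :
    ObjectProperty (ModuleCat.{u} (SkewMonoidAlgebra A G)) :=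
  fun M => ∃ h : IsRational (repOf M),
    ∀ (z : LieAlg G) (m : M), infAct h z m - (Q.moment z + algebraMap ℂ A (c z)) • m = 0

variable (Q : FilteredQuantization W A) (c : LieAlgebra.LieCharacter ℂ (LieAlg G))

lemma homC_smulA {M N : ModuleCat.{u} (SkewMonoidAlgebra A G)} (f : M ⟶ N) (a : A) (m : M) :
    homC f (a • m) = a • homC f m := hom_smulA f a m

instance : (twistedEquivariant Q c).IsClosedUnderSubobjects where
  prop_of_mono f _ := fun ⟨h, h'⟩ => ⟨isRational_of_mono f h, fun z m => homC_injective f <| by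
    rw [map_sub, infAct_hom f _ h, homC_smulA, h', map_zero]⟩

instance : (twistedEquivariant Q c).IsClosedUnderQuotients where
  prop_of_epi f _ := fun ⟨h, h'⟩ => ⟨isRational_of_epi f h, fun z x => by
    obtain ⟨m, rfl⟩ := homC_surjective f x
    rw [← infAct_hom f h, ← homC_smulA, ← map_sub, h', map_zero]⟩

instance : (twistedEquivariant Q c).ContainsZero where
  exists_zero := ⟨ModuleCat.of _ PUnit, ModuleCat.isZero_of_subsingleton _,
    fun _ => ⟨0, Fin.elim0, Fin.elim0, fun _ => Subsingleton.elim (α := PUnit) _ _⟩,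
    fun _ _ => Subsingleton.elim (α := PUnit) _ _⟩

instance : (twistedEquivariant Q c).IsClosedUnderFiniteProducts :=
  closedUnderFiniteProducts_of_biprod _ fun X X₁ X₂ i₁ i₂ p₁ p₂ hid ⟨h₁, k₁⟩ ⟨h₂, k₂⟩ =>
    ⟨isRational_of_sum i₁ i₂ p₁ p₂ hid h₁ h₂, fun z x => by
      have hx : homC i₁ (homC p₁ x) + homC i₂ (homC p₂ x) = x :=
        congrArg (fun f : X ⟶ X => f.hom x) hid
      have e₁ := congrArg (homC i₁) (k₁ z (homC p₁ x))
      have e₂ := congrArg (homC i₂) (k₂ z (homC p₂ x))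
      rw [map_sub, infAct_hom i₁ h₁ (isRational_of_sum i₁ i₂ p₁ p₂ hid h₁ h₂), homC_smulA,
        map_zero, sub_eq_zero] at e₁
      rw [map_sub, infAct_hom i₂ h₂ (isRational_of_sum i₁ i₂ p₁ p₂ hid h₁ h₂), homC_smulA,
        map_zero, sub_eq_zero] at e₂
      rw [← hx, infAct_add, e₁, e₂, smul_add, sub_self]⟩

/-- The category `(A,G,c)-mod` of `(G,c)`-equivariant `A`-modules. -/
abbrev TwistedMod := (twistedEquivariant Q c).FullSubcategory

lemma preservesFiniteLimits_ι {C : Type*} [Category C] [Abelian C] (P : ObjectProperty C)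
    [P.ContainsZero] [P.IsClosedUnderKernels] [P.IsClosedUnderCokernels]
    [P.IsClosedUnderFiniteProducts] : PreservesFiniteLimits P.ι := by
  rw [((Functor.preservesFiniteLimits_tfae P.ι).out 3 2 :)]
  intro _ _ f
  exact P.preservesKernels_ι f

lemma preservesFiniteColimits_ι {C : Type*} [Category C] [Abelian C] (P : ObjectProperty C)
    [P.ContainsZero] [P.IsClosedUnderKernels] [P.IsClosedUnderCokernels]
    [P.IsClosedUnderFiniteProducts] : PreservesFiniteColimits P.ι := by
  rw [((Functor.preservesFiniteColimits_tfae P.ι).out 3 2 :)]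
  intro _ _ f
  exact P.preservesCokernels_ι f

instance : PreservesFiniteLimits (weaklyEquivariant G A).ι := preservesFiniteLimits_ι _
instance : PreservesFiniteColimits (weaklyEquivariant G A).ι := preservesFiniteColimits_ι _
instance : PreservesFiniteLimits (twistedEquivariant Q c).ι := preservesFiniteLimits_ι _
instance : PreservesFiniteColimits (twistedEquivariant Q c).ι := preservesFiniteColimits_ι _

/-- The forgetful functor `sap_c : (A,G,c)-mod ⥤ (A,G)-mod`. -/
def sap : TwistedMod Q c ⥤ WeakMod G A :=
  ObjectProperty.ιOfLE (fun _ h => h.1)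

instance : (sap Q c).Additive where

instance : PreservesFiniteLimits (sap Q c) := by
  have : PreservesFiniteLimits (sap Q c ⋙ (weaklyEquivariant G A).ι) :=
    inferInstanceAs (PreservesFiniteLimits (twistedEquivariant Q c).ι)
  exact preservesFiniteLimits_of_reflects_of_preserves (sap Q c) (weaklyEquivariant G A).ι

instance : PreservesFiniteColimits (sap Q c) := by
  have : PreservesFiniteColimits (sap Q c ⋙ (weaklyEquivariant G A).ι) :=
    inferInstanceAs (PreservesFiniteColimits (twistedEquivariant Q c).ι)
  exact preservesFiniteColimits_of_reflects_of_preserves (sap Q c) (weaklyEquivariant G A).ι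

/-! ### Singular support -/

section SingularSupport

variable {M : Type*} [AddCommGroup M] [Module A M]

/-- `Φ` is a good filtration of the `A`-module `N`: it is compatible with the filtration of `A`
and it is generated by finitely many elements `m k` placed in degrees `d k`, that is,
`Φ j = ∑ k, F (j - d k) • m k` (equivalently, `Φ` is bounded below and `gr N` is finitely
generated over `gr A`). -/
structure IsGoodFiltration (N : Submodule A M) (Φ : ℤ → AddSubgroup M) : Prop where
  mono : Monotone Φ
  exhaustive : ∀ x, x ∈ N ↔ ∃ j, x ∈ Φ j
  smul_mem : ∀ {i j a x}, a ∈ Q.F i → x ∈ Φ j → a • x ∈ Φ (i + j)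
  generators : ∃ (n : ℕ) (m : Fin n → M) (d : Fin n → ℤ), (∀ k, m k ∈ Φ (d k)) ∧
    ∀ j, Φ j ≤ AddSubgroup.closure {x | ∃ k, ∃ a ∈ Q.F (j - d k), x = a • m k}

/-- The support of `gr N = ⨁ Φ j / Φ (j - 1)` in `W = Spec R`, `R ≅ gr A`, for a good filtration
`Φ` of `N`: the zero locus of the annihilator of the finitely generated graded `R`-module `gr N`.
This annihilator is generated by the symbols of degree `i` of the `a ∈ F i` with
`a Φ j ⊆ Φ (i + j - 1)` for all `j`. -/
def supportGr (Φ : ℤ → AddSubgroup M) : Set (PrimeSpectrum R) :=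
  {p | ∀ i (a : Q.F i), (∀ j, ∀ x ∈ Φ j, a.1 • x ∈ Φ (i + j - 1)) → Q.symbol i a ∈ p.asIdeal}

variable (M) in
/-- The singular support `SS(M)`: the union over all finitely generated submodules `N` of the
supports of `gr N` for good filtrations of `N`. -/
def singularSupport : Set (PrimeSpectrum R) :=
  {p | ∃ N : Submodule A M, N.FG ∧ ∃ Φ, IsGoodFiltration Q N Φ ∧ p ∈ supportGr Q Φ}

lemma mem_singularSupport_iff (p : PrimeSpectrum R) :
    p ∈ singularSupport Q M ↔
      ∃ m : M, ∀ i (a : Q.F i), a.1 • m = 0 → Q.symbol i a ∈ p.asIdeal := by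
  constructor
  · rintro ⟨N, -, Φ, hΦ, hp⟩
    by_contra! hcon
    obtain ⟨n, m, d, hm, hgen⟩ := hΦ.generators
    have claim : ∀ s : Finset (Fin n), ∃ i, ∃ a : Q.F i, Q.symbol i a ∉ p.asIdeal ∧
        ∀ k ∈ s, ∀ j, ∀ b ∈ Q.F j, a.1 • b • m k ∈ Φ (i + j + d k - 1) := by
      intro s
      induction s using Finset.induction_on with
      | empty =>
        refine ⟨0, ⟨1, Q.one_mem⟩, ?_, by simp⟩
        rw [Q.symbol_one]
        exact fun h => p.isPrime.ne_top ((Ideal.eq_top_iff_one _).2 h)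
      | insert k s _ ih =>
        obtain ⟨i, a, ha, has⟩ := ih
        obtain ⟨i', a', hka', ha'⟩ := hcon (m k)
        refine ⟨i' + i, ⟨a'.1 * a.1, Q.mul_mem a'.2 a.2⟩, ?_, ?_⟩
        · rw [Q.symbol_mul]
          exact fun h => (p.isPrime.mem_or_mem h).elim ha' ha
        · intro k' hk' j b hb
          rcases Finset.mem_insert.1 hk' with rfl | hk'
          · have hab : a.1 * b ∈ Q.F (i + j) := Q.mul_mem a.2 hb
            obtain ⟨hc, -⟩ := Q.symbol_commutator i' (i + j) a' ⟨a.1 * b, hab⟩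
            have := hΦ.smul_mem hc (hm k')
            have e : (a'.1 * (a.1 * b) - a.1 * b * a'.1) • m k' = (a'.1 * a.1) • b • m k' := by
              rw [sub_smul, mul_smul (a.1 * b), hka', smul_zero, sub_zero, ← mul_assoc, mul_smul]
            rw [← e]
            convert this using 2
            ring
          · have := hΦ.smul_mem a'.2 (has k' hk' j b hb)
            rw [← mul_smul] at this
            convert this using 2
            ring
    obtain ⟨i, a, ha, hk⟩ := claim Finset.univ
    refine ha (hp i a fun j x hx => ?_)
    refine AddSubgroup.closure_induction (p := fun x _ => a.1 • x ∈ Φ (i + j - 1))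
      ?_ ?_ ?_ ?_ (hgen j hx)
    · rintro _ ⟨k, b, hb, rfl⟩
      have := hk k (Finset.mem_univ _) _ b hb
      convert this using 2
      ring
    · simp
    · intro x y _ _ hx hy
      rw [smul_add]
      exact add_mem hx hy
    · intro x _ hx
      rw [smul_neg]
      exact neg_mem hx
  · rintro ⟨m, hm⟩
    let Φ : ℤ → AddSubgroup M := fun j =>
      (Q.F j).toAddSubgroup.map (LinearMap.toSpanSingleton A M m).toAddMonoidHom
    have memΦ : ∀ j x, x ∈ Φ j ↔ ∃ a ∈ Q.F j, a • m = x := fun j x => Iff.rfl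
    refine ⟨Submodule.span A {m}, Submodule.fg_span_singleton m, Φ, ⟨?_, ?_, ?_, ?_⟩, ?_⟩
    · rintro j j' h x ⟨a, ha, rfl⟩
      exact ⟨a, Q.mono h ha, rfl⟩
    · intro x
      rw [Submodule.mem_span_singleton]
      constructor
      · rintro ⟨a, rfl⟩
        obtain ⟨i, hi⟩ := Q.exhaustive a
        exact ⟨i, a, hi, rfl⟩
      · rintro ⟨j, a, -, rfl⟩
        exact ⟨a, rfl⟩
    · rintro i j a _ ha ⟨b, hb, rfl⟩
      exact ⟨a * b, Q.mul_mem ha hb, mul_smul a b m⟩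
    · refine ⟨1, fun _ => m, fun _ => 0, fun _ => ⟨1, Q.one_mem, one_smul A m⟩, ?_⟩
      rintro j _ ⟨a, ha, rfl⟩
      exact AddSubgroup.subset_closure ⟨0, a, by simpa using ha, rfl⟩
    · intro i a h
      obtain ⟨b, hb, hbm⟩ := h 0 m ⟨1, Q.one_mem, one_smul A m⟩
      have hb' : b ∈ Q.F (i - 1) := by simpa using hb
      have hbi : b ∈ Q.F i := Q.mono (by lia) hb'
      have h0 : Q.symbol i ⟨b, hbi⟩ = 0 := (Q.symbol_eq_zero_iff i _).2 hb'
      have := hm i (a - ⟨b, hbi⟩) (by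
        change (a.1 - b) • m = 0
        rw [sub_smul, sub_eq_zero]
        exact hbm.symm)
      rwa [map_sub, h0, sub_zero] at this

end SingularSupport

/-- The modules with unstable singular support, `SS(M) ⊆ W^uns`. -/
def unstableSupport (χ : G →* ℂˣ) : ObjectProperty (ModuleCat.{u} (SkewMonoidAlgebra A G)) :=
  fun M => singularSupport Q M ⊆ unstableLocus R χ

lemma singularSupport_subset_of_mono {M N : ModuleCat.{u} (SkewMonoidAlgebra A G)} (f : M ⟶ N)
    [Mono f] : singularSupport Q M ⊆ singularSupport Q N := by
  intro p hp
  rw [mem_singularSupport_iff] at hp ⊢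
  obtain ⟨m, hm⟩ := hp
  refine ⟨homC f m, fun i a h => hm i a (homC_injective f ?_)⟩
  rw [homC_smulA, h, map_zero]

lemma singularSupport_subset_of_epi {M N : ModuleCat.{u} (SkewMonoidAlgebra A G)} (f : M ⟶ N)
    [Epi f] : singularSupport Q N ⊆ singularSupport Q M := by
  intro p hp
  rw [mem_singularSupport_iff] at hp ⊢
  obtain ⟨x, hx⟩ := hp
  obtain ⟨m, rfl⟩ := homC_surjective f x
  refine ⟨m, fun i a h => hx i a ?_⟩
  rw [← homC_smulA, h, map_zero]

lemma singularSupport_subset_of_shortExact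
    {S : ShortComplex (ModuleCat.{u} (SkewMonoidAlgebra A G))} (hS : S.ShortExact) :
    singularSupport Q S.X₂ ⊆ singularSupport Q S.X₁ ∪ singularSupport Q S.X₃ := by
  have := hS.mono_f
  intro p hp
  by_contra hcon
  rw [Set.mem_union, not_or, mem_singularSupport_iff, mem_singularSupport_iff] at hcon
  rw [mem_singularSupport_iff] at hp
  obtain ⟨m, hm⟩ := hp
  obtain ⟨h₁, h₃⟩ := hcon
  push Not at h₁ h₃
  obtain ⟨i, a, ha, ha'⟩ := h₃ (homC S.g m)
  rw [← homC_smulA] at ha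
  obtain ⟨x, hx⟩ := (ShortComplex.ShortExact.moduleCat_exact_iff_function_exact S).1 hS.exact
    (a.1 • m) |>.1 ha
  obtain ⟨j, b, hb, hb'⟩ := h₁ x
  have hbam : (b.1 * a.1) • m = 0 := by
    have e : homC S.f x = a.1 • m := hx
    rw [mul_smul, ← e, ← homC_smulA, hb, map_zero]
  have := hm (j + i) ⟨b.1 * a.1, Q.mul_mem b.2 a.2⟩ hbam
  rw [Q.symbol_mul] at this
  exact (p.isPrime.mem_or_mem this).elim hb' ha'

instance (χ : G →* ℂˣ) : (unstableSupport Q χ).IsSerreClass where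
  exists_zero := ⟨ModuleCat.of _ PUnit, ModuleCat.isZero_of_subsingleton _, by
    intro p hp
    rw [mem_singularSupport_iff] at hp
    obtain ⟨m, hm⟩ := hp
    have := hm 0 ⟨1, Q.one_mem⟩ (Subsingleton.elim (α := PUnit) _ _)
    rw [Q.symbol_one] at this
    exact absurd ((Ideal.eq_top_iff_one _).2 this) p.isPrime.ne_top⟩
  prop_of_mono f _ h := (singularSupport_subset_of_mono Q f).trans h
  prop_of_epi f _ h := (singularSupport_subset_of_epi Q f).trans h
  prop_X₂_of_shortExact hS h₁ h₃ :=
    (singularSupport_subset_of_shortExact Q hS).trans (Set.union_subset h₁ h₃)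

/-! ### Microlocal categories -/

/-- The subcategory `(A,G,c)-mod^uns` of `(A,G,c)-mod`. -/
def unstableTwisted (χ : G →* ℂˣ) : ObjectProperty (TwistedMod Q c) :=
  (unstableSupport Q χ).inverseImage (twistedEquivariant Q c).ι

instance (χ : G →* ℂˣ) : (unstableTwisted Q c χ).IsSerreClass :=
  inferInstanceAs ((unstableSupport Q χ).inverseImage (twistedEquivariant Q c).ι).IsSerreClass

/-- The microlocal abelian category `E_𝔛(c)-mod`: the Serre quotient of `(A,G,c)-mod` by
`(A,G,c)-mod^uns`. -/
abbrev MicroMod (χ : G →* ℂˣ) := (unstableTwisted Q c χ).isoModSerre.Localization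

instance (χ : G →* ℂˣ) : Abelian (MicroMod Q c χ) :=
  ObjectProperty.SerreClassLocalization.abelian (unstableTwisted Q c χ).isoModSerre.Q
    (unstableTwisted Q c χ)

/-- The projection `π_c : (A,G,c)-mod ⥤ E_𝔛(c)-mod`. -/
def proj (χ : G →* ℂˣ) : TwistedMod Q c ⥤ MicroMod Q c χ := (unstableTwisted Q c χ).isoModSerre.Q

instance (χ : G →* ℂˣ) : (proj Q c χ).IsLocalization (unstableTwisted Q c χ).isoModSerre :=
  inferInstanceAs ((unstableTwisted Q c χ).isoModSerre.Q.IsLocalization _)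

instance (χ : G →* ℂˣ) : (proj Q c χ).Additive :=
  inferInstanceAs (unstableTwisted Q c χ).isoModSerre.Q.Additive

instance (χ : G →* ℂˣ) : PreservesFiniteLimits (proj Q c χ) :=
  ObjectProperty.SerreClassLocalization.preservesFiniteLimits _ (unstableTwisted Q c χ)

instance (χ : G →* ℂˣ) : PreservesFiniteColimits (proj Q c χ) :=
  ObjectProperty.SerreClassLocalization.preservesFiniteColimits _ (unstableTwisted Q c χ)

end Quantization

end Modules

/-! ### Compact generation -/

section Compact

variable {D : Type*} [Category.{w} D] [Preadditive D]

/-- `X` is compact: `Hom(X, -)`, with values in abelian groups, preserves small coproducts. -/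
def IsCompactObject (X : D) : Prop :=
  ∀ J : Type u, PreservesColimitsOfShape (Discrete J) (preadditiveCoyoneda.obj (Opposite.op X))

variable (D) in
/-- `D` has small coproducts and a (small) set of compact objects `S i` generating `D`: an object
`X` with `Hom(S i, X[n]) = 0` for all `i` and `n` is zero. -/
def IsCompactlyGenerated [HasShift D ℤ] : Prop :=
  HasCoproducts.{u} D ∧ ∃ (ι : Type u) (S : ι → D), (∀ i, IsCompactObject.{u} (S i)) ∧
    ∀ X : D, (∀ i (n : ℤ) (f : S i ⟶ X⟦n⟧), f = 0) → IsZero X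

end Compact

end Microlocal

end

noncomputable section

set_option linter.unusedSectionVars false

namespace Microlocal

/-! ### Morphisms of the derived category as fractions of chain maps. -/

section Fractions

variable {C : Type*} [Category C] [Abelian C] [HasDerivedCategory.{w} C]

open DerivedCategory

/-! The functor `sap`. A twisted module is an equivariant module on which a certain submodule of
relations (`relMod`) vanishes, so the quotient by this submodule (`twist`) is left adjoint to `sap`.
Both categories are closed under submodules, quotients and coproducts among modules over the smash
product, hence coproducts are exact. Since `G` is reductive, taking invariants of `V* ⊗ M` is exact,
so the modules `A ⊗ V`, with `V` a finite-dimensional representation, are projective generators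
(`projective_freeMod`). They give K-projective resolutions of unbounded complexes
(`exists_isKProjective_quasiIso`), and with them the left derived functor of the left adjoint. The
derived functor of `sap` preserves coproducts because `sap` does. All other colimits follow
formally: in a triangulated category epimorphisms split, so a colimit is a retract of a coproduct
(`preservesColimits_of_preservesCoproducts`).

The functor `proj`. A twisted module has unstable singular support exactly when each of its elements
is killed by all semi-invariants of `A` of large weight, weights being the powers of `χ⁻¹`
(`unstableTwisted_iff`). The quotient category thus resembles the noncommutative Proj of the graded
ring of semi-invariants, and `R^i Γ` for `i ≥ 1` is local cohomology in degree `i + 1`. The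
predicate `Van` states the vanishing of local cohomology, computed as the colimit over `n` of the
cohomology of columns over a complex of free modules (`FiltCpx`) which is built from the
semi-invariants and is exact in weights at least `n`. Three facts are needed. (1) Finite dimension
(`exists_van_of_le`). Passing to symbols reduces the claim to commutative algebra: local cohomology
with respect to finitely many elements vanishes above their number. This is `colVanish_of_le`, which
treats one generator at a time. (2) Torsion-free injectives are acyclic (`van_of_injective`).
Cocycles with values in an injective are morphisms out of free modules. They extend because the
homology of the complex of twisted free modules is torsion (`exists_smul_mem_homology`). On symbols,
multiplication by a semi-invariant of large weight is null-homotopic; the lift of this homotopy to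
`A` is correct up to lower order, and `exists_relation` controls its effect on the relations of
twisted equivariance. (3) Acyclic objects are closed under coproducts, because columns are finite.

The formal properties of local cohomology are collected in `LocalVanishing`. They yield the right
adjoint `Γ`, enough acyclic objects, and finite codimension of the class of acyclic objects. Hence
every unbounded complex has a resolution with acyclic terms, `RΓ` is computed termwise on such
complexes, and it commutes with coproducts. The modules `twist (A ⊗ V)` are projective generators,
and morphisms from them into coproducts are finite sums. Their images in the derived category of the
quotient are compact since `RΓ` preserves coproducts, and they generate since `Γ` of an adapted
complex can be acyclic only if the complex is. -/

lemma Q_map_eq_iff_postcomp {X Y : CochainComplex C ℤ} (f g : X ⟶ Y) :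
    Q.map f = Q.map g ↔ ∃ (Z : CochainComplex C ℤ) (s : Y ⟶ Z) (_ : QuasiIso s),
      Nonempty (Homotopy (f ≫ s) (g ≫ s)) := by
  constructor
  · intro h
    have h' : Qh.map ((HomotopyCategory.quotient _ _).map f) =
      Qh.map ((HomotopyCategory.quotient _ _).map g) := h
    rw [MorphismProperty.map_eq_iff_postcomp Qh (HomotopyCategory.quasiIso C _)] at h'
    obtain ⟨Z, s, hs, fac⟩ := h'
    obtain ⟨Z, rfl⟩ := HomotopyCategory.quotient_obj_surjective Z
    obtain ⟨s, rfl⟩ := (HomotopyCategory.quotient _ _).map_surjective s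
    rw [← isIso_Qh_map_iff] at hs
    refine ⟨Z, s, (isIso_Q_map_iff_quasiIso C s).1 hs, ⟨HomotopyCategory.homotopyOfEq _ _ ?_⟩⟩
    rw [Functor.map_comp, Functor.map_comp, fac]
  · rintro ⟨Z, s, hs, ⟨h⟩⟩
    have := Q_map_eq_of_homotopy C h
    rwa [Functor.map_comp, Functor.map_comp, cancel_mono] at this

lemma Q_map_eq_iff_precomp {X Y : CochainComplex C ℤ} (f g : X ⟶ Y) :
    Q.map f = Q.map g ↔ ∃ (Z : CochainComplex C ℤ) (s : Z ⟶ X) (_ : QuasiIso s),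
      Nonempty (Homotopy (s ≫ f) (s ≫ g)) := by
  constructor
  · intro h
    have h' : Qh.map ((HomotopyCategory.quotient _ _).map f) =
      Qh.map ((HomotopyCategory.quotient _ _).map g) := h
    rw [MorphismProperty.map_eq_iff_precomp Qh (HomotopyCategory.quasiIso C _)] at h'
    obtain ⟨Z, s, hs, fac⟩ := h'
    obtain ⟨Z, rfl⟩ := HomotopyCategory.quotient_obj_surjective Z
    obtain ⟨s, rfl⟩ := (HomotopyCategory.quotient _ _).map_surjective s
    rw [← isIso_Qh_map_iff] at hs
    refine ⟨Z, s, (isIso_Q_map_iff_quasiIso C s).1 hs, ⟨HomotopyCategory.homotopyOfEq _ _ ?_⟩⟩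
    rw [Functor.map_comp, Functor.map_comp, fac]
  · rintro ⟨Z, s, hs, ⟨h⟩⟩
    have := Q_map_eq_of_homotopy C h
    rwa [Functor.map_comp, Functor.map_comp, cancel_epi] at this

end Fractions

/-! ### Coproducts of complexes. -/

section Coproducts

variable {C : Type*} [Category C] [Abelian C] {J : Type u}
  {ι : Type*} {c : ComplexShape ι}

/-- A family of complexes as a complex of families. -/
@[simps]
def familyComplex (K : J → HomologicalComplex C c) : HomologicalComplex (Discrete J ⥤ C) c where
  X i := Discrete.functor fun j => (K j).X i
  d i i' := Discrete.natTrans fun j => (K j.as).d i i'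
  shape i i' h := by ext ⟨j⟩; exact (K j).shape i i' h
  d_comp_d' i i' i'' _ _ := by ext ⟨j⟩; exact (K j).d_comp_d i i' i''

/-- Functoriality of `familyComplex`. -/
@[simps]
def familyComplexMap {K L : J → HomologicalComplex C c} (f : ∀ j, K j ⟶ L j) :
    familyComplex K ⟶ familyComplex L where
  f i := Discrete.natTrans fun j => (f j.as).f i
  comm' i i' _ := by ext ⟨j⟩; exact (f j).comm i i'

/-- The evaluation at `j` recovers the family. -/
def familyComplexEval (K : J → HomologicalComplex C c) (j : J) :
    (((evaluation (Discrete J) C).obj ⟨j⟩).mapHomologicalComplex c).obj (familyComplex K) ≅ K j :=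
  HomologicalComplex.Hom.isoOfComponents (fun _ => Iso.refl _)
    (fun _ _ _ => (Category.id_comp _).trans (Category.comp_id _).symm)

/-- Invertibility of a natural transformation is pointwise, and evaluation at `j` is exact, so the
homology of a family is the family of homologies. -/
lemma quasiIso_familyComplexMap {K L : J → HomologicalComplex C c} (f : ∀ j, K j ⟶ L j)
    (hf : ∀ j, QuasiIso (f j)) : QuasiIso (familyComplexMap f) := by
  refine ⟨fun i => ?_⟩
  rw [quasiIsoAt_iff_isIso_homologyMap, NatTrans.isIso_iff_isIso_app]
  rintro ⟨j⟩
  have e : Arrow.mk ((((evaluation (Discrete J) C).obj ⟨j⟩).mapHomologicalComplex c).map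
      (familyComplexMap f)) ≅ Arrow.mk (f j) :=
    Arrow.isoMk (familyComplexEval K j) (familyComplexEval L j) (by
      ext i; exact (Category.id_comp _).trans (Category.comp_id _).symm)
  have h1 : QuasiIso ((((evaluation (Discrete J) C).obj ⟨j⟩).mapHomologicalComplex c).map
      (familyComplexMap f)) := by
    have := hf j
    rw [← HomologicalComplex.mem_quasiIso_iff] at this ⊢
    exact ((HomologicalComplex.quasiIso C c).arrow_mk_iso_iff e).2 this
  have h2 : IsIso (ShortComplex.homologyMap
      (((evaluation (Discrete J) C).obj ⟨j⟩).mapShortComplex.map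
        ((HomologicalComplex.shortComplexFunctor _ c i).map (familyComplexMap f)))) :=
    (quasiIsoAt_iff_isIso_homologyMap _ _).1 (h1.quasiIsoAt i)
  have := ShortComplex.mapHomologyIso_hom_naturality (F := (evaluation (Discrete J) C).obj ⟨j⟩)
    ((HomologicalComplex.shortComplexFunctor _ c i).map (familyComplexMap f))
  have h3 : IsIso (((evaluation (Discrete J) C).obj ⟨j⟩).map (ShortComplex.homologyMap
     ((HomologicalComplex.shortComplexFunctor _ c i).map (familyComplexMap f)))) := by
    rw [← Iso.inv_comp_eq] at this
    rw [← this]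
    exact IsIso.comp_isIso' inferInstance (IsIso.comp_isIso' h2 inferInstance)
  exact h3

variable [HasColimitsOfShape (Discrete J) C]

/-- The coproduct of a family of complexes, computed degreewise. -/
def coprodComplex (K : J → HomologicalComplex C c) : HomologicalComplex C c :=
  ((colim : (Discrete J ⥤ C) ⥤ C).mapHomologicalComplex c).obj (familyComplex K)

/-- The inclusion of a summand. -/
def coprodComplexι (K : J → HomologicalComplex C c) (j : J) : K j ⟶ coprodComplex K where
  f i := colimit.ι (Discrete.functor fun j => (K j).X i) ⟨j⟩
  comm' i i' _ := ι_colimMap ((familyComplex K).d i i') ⟨j⟩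

/-- `coprodComplex K` is the coproduct. -/
def isColimitCoprodComplex (K : J → HomologicalComplex C c) :
    IsColimit (Cofan.mk (coprodComplex K) (coprodComplexι K)) :=
  Cofan.IsColimit.mk _
    (fun s => { f := fun i => colimit.desc _ (Cofan.mk ((s.pt).X i) fun j => (s.inj j).f i)
                comm' := fun i i' _ => by
                  apply colimit.hom_ext
                  rintro ⟨j⟩
                  refine ((colimit.ι_desc_assoc _ _ _).trans ?_).trans
                    (ι_colimMap_assoc ((familyComplex K).d i i') ⟨j⟩
                      (colimit.desc _ (Cofan.mk ((s.pt).X i') fun j => (s.inj j).f i'))).symm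
                  refine ((s.inj j).comm i i').trans ?_
                  exact congrArg (fun f => (K j).d i i' ≫ f) (colimit.ι_desc
                    (Cofan.mk ((s.pt).X i') fun j => (s.inj j).f i') ⟨j⟩).symm })
    (fun s j => by ext i; exact colimit.ι_desc _ _)
    (fun s m hm => by
      ext i
      apply colimit.hom_ext
      rintro ⟨j⟩
      exact (congrArg (fun f => HomologicalComplex.Hom.f f i) (hm j)).trans
        (colimit.ι_desc (Cofan.mk ((s.pt).X i) fun j => (s.inj j).f i) ⟨j⟩).symm)

/-- The map induced on coproducts. -/
def coprodComplexMap {K L : J → HomologicalComplex C c} (f : ∀ j, K j ⟶ L j) :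
    coprodComplex K ⟶ coprodComplex L :=
  ((colim : (Discrete J ⥤ C) ⥤ C).mapHomologicalComplex c).map (familyComplexMap f)

lemma coprodComplexι_map {K L : J → HomologicalComplex C c} (f : ∀ j, K j ⟶ L j) (j : J) :
    coprodComplexι K j ≫ coprodComplexMap f = f j ≫ coprodComplexι L j := by
  ext i
  exact ι_colimMap ((familyComplexMap f).f i) ⟨j⟩

lemma quasiIso_coprodComplexMap [HasExactColimitsOfShape (Discrete J) C]
    {K L : J → HomologicalComplex C c} (f : ∀ j, K j ⟶ L j)
    (hf : ∀ j, QuasiIso (f j)) : QuasiIso (coprodComplexMap f) := by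
  have := quasiIso_familyComplexMap f hf
  exact HomologicalComplex.quasiIso_map_of_preservesHomology _ _

/-- A map out of a coproduct of complexes is null-homotopic if its components are. -/
lemma nonempty_homotopy_coprod_zero {K : J → HomologicalComplex C c} {L : HomologicalComplex C c}
    (f : coprodComplex K ⟶ L) (h : ∀ j, Nonempty (Homotopy (coprodComplexι K j ≫ f) 0)) :
    Nonempty (Homotopy f 0) := by
  replace h := fun j => (h j).some
  let hom : ∀ i i', (coprodComplex K).X i ⟶ L.X i' := fun i i' =>
    colimit.desc _ (Cofan.mk (L.X i') fun j => (h j).hom i i')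
  have hι : ∀ j i i', (coprodComplexι K j).f i ≫ hom i i' = (h j).hom i i' := fun j i i' =>
    colimit.ι_desc (Cofan.mk (L.X i') fun j => (h j).hom i i') ⟨j⟩
  refine ⟨{ hom := hom, zero := fun i i' hii' => ?_, comm := fun i => ?_ }⟩
  · apply colimit.hom_ext
    rintro ⟨j⟩
    exact (hι j i i').trans (((h j).zero i i' hii').trans comp_zero.symm)
  · apply colimit.hom_ext
    rintro ⟨j⟩
    change (coprodComplexι K j).f i ≫ f.f i = (coprodComplexι K j).f i ≫ _
    have := (h j).comm i
    simp only [HomologicalComplex.zero_f, add_zero, Preadditive.comp_add] at this ⊢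
    rw [← dNext_comp_left, ← prevD_comp_left]
    simp only [hι]
    exact this

end Coproducts

/-! ### Coproducts in the derived category. -/

section DerivedCoproducts

open DerivedCategory

variable {C : Type*} [Category C] [Abelian C] [HasDerivedCategory.{w} C] {J : Type u}
  [HasColimitsOfShape (Discrete J) C] [HasExactColimitsOfShape (Discrete J) C]

/-- The localization functor preserves coproducts if coproducts are exact. -/
def isColimitQCoprod (K : J → CochainComplex C ℤ) :
    IsColimit (Cofan.mk (Q.obj (coprodComplex K)) fun j => Q.map (coprodComplexι K j)) := by
  refine IsColimit.ofExistsUnique fun s => ?_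
  let e := Q.objObjPreimageIso s.pt
  refine existsUnique_of_exists_of_unique ?_ ?_
  -- Existence: every component is a fraction with denominator `t j : X j ⟶ K j`. Exactness of
  -- coproducts turns `coprodComplexMap t` into one common denominator.
  · choose X t ht h fac using fun j =>
      right_fac ((s.ι.app ⟨j⟩ : Q.obj (K j) ⟶ s.pt) ≫ e.inv)
    have := quasiIso_coprodComplexMap t fun j => (isIso_Q_map_iff_quasiIso C _).1 (ht j)
    refine ⟨inv (Q.map (coprodComplexMap t)) ≫
      Q.map (Cofan.IsColimit.desc (isColimitCoprodComplex X) h) ≫ e.hom, ?_⟩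
    rintro ⟨j⟩
    have h1 : Q.map (coprodComplexι K j) ≫ inv (Q.map (coprodComplexMap t)) =
        inv (Q.map (t j)) ≫ Q.map (coprodComplexι X j) := by
      rw [IsIso.comp_inv_eq, Category.assoc, ← Functor.map_comp, coprodComplexι_map,
        Functor.map_comp, IsIso.inv_hom_id_assoc]
    have h2 : coprodComplexι X j ≫ Cofan.IsColimit.desc (isColimitCoprodComplex X) h = h j :=
      Cofan.IsColimit.fac (isColimitCoprodComplex X) h j
    change Q.map (coprodComplexι K j) ≫ _ = _
    rw [reassoc_of% h1, ← Functor.map_comp_assoc, h2, ← Category.assoc, ← fac, Category.assoc,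
      e.inv_hom_id]
    exact Category.comp_id _
  · intro d d' hd hd'
    suffices ∀ φ : Q.obj (coprodComplex K) ⟶ Q.obj (Q.objPreimage s.pt),
        (∀ j, Q.map (coprodComplexι K j) ≫ φ = 0) → φ = 0 by
      have h0 := this ((d - d') ≫ e.inv) fun j => by
        have h1 : Q.map (coprodComplexι K j) ≫ d = Q.map (coprodComplexι K j) ≫ d' :=
          (hd ⟨j⟩).trans (hd' ⟨j⟩).symm
        rw [← Category.assoc, Preadditive.comp_sub, h1, sub_self, zero_comp]
      have h2 : d - d' = 0 := by
        rwa [← cancel_mono e.inv, zero_comp]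
      exact sub_eq_zero.1 h2
    intro φ hφ
    obtain ⟨Z, g, t, ht, rfl⟩ := left_fac φ
    -- Uniqueness: each component of `g` becomes null-homotopic after a quasi-isomorphism `t' j`.
    -- The homotopies are chosen independently, since a homotopy out of a coproduct is just a family
    -- of homotopies.
    have key : ∀ j, ∃ (X : CochainComplex C ℤ) (s : X ⟶ K j) (_ : QuasiIso s),
        Nonempty (Homotopy (s ≫ (coprodComplexι K j ≫ g)) (s ≫ 0)) := fun j => by
      rw [← Q_map_eq_iff_precomp]
      have := hφ j
      rw [← Category.assoc, ← cancel_mono (Q.map t), Category.assoc, IsIso.inv_hom_id,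
        Category.comp_id, zero_comp, ← Functor.map_comp] at this
      rw [this, Functor.map_zero]
    choose X t' ht' hh using key
    have := quasiIso_coprodComplexMap t' ht'
    have h0 : Q.map g = 0 := by
      rw [← cancel_epi (Q.map (coprodComplexMap t')), ← Functor.map_comp, comp_zero,
        ← Functor.map_zero Q]
      obtain ⟨h⟩ := nonempty_homotopy_coprod_zero (coprodComplexMap t' ≫ g) fun j => by
        rw [← Category.assoc, coprodComplexι_map, Category.assoc]
        simpa using hh j
      exact Q_map_eq_of_homotopy C h
    rw [h0, zero_comp]

lemma hasColimitsOfShape_derivedCategory :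
    HasColimitsOfShape (Discrete J) (DerivedCategory C) := by
  have (X : J → DerivedCategory C) : HasCoproduct X := by
    have : HasCoproduct fun j => Q.obj (Q.objPreimage (X j)) :=
      ⟨⟨⟨_, isColimitQCoprod fun j => Q.objPreimage (X j)⟩⟩⟩
    exact hasColimit_of_iso (F := Discrete.functor fun j => Q.obj (Q.objPreimage (X j)))
      (Discrete.natIso fun j => (Q.objObjPreimageIso (X j.as)).symm)
  exact ⟨fun F => hasColimit_of_iso (F := Discrete.functor fun j => F.obj ⟨j⟩)
    Discrete.natIsoFunctor⟩

instance preservesCoproducts_Q :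
    PreservesColimitsOfShape (Discrete J) (Q : CochainComplex C ℤ ⥤ DerivedCategory C) := by
  have (K : J → CochainComplex C ℤ) : PreservesColimit (Discrete.functor K)
      (Q : CochainComplex C ℤ ⥤ DerivedCategory C) :=
    preservesColimit_of_preserves_colimit_cocone (isColimitCoprodComplex K)
      ((isColimitMapCoconeCofanMkEquiv Q K (coprodComplexι K)).symm (isColimitQCoprod K))
  exact preservesColimitsOfShape_of_discrete Q

end DerivedCoproducts

/-! ### Kan extensions computed on adapted objects. -/

section Kan

variable {C D H : Type*} [Category C] [Category D] [Category H] {L : C ⥤ D}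
  {F : C ⥤ H}

/-- For the image of a morphism of `C` this is the naturality of `α` and `β`. A general `f` is a
fraction, and its middle object can be replaced by an adapted one, so that both halves of the
fraction are of the first kind. -/
lemma inv_comp_naturality_of_leftFractions {RF : D ⥤ H} (α : F ⟶ L ⋙ RF)
    (P : ObjectProperty C) (hres : ∀ X, ∃ (Y : C) (s : X ⟶ Y), P Y ∧ IsIso (L.map s))
    (hfac : ∀ ⦃X Y : C⦄ (f : L.obj X ⟶ L.obj Y), ∃ (Z : C) (g : X ⟶ Z) (s : Y ⟶ Z)
      (_ : IsIso (L.map s)), f = L.map g ≫ inv (L.map s))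
    (hα : ∀ Y, P Y → IsIso (α.app Y)) {G : D ⥤ H} (β : F ⟶ L ⋙ G)
    {Y Y' : C} (hY : P Y) (hY' : P Y') (f : L.obj Y ⟶ L.obj Y') :
    haveI := hα _ hY
    haveI := hα _ hY'
    inv (α.app Y) ≫ β.app Y ≫ G.map f = RF.map f ≫ inv (α.app Y') ≫ β.app Y' := by
  have step : ∀ {Y Y' : C} (hY : P Y) (hY' : P Y') (a : Y ⟶ Y'),
      haveI := hα _ hY
      haveI := hα _ hY'
      inv (α.app Y) ≫ β.app Y ≫ G.map (L.map a) =
        RF.map (L.map a) ≫ inv (α.app Y') ≫ β.app Y' := by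
    intro Y Y' hY hY' a
    have := hα _ hY
    have := hα _ hY'
    have h1 : F.map a ≫ β.app Y' = β.app Y ≫ G.map (L.map a) := β.naturality a
    have h2 : F.map a ≫ α.app Y' = α.app Y ≫ RF.map (L.map a) := α.naturality a
    rw [IsIso.inv_comp_eq, ← h1, ← Category.assoc, ← Category.assoc]
    congr 1
    exact (IsIso.eq_comp_inv (α.app Y')).2 h2
  obtain ⟨Z, g, s, hs, rfl⟩ := hfac f
  obtain ⟨Z', t, hZ', ht⟩ := hres Z
  have := hα _ hY
  have := hα _ hY'
  have := hα _ hZ'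
  have h3 : IsIso (L.map (s ≫ t)) := by rw [Functor.map_comp]; infer_instance
  have e : L.map g ≫ inv (L.map s) = L.map (g ≫ t) ≫ inv (L.map (s ≫ t)) := by
    simp [Functor.map_comp]
  have h1 := step hY hZ' (g ≫ t)
  have h2 := step hY' hZ' (s ≫ t)
  rw [e, G.map_comp, RF.map_comp, reassoc_of% h1, Category.assoc]
  congr 1
  rw [Functor.map_inv, Functor.map_inv, IsIso.eq_inv_comp, ← reassoc_of% h2,
    IsIso.hom_inv_id, Category.comp_id]

/-- On adapted objects a factorization of `β` through `α` is forced to be `inv α ≫ β`. Every object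
of `D` is isomorphic to the image of an adapted one, which defines the factorization everywhere and
makes it unique. -/
lemma isLeftKanExtension_of_resolutions [L.EssSurj] {RF : D ⥤ H} (α : F ⟶ L ⋙ RF)
    (P : ObjectProperty C) (hres : ∀ X, ∃ (Y : C) (s : X ⟶ Y), P Y ∧ IsIso (L.map s))
    (hfac : ∀ ⦃X Y : C⦄ (f : L.obj X ⟶ L.obj Y), ∃ (Z : C) (g : X ⟶ Z) (s : Y ⟶ Z)
      (_ : IsIso (L.map s)), f = L.map g ≫ inv (L.map s))
    (hα : ∀ Y, P Y → IsIso (α.app Y)) : RF.IsLeftKanExtension α := by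
  have hX : ∀ X : D, ∃ (Y : C) (_ : P Y), Nonempty (L.obj Y ≅ X) := fun X => by
    obtain ⟨Y, s, hY, hs⟩ := hres (L.objPreimage X)
    exact ⟨Y, hY, ⟨(asIso (L.map s)).symm ≪≫ L.objObjPreimageIso X⟩⟩
  choose Y hY e using hX
  replace e := fun X => (e X).some
  have hY' : ∀ X, IsIso (α.app (Y X)) := fun X => hα _ (hY X)
  have nat := fun {G : D ⥤ H} (β : F ⟶ L ⋙ G) {Y Y' : C} (hY : P Y) (hY' : P Y') =>
    inv_comp_naturality_of_leftFractions α P hres hfac hα β hY hY'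
  let γ : ∀ {G : D ⥤ H}, (F ⟶ L ⋙ G) → (RF ⟶ G) := fun {G} β =>
    { app := fun X => RF.map (e X).inv ≫ inv (α.app (Y X)) ≫ β.app (Y X) ≫ G.map (e X).hom
      naturality := fun X X' f => by
        have := nat β (hY X) (hY X') ((e X).hom ≫ f ≫ (e X').inv)
        simp only [Functor.map_comp, Category.assoc] at this ⊢
        rw [← cancel_mono (G.map (e X').inv)]
        simp only [Category.assoc, Iso.map_hom_inv_id]
        rw [this, Iso.map_inv_hom_id_assoc]
        exact congrArg _ (congrArg _ (congrArg _ (Category.comp_id _))) }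
  have hγ : ∀ {G : D ⥤ H} (β : F ⟶ L ⋙ G) (X : C), α.app X ≫ (γ β).app (L.obj X) = β.app X := by
    intro G β X
    have h1 : ∀ Z, P Z → α.app Z ≫ (γ β).app (L.obj Z) = β.app Z := fun Z hZ => by
      have := nat β (hY _) hZ (e (L.obj Z)).hom
      have := hα _ hZ
      change α.app Z ≫ RF.map _ ≫ inv _ ≫ β.app _ ≫ G.map _ = _
      rw [nat β (hY _) hZ, Iso.map_inv_hom_id_assoc]
      exact IsIso.hom_inv_id_assoc _ _
    obtain ⟨Z, s, hZ, hs⟩ := hres X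
    have a1 : F.map s ≫ β.app Z = β.app X ≫ G.map (L.map s) := β.naturality s
    have a2 : F.map s ≫ α.app Z = α.app X ≫ RF.map (L.map s) := α.naturality s
    rw [← cancel_mono (G.map (L.map s))]
    refine Eq.trans ?_ a1
    rw [← h1 Z hZ, reassoc_of% a2, Category.assoc, (γ β).naturality]
  have uniq : ∀ {G : D ⥤ H} (γ₁ γ₂ : RF ⟶ G),
      (∀ X, α.app X ≫ γ₁.app (L.obj X) = α.app X ≫ γ₂.app (L.obj X)) → γ₁ = γ₂ := by
    intro G γ₁ γ₂ h
    ext X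
    rw [← cancel_epi (RF.map (e X).hom), γ₁.naturality, γ₂.naturality]
    congr 1
    rw [← cancel_epi (α.app (Y X))]
    exact h (Y X)
  exact ⟨⟨IsInitial.ofUniqueHom
    (fun s => StructuredArrow.homMk (γ s.hom) (by ext X; exact hγ s.hom X))
    (fun s m => by
      apply StructuredArrow.hom_ext
      apply uniq
      intro X
      refine Eq.trans ?_ (hγ s.hom X).symm
      exact NatTrans.congr_app (StructuredArrow.w m) X)⟩⟩

/-- Dual of `inv_comp_naturality_of_leftFractions`: resolutions now map to the object, and
denominators sit at the source. -/
lemma comp_inv_naturality_of_rightFractions {LF : D ⥤ H} (α : L ⋙ LF ⟶ F)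
    (P : ObjectProperty C) (hres : ∀ X, ∃ (Y : C) (s : Y ⟶ X), P Y ∧ IsIso (L.map s))
    (hfac : ∀ ⦃X Y : C⦄ (f : L.obj X ⟶ L.obj Y), ∃ (Z : C) (s : Z ⟶ X)
      (_ : IsIso (L.map s)) (g : Z ⟶ Y), f = inv (L.map s) ≫ L.map g)
    (hα : ∀ Y, P Y → IsIso (α.app Y)) {G : D ⥤ H} (β : L ⋙ G ⟶ F)
    {Y Y' : C} (hY : P Y) (hY' : P Y') (f : L.obj Y ⟶ L.obj Y') :
    haveI := hα _ hY
    haveI := hα _ hY'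
    G.map f ≫ β.app Y' ≫ inv (α.app Y') = β.app Y ≫ inv (α.app Y) ≫ LF.map f := by
  have step : ∀ {Y Y' : C} (hY : P Y) (hY' : P Y') (a : Y ⟶ Y'),
      haveI := hα _ hY
      haveI := hα _ hY'
      G.map (L.map a) ≫ β.app Y' ≫ inv (α.app Y') =
        β.app Y ≫ inv (α.app Y) ≫ LF.map (L.map a) := by
    intro Y Y' hY hY' a
    have := hα _ hY
    have := hα _ hY'
    have h1 : G.map (L.map a) ≫ β.app Y' = β.app Y ≫ F.map a := β.naturality a
    have h2 : LF.map (L.map a) ≫ α.app Y' = α.app Y ≫ F.map a := α.naturality a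
    rw [reassoc_of% h1]
    congr 1
    rw [IsIso.comp_inv_eq, Category.assoc, h2]
    exact (IsIso.inv_hom_id_assoc _ _).symm
  obtain ⟨Z, s, hs, g, rfl⟩ := hfac f
  obtain ⟨Z', t, hZ', ht⟩ := hres Z
  have := hα _ hY
  have := hα _ hY'
  have := hα _ hZ'
  have h3 : IsIso (L.map (t ≫ s)) := by rw [Functor.map_comp]; infer_instance
  have e : inv (L.map s) ≫ L.map g = inv (L.map (t ≫ s)) ≫ L.map (t ≫ g) := by
    simp [Functor.map_comp]
  have h1 := step hZ' hY' (t ≫ g)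
  have h2 := step hZ' hY (t ≫ s)
  rw [e, G.map_comp, LF.map_comp, Category.assoc, h1, Functor.map_inv,
    Functor.map_inv, IsIso.inv_comp_eq]
  rw [reassoc_of% h2, IsIso.hom_inv_id_assoc]

lemma isRightKanExtension_of_resolutions [L.EssSurj] {LF : D ⥤ H} (α : L ⋙ LF ⟶ F)
    (P : ObjectProperty C) (hres : ∀ X, ∃ (Y : C) (s : Y ⟶ X), P Y ∧ IsIso (L.map s))
    (hfac : ∀ ⦃X Y : C⦄ (f : L.obj X ⟶ L.obj Y), ∃ (Z : C) (s : Z ⟶ X)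
      (_ : IsIso (L.map s)) (g : Z ⟶ Y), f = inv (L.map s) ≫ L.map g)
    (hα : ∀ Y, P Y → IsIso (α.app Y)) : LF.IsRightKanExtension α := by
  have hX : ∀ X : D, ∃ (Y : C) (_ : P Y), Nonempty (L.obj Y ≅ X) := fun X => by
    obtain ⟨Y, s, hY, hs⟩ := hres (L.objPreimage X)
    exact ⟨Y, hY, ⟨asIso (L.map s) ≪≫ L.objObjPreimageIso X⟩⟩
  choose Y hY e using hX
  replace e := fun X => (e X).some
  have hY' : ∀ X, IsIso (α.app (Y X)) := fun X => hα _ (hY X)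
  have nat := fun {G : D ⥤ H} (β : L ⋙ G ⟶ F) {Y Y' : C} (hY : P Y) (hY' : P Y') =>
    comp_inv_naturality_of_rightFractions α P hres hfac hα β hY hY'
  let γ : ∀ {G : D ⥤ H}, (L ⋙ G ⟶ F) → (G ⟶ LF) := fun {G} β =>
    { app := fun X => G.map (e X).inv ≫ β.app (Y X) ≫ inv (α.app (Y X)) ≫ LF.map (e X).hom
      naturality := fun X X' f => by
        have := nat β (hY X) (hY X') ((e X).hom ≫ f ≫ (e X').inv)
        simp only [Functor.map_comp, Category.assoc] at this ⊢
        rw [← cancel_epi (G.map (e X).hom), reassoc_of% this]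
        rw [Iso.map_inv_hom_id, Iso.map_hom_inv_id_assoc]
        exact congrArg _ (congrArg _ (congrArg _ (Category.comp_id _))) }
  have hγ : ∀ {G : D ⥤ H} (β : L ⋙ G ⟶ F) (X : C), (γ β).app (L.obj X) ≫ α.app X = β.app X := by
    intro G β X
    have h1 : ∀ Z, P Z → (γ β).app (L.obj Z) ≫ α.app Z = β.app Z := fun Z hZ => by
      have := hα _ hZ
      change (G.map _ ≫ β.app _ ≫ inv _ ≫ LF.map _) ≫ α.app Z = _
      rw [← nat β (hY _) hZ, Iso.map_inv_hom_id_assoc]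
      exact (Category.assoc _ _ _).trans
        ((congrArg (fun f => β.app Z ≫ f) (IsIso.inv_hom_id _)).trans (Category.comp_id _))
    obtain ⟨Z, s, hZ, hs⟩ := hres X
    have a1 : G.map (L.map s) ≫ β.app X = β.app Z ≫ F.map s := β.naturality s
    have a2 : LF.map (L.map s) ≫ α.app X = α.app Z ≫ F.map s := α.naturality s
    rw [← cancel_epi (G.map (L.map s))]
    refine Eq.trans ?_ a1.symm
    rw [← h1 Z hZ]
    exact ((γ β).naturality_assoc _ _).trans
      ((congrArg _ a2).trans (Category.assoc _ _ _).symm)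
  have uniq : ∀ {G : D ⥤ H} (γ₁ γ₂ : G ⟶ LF),
      (∀ X, γ₁.app (L.obj X) ≫ α.app X = γ₂.app (L.obj X) ≫ α.app X) → γ₁ = γ₂ := by
    intro G γ₁ γ₂ h
    ext X
    rw [← cancel_mono (LF.map (e X).inv), ← γ₁.naturality, ← γ₂.naturality]
    congr 1
    rw [← cancel_mono (α.app (Y X))]
    exact h (Y X)
  exact ⟨⟨IsTerminal.ofUniqueHom
    (fun s => CostructuredArrow.homMk (γ s.hom) (by ext X; exact hγ s.hom X))
    (fun s m => by
      apply CostructuredArrow.hom_ext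
      apply uniq
      intro X
      refine Eq.trans ?_ (hγ s.hom X).symm
      exact NatTrans.congr_app (CostructuredArrow.w m) X)⟩⟩

end Kan

/-! ### The adjunction between the derived functors of an exact functor and of its adjoint. -/

section DerivedAdjunction

open DerivedCategory

variable {C₁ C₂ : Type*} [Category C₁] [Category C₂] [Abelian C₁] [Abelian C₂]

section Complexes

variable {F : C₁ ⥤ C₂} {G : C₂ ⥤ C₁} [F.Additive] [G.Additive] (adj : F ⊣ G)

/-- The adjunction on complexes induced by an adjunction of additive functors. -/
def mapComplexAdjunction : F.mapHomologicalComplex (ComplexShape.up ℤ) ⊣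
    G.mapHomologicalComplex (ComplexShape.up ℤ) where
  unit :=
    { app := fun K => { f := fun i => adj.unit.app (K.X i)
                        comm' := fun i j _ => (adj.unit.naturality (K.d i j)).symm }
      naturality := fun K L f => by ext i; exact adj.unit.naturality (f.f i) }
  counit :=
    { app := fun K => { f := fun i => adj.counit.app (K.X i)
                        comm' := fun i j _ => (adj.counit.naturality (K.d i j)).symm }
      naturality := fun K L f => by ext i; exact adj.counit.naturality (f.f i) }
  left_triangle_components K := by ext i; exact adj.left_triangle_components (K.X i)
  right_triangle_components K := by ext i; exact adj.right_triangle_components (K.X i)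

lemma nonempty_homotopy_homEquiv_symm {X : CochainComplex C₁ ℤ} {Y : CochainComplex C₂ ℤ}
    {f g : X ⟶ (G.mapHomologicalComplex (ComplexShape.up ℤ)).obj Y} (h : Homotopy f g) :
    Nonempty (Homotopy (((mapComplexAdjunction adj).homEquiv X Y).symm f)
      (((mapComplexAdjunction adj).homEquiv X Y).symm g)) := by
  rw [Adjunction.homEquiv_counit, Adjunction.homEquiv_counit]
  exact ⟨(F.mapHomotopy h).compRight _⟩

lemma nonempty_homotopy_homEquiv {X : CochainComplex C₁ ℤ} {Y : CochainComplex C₂ ℤ}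
    {f g : (F.mapHomologicalComplex (ComplexShape.up ℤ)).obj X ⟶ Y} (h : Homotopy f g) :
    Nonempty (Homotopy ((mapComplexAdjunction adj).homEquiv X Y f)
      ((mapComplexAdjunction adj).homEquiv X Y g)) := by
  rw [Adjunction.homEquiv_unit, Adjunction.homEquiv_unit]
  exact ⟨(G.mapHomotopy h).compLeft _⟩

end Complexes

variable [HasDerivedCategory.{w₁} C₁] [HasDerivedCategory.{w₂} C₂]

section Right

variable {F : C₁ ⥤ C₂} {G : C₂ ⥤ C₁} [F.Additive] [G.Additive] (adj : F ⊣ G)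
  [PreservesFiniteLimits F] [PreservesFiniteColimits F]
  (P : ObjectProperty (CochainComplex C₂ ℤ))
  (hres : ∀ X, ∃ (Y : CochainComplex C₂ ℤ) (s : X ⟶ Y), P Y ∧ QuasiIso s)
  (hG : ∀ ⦃Y Y' : CochainComplex C₂ ℤ⦄ (s : Y ⟶ Y'), P Y → P Y' → QuasiIso s →
    QuasiIso ((G.mapHomologicalComplex (ComplexShape.up ℤ)).map s))

/-- The comparison of `Q ⋙ F` with the functor induced on derived categories, followed by the
counit. -/
def derivedCounit (Y : CochainComplex C₂ ℤ) :
    F.mapDerivedCategory.obj (Q.obj ((G.mapHomologicalComplex (ComplexShape.up ℤ)).obj Y)) ⟶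
      Q.obj Y :=
  F.mapDerivedCategoryFactors.hom.app _ ≫ Q.map ((mapComplexAdjunction adj).counit.app Y)

lemma derivedCounit_naturality {Y Y' : CochainComplex C₂ ℤ} (s : Y ⟶ Y') :
    F.mapDerivedCategory.map (Q.map ((G.mapHomologicalComplex (ComplexShape.up ℤ)).map s)) ≫
      derivedCounit adj Y' = derivedCounit adj Y ≫ Q.map s := by
  have h1 := F.mapDerivedCategoryFactors_hom_naturality
    ((G.mapHomologicalComplex (ComplexShape.up ℤ)).map s)
  have h2 := (mapComplexAdjunction adj).counit.naturality s
  unfold derivedCounit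
  rw [reassoc_of% h1, Category.assoc, ← Q.map_comp]
  congr 1
  rw [← Q.map_comp]
  exact congrArg Q.map h2

lemma map_Q_map_derivedCounit {X : CochainComplex C₁ ℤ} {Y : CochainComplex C₂ ℤ}
    (f : X ⟶ (G.mapHomologicalComplex (ComplexShape.up ℤ)).obj Y) :
    F.mapDerivedCategory.map (Q.map f) ≫ derivedCounit adj Y =
      F.mapDerivedCategoryFactors.hom.app X ≫
        Q.map (((mapComplexAdjunction adj).homEquiv X Y).symm f) := by
  have h1 := F.mapDerivedCategoryFactors_hom_naturality f
  unfold derivedCounit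
  rw [reassoc_of% h1, ← Q.map_comp, Adjunction.homEquiv_counit]

include hres hG in
-- Both sides are calculated with fractions, and homotopies pass through the adjunction on
-- complexes. A denominator `Y ⟶ Z` can be enlarged to end at an adapted complex; as `Y` is adapted
-- as well, `G` keeps it a quasi-isomorphism and the fraction can be moved across the adjunction.
lemma derivedCounit_bijective_Q (X : CochainComplex C₁ ℤ) {Y : CochainComplex C₂ ℤ} (hY : P Y) :
    Function.Bijective
      (fun g : Q.obj X ⟶ Q.obj ((G.mapHomologicalComplex (ComplexShape.up ℤ)).obj Y) =>
        F.mapDerivedCategory.map g ≫ derivedCounit adj Y) := by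
  constructor
  · intro g g' h
    rw [← sub_eq_zero]
    have h0 : F.mapDerivedCategory.map (g - g') ≫ derivedCounit adj Y = 0 := by
      rw [Functor.map_sub, Preadditive.sub_comp, sub_eq_zero]
      exact h
    generalize g - g' = k at h0
    obtain ⟨X', s, hs, k', rfl⟩ := right_fac k
    rw [Functor.map_comp, Category.assoc, map_Q_map_derivedCounit, Functor.map_inv,
      IsIso.inv_comp_eq, comp_zero, ← cancel_epi (F.mapDerivedCategoryFactors.inv.app X'),
      Iso.inv_hom_id_app_assoc, comp_zero, ← Q.map_zero, Q_map_eq_iff_postcomp] at h0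
    obtain ⟨Z, t, ht, ⟨h0⟩⟩ := h0
    -- Prolonging the denominator to an adapted complex is what makes `hG` applicable to `t ≫ t'`.
    obtain ⟨Y', t', hY', ht'⟩ := hres Z
    have h1 := (h0.compRight t').trans (Homotopy.ofEq (by simp) : Homotopy _ 0)
    obtain ⟨h2⟩ := nonempty_homotopy_homEquiv adj
      ((Homotopy.ofEq (by simp) : Homotopy _ _).trans h1 :
        Homotopy (((mapComplexAdjunction adj).homEquiv X' Y).symm k' ≫ (t ≫ t')) 0)
    rw [Adjunction.homEquiv_naturality_right, Equiv.apply_symm_apply] at h2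
    have h3 := Q_map_eq_of_homotopy C₁ h2
    have h4 : QuasiIso ((G.mapHomologicalComplex (ComplexShape.up ℤ)).map (t ≫ t')) :=
      hG _ hY hY' inferInstance
    rw [Adjunction.homEquiv_unit, Functor.map_zero, comp_zero, Functor.map_zero,
      Functor.map_comp] at h3
    have h5 : Q.map k' = 0 := by
      rw [← cancel_mono (Q.map ((G.mapHomologicalComplex (ComplexShape.up ℤ)).map (t ≫ t'))),
        zero_comp, ← h3]
    rw [h5, comp_zero]
  · intro a
    obtain ⟨Z, f, s, hs, hfac⟩ := left_fac (F.mapDerivedCategoryFactors.inv.app X ≫ a)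
    obtain ⟨Y', t, hY', ht⟩ := hres Z
    have hs' := (isIso_Q_map_iff_quasiIso C₂ s).1 hs
    have h4 : QuasiIso ((G.mapHomologicalComplex (ComplexShape.up ℤ)).map (s ≫ t)) :=
      hG _ hY hY' inferInstance
    refine ⟨Q.map ((mapComplexAdjunction adj).homEquiv X Y' (f ≫ t)) ≫
      inv (Q.map ((G.mapHomologicalComplex (ComplexShape.up ℤ)).map (s ≫ t))), ?_⟩
    have h5 : IsIso (Q.map (s ≫ t)) := by rw [Functor.map_comp]; infer_instance
    rw [← cancel_mono (Q.map (s ≫ t))]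
    dsimp only
    rw [Category.assoc, ← derivedCounit_naturality, ← Functor.map_comp_assoc, Category.assoc,
      IsIso.inv_hom_id, Category.comp_id, map_Q_map_derivedCounit, Equiv.symm_apply_apply]
    have h6 : a = F.mapDerivedCategoryFactors.hom.app X ≫ Q.map f ≫ inv (Q.map s) := by
      rw [← hfac, Iso.hom_inv_id_app_assoc]
    rw [h6]
    simp [Functor.map_comp]

include hres hG in
lemma derivedCounit_bijective (X : DerivedCategory C₁) {Y : CochainComplex C₂ ℤ} (hY : P Y)
    {Z : DerivedCategory C₂} (e : Q.obj Y ≅ Z) :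
    Function.Bijective
      (fun g : X ⟶ Q.obj ((G.mapHomologicalComplex (ComplexShape.up ℤ)).obj Y) =>
        F.mapDerivedCategory.map g ≫ derivedCounit adj Y ≫ e.hom) := by
  have h := derivedCounit_bijective_Q adj P hres hG (Q.objPreimage X) hY
  let e' := Q.objObjPreimageIso X
  have h1 : ∀ g : X ⟶ Q.obj ((G.mapHomologicalComplex (ComplexShape.up ℤ)).obj Y),
      F.mapDerivedCategory.map g ≫ derivedCounit adj Y ≫ e.hom =
      F.mapDerivedCategory.map e'.inv ≫
        (F.mapDerivedCategory.map (e'.hom ≫ g) ≫ derivedCounit adj Y) ≫ e.hom := fun g => by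
    simp
  constructor
  · intro g g' hgg
    dsimp only at hgg
    rw [h1, h1, cancel_epi, cancel_mono] at hgg
    exact (cancel_epi e'.hom).1 (h.1 hgg)
  · intro a
    obtain ⟨g, hg⟩ := h.2 (F.mapDerivedCategory.map e'.hom ≫ a ≫ e.inv)
    dsimp only at hg
    refine ⟨e'.inv ≫ g, ?_⟩
    dsimp only
    rw [h1, Iso.hom_inv_id_assoc, hg]
    simp

include adj hres hG in
/-- The right derived functor of a right adjoint of an exact functor, when there are enough
adapted complexes. -/
lemma exists_right_derived_adjoint :
    ∃ (RG : DerivedCategory C₂ ⥤ DerivedCategory C₁)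
      (α : G.mapHomologicalComplex (ComplexShape.up ℤ) ⋙ Q ⟶ Q ⋙ RG),
      RG.IsRightDerivedFunctor α (HomologicalComplex.quasiIso _ (ComplexShape.up ℤ)) ∧
      Nonempty (F.mapDerivedCategory ⊣ RG) ∧ ∀ Y, P Y → IsIso (α.app Y) := by
  have hX : ∀ Z : DerivedCategory C₂, ∃ (Y : CochainComplex C₂ ℤ) (_ : P Y),
      Nonempty (Q.obj Y ≅ Z) := fun Z => by
    obtain ⟨Y, s, hY, hs⟩ := hres (Q.objPreimage Z)
    exact ⟨Y, hY, ⟨(asIso (Q.map s)).symm ≪≫ Q.objObjPreimageIso Z⟩⟩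
  choose Y hY e using hX
  replace e := fun Z => (e Z).some
  -- The functor `Hom(F -, Z)` is represented by `Q (G (Y Z))` for any adapted `Y Z` isomorphic to
  -- `Z`. The functoriality in `Z` then comes from representability, and no functorial resolution is
  -- required.
  let E : ∀ (X : DerivedCategory C₁) (Z : DerivedCategory C₂),
      (F.mapDerivedCategory.obj X ⟶ Z) ≃
        (X ⟶ Q.obj ((G.mapHomologicalComplex (ComplexShape.up ℤ)).obj (Y Z))) := fun X Z =>
    (Equiv.ofBijective _ (derivedCounit_bijective adj P hres hG X (hY Z) (e Z))).symm
  have hE : ∀ (X : DerivedCategory C₁) (Z : DerivedCategory C₂) g,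
      (E X Z).symm g = F.mapDerivedCategory.map g ≫ derivedCounit adj (Y Z) ≫ (e Z).hom :=
    fun X Z g => rfl
  have he : ∀ X' X Z f g, E X' Z (F.mapDerivedCategory.map f ≫ g) = f ≫ E X Z g := by
    intro X' X Z f g
    rw [← Equiv.eq_symm_apply, hE, Functor.map_comp, Category.assoc, ← hE,
      Equiv.symm_apply_apply]
  let RG := Adjunction.rightAdjointOfEquiv E he
  let A : F.mapDerivedCategory ⊣ RG := Adjunction.adjunctionOfEquivRight E he
  let α : G.mapHomologicalComplex (ComplexShape.up ℤ) ⋙ Q ⟶ Q ⋙ RG :=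
    { app := fun K => A.homEquiv _ _ (derivedCounit adj K)
      naturality := fun K L s => by
        exact (A.homEquiv_naturality_left (Q.map _) (derivedCounit adj L)).symm.trans
          ((congrArg _ (derivedCounit_naturality adj s)).trans
            (A.homEquiv_naturality_right (derivedCounit adj K) (Q.map s))) }
  have hα : ∀ K, P K → IsIso (α.app K) := by
    intro K hK
    -- By Yoneda it suffices to compose with `α.app K`. Through the adjunction this is the bijection
    -- of `derivedCounit_bijective` for `K` itself, and not for the complex chosen for `Q.obj K`.
    have key : ∀ X : DerivedCategory C₁, Function.Bijective
        (fun g : X ⟶ Q.obj ((G.mapHomologicalComplex (ComplexShape.up ℤ)).obj K) =>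
          g ≫ α.app K) := by
      intro X
      have h := derivedCounit_bijective adj P hres hG X hK (Iso.refl _)
      have h1 : (fun g : X ⟶ Q.obj ((G.mapHomologicalComplex (ComplexShape.up ℤ)).obj K) =>
          g ≫ α.app K) = (A.homEquiv X (Q.obj K)) ∘ fun g =>
            F.mapDerivedCategory.map g ≫ derivedCounit adj K ≫ (Iso.refl (Q.obj K)).hom := by
        funext g
        simp only [Function.comp, Iso.refl_hom, Category.comp_id]
        exact (Adjunction.homEquiv_naturality_left _ _ _).symm
      rw [h1]
      exact (A.homEquiv X (Q.obj K)).bijective.comp h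
    obtain ⟨k, hk⟩ := (key _).2 (𝟙 _)
    refine ⟨k, (key _).1 ?_, hk⟩
    dsimp only at hk ⊢
    rw [Category.assoc, hk]
    exact (Category.comp_id _).trans (Category.id_comp _).symm
  refine ⟨RG, α, ⟨?_⟩, ⟨A⟩, hα⟩
  refine isLeftKanExtension_of_resolutions α P ?_ (fun X Y f => left_fac f) hα
  intro X
  obtain ⟨Y, s, hY, hs⟩ := hres X
  exact ⟨Y, s, hY, inferInstance⟩

end Right

section Left

variable {F : C₁ ⥤ C₂} {G : C₂ ⥤ C₁} [F.Additive] [G.Additive] (adj : F ⊣ G)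
  [PreservesFiniteLimits G] [PreservesFiniteColimits G]
  (P : ObjectProperty (CochainComplex C₁ ℤ))
  (hres : ∀ X, ∃ (Y : CochainComplex C₁ ℤ) (s : Y ⟶ X), P Y ∧ QuasiIso s)
  (hF : ∀ ⦃Y Y' : CochainComplex C₁ ℤ⦄ (s : Y ⟶ Y'), P Y → P Y' → QuasiIso s →
    QuasiIso ((F.mapHomologicalComplex (ComplexShape.up ℤ)).map s))

/-- The unit, followed by the comparison of `G ⋙ Q` with the functor induced on derived
categories. -/
def derivedUnit (X : CochainComplex C₁ ℤ) :
    Q.obj X ⟶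
      G.mapDerivedCategory.obj (Q.obj ((F.mapHomologicalComplex (ComplexShape.up ℤ)).obj X)) :=
  Q.map ((mapComplexAdjunction adj).unit.app X) ≫ G.mapDerivedCategoryFactors.inv.app _

lemma mapDerivedCategoryFactors_inv_naturality' {X Y : CochainComplex C₂ ℤ} (f : X ⟶ Y) :
    G.mapDerivedCategoryFactors.inv.app X ≫ G.mapDerivedCategory.map (Q.map f) =
      Q.map ((G.mapHomologicalComplex (ComplexShape.up ℤ)).map f) ≫
        G.mapDerivedCategoryFactors.inv.app Y :=
  (G.mapDerivedCategoryFactors.inv.naturality f).symm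

lemma derivedUnit_naturality {X X' : CochainComplex C₁ ℤ} (s : X ⟶ X') :
    derivedUnit adj X ≫ G.mapDerivedCategory.map
      (Q.map ((F.mapHomologicalComplex (ComplexShape.up ℤ)).map s)) =
        Q.map s ≫ derivedUnit adj X' := by
  have h1 := mapDerivedCategoryFactors_inv_naturality' (G := G)
    ((F.mapHomologicalComplex (ComplexShape.up ℤ)).map s)
  have h2 := (mapComplexAdjunction adj).unit.naturality s
  unfold derivedUnit
  rw [Category.assoc, h1, ← Category.assoc, ← Category.assoc, ← Q.map_comp]
  congr 1
  rw [← Q.map_comp]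
  exact congrArg Q.map h2.symm

lemma derivedUnit_map_Q_map {X : CochainComplex C₁ ℤ} {Y : CochainComplex C₂ ℤ}
    (f : (F.mapHomologicalComplex (ComplexShape.up ℤ)).obj X ⟶ Y) :
    derivedUnit adj X ≫ G.mapDerivedCategory.map (Q.map f) =
      Q.map ((mapComplexAdjunction adj).homEquiv X Y f) ≫
        G.mapDerivedCategoryFactors.inv.app Y := by
  have h1 := mapDerivedCategoryFactors_inv_naturality' (G := G) f
  unfold derivedUnit
  rw [Category.assoc, h1, ← Category.assoc, ← Q.map_comp, Adjunction.homEquiv_unit]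

include hres hF in
-- Dual of `derivedCounit_bijective_Q`: fractions have their denominator at the source, which is
-- refined to an adapted complex so that `F` preserves the quasi-isomorphism.
lemma derivedUnit_bijective_Q {X : CochainComplex C₁ ℤ} (hX : P X) (Y : CochainComplex C₂ ℤ) :
    Function.Bijective
      (fun g : Q.obj ((F.mapHomologicalComplex (ComplexShape.up ℤ)).obj X) ⟶ Q.obj Y =>
        derivedUnit adj X ≫ G.mapDerivedCategory.map g) := by
  constructor
  · intro g g' h
    rw [← sub_eq_zero]
    have h0 : derivedUnit adj X ≫ G.mapDerivedCategory.map (g - g') = 0 := by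
      rw [Functor.map_sub, Preadditive.comp_sub, sub_eq_zero]
      exact h
    generalize g - g' = k at h0
    obtain ⟨Y', k', s, hs, rfl⟩ := left_fac k
    rw [Functor.map_comp, ← Category.assoc, derivedUnit_map_Q_map, Functor.map_inv,
      IsIso.comp_inv_eq, zero_comp, ← cancel_mono (G.mapDerivedCategoryFactors.hom.app Y'),
      Category.assoc, Iso.inv_hom_id_app, zero_comp] at h0
    replace h0 := (Category.comp_id _).symm.trans h0
    rw [← Q.map_zero, Q_map_eq_iff_precomp] at h0
    obtain ⟨Z, t, ht, ⟨h0⟩⟩ := h0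
    obtain ⟨X', t', hX', ht'⟩ := hres Z
    have h1 := (h0.compLeft t').trans (Homotopy.ofEq (by simp) : Homotopy _ 0)
    obtain ⟨h2⟩ := nonempty_homotopy_homEquiv_symm adj
      ((Homotopy.ofEq (by simp) : Homotopy _ _).trans h1 :
        Homotopy ((t' ≫ t) ≫ ((mapComplexAdjunction adj).homEquiv X Y') k') 0)
    rw [Adjunction.homEquiv_naturality_left_symm, Equiv.symm_apply_apply] at h2
    have h3 := Q_map_eq_of_homotopy C₂ h2
    have h4 : QuasiIso ((F.mapHomologicalComplex (ComplexShape.up ℤ)).map (t' ≫ t)) :=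
      hF _ hX' hX inferInstance
    rw [Adjunction.homEquiv_counit, Functor.map_zero, zero_comp, Functor.map_zero,
      Functor.map_comp] at h3
    have h5 : Q.map k' = 0 := by
      rw [← cancel_epi (Q.map ((F.mapHomologicalComplex (ComplexShape.up ℤ)).map (t' ≫ t))),
        comp_zero, ← h3]
    rw [h5, zero_comp]
  · intro a
    obtain ⟨Z, s, hs, f, hfac⟩ := right_fac (a ≫ G.mapDerivedCategoryFactors.hom.app Y)
    obtain ⟨X', t, hX', ht⟩ := hres Z
    have hs' := (isIso_Q_map_iff_quasiIso C₁ s).1 hs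
    have h4 : QuasiIso ((F.mapHomologicalComplex (ComplexShape.up ℤ)).map (t ≫ s)) :=
      hF _ hX' hX inferInstance
    refine ⟨inv (Q.map ((F.mapHomologicalComplex (ComplexShape.up ℤ)).map (t ≫ s))) ≫
      Q.map (((mapComplexAdjunction adj).homEquiv X' Y).symm (t ≫ f)), ?_⟩
    have h5 : IsIso (Q.map (t ≫ s)) := by rw [Functor.map_comp]; infer_instance
    rw [← cancel_epi (Q.map (t ≫ s))]
    dsimp only
    rw [← Category.assoc, ← derivedUnit_naturality, Category.assoc, ← Functor.map_comp,
      IsIso.hom_inv_id_assoc, derivedUnit_map_Q_map, Equiv.apply_symm_apply]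
    have h6 : a = (inv (Q.map s) ≫ Q.map f) ≫ G.mapDerivedCategoryFactors.inv.app Y := by
      rw [← hfac, Category.assoc, Iso.hom_inv_id_app]
      exact (Category.comp_id _).symm
    rw [h6]
    simp [Functor.map_comp]

include hres hF in
lemma derivedUnit_bijective {X : CochainComplex C₁ ℤ} (hX : P X) (Y : DerivedCategory C₂)
    {Z : DerivedCategory C₁} (e : Z ≅ Q.obj X) :
    Function.Bijective
      (fun g : Q.obj ((F.mapHomologicalComplex (ComplexShape.up ℤ)).obj X) ⟶ Y =>
        (e.hom ≫ derivedUnit adj X) ≫ G.mapDerivedCategory.map g) := by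
  have h := derivedUnit_bijective_Q adj P hres hF hX (Q.objPreimage Y)
  let e' := Q.objObjPreimageIso Y
  have h1 : ∀ g : Q.obj ((F.mapHomologicalComplex (ComplexShape.up ℤ)).obj X) ⟶ Y,
      (e.hom ≫ derivedUnit adj X) ≫ G.mapDerivedCategory.map g =
      (e.hom ≫ (derivedUnit adj X ≫ G.mapDerivedCategory.map (g ≫ e'.inv))) ≫
        G.mapDerivedCategory.map e'.hom := fun g => by
    simp
  constructor
  · intro g g' hgg
    dsimp only at hgg
    rw [h1, h1, cancel_mono, cancel_epi] at hgg
    exact (cancel_mono e'.inv).1 (h.1 hgg)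
  · intro a
    obtain ⟨g, hg⟩ := h.2 (e.inv ≫ a ≫ G.mapDerivedCategory.map e'.inv)
    dsimp only at hg
    refine ⟨g ≫ e'.hom, ?_⟩
    have h2 : (g ≫ e'.hom) ≫ e'.inv = g := by simp
    dsimp only
    rw [h1, h2, hg]
    simp

include adj hres hF in
/-- The left derived functor of a left adjoint of an exact functor, when there are enough
adapted complexes. -/
lemma exists_left_derived_adjoint :
    ∃ (LF : DerivedCategory C₁ ⥤ DerivedCategory C₂)
      (α : Q ⋙ LF ⟶ F.mapHomologicalComplex (ComplexShape.up ℤ) ⋙ Q),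
      LF.IsLeftDerivedFunctor α (HomologicalComplex.quasiIso _ (ComplexShape.up ℤ)) ∧
      Nonempty (LF ⊣ G.mapDerivedCategory) := by
  have hX : ∀ Z : DerivedCategory C₁, ∃ (X : CochainComplex C₁ ℤ) (_ : P X),
      Nonempty (Z ≅ Q.obj X) := fun Z => by
    obtain ⟨Y, s, hY, hs⟩ := hres (Q.objPreimage Z)
    exact ⟨Y, hY, ⟨(Q.objObjPreimageIso Z).symm ≪≫ (asIso (Q.map s)).symm⟩⟩
  choose X hX e using hX
  replace e := fun Z => (e Z).some
  let E : ∀ (Z : DerivedCategory C₁) (Y : DerivedCategory C₂),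
      (Q.obj ((F.mapHomologicalComplex (ComplexShape.up ℤ)).obj (X Z)) ⟶ Y) ≃
        (Z ⟶ G.mapDerivedCategory.obj Y) := fun Z Y =>
    Equiv.ofBijective _ (derivedUnit_bijective adj P hres hF (hX Z) Y (e Z))
  have he : ∀ X Y Y' g h, E X Y' (h ≫ g) = E X Y h ≫ G.mapDerivedCategory.map g := by
    intro X Y Y' g h
    change _ ≫ G.mapDerivedCategory.map (h ≫ g) = (_ ≫ _) ≫ _
    rw [Functor.map_comp]
    exact (Category.assoc _ _ _).symm
  let LF := Adjunction.leftAdjointOfEquiv E he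
  let A : LF ⊣ G.mapDerivedCategory := Adjunction.adjunctionOfEquivLeft E he
  let α : Q ⋙ LF ⟶ F.mapHomologicalComplex (ComplexShape.up ℤ) ⋙ Q :=
    { app := fun K => (A.homEquiv _ _).symm (derivedUnit adj K)
      naturality := fun K L s => by
        exact (A.homEquiv_naturality_left_symm (Q.map s) (derivedUnit adj L)).symm.trans
          ((congrArg _ (derivedUnit_naturality adj s).symm).trans
            (A.homEquiv_naturality_right_symm (derivedUnit adj K) (Q.map _))) }
  have hα : ∀ K, P K → IsIso (α.app K) := by
    intro K hK
    have key : ∀ Y : DerivedCategory C₂, Function.Bijective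
        (fun g : Q.obj ((F.mapHomologicalComplex (ComplexShape.up ℤ)).obj K) ⟶ Y =>
          α.app K ≫ g) := by
      intro Y
      have h := derivedUnit_bijective adj P hres hF hK Y (Iso.refl _)
      have h1 : (fun g : Q.obj ((F.mapHomologicalComplex (ComplexShape.up ℤ)).obj K) ⟶ Y =>
          α.app K ≫ g) = (A.homEquiv (Q.obj K) Y).symm ∘ fun g =>
            ((Iso.refl (Q.obj K)).hom ≫ derivedUnit adj K) ≫ G.mapDerivedCategory.map g := by
        funext g
        simp only [Function.comp, Iso.refl_hom, Category.id_comp]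
        exact (Adjunction.homEquiv_naturality_right_symm _ _ _).symm
      rw [h1]
      exact (A.homEquiv (Q.obj K) Y).symm.bijective.comp h
    obtain ⟨k, hk⟩ := (key _).2 (𝟙 _)
    refine ⟨k, hk, (key _).1 ?_⟩
    dsimp only at hk ⊢
    rw [reassoc_of% hk]
    exact (Category.comp_id _).symm
  refine ⟨LF, α, ⟨?_⟩, ⟨A⟩⟩
  refine isRightKanExtension_of_resolutions α P ?_ (fun X Y f => right_fac f) hα
  intro X
  obtain ⟨Y, s, hY, hs⟩ := hres X
  exact ⟨Y, s, hY, inferInstance⟩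

end Left

end DerivedAdjunction

/-! ### Telescopes and orthogonality in triangulated categories. -/

section Telescope

open Pretriangulated

variable {T : Type*} [Category T] [HasZeroObject T] [HasShift T ℤ] [Preadditive T]
  [∀ n : ℤ, (shiftFunctor T n).Additive] [Pretriangulated T]

/-- Along a telescope whose transition maps are inverted by `Hom(-, L)` for all `L` in `P`, the map
from the first term to the homotopy colimit is inverted by `Hom(-, L)` for all `L` in `P`. -/
lemma bijective_precomp_telescope (P : ObjectProperty T) [P.IsStableUnderShift ℤ]
    {X : ℕ → T} (s : ∀ n, X n ⟶ X (n + 1))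
    (hs : ∀ n L, P L → Function.Bijective fun f : X (n + 1) ⟶ L => s n ≫ f)
    {B N : T} (ι : ∀ n, X n ⟶ B)
    (hdesc : ∀ (L : T) (f : ∀ n, X n ⟶ L), ∃ g : B ⟶ L, ∀ n, ι n ≫ g = f n)
    (hext : ∀ (L : T) (g : B ⟶ L), (∀ n, ι n ≫ g = 0) → g = 0)
    (S : B ⟶ B) (hS : ∀ n, ι n ≫ S = s n ≫ ι (n + 1)) (j : B ⟶ N) (d : N ⟶ B⟦(1 : ℤ)⟧)
    (hT : Triangle.mk (𝟙 B - S) j d ∈ distTriang T) (L : T) (hL : P L) :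
    Function.Bijective fun f : N ⟶ L => (ι 0 ≫ j) ≫ f := by
  -- The recursion `s n ≫ a (n + 1) = a n - b n` is solvable from any initial value, because `Hom(-,
  -- L)` inverts the `s n`. With `b` arbitrary it says that `𝟙 B - S` acts surjectively on `Hom(B,
  -- L)`; with `b = 0` it extends a map on `X 0` to a compatible family.
  have rec_surj : ∀ (L : T), P L → ∀ b : ∀ n, X n ⟶ L, ∀ a₀ : X 0 ⟶ L, ∃ a : ∀ n, X n ⟶ L, a 0 = a₀ ∧
      ∀ n, s n ≫ a (n + 1) = a n - b n := by
    intro L hL b a₀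
    choose ext hext' using fun n => (hs n L hL).2
    refine ⟨fun n => Nat.rec a₀ (fun n a => ext n (a - b n)) n, rfl, fun n => ?_⟩
    exact hext' n _
  have surj : ∀ (L : T), P L → ∀ b : B ⟶ L, ∃ a : B ⟶ L, (𝟙 B - S) ≫ a = b := by
    intro L hL b
    obtain ⟨a, -, ha⟩ := rec_surj L hL (fun n => ι n ≫ b) 0
    obtain ⟨g, hg⟩ := hdesc L a
    refine ⟨g, ?_⟩
    rw [← sub_eq_zero]
    apply hext
    intro n
    rw [Preadditive.comp_sub, Preadditive.sub_comp, Category.id_comp, Preadditive.comp_sub, hg,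
      ← Category.assoc, hS, Category.assoc, hg, ha]
    abel
  have h12 : (𝟙 B - S) ≫ j = 0 := comp_distTriang_mor_zero₁₂ _ hT
  have h31 : d ≫ (𝟙 B - S)⟦(1 : ℤ)⟧' = 0 := comp_distTriang_mor_zero₃₁ _ hT
  have hj : ∀ n, s n ≫ ι (n + 1) ≫ j = ι n ≫ j := fun n => by
    rw [← Category.assoc, ← hS, Category.assoc]
    have : ι n ≫ (𝟙 B - S) ≫ j = 0 := by rw [h12, comp_zero]
    rw [Preadditive.sub_comp, Preadditive.comp_sub, Category.id_comp, sub_eq_zero] at this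
    exact this.symm
  constructor
  · intro f f' hff
    rw [← sub_eq_zero]
    have h0 : (ι 0 ≫ j) ≫ (f - f') = 0 := by
      rw [Preadditive.comp_sub, sub_eq_zero]; exact hff
    generalize f - f' = g at h0
    have hn : ∀ n, ι n ≫ j ≫ g = 0 := by
      intro n
      induction n with
      | zero => rw [← Category.assoc]; exact h0
      | succ n ih =>
        apply (hs n L hL).1
        dsimp only
        have h1 := congrArg (fun f => f ≫ g) (hj n)
        simp only [Category.assoc] at h1
        rw [comp_zero, h1, ih]
    -- A map that dies on `B` factors through `d`. Surjectivity of `𝟙 B - S` on maps into `L⟦-1⟧`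
    -- shows that the factor is divisible by the shift of `𝟙 B - S`, which `d` kills.
    have hg' : ∃ g' : B⟦(1 : ℤ)⟧ ⟶ L, g = d ≫ g' := Triangle.yoneda_exact₃ _ hT g (hext _ _ hn)
    obtain ⟨g', rfl⟩ := hg'
    let e : (L⟦(-1 : ℤ)⟧)⟦(1 : ℤ)⟧ ≅ L := (shiftEquiv T (1 : ℤ)).counitIso.app L
    obtain ⟨b, hb⟩ := (shiftFunctor T (1 : ℤ)).map_surjective (g' ≫ e.inv)
    obtain ⟨a, rfl⟩ := surj _ (P.le_shift (-1) _ hL) b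
    have : g' = (𝟙 B - S)⟦(1 : ℤ)⟧' ≫ a⟦(1 : ℤ)⟧' ≫ e.hom := by
      rw [← Functor.map_comp_assoc, hb, Category.assoc, e.inv_hom_id, Category.comp_id]
    rw [this, reassoc_of% h31, zero_comp]
  · intro f
    obtain ⟨a, ha0, ha⟩ := rec_surj L hL (fun n => 0) f
    obtain ⟨g, hg⟩ := hdesc L a
    have h0 : (𝟙 B - S) ≫ g = 0 := by
      apply hext
      intro n
      rw [Preadditive.sub_comp, Category.id_comp, Preadditive.comp_sub, hg,
        ← Category.assoc, hS, Category.assoc, hg, ha]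
      abel
    have hh : ∃ h : N ⟶ L, g = j ≫ h := Triangle.yoneda_exact₂ _ hT g h0
    obtain ⟨h, rfl⟩ := hh
    refine ⟨h, ?_⟩
    dsimp only
    rw [Category.assoc, hg, ha0]

/-- The fibre of a map which is inverted by `Hom(-, L)` for all `L` in `P` is left orthogonal to
`P`. -/
lemma leftOrthogonal_fibre (P : ObjectProperty T) [P.IsStableUnderShift ℤ] {F X N : T}
    (i : F ⟶ X) (κ : X ⟶ N) (d : N ⟶ F⟦(1 : ℤ)⟧) (hT : Triangle.mk i κ d ∈ distTriang T)
    (hκ : ∀ L, P L → Function.Bijective fun f : N ⟶ L => κ ≫ f) : P.leftOrthogonal F := by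
  intro L f hL
  -- The vanishing is proved for the shifted fibre, which is a term of the rotated triangle, and `f`
  -- is recovered from its shift.
  have hF : ∀ L, P L → ∀ f : F⟦(1 : ℤ)⟧ ⟶ L, f = 0 := by
    intro L hL f
    have h1 : d ≫ f = 0 := by
      apply (hκ L hL).1
      dsimp only
      rw [comp_zero, ← Category.assoc]
      have : κ ≫ d = 0 := comp_distTriang_mor_zero₂₃ _ hT
      rw [this, zero_comp]
    have hg : ∃ g : X⟦(1 : ℤ)⟧ ⟶ L, f = (-i⟦(1 : ℤ)⟧') ≫ g := by
      obtain ⟨g, hg⟩ := Triangle.yoneda_exact₃ _ (rot_of_distTriang _ hT) f h1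
      exact ⟨g, hg⟩
    obtain ⟨g, rfl⟩ := hg
    let e : (L⟦(-1 : ℤ)⟧)⟦(1 : ℤ)⟧ ≅ L := (shiftEquiv T (1 : ℤ)).counitIso.app L
    obtain ⟨b, hb⟩ := (shiftFunctor T (1 : ℤ)).map_surjective (g ≫ e.inv)
    obtain ⟨a, rfl⟩ := (hκ _ (P.le_shift (-1) _ hL)).2 b
    have h2 : g = κ⟦(1 : ℤ)⟧' ≫ a⟦(1 : ℤ)⟧' ≫ e.hom := by
      rw [← Functor.map_comp_assoc]
      exact ((hb =≫ e.hom).trans ((Category.assoc _ _ _).trans (by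
        rw [e.inv_hom_id, Category.comp_id]))).symm
    have h4 : i ≫ κ = 0 := comp_distTriang_mor_zero₁₂ _ hT
    have h3 : i⟦(1 : ℤ)⟧' ≫ κ⟦(1 : ℤ)⟧' = 0 := by
      rw [← (shiftFunctor T (1 : ℤ)).map_comp, h4, Functor.map_zero]
    rw [h2, Preadditive.neg_comp, reassoc_of% h3, zero_comp, neg_zero]
  have := hF _ (P.le_shift 1 _ hL) (f⟦(1 : ℤ)⟧')
  rwa [Functor.map_eq_zero_iff] at this

end Telescope

/-! ### K-projective resolutions of unbounded complexes. -/

section Resolution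

variable {C : Type*} [Category C] [Abelian C]

/-- Homology commutes with the exact functor `colim`, so the homology of the coproduct is the
coproduct of the homologies. -/
lemma homologyMap_coprodComplexι_jointly_epi {J : Type u} [HasColimitsOfShape (Discrete J) C]
    [HasExactColimitsOfShape (Discrete J) C] {I : Type*} {c : ComplexShape I}
    (K : J → HomologicalComplex C c) (i : I) {Z : C} (g : (coprodComplex K).homology i ⟶ Z)
    (hg : ∀ j, HomologicalComplex.homologyMap (coprodComplexι K j) i ≫ g = 0) : g = 0 := by
  let S := (familyComplex K).sc i
  let E : (Discrete J ⥤ C) ⥤ C := colim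
  let e : (coprodComplex K).homology i ≅ E.obj S.homology := S.mapHomologyIso E
  rw [← cancel_epi e.inv, comp_zero]
  apply colimit.hom_ext
  rintro ⟨j⟩
  let τ : (evaluation (Discrete J) C).obj ⟨j⟩ ⟶ E :=
    { app := fun F => colimit.ι F ⟨j⟩
      naturality := fun F G f => (ι_colimMap f ⟨j⟩).symm }
  have h1 := NatTrans.app_homology τ S
  have h2 : S.mapNatTrans τ = (HomologicalComplex.shortComplexFunctor C c i).map
      ((familyComplexEval K j).hom ≫ coprodComplexι K j) := by
    ext
    · exact (Category.id_comp _).symm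
    · exact (Category.id_comp _).symm
    · exact (Category.id_comp _).symm
  have h3 : ShortComplex.homologyMap (S.mapNatTrans τ) ≫ g = 0 := by
    rw [h2]
    refine Eq.trans (congrArg (fun f => f ≫ g) (HomologicalComplex.homologyMap_comp
      (familyComplexEval K j).hom (coprodComplexι K j) i)) ?_
    exact (Category.assoc _ _ _).trans ((congrArg _ (hg j)).trans comp_zero)
  change τ.app S.homology ≫ e.inv ≫ g = _ ≫ 0
  rw [h1, comp_zero]
  simp only [Category.assoc]
  have h4 : (S.mapHomologyIso E).hom ≫ e.inv ≫ g = g := e.hom_inv_id_assoc g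
  exact (congrArg (fun f => _ ≫ _ ≫ f) h4).trans ((congrArg _ h3).trans comp_zero)

/-- With zero differential on the source the homotopy equation has a single term, so the components
of the homotopy can be chosen degree by degree. -/
lemma nonempty_homotopy_zero_of_d_eq_zero {K L : CochainComplex C ℤ} (f : K ⟶ L)
    (hd : ∀ i j, K.d i j = 0)
    (hf : ∀ i, ∃ h : K.X i ⟶ L.X (i - 1), h ≫ L.d (i - 1) i = f.f i) :
    Nonempty (Homotopy f 0) := by
  choose h hh using hf
  refine ⟨{
    hom := fun i j => if hij : j + 1 = i then h i ≫ (L.XIsoOfEq (by lia)).hom else 0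
    zero := fun i j hij => dif_neg hij
    comm := fun i => ?_ }⟩
  rw [dNext_eq _ (show (ComplexShape.up ℤ).Rel i (i + 1) by simp),
    prevD_eq _ (show (ComplexShape.up ℤ).Rel (i - 1) i by simp), hd, zero_comp, zero_add,
    dif_pos (by lia)]
  simp [hh]

/-- A complex of projectives with zero differential is K-projective. -/
lemma isKProjective_of_d_eq_zero (K : CochainComplex C ℤ) [∀ i, Projective (K.X i)]
    (hd : ∀ i j, K.d i j = 0) : K.IsKProjective where
  nonempty_homotopy_zero {L} f hL := by
    refine nonempty_homotopy_zero_of_d_eq_zero f hd fun i => ?_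
    have h1 := (L.exactAt_iff' (i - 1) i (i + 1) (by simp) (by simp)).1 (hL i)
    have h2 : f.f i ≫ L.d i (i + 1) = 0 := by rw [f.comm, hd, zero_comp]
    exact ⟨h1.liftFromProjective (f.f i) h2, h1.liftFromProjective_comp _ h2⟩

variable [EnoughProjectives C]

/-- A complex of projectives with zero differential which covers the cycles of `K`. -/
def cyclesCover (K : CochainComplex C ℤ) : CochainComplex C ℤ where
  X i := Projective.over (K.cycles i)
  d _ _ := 0
  shape _ _ _ := rfl
  d_comp_d' _ _ _ _ _ := comp_zero

/-- The map from the cover of the cycles. -/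
def cyclesCoverπ (K : CochainComplex C ℤ) : cyclesCover K ⟶ K where
  f i := Projective.π (K.cycles i) ≫ K.iCycles i
  comm' i j _ := by
    exact (Category.assoc _ _ _).trans ((congrArg _ (K.iCycles_d i j)).trans
      (comp_zero.trans zero_comp.symm))

instance (K : CochainComplex C ℤ) : (cyclesCover K).IsKProjective :=
  have (i : ℤ) : Projective ((cyclesCover K).X i) :=
    inferInstanceAs (Projective (Projective.over (K.cycles i)))
  isKProjective_of_d_eq_zero _ fun _ _ => rfl

instance (K : CochainComplex C ℤ) (i : ℤ) :
    Epi (HomologicalComplex.homologyMap (cyclesCoverπ K) i) := by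
  let j : Projective.over (K.cycles i) ⟶ (cyclesCover K).cycles i :=
    (cyclesCover K).liftCycles (𝟙 _) (i + 1) (by simp) comp_zero
  have hj : j ≫ (cyclesCover K).iCycles i = 𝟙 _ :=
    HomologicalComplex.liftCycles_i _ _ _ _ _
  have h1 : j ≫ HomologicalComplex.cyclesMap (cyclesCoverπ K) i = Projective.π (K.cycles i) := by
    rw [← cancel_mono (K.iCycles i), Category.assoc, HomologicalComplex.cyclesMap_i,
      ← Category.assoc, hj]
    exact Category.id_comp _
  have h2 : Epi (HomologicalComplex.cyclesMap (cyclesCoverπ K) i) := by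
    have : Epi (j ≫ HomologicalComplex.cyclesMap (cyclesCoverπ K) i) := by
      rw [h1]; infer_instance
    exact epi_of_epi j _
  have h3 := HomologicalComplex.homologyπ_naturality (cyclesCoverπ K) i
  have : Epi ((cyclesCover K).homologyπ i ≫
      HomologicalComplex.homologyMap (cyclesCoverπ K) i) := by
    rw [h3]; infer_instance
  exact epi_of_epi ((cyclesCover K).homologyπ i) _

/-- The composite of the cover with the inclusion into its cone is null-homotopic, and the cover is
epi on homology; passing to the cone therefore kills all homology of `K`. -/
lemma homologyMap_inr_cyclesCoverπ (K : CochainComplex C ℤ) (i : ℤ) :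
    HomologicalComplex.homologyMap (CochainComplex.mappingCone.inr (cyclesCoverπ K)) i = 0 := by
  rw [← cancel_epi (HomologicalComplex.homologyMap (cyclesCoverπ K) i), comp_zero,
    ← HomologicalComplex.homologyMap_comp]
  exact ((HomologicalComplex.homotopyCofiber.inrCompHomotopy (cyclesCoverπ K)
    (fun j => ⟨j - 1, by simp⟩)).homologyMap_eq i).trans (HomologicalComplex.homologyMap_zero ..)

variable [HasColimitsOfShape (Discrete ℕ) C] [HasExactColimitsOfShape (Discrete ℕ) C]

/-- The cone of the cover of the cycles. -/
def killHomology (K : CochainComplex C ℤ) : CochainComplex C ℤ :=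
  CochainComplex.mappingCone (cyclesCoverπ K)

/-- The iterated cones of the covers of the cycles. -/
def killHomologyIter (K : CochainComplex C ℤ) : ℕ → CochainComplex C ℤ
  | 0 => K
  | n + 1 => killHomology (killHomologyIter K n)

/-- Every complex has a K-projective resolution. -/
theorem exists_isKProjective_quasiIso (K : CochainComplex C ℤ) :
    ∃ (F : CochainComplex C ℤ) (s : F ⟶ K), F.IsKProjective ∧ QuasiIso s := by
  let X : ℕ → CochainComplex C ℤ := killHomologyIter K
  let s : ∀ n, X n ⟶ X (n + 1) := fun n => CochainComplex.mappingCone.inr (cyclesCoverπ (X n))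
  let B := coprodComplex X
  let hB := isColimitCoprodComplex X
  let S : B ⟶ B := Cofan.IsColimit.desc hB fun n => s n ≫ coprodComplexι X (n + 1)
  have hS : ∀ n, coprodComplexι X n ≫ S = s n ≫ coprodComplexι X (n + 1) := fun n =>
    Cofan.IsColimit.fac hB _ n
  have hS0 : ∀ i, HomologicalComplex.homologyMap S i = 0 := fun i => by
    apply homologyMap_coprodComplexι_jointly_epi
    intro n
    have h0 : HomologicalComplex.homologyMap (s n) i = 0 := homologyMap_inr_cyclesCoverπ (X n) i
    rw [← HomologicalComplex.homologyMap_comp, hS, HomologicalComplex.homologyMap_comp, h0,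
      zero_comp]
  -- The shift `S` vanishes on homology because every transition map does, so `𝟙 B - S` is the
  -- identity on homology. Its cone, the homotopy colimit of the telescope, is acyclic.
  have hqis : QuasiIso (𝟙 B - S) := ⟨fun i => by
    rw [quasiIsoAt_iff_isIso_homologyMap, HomologicalComplex.homologyMap_sub, hS0, sub_zero,
      HomologicalComplex.homologyMap_id]
    infer_instance⟩
  let q := HomotopyCategory.quotient C (ComplexShape.up ℤ)
  let A := HomotopyCategory.subcategoryAcyclic C
  -- The complex `X (n + 1)` is the cone of a map from the K-projective complex `cyclesCover (X n)`,
  -- which has no maps to acyclic complexes up to homotopy.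
  have hs : ∀ n L, A L → Function.Bijective fun f : q.obj (X (n + 1)) ⟶ L => q.map (s n) ≫ f := by
    intro n L hL
    have hT := HomotopyCategory.mappingCone_triangleh_distinguished (cyclesCoverπ (X n))
    have hQ : A.leftOrthogonal (q.obj (cyclesCover (X n))) :=
      CochainComplex.IsKProjective.leftOrthogonal _
    constructor
    · intro f f' hff
      rw [← sub_eq_zero]
      have h0 : q.map (s n) ≫ (f - f') = 0 := by
        rw [Preadditive.comp_sub, sub_eq_zero]; exact hff
      obtain ⟨g, hg⟩ := Pretriangulated.Triangle.yoneda_exact₃ _ hT (f - f') h0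
      exact hg.trans ((congrArg _ (A.leftOrthogonal.le_shift 1 _ hQ g hL)).trans comp_zero)
    · intro f
      obtain ⟨g, hg⟩ := Pretriangulated.Triangle.yoneda_exact₂ _ hT f (hQ _ hL)
      exact ⟨g, hg.symm⟩
  let N := CochainComplex.mappingCone (𝟙 B - S)
  have hN : A (q.obj N) := by
    have h1 : A.trW (q.map (𝟙 B - S)) := by
      rw [← HomotopyCategory.quasiIso_eq_trW_subcategoryAcyclic,
        HomotopyCategory.quotient_map_mem_quasiIso_iff]
      exact hqis
    exact (A.trW_iff_of_distinguished _
      (HomotopyCategory.mappingCone_triangleh_distinguished (𝟙 B - S))).1 h1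
  have hT := HomotopyCategory.mappingCone_triangleh_distinguished (𝟙 B - S)
  have hκ := bijective_precomp_telescope A (X := fun n => q.obj (X n)) (fun n => q.map (s n)) hs
    (B := q.obj B) (fun n => q.map (coprodComplexι X n))
    (fun L f => by
      obtain ⟨L, rfl⟩ := HomotopyCategory.quotient_obj_surjective L
      choose f' hf' using fun n => q.map_surjective (f n)
      refine ⟨q.map (Cofan.IsColimit.desc hB f'), fun n => ?_⟩
      rw [← hf', ← q.map_comp]
      exact congrArg q.map (Cofan.IsColimit.fac hB _ n))
    (fun L g hg => by
      obtain ⟨L, rfl⟩ := HomotopyCategory.quotient_obj_surjective L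
      obtain ⟨g, rfl⟩ := q.map_surjective g
      obtain ⟨h⟩ := nonempty_homotopy_coprod_zero g fun n => by
        have := hg n
        rw [← q.map_comp, ← q.map_zero] at this
        exact ⟨HomotopyCategory.homotopyOfEq _ _ this⟩
      rw [HomotopyCategory.eq_of_homotopy _ _ h, Functor.map_zero])
    (q.map S) (fun n => by rw [← q.map_comp, hS, q.map_comp])
    (q.map (CochainComplex.mappingCone.inr (𝟙 B - S))) _
    (by
      have e : q.map (𝟙 B - S) = 𝟙 (q.obj B) - q.map S := by
        rw [Functor.map_sub, CategoryTheory.Functor.map_id]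
      rw [← e]
      exact hT)
  -- The resolution is the fibre of `K ⟶ N`. It is K-projective because this map is inverted by
  -- `Hom(-, L)` for acyclic `L`, and `F ⟶ K` is a quasi-isomorphism because `N` is acyclic.
  obtain ⟨F, i, d, hF⟩ := Pretriangulated.distinguished_cocone_triangle₁
    (q.map (coprodComplexι X 0) ≫ q.map (CochainComplex.mappingCone.inr (𝟙 B - S)))
  obtain ⟨F, rfl⟩ := HomotopyCategory.quotient_obj_surjective F
  obtain ⟨i, rfl⟩ := q.map_surjective i
  refine ⟨F, i, ?_, ?_⟩
  · rw [CochainComplex.isKProjective_iff_leftOrthogonal]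
    exact leftOrthogonal_fibre A _ _ _ hF hκ
  · have : A.trW (q.map i) := ObjectProperty.trW.mk A hF hN
    rw [← HomotopyCategory.quasiIso_eq_trW_subcategoryAcyclic,
      HomotopyCategory.quotient_map_mem_quasiIso_iff] at this
    exact this

end Resolution

/-! ### Resolutions with terms in a class of finite codimension. -/

section AcyclicResolutions

open CochainComplex HomComplex

variable {C : Type*} [Category C] [Abelian C]

lemma acyclic_mappingCone_iff {K L : CochainComplex C ℤ} (f : K ⟶ L) :
    (mappingCone f).Acyclic ↔ QuasiIso f := by
  let q := HomotopyCategory.quotient C (ComplexShape.up ℤ)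
  let A := HomotopyCategory.subcategoryAcyclic C
  rw [← HomotopyCategory.quotient_obj_mem_subcategoryAcyclic_iff_acyclic]
  refine (A.trW_iff_of_distinguished _
    (HomotopyCategory.mappingCone_triangleh_distinguished f)).symm.trans ?_
  change A.trW (q.map f) ↔ _
  rw [← HomotopyCategory.quasiIso_eq_trW_subcategoryAcyclic,
    HomotopyCategory.quotient_map_mem_quasiIso_iff]
  rfl

lemma acyclic_shift {K : CochainComplex C ℤ} (hK : K.Acyclic) (n : ℤ) : (K⟦n⟧).Acyclic := by
  intro i
  have := hK (n + i)
  rw [HomologicalComplex.exactAt_iff_isZero_homology] at this ⊢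
  exact this.of_iso ((ShiftSequence.shiftIso C n i (n + i) rfl).app K)

/-- The complex with zero differential and given terms. -/
def zeroDifferential (X : ℤ → C) : CochainComplex C ℤ where
  X := X
  d _ _ := 0
  shape _ _ _ := rfl
  d_comp_d' _ _ _ _ _ := comp_zero

/-- The embedding of a complex into a contractible one. -/
def toDisk {K : CochainComplex C ℤ} {Y : ℤ → C} (i : ∀ n, K.X n ⟶ Y n) :
    K ⟶ mappingCone (𝟙 (zeroDifferential Y)) :=
  mappingCone.lift _
    (Cocycle.mk (-(δ 0 1 (Cochain.ofHoms (G := zeroDifferential Y) i))) 2 (by lia) (by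
      rw [δ_neg, δ_δ, neg_zero]))
    (Cochain.ofHoms (G := zeroDifferential Y) i) (by
      rw [Cocycle.mk_coe, Cochain.comp_id]
      exact add_neg_cancel _)

instance {K : CochainComplex C ℤ} {Y : ℤ → C} (i : ∀ n, K.X n ⟶ Y n) [∀ n, Mono (i n)] :
    Mono (toDisk i) := by
  have (n : ℤ) : Mono ((toDisk i).f n) := by
    have h : (toDisk i).f n ≫ (mappingCone.snd (𝟙 (zeroDifferential Y))).v n n (add_zero n) =
        i n := by
      refine (mappingCone.lift_f_snd_v _ _ _ _ _ _ _).trans ?_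
      exact Cochain.ofHoms_v _ _
    have hi : Mono (i n) := inferInstance
    have : Mono ((toDisk i).f n ≫
        (mappingCone.snd (𝟙 (zeroDifferential Y))).v n n (add_zero n)) := by
      rw [h]; exact hi
    exact mono_of_mono _ ((mappingCone.snd (𝟙 (zeroDifferential Y))).v n n (add_zero n))
  exact HomologicalComplex.mono_of_mono_f _ this

variable (I : ObjectProperty C)

/-- The complexes with terms in `I`. -/
def termsIn : ObjectProperty (CochainComplex C ℤ) := fun K => ∀ n, I (K.X n)

/-- The objects all of whose `n`-th cosyzygies with respect to `I` are in `I`. -/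
def codimLE : ℕ → ObjectProperty C
  | 0 => I
  | n + 1 => fun X => ∀ S : ShortComplex C, S.ShortExact → S.X₁ = X → I S.X₂ → codimLE n S.X₃

variable [I.IsStableUnderRetracts] (hbi : ∀ X Y, I X → I Y → I (X ⊞ Y))

include hbi in
lemma termsIn_mappingCone {K L : CochainComplex C ℤ} (f : K ⟶ L) (hK : termsIn I K)
    (hL : termsIn I L) : termsIn I (mappingCone f) := fun n =>
  I.prop_of_iso (HomologicalComplex.homotopyCofiber.XIsoBiprod f n (n + 1) rfl).symm
    (hbi _ _ (hK _) (hL _))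

/-- With acyclic middle terms the connecting maps are isomorphisms from the homology of the third
term in degree `j - 1` to that of the first term in degree `j`. -/
lemma quasiIso_τ₁_of_acyclic {S S' : ShortComplex (CochainComplex C ℤ)} (φ : S ⟶ S')
    (hS : S.ShortExact) (hS' : S'.ShortExact) (h₂ : S.X₂.Acyclic) (h₂' : S'.X₂.Acyclic)
    (h₃ : QuasiIso φ.τ₃) : QuasiIso φ.τ₁ := ⟨fun j => by
  rw [quasiIsoAt_iff_isIso_homologyMap]
  have hij : (ComplexShape.up ℤ).Rel (j - 1) j := by simp
  have z := fun i => (S.X₂.exactAt_iff_isZero_homology i).1 (h₂ i)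
  have z' := fun i => (S'.X₂.exactAt_iff_isZero_homology i).1 (h₂' i)
  have := hS.isIso_δ (j - 1) j hij (z _) (z _)
  have := hS'.isIso_δ (j - 1) j hij (z' _) (z' _)
  have h := HomologicalComplex.HomologySequence.δ_naturality φ hS hS' (j - 1) j hij
  have : IsIso (hS.δ (j - 1) j hij ≫ HomologicalComplex.homologyMap φ.τ₁ j) := by
    rw [h]; infer_instance
  exact IsIso.of_isIso_comp_left (hS.δ (j - 1) j hij) _⟩

include hbi in
/-- Resolutions of complexes whose terms have bounded codimension with respect to `I`. -/
lemma exists_quasiIso_termsIn_of_codimLE (hemb : ∀ X, ∃ (Y : C) (i : X ⟶ Y), Mono i ∧ I Y)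
    (n : ℕ) (K : CochainComplex C ℤ) (hK : ∀ i, codimLE I n (K.X i)) :
    ∃ (L : CochainComplex C ℤ) (s : K ⟶ L), termsIn I L ∧ QuasiIso s := by
  induction n generalizing K with
  | zero => exact ⟨K, 𝟙 K, hK, inferInstance⟩
  | succ n ih =>
    -- Dimension shifting for whole complexes: `K` embeds into a contractible complex `D` with terms
    -- in `I`, and the terms of the quotient have smaller codimension, so that the induction
    -- hypothesis resolves it by `L₁`.
    choose Y i hi hY using fun n => hemb (K.X n)
    let D := mappingCone (𝟙 (zeroDifferential Y))
    have hD : termsIn I D := termsIn_mappingCone I hbi _ hY hY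
    have hDa : D.Acyclic := (acyclic_mappingCone_iff _).2 inferInstance
    let S := ShortComplex.mk (toDisk i) (cokernel.π (toDisk i)) (cokernel.condition _)
    have hS : S.ShortExact :=
      { exact := ShortComplex.exact_cokernel (toDisk i)
        mono_f := inferInstanceAs (Mono (toDisk i))
        epi_g := inferInstanceAs (Epi (cokernel.π (toDisk i))) }
    obtain ⟨L₁, s, hL₁, hs⟩ := ih S.X₃ fun j =>
      hK j _ ((HomologicalComplex.shortExact_iff_degreewise_shortExact S).1 hS j) rfl (hD j)
    -- Adding the contractible complex `E` makes `D ⊞ E ⟶ L₁` epi and split in every degree. Its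
    -- kernel then has terms that are retracts of objects of `I`, and it receives a
    -- quasi-isomorphism from `K`.
    let E := mappingCocone (𝟙 L₁)
    have hE : termsIn I E := fun j => termsIn_mappingCone I hbi (𝟙 L₁) hL₁ hL₁ (j + -1)
    have hEa : E.Acyclic := acyclic_shift ((acyclic_mappingCone_iff _).2 inferInstance) _
    let p : D ⊞ E ⟶ L₁ := biprod.desc (S.g ≫ s) (mappingCocone.fst (𝟙 L₁))
    let σ : ∀ j, L₁.X j ⟶ (D ⊞ E).X j := fun j =>
      (mappingCocone.inl (𝟙 L₁)).v j j (add_zero j) ≫ (biprod.inr : E ⟶ D ⊞ E).f j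
    have hσ : ∀ j, σ j ≫ p.f j = 𝟙 _ := fun j => by
      have h1 : (biprod.inr : E ⟶ D ⊞ E).f j ≫ p.f j = (mappingCocone.fst (𝟙 L₁)).f j := by
        rw [← HomologicalComplex.comp_f, biprod.inr_desc]
      rw [Category.assoc, h1, mappingCocone.inl_v_fst_f]
    have hp : Epi p := HomologicalComplex.epi_of_epi_f _ fun j =>
      (SplitEpi.mk (σ j) (hσ j)).epi
    let S' := ShortComplex.mk (kernel.ι p) p (kernel.condition p)
    have hS' : S'.ShortExact :=
      { exact := ShortComplex.exact_kernel p
        mono_f := inferInstanceAs (Mono (kernel.ι p))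
        epi_g := hp }
    have hDE : termsIn I (D ⊞ E) := fun j =>
      I.prop_of_iso (HomologicalComplex.biprodXIso D E j).symm (hbi _ _ (hD j) (hE j))
    have hDEa : (D ⊞ E).Acyclic := by
      refine (ShortComplex.Splitting.ofHasBinaryBiproduct D E).shortExact.acyclic_X₂ hDa hEa
    let φ : S ⟶ S' :=
      { τ₁ := kernel.lift p (S.f ≫ biprod.inl) (by
          rw [Category.assoc, biprod.inl_desc, ← Category.assoc, S.zero, zero_comp])
        τ₂ := biprod.inl
        τ₃ := s
        comm₁₂ := kernel.lift_ι _ _ _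
        comm₂₃ := biprod.inl_desc _ _ }
    refine ⟨kernel p, φ.τ₁, fun j => ?_, quasiIso_τ₁_of_acyclic φ hS hS' hDa hDEa hs⟩
    have hj := (HomologicalComplex.shortExact_iff_degreewise_shortExact S').1 hS' j
    have := hj.mono_f
    have sp := ShortComplex.Splitting.ofExactOfSection _ hj.exact (σ j) (hσ j) this
    exact I.prop_of_retract ⟨(kernel.ι p).f j, sp.r, sp.f_r⟩ (hDE j)

variable {C₁ : Type*} [Category C₁] [Abelian C₁] (Γ : C ⥤ C₁) [Γ.Additive]
  [PreservesFiniteLimits Γ]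

/-- A left exact functor which is exact on short exact sequences in `I` preserves the acyclicity
of complexes with terms in `I`. -/
lemma acyclic_map_of_termsIn
    (hses : ∀ S : ShortComplex C, S.ShortExact → I S.X₁ → I S.X₂ → I S.X₃ ∧ Epi (Γ.map S.g))
    (N : ℕ) (hN : ∀ X, codimLE I N X) (K : CochainComplex C ℤ) (hK : termsIn I K)
    (hKa : K.Acyclic) : ((Γ.mapHomologicalComplex (ComplexShape.up ℤ)).obj K).Acyclic := by
  have hd : ∀ i, K.toCycles i (i + 1) ≫ K.iCycles (i + 1) = K.d i (i + 1) := fun i =>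
    K.toCycles_i i (i + 1)
  have hker : ∀ i, (ShortComplex.mk (K.iCycles i) (K.d i (i + 1)) (K.iCycles_d _ _)).Exact :=
    fun i => ShortComplex.exact_of_f_is_kernel _ (K.cyclesIsKernel i (i + 1) (by simp))
  have hZ : ∀ i, K.iCycles i ≫ K.toCycles i (i + 1) = 0 := fun i => by
    rw [← cancel_mono (K.iCycles (i + 1)), Category.assoc, hd, K.iCycles_d, zero_comp]
  have hex : ∀ i, (ShortComplex.mk _ _ (hZ i)).ShortExact := fun i =>
    { exact := by
        refine (ShortComplex.exact_iff_of_epi_of_isIso_of_mono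
          (S₁ := ShortComplex.mk _ _ (hZ i)) (S₂ := ShortComplex.mk (K.iCycles i) (K.d i (i + 1)) (K.iCycles_d _ _))
          { τ₁ := 𝟙 _, τ₂ := 𝟙 _, τ₃ := K.iCycles (i + 1), comm₁₂ := ?_, comm₂₃ := ?_ }).2 (hker i)
        · exact (Category.id_comp _).trans (Category.comp_id _).symm
        · exact (Category.id_comp _).trans (hd i).symm
      mono_f := inferInstanceAs (Mono (K.iCycles i))
      epi_g := Preadditive.epi_of_isZero_cokernel' _ (K.homologyIsCokernel i (i + 1) (by simp))
        ((K.exactAt_iff_isZero_homology _).1 (hKa (i + 1))) }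
  have hcyc : ∀ n i, codimLE I n (K.cycles i) → I (K.cycles (i + n)) := by
    intro n
    induction n with
    | zero => intro i h; rwa [Int.natCast_zero, add_zero]
    | succ n ih =>
      intro i h
      have := ih (i + 1) (h _ (hex i) rfl (hK i))
      rwa [add_assoc, add_comm 1, ← Nat.cast_succ] at this
  -- Each object of cycles is an `N`-th cosyzygy of the cycles `N` places to the left, hence lies in
  -- `I`; the complex need not be bounded.
  have hI : ∀ i, I (K.cycles i) := fun i => by
    have := hcyc N (i - N) (hN _)
    rwa [sub_add_cancel] at this
  intro i
  obtain ⟨i, rfl⟩ : ∃ k, k + 1 = i := ⟨i - 1, by lia⟩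
  rw [HomologicalComplex.exactAt_iff' _ i (i + 1) (i + 1 + 1) (by simp) (by simp)]
  have hepi : Epi (Γ.map (K.toCycles i (i + 1))) := (hses _ (hex i) (hI i) (hK i)).2
  have hm : Mono (ShortComplex.mk (K.iCycles (i + 1)) (K.d (i + 1) (i + 1 + 1))
    (K.iCycles_d _ _)).f := inferInstanceAs (Mono (K.iCycles (i + 1)))
  have h := (hker (i + 1)).map_of_mono_of_preservesKernel Γ hm inferInstance
  let φ : ((Γ.mapHomologicalComplex (ComplexShape.up ℤ)).obj K).sc' i (i + 1) (i + 1 + 1) ⟶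
      (ShortComplex.mk (K.iCycles (i + 1)) (K.d (i + 1) (i + 1 + 1)) (K.iCycles_d _ _)).map Γ :=
    { τ₁ := Γ.map (K.toCycles i (i + 1))
      τ₂ := 𝟙 _
      τ₃ := 𝟙 _
      comm₁₂ := (Γ.map_comp _ _).symm.trans ((congrArg Γ.map (hd i)).trans
        (Category.comp_id _).symm)
      comm₂₃ := (Category.id_comp _).trans (Category.comp_id _).symm }
  have : Epi φ.τ₁ := hepi
  have : IsIso φ.τ₂ := inferInstanceAs (IsIso (𝟙 _))
  have : Mono φ.τ₃ := inferInstanceAs (Mono (𝟙 _))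
  exact (ShortComplex.exact_iff_of_epi_of_isIso_of_mono φ).2 h

include hbi in
/-- A left exact functor which is exact on short exact sequences in `I` preserves
quasi-isomorphisms of complexes with terms in `I`. -/
lemma quasiIso_map_of_termsIn
    (hses : ∀ S : ShortComplex C, S.ShortExact → I S.X₁ → I S.X₂ → I S.X₃ ∧ Epi (Γ.map S.g))
    (N : ℕ) (hN : ∀ X, codimLE I N X) {K L : CochainComplex C ℤ} (s : K ⟶ L) (hK : termsIn I K)
    (hL : termsIn I L) (hs : QuasiIso s) :
    QuasiIso ((Γ.mapHomologicalComplex (ComplexShape.up ℤ)).map s) := by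
  rw [← acyclic_mappingCone_iff] at hs ⊢
  have h := acyclic_map_of_termsIn I Γ hses N hN _ (termsIn_mappingCone I hbi s hK hL) hs
  intro i
  have hi := h i
  rw [HomologicalComplex.exactAt_iff_isZero_homology] at hi ⊢
  exact hi.of_iso ((HomologicalComplex.homologyFunctor C₁ _ i).mapIso
    (mappingCone.mapHomologicalComplexIso s Γ).symm)

end AcyclicResolutions

/-! ### From coproducts to all colimits in triangulated categories. -/

section AllColimits

open Pretriangulated

variable {T : Type*} [Category T] [HasZeroObject T] [HasShift T ℤ] [Preadditive T]
  [∀ n : ℤ, (shiftFunctor T n).Additive] [Pretriangulated T] [HasCoproducts.{u} T]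
  {T' : Type*} [Category T'] [Preadditive T'] (F : T ⥤ T') [F.Additive]

/-- An additive functor on a pretriangulated category which preserves coproducts preserves all
colimits. -/
lemma preservesColimits_of_preservesCoproducts
    (hF : ∀ J : Type u, PreservesColimitsOfShape (Discrete J) F) :
    PreservesColimitsOfSize.{u, u} F := by
  refine ⟨fun {𝒥} _ => ⟨fun {K} => ⟨fun {c} hc => ?_⟩⟩⟩
  have jointly : ∀ {J : Type u} (X : J → T) {Z : T'} (f g : F.obj (∐ X) ⟶ Z),
      (∀ j, F.map (Sigma.ι X j) ≫ f = F.map (Sigma.ι X j) ≫ g) → f = g := by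
    intro J X Z f g h
    have := hF J
    exact (isColimitOfPreserves F (colimit.isColimit (Discrete.functor X))).hom_ext
      fun ⟨j⟩ => h j
  let p : ∐ K.obj ⟶ c.pt := Sigma.desc c.ι.app
  have hιp : ∀ j, Sigma.ι K.obj j ≫ p = c.ι.app j := fun j => Sigma.ι_desc _ _
  have hp : Epi p := ⟨fun f g h => hc.hom_ext fun j => by
    rw [← hιp, Category.assoc, Category.assoc, h]⟩
  -- The colimit is a quotient of the coproduct of the diagram, and epimorphisms split in a
  -- pretriangulated category. It is thus a retract of the coproduct.
  obtain ⟨σ, hσ⟩ : ∃ σ : c.pt ⟶ ∐ K.obj, σ ≫ p = 𝟙 _ := by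
    have := isSplitEpi_of_epi p
    exact ⟨section_ p, IsSplitEpi.id p⟩
  let X : (Σ a b : 𝒥, a ⟶ b) → T := fun u => K.obj u.1
  let r : ∐ X ⟶ ∐ K.obj := Sigma.desc fun u =>
    Sigma.ι K.obj u.1 - K.map u.2.2 ≫ Sigma.ι K.obj u.2.1
  have hr : ∀ u, Sigma.ι X u ≫ r = Sigma.ι K.obj u.1 - K.map u.2.2 ≫ Sigma.ι K.obj u.2.1 :=
    fun u => Sigma.ι_desc _ _
  -- The cone `Z` of the map of relations `r` carries a cocone, so `q` factors through `p` and the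
  -- complementary idempotent `𝟙 - p ≫ σ` dies in `Z`. It therefore factors through `r`. Such an
  -- equation is preserved by every additive functor, and it gives the universal property after
  -- applying `F`.
  obtain ⟨y, hy⟩ : ∃ y : ∐ K.obj ⟶ ∐ X, 𝟙 _ - p ≫ σ = y ≫ r := by
    obtain ⟨Z, q, d, hT⟩ := distinguished_cocone_triangle r
    have h0 : r ≫ q = 0 := comp_distTriang_mor_zero₁₂ _ hT
    have hq : ∀ a b (u : a ⟶ b), K.map u ≫ Sigma.ι K.obj b ≫ q = Sigma.ι K.obj a ≫ q := by
      intro a b u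
      have h1 : Sigma.ι X ⟨a, b, u⟩ ≫ r ≫ q = 0 := by rw [h0, comp_zero]
      rw [← Category.assoc, hr, Preadditive.sub_comp, sub_eq_zero, Category.assoc] at h1
      exact h1.symm
    let s : Cocone K :=
      { pt := Z
        ι := { app := fun j => Sigma.ι K.obj j ≫ q
               naturality := fun a b u => (hq a b u).trans (Category.comp_id _).symm } }
    have hs : p ≫ hc.desc s = q := Sigma.hom_ext _ _ fun j => by
      rw [← Category.assoc, hιp, hc.fac]
    have h2 : (𝟙 _ - p ≫ σ) ≫ q = 0 := by
      rw [← hs, Preadditive.sub_comp, Category.id_comp, Category.assoc, reassoc_of% hσ, sub_self]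
    have h3 : ∃ y : ∐ K.obj ⟶ ∐ X, 𝟙 _ - p ≫ σ = y ≫ r := Triangle.coyoneda_exact₂ _ hT _ h2
    exact h3
  have desc (s : Cocone (K ⋙ F)) : ∃ d : F.obj (∐ K.obj) ⟶ s.pt,
      ∀ j, F.map (Sigma.ι K.obj j) ≫ d = s.ι.app j := by
    have := hF 𝒥
    let h := isColimitOfPreserves F (colimit.isColimit (Discrete.functor K.obj))
    let s' : Cocone (Discrete.functor K.obj ⋙ F) :=
      { pt := s.pt
        ι := Discrete.natTrans fun j => s.ι.app j.as }
    exact ⟨h.desc s', fun j => h.fac s' ⟨j⟩⟩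
  choose d hd using desc
  refine ⟨
    { desc := fun s => F.map σ ≫ d s
      fac := fun s j => ?_
      uniq := fun s m hm => ?_ }⟩
  · have h1 : F.map r ≫ d s = 0 := jointly _ _ _ fun u => by
      rw [← Category.assoc, ← F.map_comp, hr, F.map_sub, Preadditive.sub_comp, hd, F.map_comp,
        Category.assoc, hd, comp_zero, sub_eq_zero]
      exact ((s.ι.naturality u.2.2).trans (Category.comp_id _)).symm
    have h2 : F.map (p ≫ σ) ≫ d s = d s := by
      have : p ≫ σ = 𝟙 _ - y ≫ r := by rw [← hy, sub_sub_cancel]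
      rw [this, F.map_sub, Preadditive.sub_comp, F.map_comp, Category.assoc, h1, comp_zero,
        sub_zero, CategoryTheory.Functor.map_id, Category.id_comp]
    change F.map (c.ι.app j) ≫ F.map σ ≫ d s = _
    rw [← hιp, F.map_comp, Category.assoc, ← F.map_comp_assoc p, h2, hd]
  · have h1 : F.map p ≫ m = d s := jointly _ _ _ fun j => by
      rw [← F.map_comp_assoc, hιp, hd]
      exact hm j
    rw [← h1, ← F.map_comp_assoc, hσ, CategoryTheory.Functor.map_id, Category.id_comp]

end AllColimits

/-! ### Functors of derived categories that preserve coproducts. -/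

section DerivedCoproductPreservation

open DerivedCategory

variable {C C' : Type*} [Category C] [Abelian C] [Category C'] [Abelian C']
  [HasDerivedCategory.{w₁} C] [HasDerivedCategory.{w₂} C'] {J : Type u}
  [HasColimitsOfShape (Discrete J) C] [HasExactColimitsOfShape (Discrete J) C]
  [HasColimitsOfShape (Discrete J) C'] [HasExactColimitsOfShape (Discrete J) C']

/-- A functor on derived categories, which is induced degreewise on adapted complexes by an
additive functor preserving coproducts of the terms of these complexes, preserves coproducts. -/
lemma preservesCoproducts_of_adapted (Φ : C ⥤ C') [Φ.Additive]
    (F : DerivedCategory C ⥤ DerivedCategory C')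
    (α : Φ.mapHomologicalComplex (ComplexShape.up ℤ) ⋙ Q ⟶ Q ⋙ F)
    (P : ObjectProperty (CochainComplex C ℤ)) (hα : ∀ K, P K → IsIso (α.app K))
    (hres : ∀ X, ∃ (Y : CochainComplex C ℤ) (s : X ⟶ Y), P Y ∧ QuasiIso s)
    (hP : ∀ K : J → CochainComplex C ℤ, (∀ j, P (K j)) → P (coprodComplex K))
    (hΦ : ∀ K : J → CochainComplex C ℤ, (∀ j, P (K j)) →
      ∀ i, PreservesColimit (Discrete.functor fun j => (K j).X i) Φ) :
    PreservesColimitsOfShape (Discrete J) F := by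
  have key (K : J → CochainComplex C ℤ) (hK : ∀ j, P (K j)) :
      PreservesColimit (Discrete.functor fun j => Q.obj (K j)) F := by
    let Φ' := Φ.mapHomologicalComplex (ComplexShape.up ℤ)
    have h1 : IsColimit (Cofan.mk (Φ'.obj (coprodComplex K)) fun j =>
        Φ'.map (coprodComplexι K j)) := by
      refine HomologicalComplex.isColimitOfEval _ _ fun i => ?_
      have := hΦ K hK i
      have h := isColimitMapCoconeCofanMkEquiv Φ _ _
        (isColimitOfPreserves Φ (coproductIsCoproduct fun j => (K j).X i))
      exact (isColimitMapCoconeCofanMkEquiv (HomologicalComplex.eval C' _ i) _ _).symm h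
    have h2 : IsColimit (Cofan.mk (Q.obj (Φ'.obj (coprodComplex K))) fun j =>
        Q.map (Φ'.map (coprodComplexι K j))) := by
      exact isColimitMapCoconeCofanMkEquiv Q _ _ (isColimitOfPreserves Q h1)
    have h3 : IsColimit (Cofan.mk (F.obj (Q.obj (coprodComplex K))) fun j =>
        F.map (Q.map (coprodComplexι K j))) := by
      have := hα _ (hP K hK)
      have (j : J) := hα _ (hK j)
      let e : Discrete.functor (fun j => Q.obj (Φ'.obj (K j))) ≅
          Discrete.functor (fun j => F.obj (Q.obj (K j))) :=
        Discrete.natIso fun j => asIso (α.app (K j.as))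
      refine (IsColimit.precomposeHomEquiv e _) (IsColimit.ofIsoColimit h2
        (Cocone.ext (asIso (α.app (coprodComplex K))) fun ⟨j⟩ => α.naturality _))
    exact preservesColimit_of_preserves_colimit_cocone (isColimitQCoprod K)
      ((isColimitMapCoconeCofanMkEquiv F _ _).symm h3)
  have (X : J → DerivedCategory C) : PreservesColimit (Discrete.functor X) F := by
    have : ∀ j, ∃ (Y : CochainComplex C ℤ), P Y ∧ Nonempty (Q.obj Y ≅ X j) := fun j => by
      obtain ⟨Y, s, hY, hs⟩ := hres (Q.objPreimage (X j))
      exact ⟨Y, hY, ⟨(asIso (Q.map s)).symm ≪≫ Q.objObjPreimageIso (X j)⟩⟩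
    choose Y hY e using this
    have := key Y hY
    exact preservesColimit_of_iso_diagram F
      (K₁ := Discrete.functor fun j => Q.obj (Y j)) (Discrete.natIso fun j => (e j.as).some)
  exact preservesColimitsOfShape_of_discrete F

/-- Homology commutes with exact coproducts. -/
def isColimitHomologyCoprodComplex (K : J → CochainComplex C ℤ) (n : ℤ) :
    IsColimit (Cofan.mk ((coprodComplex K).homology n) fun j =>
      HomologicalComplex.homologyMap (coprodComplexι K j) n) := by
  let S := (familyComplex K).sc n
  let E : (Discrete J ⥤ C) ⥤ C := colim
  let e : (coprodComplex K).homology n ≅ E.obj S.homology := S.mapHomologyIso E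
  let τ (j : J) : (evaluation (Discrete J) C).obj ⟨j⟩ ⟶ E :=
    { app := fun F => colimit.ι F ⟨j⟩
      naturality := fun F G f => (ι_colimMap f ⟨j⟩).symm }
  let ε (j : J) : S.homology.obj ⟨j⟩ ≅ (K j).homology n :=
    (S.mapHomologyIso ((evaluation (Discrete J) C).obj ⟨j⟩)).symm ≪≫
      (HomologicalComplex.homologyFunctor C _ n).mapIso (familyComplexEval K j)
  have hε (j : J) : colimit.ι S.homology ⟨j⟩ ≫ e.inv =
      (ε j).hom ≫ HomologicalComplex.homologyMap (coprodComplexι K j) n := by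
    have h1 := NatTrans.app_homology (τ j) S
    have h2 : S.mapNatTrans (τ j) = (HomologicalComplex.shortComplexFunctor C _ n).map
        ((familyComplexEval K j).hom ≫ coprodComplexι K j) := by
      ext
      · exact (Category.id_comp _).symm
      · exact (Category.id_comp _).symm
      · exact (Category.id_comp _).symm
    have h3 : ShortComplex.homologyMap (S.mapNatTrans (τ j)) =
        HomologicalComplex.homologyMap (familyComplexEval K j).hom n ≫
          HomologicalComplex.homologyMap (coprodComplexι K j) n := by
      rw [h2]
      exact HomologicalComplex.homologyMap_comp (familyComplexEval K j).hom
        (coprodComplexι K j) n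
    change (τ j).app S.homology ≫ e.inv = _
    rw [h1, h3]
    have h4 : ∀ {Z : C} (g : Z ⟶ _), (g ≫ (S.mapHomologyIso E).hom) ≫ e.inv = g := fun g =>
      (Category.assoc _ _ _).trans ((congrArg _ e.hom_inv_id).trans (Category.comp_id g))
    refine (Category.assoc _ _ _).trans ((congrArg _ (h4 _)).trans ?_)
    exact (Category.assoc _ _ _).symm
  let e' : S.homology ≅ Discrete.functor fun j => (K j).homology n :=
    Discrete.natIso fun j => ε j.as
  refine (IsColimit.precomposeHomEquiv e' _) (IsColimit.ofIsoColimit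
    (colimit.isColimit S.homology) (Cocone.ext e.symm fun ⟨j⟩ => hε j))

instance preservesCoproducts_homologyFunctor (n : ℤ) :
    PreservesColimitsOfShape (Discrete J) (homologyFunctor C n) := by
  have key (K : J → CochainComplex C ℤ) :
      PreservesColimit (Discrete.functor fun j => Q.obj (K j)) (homologyFunctor C n) := by
    have h1 : IsColimit (Cofan.mk ((coprodComplex K).homology n) fun j =>
        HomologicalComplex.homologyMap (coprodComplexι K j) n) :=
      isColimitHomologyCoprodComplex K n
    have h3 : IsColimit (Cofan.mk ((homologyFunctor C n).obj (Q.obj (coprodComplex K))) fun j =>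
        (homologyFunctor C n).map (Q.map (coprodComplexι K j))) := by
      let e : Discrete.functor (fun j => (K j).homology n) ≅
          Discrete.functor (fun j => (homologyFunctor C n).obj (Q.obj (K j))) :=
        Discrete.natIso fun j => ((homologyFunctorFactors C n).app (K j.as)).symm
      refine (IsColimit.precomposeHomEquiv e _) (IsColimit.ofIsoColimit h1
        (Cocone.ext ((homologyFunctorFactors C n).app (coprodComplex K)).symm fun ⟨j⟩ =>
          (homologyFunctorFactors C n).inv.naturality _))
    exact preservesColimit_of_preserves_colimit_cocone (isColimitQCoprod K)
      ((isColimitMapCoconeCofanMkEquiv _ _ _).symm h3)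
  have (X : J → DerivedCategory C) :
      PreservesColimit (Discrete.functor X) (homologyFunctor C n) := by
    have := key fun j => Q.objPreimage (X j)
    exact preservesColimit_of_iso_diagram _
      (K₁ := Discrete.functor fun j => Q.obj (Q.objPreimage (X j)))
      (Discrete.natIso fun j => Q.objObjPreimageIso (X j.as))
  exact preservesColimitsOfShape_of_discrete _

end DerivedCoproductPreservation

/-! ### Compact objects of the derived category from projectives. -/

section Compact

open DerivedCategory

variable {C : Type*} [Category C] [Abelian C] [HasDerivedCategory.{w} C]

instance (P : C) [Projective P] (i : ℤ) :
    Projective (((HomologicalComplex.single C (ComplexShape.up ℤ) 0).obj P).X i) := by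
  by_cases hi : i = 0
  · subst hi
    exact Projective.of_iso (HomologicalComplex.singleObjXSelf _ 0 P).symm inferInstance
  · exact (HomologicalComplex.isZero_single_obj_X _ 0 P i hi).projective

instance (P : C) [Projective P] :
    CochainComplex.IsKProjective ((HomologicalComplex.single C (ComplexShape.up ℤ) 0).obj P) :=
  isKProjective_of_d_eq_zero _ fun _ _ => HomologicalComplex.single_obj_d ..

/-- `P` as the zeroth homology of the complex `P[0]`. -/
def homologySingleIso (P : C) : P ≅ (homologyFunctor C 0).obj
    (Q.obj ((HomologicalComplex.single C (ComplexShape.up ℤ) 0).obj P)) :=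
  (HomologicalComplex.singleObjHomologySelfIso (ComplexShape.up ℤ) 0 P).symm ≪≫
    (homologyFunctorFactors C 0).symm.app _

lemma homologySingleIso_hom_map_Q_map {P : C} {K : CochainComplex C ℤ}
    (φ : (HomologicalComplex.single C (ComplexShape.up ℤ) 0).obj P ⟶ K) :
    (homologySingleIso P).hom ≫ (homologyFunctor C 0).map (Q.map φ) =
      ((HomologicalComplex.singleObjCyclesSelfIso (ComplexShape.up ℤ) 0 P).inv ≫
        HomologicalComplex.cyclesMap φ 0) ≫ K.homologyπ 0 ≫
        (homologyFunctorFactors C 0).inv.app K := by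
  have h := (homologyFunctorFactors C 0).inv.naturality φ
  refine (Category.assoc _ _ _).trans ((congrArg (fun f => _ ≫ f) h.symm).trans ?_)
  change (HomologicalComplex.singleObjHomologySelfIso (ComplexShape.up ℤ) 0 P).inv ≫
    HomologicalComplex.homologyMap φ 0 ≫ _ = _
  rw [← HomologicalComplex.singleObjCyclesSelfIso_inv_homologyπ]
  rw [Category.assoc, Category.assoc]
  refine congrArg _ ?_
  refine (Category.assoc _ _ _).symm.trans ((congrArg (fun f => f ≫ _)
    (HomologicalComplex.homologyπ_naturality φ 0)).trans (Category.assoc _ _ _))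

lemma Q_map_surjective_of_isKProjective {K L : CochainComplex C ℤ} [K.IsKProjective] :
    Function.Surjective (Q.map : (K ⟶ L) → _) := by
  intro f
  obtain ⟨g, hg⟩ := (CochainComplex.IsKProjective.Qh_map_bijective K _).2
    ((quotientCompQhIso C).hom.app K ≫ f ≫ (quotientCompQhIso C).inv.app L)
  obtain ⟨g, rfl⟩ := (HomotopyCategory.quotient _ _).map_surjective g
  refine ⟨g, ?_⟩
  have := (quotientCompQhIso C).hom.naturality g
  rw [← cancel_epi ((quotientCompQhIso C).hom.app K)]
  refine this.symm.trans ?_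
  refine (congrArg (fun f => f ≫ (quotientCompQhIso C).hom.app L) hg).trans ?_
  simp

/-- Maps from a projective object in the derived category are computed by homology. -/
lemma bijective_homologyFunctor_of_projective (P : C) [Projective P] (X : DerivedCategory C) :
    Function.Bijective
      fun f : Q.obj ((HomologicalComplex.single C (ComplexShape.up ℤ) 0).obj P) ⟶ X =>
        (homologySingleIso P).hom ≫ (homologyFunctor C 0).map f := by
  suffices ∀ K : CochainComplex C ℤ, Function.Bijective
      fun f : Q.obj ((HomologicalComplex.single C (ComplexShape.up ℤ) 0).obj P) ⟶ Q.obj K =>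
        (homologySingleIso P).hom ≫ (homologyFunctor C 0).map f by
    let e := Q.objObjPreimageIso X
    have h := this (Q.objPreimage X)
    have h' := (((Iso.refl P).homCongr ((homologyFunctor C 0).mapIso e)).bijective.comp h).comp
      ((Iso.refl _).homCongr e).symm.bijective
    convert! h' using 1
    ext f
    have h1 : f = (f ≫ e.inv) ≫ e.hom := by
      rw [Category.assoc, e.inv_hom_id, Category.comp_id]
    conv_lhs => rw [h1, Functor.map_comp]
    change _ = 𝟙 _ ≫ ((homologySingleIso P).hom ≫ (homologyFunctor C 0).map (𝟙 _ ≫ f ≫ e.inv)) ≫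
      (homologyFunctor C 0).map e.hom
    rw [Category.id_comp, Category.id_comp, Category.assoc]
  intro K
  constructor
  · intro f f' hff
    rw [← sub_eq_zero]
    have h0 : (homologySingleIso P).hom ≫ (homologyFunctor C 0).map (f - f') = 0 := by
      rw [Functor.map_sub, Preadditive.comp_sub, sub_eq_zero]; exact hff
    generalize f - f' = g at h0
    obtain ⟨φ, rfl⟩ := Q_map_surjective_of_isKProjective g
    rw [homologySingleIso_hom_map_Q_map] at h0
    have h1 : ((HomologicalComplex.singleObjCyclesSelfIso (ComplexShape.up ℤ) 0 P).inv ≫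
        HomologicalComplex.cyclesMap φ 0) ≫ K.homologyπ 0 = 0 := by
      refine (cancel_mono ((homologyFunctorFactors C 0).inv.app K)).1 ?_
      exact (Category.assoc _ _ _).trans (h0.trans zero_comp.symm)
    have hex : (ShortComplex.mk (K.toCycles (-1) 0) (K.homologyπ 0)
        (K.toCycles_comp_homologyπ _ _)).Exact :=
      ShortComplex.exact_of_g_is_cokernel _ (K.homologyIsCokernel (-1) 0 (by simp))
    -- The class of `φ` in homology vanishes, so its cycle is a boundary. Projectivity of `P` lifts
    -- it through the boundary map, and this lift is the homotopy.
    let y := hex.liftFromProjective _ h1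
    have hy : y ≫ K.toCycles (-1) 0 =
        (HomologicalComplex.singleObjCyclesSelfIso (ComplexShape.up ℤ) 0 P).inv ≫
          HomologicalComplex.cyclesMap φ 0 := hex.liftFromProjective_comp _ h1
    obtain ⟨h⟩ := nonempty_homotopy_zero_of_d_eq_zero φ
      (fun _ _ => HomologicalComplex.single_obj_d ..) fun i => by
      by_cases hi : i = 0
      · subst hi
        refine ⟨(HomologicalComplex.singleObjXSelf (ComplexShape.up ℤ) 0 P).hom ≫ y, ?_⟩
        have h2 : y ≫ K.d (-1) 0 =
            (HomologicalComplex.singleObjXSelf (ComplexShape.up ℤ) 0 P).inv ≫ φ.f 0 := by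
          rw [← K.toCycles_i, ← Category.assoc, hy, Category.assoc, HomologicalComplex.cyclesMap_i,
            ← Category.assoc, HomologicalComplex.singleObjCyclesSelfIso_inv_iCycles]
        rw [Category.assoc]
        refine (congrArg _ h2).trans ?_
        rw [Iso.hom_inv_id_assoc]
      · exact ⟨0, (HomologicalComplex.isZero_single_obj_X _ 0 P i hi).eq_of_src _ _⟩
    rw [Q_map_eq_of_homotopy C h, Functor.map_zero]
  · intro g
    let g' : P ⟶ K.homology 0 := g ≫ (homologyFunctorFactors C 0).hom.app K
    let z := Projective.factorThru g' (K.homologyπ 0)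
    have hz : z ≫ K.homologyπ 0 = g' := Projective.factorThru_comp _ _
    let φ : (HomologicalComplex.single C (ComplexShape.up ℤ) 0).obj P ⟶ K :=
      HomologicalComplex.mkHomFromSingle (z ≫ K.iCycles 0) fun k _ => by
        rw [Category.assoc, K.iCycles_d, comp_zero]
    refine ⟨Q.map φ, ?_⟩
    dsimp only
    have h1 : (HomologicalComplex.singleObjCyclesSelfIso (ComplexShape.up ℤ) 0 P).inv ≫
        HomologicalComplex.cyclesMap φ 0 = z := by
      rw [← cancel_mono (K.iCycles 0), Category.assoc, HomologicalComplex.cyclesMap_i,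
        ← Category.assoc, HomologicalComplex.singleObjCyclesSelfIso_inv_iCycles]
      simp [φ]
    rw [homologySingleIso_hom_map_Q_map, h1]
    refine (Category.assoc _ _ _).symm.trans ?_
    rw [hz]
    change (g ≫ _) ≫ _ = g
    refine (Category.assoc _ _ _).trans ((congrArg _ (Iso.hom_inv_id_app _ _)).trans ?_)
    exact Category.comp_id _

/-- Every morphism from `P` to a coproduct is a finite sum of morphisms to the summands. -/
def IsFinitary {D : Type*} [Category D] [Preadditive D] (P : D) : Prop :=
  ∀ ⦃J : Type u⦄ (X : J → D) (Z : D) (i : ∀ j, X j ⟶ Z), IsColimit (Cofan.mk Z i) →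
    ∀ f : P ⟶ Z, ∃ (s : Finset J) (g : ∀ j, P ⟶ X j), f = ∑ j ∈ s, g j ≫ i j

/-- Zero maps provide projections `π j` of the coproduct onto its summands. A finitary `P` sees only
finitely many of them, so the map out of `Hom(P, Z)` determined by a cocone is the finite sum of its
values on the `f ≫ π j`. -/
lemma isCompactObject_of_isFinitary {D : Type*} [Category D] [Preadditive D] {P : D}
    (hP : IsFinitary.{u} P) : IsCompactObject.{u} P := by
  classical
  intro J
  have (X : J → D) : PreservesColimit (Discrete.functor X)
      (preadditiveCoyoneda.obj (Opposite.op P)) := by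
    refine ⟨fun {c} hc => ⟨?_⟩⟩
    let i : ∀ j, X j ⟶ c.pt := fun j => c.ι.app ⟨j⟩
    have hi : IsColimit (Cofan.mk c.pt i) :=
      IsColimit.ofIsoColimit hc (Cocone.ext (Iso.refl _) fun _ => Category.comp_id _)
    let π : ∀ j, c.pt ⟶ X j := fun j => Cofan.IsColimit.desc hi fun k =>
      if h : k = j then eqToHom (congrArg X h) else 0
    have hπ : ∀ k j, i k ≫ π j = if h : k = j then eqToHom (congrArg X h) else 0 :=
      fun k j => Cofan.IsColimit.fac hi _ k
    have hπ' : ∀ k j, k ≠ j → i k ≫ π j = 0 := fun k j h => by rw [hπ, dif_neg h]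
    have hfin : ∀ f : P ⟶ c.pt, ∃ s : Finset J, ∀ j ∉ s, f ≫ π j = 0 := fun f => by
      obtain ⟨s, g, rfl⟩ := hP X c.pt i hi f
      refine ⟨s, fun j hj => ?_⟩
      rw [Preadditive.sum_comp]
      refine Finset.sum_eq_zero fun k hk => ?_
      rw [Category.assoc, hπ' k j (by rintro rfl; exact hj hk), comp_zero]
    let d (s : Cocone (Discrete.functor X ⋙ preadditiveCoyoneda.obj (Opposite.op P))) (j : J) :
        (P ⟶ X j) →+ s.pt := (s.ι.app ⟨j⟩).hom
    have hsupp (s) (f : P ⟶ c.pt) : (Function.support fun j => d s j (f ≫ π j)).Finite := by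
      obtain ⟨t, ht⟩ := hfin f
      refine t.finite_toSet.subset fun j hj => ?_
      by_contra hjt
      exact hj ((congrArg (d s j) (ht j hjt)).trans (map_zero _))
    let D (s : Cocone (Discrete.functor X ⋙ preadditiveCoyoneda.obj (Opposite.op P))) :
        (P ⟶ c.pt) →+ s.pt := AddMonoidHom.mk' (fun f => ∑ᶠ j, d s j (f ≫ π j)) fun f g => by
      rw [← finsum_add_distrib (hsupp s f) (hsupp s g)]
      exact finsum_congr fun j => by rw [Preadditive.add_comp, map_add]
    have hD (s) (j : J) (g : P ⟶ X j) : D s (g ≫ i j) = d s j g := by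
      change ∑ᶠ k, d s k ((g ≫ i j) ≫ π k) = _
      rw [finsum_eq_single _ j fun k hk => by
        rw [Category.assoc, hπ' j k hk.symm, comp_zero, map_zero], Category.assoc, hπ, dif_pos rfl,
        eqToHom_refl, Category.comp_id]
    refine
      { desc := fun s => AddCommGrpCat.ofHom (D s)
        fac := fun s ⟨j⟩ => AddCommGrpCat.ext fun g => hD s j g
        uniq := fun s m hm => AddCommGrpCat.ext fun f => ?_ }
    obtain ⟨t, g, rfl⟩ := hP X c.pt i hi f
    have hsum (m' : (P ⟶ c.pt) →+ s.pt) (hm' : ∀ j (g : P ⟶ X j), m' (g ≫ i j) = d s j g) :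
        m' (∑ j ∈ t, g j ≫ i j) = D s (∑ j ∈ t, g j ≫ i j) := by
      rw [map_sum, map_sum]
      exact Finset.sum_congr rfl fun j _ => by rw [hD, hm']
    exact hsum m.hom fun j g => congrArg (fun q => q.hom g) (hm ⟨j⟩)
  exact preservesColimitsOfShape_of_discrete _

/-- A finitary projective object is finitary in the derived category. -/
lemma isFinitary_Q_single (P : C) [Projective P] [HasCoproducts.{u} C]
    [∀ J : Type u, HasExactColimitsOfShape (Discrete J) C] (hP : IsFinitary.{u} P) :
    IsFinitary.{u} (Q.obj ((HomologicalComplex.single C (ComplexShape.up ℤ) 0).obj P)) := by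
  intro J X Z i hc f
  have h := isColimitMapCoconeCofanMkEquiv (homologyFunctor C 0) _ _
    (isColimitOfPreserves (homologyFunctor C 0) hc)
  obtain ⟨s, g, hg⟩ := hP _ _ _ h ((homologySingleIso P).hom ≫ (homologyFunctor C 0).map f)
  choose g' hg' using fun j => (bijective_homologyFunctor_of_projective P (X j)).2 (g j)
  refine ⟨s, g', (bijective_homologyFunctor_of_projective P _).1 ?_⟩
  dsimp only at hg' ⊢
  rw [hg, Functor.map_sum, Preadditive.comp_sum]
  refine Finset.sum_congr rfl fun j _ => ?_
  rw [Functor.map_comp, ← Category.assoc, hg']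

/-- A left adjoint of a coproduct-preserving functor preserves finitary objects. -/
lemma isFinitary_leftAdjoint_obj {D D' : Type*} [Category D] [Preadditive D] [Category D']
    [Preadditive D'] {L : D ⥤ D'} {R : D' ⥤ D} (adj : L ⊣ R) [L.Additive]
    (hR : ∀ J : Type u, PreservesColimitsOfShape (Discrete J) R) {P : D} (hP : IsFinitary.{u} P) :
    IsFinitary.{u} (L.obj P) := by
  intro J X Z i hc f
  have := hR J
  have h := isColimitMapCoconeCofanMkEquiv R _ _ (isColimitOfPreserves R hc)
  obtain ⟨s, g, hg⟩ := hP _ _ _ h (adj.homEquiv _ _ f)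
  refine ⟨s, fun j => (adj.homEquiv _ _).symm (g j), (adj.homEquiv _ _).injective ?_⟩
  rw [hg]
  have := adj.right_adjoint_additive
  rw [← adj.homAddEquiv_apply, map_sum]
  refine Finset.sum_congr rfl fun j _ => ?_
  rw [adj.homAddEquiv_apply, adj.homEquiv_naturality_right, Equiv.apply_symm_apply]

end Compact

/-! ### Derived adjoints under hypotheses on the abelian categories. -/

section Conclusions

open DerivedCategory

variable {C : Type*} [Category C] [Abelian C] [HasDerivedCategory.{w} C]

lemma hasCoproducts_derivedCategory [HasCoproducts.{u} C]
    [∀ J : Type u, HasExactColimitsOfShape (Discrete J) C] :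
    HasCoproducts.{u} (DerivedCategory C) := fun _ => hasColimitsOfShape_derivedCategory

lemma isZero_Q_obj_of_acyclic {K : CochainComplex C ℤ} (hK : K.Acyclic) : IsZero (Q.obj K) := by
  have : QuasiIso (0 : K ⟶ K) := ⟨fun i => by
    rw [quasiIsoAt_iff_isIso_homologyMap, HomologicalComplex.homologyMap_zero]
    have := (K.exactAt_iff_isZero_homology i).1 (hK i)
    exact ⟨0, this.eq_of_src _ _, this.eq_of_src _ _⟩⟩
  have h : IsIso (Q.map (0 : K ⟶ K)) := inferInstance
  rw [Functor.map_zero] at h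
  rw [IsZero.iff_id_eq_zero, ← IsIso.hom_inv_id (0 : Q.obj K ⟶ Q.obj K), zero_comp]

variable {C' : Type*} [Category C'] [Abelian C'] [HasDerivedCategory.{w₁} C']

/-- An exact functor which preserves coproducts preserves the colimits of the derived category. -/
lemma preservesColimits_mapDerivedCategory [HasCoproducts.{u} C] [HasCoproducts.{u} C']
    [∀ J : Type u, HasExactColimitsOfShape (Discrete J) C]
    [∀ J : Type u, HasExactColimitsOfShape (Discrete J) C'] (F : C ⥤ C') [F.Additive]
    [PreservesFiniteLimits F] [PreservesFiniteColimits F]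
    (hF : ∀ J : Type u, PreservesColimitsOfShape (Discrete J) F) :
    PreservesColimitsOfSize.{u, u} F.mapDerivedCategory := by
  have : HasCoproducts.{u} (DerivedCategory C) := hasCoproducts_derivedCategory
  refine preservesColimits_of_preservesCoproducts _ fun J => ?_
  have := hF J
  exact preservesCoproducts_of_adapted F F.mapDerivedCategory F.mapDerivedCategoryFactors.inv ⊤
    (fun _ _ => inferInstance) (fun X => ⟨X, 𝟙 X, trivial, inferInstance⟩)
    (fun _ _ => trivial) (fun _ _ _ => inferInstance)

/-- The left derived functor of a left adjoint of an exact functor. -/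
lemma exists_left_derived_adjoint_of_enoughProjectives [EnoughProjectives C']
    [HasColimitsOfShape (Discrete ℕ) C'] [HasExactColimitsOfShape (Discrete ℕ) C']
    {Φ : C' ⥤ C} {G : C ⥤ C'} [Φ.Additive] [G.Additive] (adj : Φ ⊣ G)
    [PreservesFiniteLimits G] [PreservesFiniteColimits G] :
    ∃ (LF : DerivedCategory C' ⥤ DerivedCategory C)
      (α : Q ⋙ LF ⟶ Φ.mapHomologicalComplex (ComplexShape.up ℤ) ⋙ Q),
      LF.IsLeftDerivedFunctor α (HomologicalComplex.quasiIso _ (ComplexShape.up ℤ)) ∧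
      Nonempty (LF ⊣ G.mapDerivedCategory) := by
  refine exists_left_derived_adjoint adj CochainComplex.IsKProjective ?_ ?_
  · intro X
    obtain ⟨F, s, hF, hs⟩ := exists_isKProjective_quasiIso X
    exact ⟨F, s, hF, hs⟩
  -- A quasi-isomorphism of K-projective complexes is a homotopy equivalence, and every additive
  -- functor preserves those.
  · intro X Y s hX hY hs
    have h := (CochainComplex.IsKProjective.quasiIso_iff s).1 hs
    obtain ⟨e, rfl⟩ := h
    exact ((Φ.mapHomotopyEquiv e).quasiIso_hom :)

section Right

variable [HasCoproducts.{u} C] [HasCoproducts.{u} C']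
  [∀ J : Type u, HasExactColimitsOfShape (Discrete J) C]
  [∀ J : Type u, HasExactColimitsOfShape (Discrete J) C']
  {π : C' ⥤ C} {Γ : C ⥤ C'} [π.Additive] [Γ.Additive] (adj : π ⊣ Γ)
  [PreservesFiniteLimits π] [PreservesFiniteColimits π] [Γ.Full] [Γ.Faithful]

include adj in
-- The exact functor `π` recovers `Y` from `Γ Y`, as the counit is invertible when `Γ` is fully
-- faithful.
lemma acyclic_of_acyclic_map {Y : CochainComplex C ℤ}
    (hY : ((Γ.mapHomologicalComplex (ComplexShape.up ℤ)).obj Y).Acyclic) : Y.Acyclic := by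
  intro i
  have h := hY i
  rw [HomologicalComplex.exactAt_iff' _ (i - 1) i (i + 1) (by simp) (by simp)] at h ⊢
  have h1 : ((Y.sc' (i - 1) i (i + 1)).map (Γ ⋙ π)).Exact := h.map π
  exact (ShortComplex.exact_iff_of_iso
    ((Y.sc' (i - 1) i (i + 1)).mapNatIso (asIso adj.counit))).1 h1

variable (I : ObjectProperty C) [I.IsStableUnderRetracts]
  (hbi : ∀ X Y, I X → I Y → I (X ⊞ Y))
  (hemb : ∀ X, ∃ (Y : C) (i : X ⟶ Y), Mono i ∧ I Y)
  (hses : ∀ S : ShortComplex C, S.ShortExact → I S.X₁ → I S.X₂ → I S.X₃ ∧ Epi (Γ.map S.g))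
  (N : ℕ) (hN : ∀ X, codimLE I N X)
  (hcop : ∀ (J : Type u) (X : J → C), (∀ j, I (X j)) → I (∐ X))
  (hΓ : ∀ (J : Type u) (X : J → C), (∀ j, I (X j)) → PreservesColimit (Discrete.functor X) Γ)
  {ι : Type u} (P : ι → C') (hP : ∀ i, Projective (P i)) (hfin : ∀ i, IsFinitary.{u} (P i))
  (hgen : ∀ M : C', (∀ i (f : P i ⟶ M), f = 0) → IsZero M)

include adj hbi hemb hses hN hcop hΓ hP hfin hgen in
/-- The derived functors of an exact functor with a fully faithful right adjoint of bounded
cohomological dimension which commutes with coproducts of acyclic objects. -/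
theorem exists_right_derived_adjoint_and_isCompactlyGenerated :
    (∃ (RG : DerivedCategory C ⥤ DerivedCategory C')
      (α : Γ.mapHomologicalComplex (ComplexShape.up ℤ) ⋙ Q ⟶ Q ⋙ RG)
      (_ : RG.IsRightDerivedFunctor α (HomologicalComplex.quasiIso _ (ComplexShape.up ℤ))),
      Nonempty (π.mapDerivedCategory ⊣ RG) ∧ PreservesColimitsOfSize.{u, u} RG) ∧
    IsCompactlyGenerated.{u} (DerivedCategory C) := by
  have : HasCoproducts.{u} (DerivedCategory C) := hasCoproducts_derivedCategory
  have : PreservesLimitsOfSize.{0, 0} Γ := adj.rightAdjoint_preservesLimits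
  have : PreservesFiniteLimits Γ := PreservesLimitsOfSize.preservesFiniteLimits Γ
  have hres : ∀ X, ∃ (Y : CochainComplex C ℤ) (s : X ⟶ Y), termsIn I Y ∧ QuasiIso s :=
    fun X => exists_quasiIso_termsIn_of_codimLE I hbi hemb N X fun i => hN _
  obtain ⟨RG, α, hα, ⟨A⟩, hα'⟩ := exists_right_derived_adjoint adj (termsIn I) hres
    fun Y Y' s hY hY' hs => quasiIso_map_of_termsIn I hbi Γ hses N hN s hY hY' hs
  have hadd : RG.Additive := A.right_adjoint_additive
  have hRG (J : Type u) : PreservesColimitsOfShape (Discrete J) RG :=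
    preservesCoproducts_of_adapted Γ RG α (termsIn I) hα' hres
      (fun K hK i => hcop J _ fun j => hK j i) (fun K hK i => hΓ J _ fun j => hK j i)
  refine ⟨⟨RG, α, hα, ⟨A⟩, preservesColimits_of_preservesCoproducts RG hRG⟩, inferInstance, ι,
    fun i => π.mapDerivedCategory.obj
      (Q.obj ((HomologicalComplex.single C' (ComplexShape.up ℤ) 0).obj (P i))), fun i => ?_, ?_⟩
  · have := hP i
    exact isCompactObject_of_isFinitary
      (isFinitary_leftAdjoint_obj A hRG (isFinitary_Q_single (P i) (hfin i)))
  · intro X hX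
    -- On an adapted complex `RG` is `Γ` applied termwise. By adjunction the vanishing of all maps
    -- from the generators says that no `P i` maps nontrivially to the homology of `Γ Y`, so `Γ Y`
    -- is acyclic, and then so is `Y`.
    obtain ⟨Y, s, hY, hs⟩ := hres (Q.objPreimage X)
    let e : X ≅ Q.obj Y := (Q.objObjPreimageIso X).symm ≪≫ asIso (Q.map s)
    refine (isZero_Q_obj_of_acyclic (acyclic_of_acyclic_map adj fun n => ?_)).of_iso e
    let e' : X⟦n⟧ ≅ Q.obj (Y⟦n⟧) := (shiftFunctor _ n).mapIso e ≪≫ (Q.commShiftIso n).symm.app Y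
    have hα'' : IsIso (α.app (Y⟦n⟧)) := hα' _ fun i => hY (i + n)
    have h0 : IsZero ((homologyFunctor C' 0).obj (RG.obj (Q.obj (Y⟦n⟧)))) := by
      refine hgen _ fun i f => ?_
      have := hP i
      obtain ⟨g, rfl⟩ := (bijective_homologyFunctor_of_projective (P i) _).2 f
      have hg : (A.homEquiv _ _).symm g ≫ e'.inv = 0 := hX i n _
      have hg' : (A.homEquiv _ _).symm g = 0 := by
        rw [← cancel_mono e'.inv, hg, zero_comp]
      have hg'' : g = 0 := by
        rw [← (A.homEquiv _ _).apply_symm_apply g, hg', ← A.homAddEquiv_apply, map_zero]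
      dsimp only
      rw [hg'', Functor.map_zero, comp_zero]
    have h1 := h0.of_iso ((homologyFunctor C' 0).mapIso (asIso (α.app (Y⟦n⟧))))
    have h2 := h1.of_iso ((homologyFunctorFactors C' 0).symm.app _)
    have h3 := h2.of_iso ((HomologicalComplex.homologyFunctor C' _ 0).mapIso
      (((Γ.mapHomologicalComplex (ComplexShape.up ℤ)).commShiftIso n).symm.app Y))
    have h4 := h3.of_iso ((CochainComplex.ShiftSequence.shiftIso C' n 0 n (by lia)).symm.app _)
    exact (HomologicalComplex.exactAt_iff_isZero_homology _ n).2 h4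

end Right

end Conclusions

/-! ### Localization at a Serre class from formal local cohomology. -/

section SerreQuotient

open ObjectProperty

variable {C : Type*} [Category C] [Abelian C] (P : ObjectProperty C) [P.IsSerreClass]

lemma shortExact_cokernel {X Y : C} (f : X ⟶ Y) [Mono f] :
    (ShortComplex.mk f (cokernel.π f) (cokernel.condition f)).ShortExact where
  exact := ShortComplex.exact_cokernel f
  mono_f := by assumption

lemma shortExact_kernel {X Y : C} (f : X ⟶ Y) [Epi f] :
    (ShortComplex.mk (kernel.ι f) f (kernel.condition f)).ShortExact where
  exact := ShortComplex.exact_kernel f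
  epi_g := by assumption

/-- There are no nonzero maps from objects of `P` to `X`. -/
def TorsionFree : ObjectProperty C := fun X => ∀ ⦃T⦄ (f : T ⟶ X), P T → f = 0

variable {P}

/-- Two extensions differ by a map from the torsion object `cokernel i` to `S.X₁`, which is zero.
For existence, extend into the injective `S.X₂`; the composite to the torsion-free `S.X₃` factors
through `cokernel i`, hence vanishes, and the extension lands in `S.X₁`. -/
lemma bijective_precomp_of_mono {S : ShortComplex C} (hS : S.ShortExact) [Injective S.X₂]
    (h₁ : TorsionFree P S.X₁) (h₃ : TorsionFree P S.X₃) {X Y : C} (i : X ⟶ Y) [Mono i]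
    (hi : P (cokernel i)) : Function.Bijective (fun f : Y ⟶ S.X₁ => i ≫ f) := by
  have := hS.mono_f
  constructor
  · intro f f' hff
    have h0 : i ≫ (f - f') = 0 := by rw [Preadditive.comp_sub, sub_eq_zero]; exact hff
    rw [← sub_eq_zero, ← cokernel.π_desc i (f - f') h0, h₁ (cokernel.desc i _ h0) hi, comp_zero]
  · intro h
    have h0 : i ≫ Injective.factorThru (h ≫ S.f) i ≫ S.g = 0 := by simp
    have h0' : Injective.factorThru (h ≫ S.f) i ≫ S.g = 0 := by
      rw [← cokernel.π_desc i _ h0, h₃ (cokernel.desc i _ h0) hi, comp_zero]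
    refine ⟨hS.exact.lift _ h0', ?_⟩
    rw [← cancel_mono S.f]
    simp

lemma bijective_precomp_of_epi {M : C} (hM : TorsionFree P M) {X Y : C} (q : X ⟶ Y) [Epi q]
    (hq : P (kernel q)) : Function.Bijective (fun f : Y ⟶ M => q ≫ f) :=
  ⟨fun _ _ hff => (cancel_epi q).1 hff, fun h =>
    ⟨(ShortComplex.exact_kernel q).desc h (hM _ hq), (ShortComplex.exact_kernel q).g_desc _ _⟩⟩

/-- A torsion-free object with an injective resolution starting with a torsion-free cokernel is
local. -/
lemma isLocal_of_shortExact {S : ShortComplex C} (hS : S.ShortExact) [Injective S.X₂]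
    (h₁ : TorsionFree P S.X₁) (h₃ : TorsionFree P S.X₃) : P.isoModSerre.isLocal S.X₁ := by
  rw [MorphismProperty.isLocal_iff]
  intro X Y f hf
  have hq : P (kernel (Abelian.factorThruImage f)) := (monoModSerre.isoModSerre_factorThruImage hf.1).1
  have hi : P (cokernel (Abelian.image.ι f)) := (epiModSerre.isoModSerre_image_ι hf.2).2
  have := (bijective_precomp_of_epi h₁ (Abelian.factorThruImage f) hq).comp
    (bijective_precomp_of_mono hS h₁ h₃ (Abelian.image.ι f) hi)
  convert this using 2 with g
  simp

variable (P) in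
/-- The formal properties of the vanishing of the right derived functors of a localization: `V i M`
stands for the vanishing of the `i`-th local cohomology of `M` with respect to the Serre class
`P`. -/
structure LocalVanishing (V : ℕ → ObjectProperty C) : Prop where
  retract : ∀ {i X Y} (s : X ⟶ Y) (r : Y ⟶ X), s ≫ r = 𝟙 X → V i Y → V i X
  sub : ∀ {X Y} (f : X ⟶ Y) [Mono f], V 0 Y → V 0 X
  ext : ∀ {S : ShortComplex C}, S.ShortExact → ∀ {i}, V i S.X₁ → V i S.X₃ → V i S.X₂
  quot : ∀ {S : ShortComplex C}, S.ShortExact → ∀ {i}, V i S.X₂ → V (i + 1) S.X₁ → V i S.X₃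
  ker : ∀ {S : ShortComplex C}, S.ShortExact → ∀ {i}, V (i + 1) S.X₂ → V i S.X₃ → V (i + 1) S.X₁
  torsion : ∀ {T}, P T → ∀ i, V (i + 1) T
  torsionFree : ∀ {M}, V 0 M → TorsionFree P M
  torsionSub : ∀ M, ∃ (F : C) (p : M ⟶ F), Epi p ∧ P (kernel p) ∧ V 0 F
  embed : ∀ M, V 0 M → ∃ (E : C) (f : M ⟶ E), Mono f ∧ Injective E ∧ V 0 E
  injective : ∀ {E}, Injective E → V 0 E → ∀ i, V i E

namespace LocalVanishing

variable {V : ℕ → ObjectProperty C} (hV : LocalVanishing P V)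

include hV

lemma of_iso {X Y : C} (e : X ≅ Y) {i : ℕ} (h : V i X) : V i Y := hV.retract e.inv e.hom (by simp) h

/-- In a torsion-free injective hull `E` of `M`, the quotient `E / M` is torsion-free by `V 0 E` and
`V 1 M`, so that `isLocal_of_shortExact` applies. -/
lemma isLocal {M : C} (h₀ : V 0 M) (h₁ : V 1 M) : P.isoModSerre.isLocal M := by
  obtain ⟨E, f, hf, hE, hE'⟩ := hV.embed M h₀
  have hS := shortExact_cokernel f
  have : Injective (ShortComplex.mk f (cokernel.π f) (cokernel.condition f)).X₂ := hE
  exact isLocal_of_shortExact hS (hV.torsionFree h₀) (hV.torsionFree (hV.quot hS hE' h₁))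

/-- Every object has a localization. -/
lemma exists_localization (M : C) : ∃ (L : C) (f : M ⟶ L), P.isoModSerre f ∧ V 0 L ∧ V 1 L := by
  -- The localization is the preimage, in a torsion-free injective `E` containing `F = M / torsion`,
  -- of the torsion of `E / F`. It appears here as the kernel of `E ⟶ D` with `D` the torsion-free
  -- quotient of `E / F`.
  obtain ⟨F, p, hp, hpP, hF⟩ := hV.torsionSub M
  obtain ⟨E, j, hj, hE, hE'⟩ := hV.embed F hF
  obtain ⟨D, q, hq, hqP, hD⟩ := hV.torsionSub (cokernel j)
  let π := cokernel.π j ≫ q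
  have hπ : Epi π := epi_comp _ _
  have hS := shortExact_kernel π
  let i : F ⟶ kernel π := kernel.lift π j (by simp [π])
  have hij : i ≫ kernel.ι π = j := kernel.lift_ι _ _ _
  have hi : Mono i := by
    have : Mono (i ≫ kernel.ι π) := by rw [hij]; exact hj
    exact mono_of_mono i (kernel.ι π)
  let t : kernel π ⟶ kernel q :=
    kernel.lift q (kernel.ι π ≫ cokernel.π j) (by rw [Category.assoc]; exact kernel.condition π)
  have ht : t ≫ kernel.ι q = kernel.ι π ≫ cokernel.π j := kernel.lift_ι _ _ _
  have hit : i ≫ t = 0 := by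
    rw [← cancel_mono (kernel.ι q), Category.assoc, ht, reassoc_of% hij, cokernel.condition, zero_comp]
  have hex : (ShortComplex.mk i t hit).Exact := by
    refine ShortComplex.exact_of_f_is_kernel _ (KernelFork.IsLimit.ofι' i hit fun {A} x hx => ?_)
    have h0 : (x ≫ kernel.ι π) ≫ cokernel.π j = 0 := by
      rw [Category.assoc, ← ht, reassoc_of% hx, zero_comp]
    refine ⟨(ShortComplex.exact_cokernel j).lift _ h0, ?_⟩
    rw [← cancel_mono (kernel.ι π), Category.assoc, hij]
    exact (ShortComplex.exact_cokernel j).lift_f _ _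
  have hci : P (cokernel i) := by
    have : Mono (cokernel.desc i t hit) := hex.mono_cokernelDesc
    exact P.prop_of_mono (cokernel.desc i t hit) hqP
  refine ⟨kernel π, p ≫ i, P.isoModSerre.comp_mem _ _ (P.isoModSerre_of_epi p hpP)
    (P.isoModSerre_of_mono i hci), hV.sub (kernel.ι π) hE', hV.ker hS (hV.injective hE hE' 1) hD⟩

/-- Factor through the image: the kernel and the cokernel of `f` are torsion and have no local
cohomology in positive degrees. In degree zero they do, hence the shifted index. -/
lemma of_isoModSerre {M N : C} (f : M ⟶ N) (hf : P.isoModSerre f) {i : ℕ} (h : V (i + 1) M) :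
    V (i + 1) N := by
  have h₁ : V (i + 1) (Abelian.image f) := by
    have hS := shortExact_kernel (Abelian.factorThruImage f)
    exact hV.quot hS h (hV.torsion (monoModSerre.isoModSerre_factorThruImage hf.1).1 _)
  have hS := shortExact_cokernel (Abelian.image.ι f)
  exact hV.ext hS h₁ (hV.torsion (epiModSerre.isoModSerre_image_ι hf.2).2 _)

end LocalVanishing

variable (P) {D : Type*} [Category D] [Abelian D] (L : C ⥤ D) [L.IsLocalization P.isoModSerre]

lemma bijective_map_of_isLocal {M : C} (hM : P.isoModSerre.isLocal M) (X : C) :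
    Function.Bijective (fun f : X ⟶ M => L.map f) := by
  rw [MorphismProperty.isLocal_iff] at hM
  constructor
  · intro f g hfg
    obtain ⟨Z, s, hs, h⟩ := (MorphismProperty.map_eq_iff_precomp L P.isoModSerre f g).1 hfg
    exact (hM s hs).1 h
  · intro f
    obtain ⟨φ, hφ⟩ := Localization.exists_rightFraction L P.isoModSerre f
    obtain ⟨g, hg⟩ := (hM φ.s φ.hs).2 φ.f
    have : IsIso (L.map φ.s) := Localization.inverts L P.isoModSerre φ.s φ.hs
    refine ⟨g, ?_⟩
    rw [hφ, ← cancel_epi (L.map φ.s), MorphismProperty.RightFraction.map_s_comp_map, ← hg, L.map_comp]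

variable {V : ℕ → ObjectProperty C} (hV : LocalVanishing P V)

include hV

/-- The right adjoint of the localization functor. -/
lemma exists_rightAdjoint_localization :
    ∃ (Γ : D ⥤ C) (adj : L ⊣ Γ), IsIso adj.counit ∧ ∀ Y, V 0 (Γ.obj Y) ∧ V 1 (Γ.obj Y) := by
  have := Localization.essSurj L P.isoModSerre
  have key : ∀ Y : D, ∃ M : C, Nonempty (L.obj M ≅ Y) ∧ V 0 M ∧ V 1 M := fun Y => by
    obtain ⟨M, f, hf, h⟩ := hV.exists_localization (L.objPreimage Y)
    have := Localization.inverts L P.isoModSerre f hf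
    exact ⟨M, ⟨(asIso (L.map f)).symm ≪≫ L.objObjPreimageIso Y⟩, h⟩
  choose M θ h using key
  replace θ := fun Y => (θ Y).some
  have hb : ∀ X Y, Function.Bijective (fun f : X ⟶ M Y => L.map f ≫ (θ Y).hom) := fun X Y =>
    ((θ Y).homToEquiv (Z := L.obj X)).bijective.comp
      (bijective_map_of_isLocal P L (hV.isLocal (h Y).1 (h Y).2) X)
  let e : ∀ X Y, (L.obj X ⟶ Y) ≃ (X ⟶ M Y) := fun X Y => (Equiv.ofBijective _ (hb X Y)).symm
  have he : ∀ X' X Y f g, e X' Y (L.map f ≫ g) = f ≫ e X Y g := fun X' X Y f g => by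
    rw [Equiv.symm_apply_eq]
    change _ = L.map (f ≫ e X Y g) ≫ _
    rw [L.map_comp, Category.assoc]
    exact congrArg _ ((e X Y).symm_apply_apply g).symm
  refine ⟨_, Adjunction.adjunctionOfEquivRight e he, ?_, fun Y => h Y⟩
  rw [NatTrans.isIso_iff_isIso_app]
  intro Y
  have : (Adjunction.adjunctionOfEquivRight e he).counit.app Y = (θ Y).hom := by
    change L.map (𝟙 (M Y)) ≫ (θ Y).hom = _
    rw [CategoryTheory.Functor.map_id, Category.id_comp]
  rw [this]
  infer_instance

end SerreQuotient

/-! ### Acyclic objects of the section functor. -/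

section SerreQuotient

open ObjectProperty

lemma isIso_of_isIso₁₂ {C : Type*} [Category C] [Abelian C] {S T : ShortComplex C} (φ : S ⟶ T)
    (hS : S.ShortExact) (hT : T.ShortExact) [IsIso φ.τ₁] [IsIso φ.τ₂] : IsIso φ.τ₃ := by
  have := hS.epi_g
  have := hT.epi_g
  have := hT.mono_f
  have h : IsColimit (CokernelCofork.ofπ S.g S.zero) := hS.exact.gIsCokernel
  let d : T.X₃ ⟶ S.X₃ := hT.exact.desc (inv φ.τ₂ ≫ S.g) (by
    rw [← cancel_epi φ.τ₁, φ.comm₁₂_assoc]; simp)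
  have hd : T.g ≫ d = inv φ.τ₂ ≫ S.g := hT.exact.g_desc _ _
  refine ⟨d, ?_, ?_⟩
  · rw [← cancel_epi S.g, ← φ.comm₂₃_assoc, hd]; simp
  · rw [← cancel_epi T.g, reassoc_of% hd, ← φ.comm₂₃]; simp

variable {C : Type*} [Category C] [Abelian C] {P : ObjectProperty C} [P.IsSerreClass]
  {D : Type*} [Category D] [Abelian D] {L : C ⥤ D} [L.IsLocalization P.isoModSerre]
  {V : ℕ → ObjectProperty C} (hV : LocalVanishing P V) {Γ : D ⥤ C} (adj : L ⊣ Γ)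
  [IsIso adj.counit] (hΓ : ∀ Y, V 0 (Γ.obj Y) ∧ V 1 (Γ.obj Y))

lemma isIso_unit_of_isLocal {M : C} (hM : P.isoModSerre.isLocal M) : IsIso (adj.unit.app M) := by
  refine isIso_of_yoneda_map_bijective _ fun X => ?_
  have h := bijective_map_of_isLocal P L hM X
  have := (adj.homEquiv X (L.obj M)).bijective.comp h
  have e : (fun f : X ⟶ M => f ≫ adj.unit.app M) =
      ⇑(adj.homEquiv X (L.obj M)) ∘ fun f => L.map f :=
    funext fun f => (adj.unit.naturality f).trans (adj.homEquiv_unit X (L.obj M) (L.map f)).symm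
  rwa [← e] at this

include adj in
lemma isIso_of_isLocal {M N : C} (hM : P.isoModSerre.isLocal M) (hN : P.isoModSerre.isLocal N)
    (f : M ⟶ N) [IsIso (L.map f)] : IsIso f := by
  have := isIso_unit_of_isLocal adj hM
  have := isIso_unit_of_isLocal adj hN
  have h := adj.unit.naturality f
  dsimp at h
  have : IsIso (f ≫ adj.unit.app N) := by rw [h]; infer_instance
  exact IsIso.of_isIso_comp_right f (adj.unit.app N)

variable (V) in
/-- The objects on which all higher derived functors of `Γ` vanish. -/
def localAcyclic (Γ : D ⥤ C) : ObjectProperty D := fun X => ∀ i, V i (Γ.obj X)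

variable [L.Additive] [PreservesFiniteLimits L] [PreservesFiniteColimits L] [Γ.Additive]

include hV in
lemma localAcyclic_isStableUnderRetracts : (localAcyclic V Γ).IsStableUnderRetracts where
  of_retract r h i := hV.retract (Γ.map r.i) (Γ.map r.r) (by
    rw [← Γ.map_comp, r.retract, CategoryTheory.Functor.map_id]) (h i)

include hV in
lemma localAcyclic_biprod (X Y : D) (hX : localAcyclic V Γ X) (hY : localAcyclic V Γ Y) :
    localAcyclic V Γ (X ⊞ Y) := fun i =>
  hV.ext ((ShortComplex.Splitting.ofHasBinaryBiproduct X Y).map Γ).shortExact (hX i) (hY i)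

include adj in
lemma mono_rightAdjoint_map {X Y : D} (f : X ⟶ Y) [Mono f] : Mono (Γ.map f) := by
  have : PreservesLimitsOfSize.{0, 0} Γ := adj.rightAdjoint_preservesLimits
  infer_instance

include adj in
/-- The canonical map from the cokernel of `Γ X ⟶ Γ Y` to `Γ Z` is inverted by the localization. -/
lemma isIso_map_cokernelDesc {S : ShortComplex D} (hS : S.ShortExact) :
    IsIso (L.map (cokernel.desc (Γ.map S.f) (Γ.map S.g) (by rw [← Γ.map_comp, S.zero, Γ.map_zero]))) := by
  have := hS.mono_f
  have := mono_rightAdjoint_map adj S.f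
  set c := cokernel.desc (Γ.map S.f) (Γ.map S.g) (by rw [← Γ.map_comp, S.zero, Γ.map_zero])
  have h₁ := (shortExact_cokernel (Γ.map S.f)).map_of_exact L
  have hc : cokernel.π (Γ.map S.f) ≫ c = Γ.map S.g := cokernel.π_desc _ _ _
  let φ : (ShortComplex.mk (Γ.map S.f) _ (cokernel.condition _)).map L ⟶ S :=
    { τ₁ := adj.counit.app _
      τ₂ := adj.counit.app _
      τ₃ := L.map c ≫ adj.counit.app _
      comm₁₂ := (adj.counit.naturality S.f).symm
      comm₂₃ := by
        have : L.map (cokernel.π (Γ.map S.f)) ≫ L.map c = L.map (Γ.map S.g) := by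
          rw [← L.map_comp, hc]
        exact (adj.counit.naturality S.g).symm.trans
          ((congrArg (· ≫ adj.counit.app _) this.symm).trans (Category.assoc _ _ _)) }
  have : IsIso φ.τ₁ := inferInstanceAs (IsIso (adj.counit.app _))
  have : IsIso φ.τ₂ := inferInstanceAs (IsIso (adj.counit.app _))
  have : IsIso (L.map c ≫ adj.counit.app S.X₃) := isIso_of_isIso₁₂ φ h₁ hS
  exact IsIso.of_isIso_comp_right _ (adj.counit.app _)

include hV hΓ adj in
-- The cokernel of `Γ S.X₁ ⟶ Γ S.X₂` has no local cohomology, hence is local. Its comparison with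
-- the local object `Γ S.X₃` becomes invertible under `L`, and so it is already invertible.
lemma localAcyclic_of_shortExact (S : ShortComplex D) (hS : S.ShortExact)
    (h₁ : localAcyclic V Γ S.X₁) (h₂ : localAcyclic V Γ S.X₂) :
    localAcyclic V Γ S.X₃ ∧ Epi (Γ.map S.g) := by
  have := hS.mono_f
  have := mono_rightAdjoint_map adj S.f
  have hL := isIso_map_cokernelDesc adj hS
  have hC : ∀ i, V i (cokernel (Γ.map S.f)) := fun i =>
    hV.quot (shortExact_cokernel (Γ.map S.f)) (h₂ i) (h₁ _)
  have := isIso_of_isLocal adj (hV.isLocal (hC 0) (hC 1))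
    (hV.isLocal (hΓ S.X₃).1 (hΓ S.X₃).2) (cokernel.desc (Γ.map S.f) (Γ.map S.g) _)
  refine ⟨fun i => hV.of_iso (asIso (cokernel.desc (Γ.map S.f) (Γ.map S.g) _)) (hC i), ?_⟩
  rw [← cokernel.π_desc (Γ.map S.f) (Γ.map S.g) (by rw [← Γ.map_comp, S.zero, Γ.map_zero])]
  infer_instance

include hV hΓ adj in
-- The index `i` of `V` corresponds to the derived functor of `Γ` in degree `i - 1`, and `V 0`, `V
-- 1` hold automatically for `Γ X`. Vanishing from `n + 2` on therefore means cohomological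
-- dimension at most `n`, and each cosyzygy lowers it by one.
lemma codimLE_localAcyclic (n : ℕ) (X : D) (hX : ∀ i, n + 2 ≤ i → V i (Γ.obj X)) :
    codimLE (localAcyclic V Γ) n X := by
  induction n generalizing X with
  | zero =>
    intro i
    match i with
    | 0 => exact (hΓ X).1
    | 1 => exact (hΓ X).2
    | i + 2 => exact hX _ (by lia)
  | succ n ih =>
    rintro S hS rfl h₂
    refine ih _ fun i hi => ?_
    obtain ⟨i, rfl⟩ : ∃ j, i = j + 1 := ⟨i - 1, by lia⟩
    have := hS.mono_f
    have := mono_rightAdjoint_map adj S.f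
    exact hV.of_isoModSerre _ ((SerreClassLocalization.isIso_map_iff L P _).1 (isIso_map_cokernelDesc adj hS))
      (hV.quot (shortExact_cokernel (Γ.map S.f)) (h₂ _) (hX _ (by lia)))

include hV adj hΓ in
-- A torsion-free injective `E` containing `Γ X` is local, so `E` is `Γ` of `L E`, and the exact
-- functor `L` carries the embedding to one of `X`.
lemma exists_mono_localAcyclic (X : D) : ∃ (Y : D) (i : X ⟶ Y), Mono i ∧ localAcyclic V Γ Y := by
  obtain ⟨E, f, hf, hE, hE'⟩ := hV.embed _ (hΓ X).1
  have hE'' := hV.injective hE hE'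
  have := isIso_unit_of_isLocal adj (hV.isLocal (hE'' 0) (hE'' 1))
  exact ⟨L.obj E, inv (adj.counit.app X) ≫ L.map f, mono_comp _ _,
    fun i => hV.of_iso (asIso (adj.unit.app E)) (hE'' i)⟩

variable [HasCoproducts.{u} C] [HasCoproducts.{u} D]
  (hcop : ∀ (J : Type u) (X : J → C), (∀ j i, V i (X j)) → ∀ i, V i (∐ X))

include hV hΓ hcop adj in
-- The comparison is always invertible after `L`, which preserves coproducts. For acyclic summands
-- the coproduct of the `Γ (X j)` is again local by `hcop`, and between local objects `L` reflects
-- isomorphisms.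
lemma isIso_sigmaComparison (J : Type u) (X : J → D) (hX : ∀ j, localAcyclic V Γ (X j)) :
    IsIso (sigmaComparison Γ X) := by
  have : PreservesColimitsOfSize.{u, u} L := adj.leftAdjoint_preservesColimits
  have hC := hcop J (fun j => Γ.obj (X j)) hX
  have h : sigmaComparison L (fun j => Γ.obj (X j)) ≫ L.map (sigmaComparison Γ X) ≫
      adj.counit.app _ = Limits.Sigma.map (fun j => adj.counit.app (X j)) := by
    refine Limits.Sigma.hom_ext _ _ fun j => ?_
    rw [ι_comp_sigmaComparison_assoc, ← L.map_comp_assoc, ι_comp_sigmaComparison, Sigma.ι_map]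
    exact adj.counit.naturality _
  have : IsIso (L.map (sigmaComparison Γ X)) := by
    have h1 : IsIso (sigmaComparison L (fun j => Γ.obj (X j)) ≫ L.map (sigmaComparison Γ X) ≫
      adj.counit.app _) := by rw [h]; infer_instance
    have h2 := IsIso.of_isIso_comp_left (sigmaComparison L (fun j => Γ.obj (X j))) (L.map (sigmaComparison Γ X) ≫
      adj.counit.app _)
    exact IsIso.of_isIso_comp_right _ (adj.counit.app _)
  exact isIso_of_isLocal adj (hV.isLocal (hC 0) (hC 1))
    (hV.isLocal (hΓ _).1 (hΓ _).2) _

include adj in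
-- Coproducts in `D` are obtained by applying `Γ` termwise, taking the coproduct in `C` and applying
-- `L`; all three operations are left exact.
lemma hasExactCoproducts_of_localization (J : Type u) [HasExactColimitsOfShape (Discrete J) C] :
    HasExactColimitsOfShape (Discrete J) D where
  preservesFiniteLimits := by
    have : PreservesColimitsOfSize.{u, u} L := adj.leftAdjoint_preservesColimits
    have : PreservesLimitsOfSize.{0, 0} Γ := adj.rightAdjoint_preservesLimits
    have : PreservesFiniteLimits Γ := PreservesLimitsOfSize.preservesFiniteLimits Γ
    have : PreservesFiniteLimits (colim (J := Discrete J) (C := C)) :=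
      HasExactColimitsOfShape.preservesFiniteLimits
    let e : (Functor.whiskeringRight (Discrete J) D C).obj Γ ⋙ colim ⋙ L ≅ colim :=
      Functor.isoWhiskerLeft _ (preservesColimitNatIso L) ≪≫
        Functor.isoWhiskerRight ((Functor.whiskeringRight (Discrete J) D D).mapIso
          (asIso adj.counit)) colim
    have : PreservesFiniteLimits ((Functor.whiskeringRight (Discrete J) D C).obj Γ) :=
      ⟨fun K _ _ => inferInstance⟩
    exact preservesFiniteLimits_of_natIso e

end SerreQuotient

/-! ### The derived section functor of a localization. -/

section Main

variable {C : Type*} [Category C] [Abelian C] (P : ObjectProperty C) [P.IsSerreClass]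
  {D : Type*} [Category D] [Abelian D] (L : C ⥤ D) [L.IsLocalization P.isoModSerre]
  [L.Additive] [PreservesFiniteLimits L] [PreservesFiniteColimits L]
  [HasDerivedCategory.{w} D] [HasDerivedCategory.{w₁} C]
  [HasCoproducts.{u} C] [∀ J : Type u, HasExactColimitsOfShape (Discrete J) C]

/-- The derived functors of the localization by a Serre class with finite local cohomological
dimension. -/
theorem exists_rightDerived_localization {V : ℕ → ObjectProperty C} (hV : LocalVanishing P V)
    (hcop : ∀ (J : Type u) (X : J → C), (∀ j i, V i (X j)) → ∀ i, V i (∐ X))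
    (N : ℕ) (hN : ∀ M i, N ≤ i → V i M)
    {ι : Type u} (S : ι → C) (hS : ∀ i, Projective (S i)) (hfin : ∀ i, IsFinitary.{u} (S i))
    (hgen : ∀ M : C, (∀ i (f : S i ⟶ M), f = 0) → IsZero M) :
    HasCoproducts.{u} (DerivedCategory D) ∧
    (∃ (Γ : D ⥤ C) (_ : L ⊣ Γ) (_ : Γ.Additive)
      (RΓ : DerivedCategory D ⥤ DerivedCategory C)
      (α : Γ.mapHomologicalComplex (ComplexShape.up ℤ) ⋙ DerivedCategory.Q ⟶
        DerivedCategory.Q ⋙ RΓ)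
      (_ : RΓ.IsRightDerivedFunctor α (HomologicalComplex.quasiIso _ (ComplexShape.up ℤ))),
      Nonempty (L.mapDerivedCategory ⊣ RΓ) ∧ PreservesColimitsOfSize.{u, u} RΓ) ∧
    IsCompactlyGenerated.{u} (DerivedCategory D) := by
  obtain ⟨Γ, adj, hadj, hΓ⟩ := exists_rightAdjoint_localization P L hV
  have : Γ.Additive := adj.right_adjoint_additive
  let hff := adj.fullyFaithfulROfIsIsoCounit
  have := hff.full
  have := hff.faithful
  have : Reflective Γ := { L := L, adj := adj }
  have (J : Type u) : HasColimitsOfShape (Discrete J) D := hasColimitsOfShape_of_reflective Γ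
  have hD : HasCoproducts.{u} D := this
  have (J : Type u) : HasExactColimitsOfShape (Discrete J) D :=
    hasExactCoproducts_of_localization (Γ := Γ) adj J
  have := localAcyclic_isStableUnderRetracts (Γ := Γ) hV
  have hσ := fun (J : Type u) (X : J → D) (hX : ∀ j, localAcyclic V Γ (X j)) =>
    isIso_sigmaComparison hV adj hΓ hcop J X hX
  obtain ⟨h₁, h₂⟩ := exists_right_derived_adjoint_and_isCompactlyGenerated adj (localAcyclic V Γ)
    (localAcyclic_biprod hV) (exists_mono_localAcyclic hV adj hΓ)
    (localAcyclic_of_shortExact hV adj hΓ) N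
    (fun X => codimLE_localAcyclic hV adj hΓ N X fun i hi => hN _ _ (by lia))
    (fun J X hX i => by
      have := hσ J X hX
      exact hV.of_iso (asIso (sigmaComparison Γ X)) (hcop J _ hX i))
    (fun J X hX => by
      have := hσ J X hX
      exact PreservesCoproduct.of_iso_comparison Γ X) S hS hfin hgen
  exact ⟨h₂.1, ⟨Γ, adj, inferInstance, h₁⟩, h₂⟩

end Main

lemma exists_dependent_seq {α : ℕ → Type*} (P : ∀ j, α j → Prop)
    (r : ∀ j, α j → α (j + 1) → Prop) (h₀ : ∃ a, P 0 a)
    (h : ∀ j a, P j a → ∃ a', P (j + 1) a' ∧ r j a a') :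
    ∃ f : ∀ j, α j, (∀ j, P j (f j)) ∧ ∀ j, r j (f j) (f (j + 1)) := by
  choose a₀ h₀ using h₀
  choose s hs using h
  let F : ∀ j, { a : α j // P j a } := fun j =>
    Nat.rec ⟨a₀, h₀⟩ (fun j a => ⟨s j a.1 a.2, (hs j a.1 a.2).1⟩) j
  exact ⟨fun j => (F j).1, fun j => (F j).2, fun j => (hs j (F j).1 (F j).2).2⟩

/-! ### Columns with entries in a module. -/

section Columns

variable {S : Type*} [Ring S] {B : Type*} [AddCommGroup B] [Module S B]
  {ι κ τ : Type*} [Fintype κ] [Fintype τ]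

/-- The product of a matrix and a column with entries in a module. -/
def mulCol (D : Matrix ι κ S) (x : κ → B) : ι → B := fun p => ∑ q, D p q • x q

lemma mulCol_add (D : Matrix ι κ S) (x y : κ → B) : mulCol D (x + y) = mulCol D x + mulCol D y := by
  ext p; simp [mulCol, Finset.sum_add_distrib]

lemma mulCol_sub (D : Matrix ι κ S) (x y : κ → B) : mulCol D (x - y) = mulCol D x - mulCol D y := by
  ext p; simp [mulCol, Finset.sum_sub_distrib, smul_sub]

lemma mulCol_zero (D : Matrix ι κ S) : mulCol D (0 : κ → B) = 0 := by
  ext p; simp [mulCol]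

lemma zero_mulCol (x : κ → B) : mulCol (0 : Matrix ι κ S) x = 0 := by
  ext p; simp [mulCol]

lemma add_mulCol (D E : Matrix ι κ S) (x : κ → B) : mulCol (D + E) x = mulCol D x + mulCol E x := by
  ext p; simp [mulCol, Finset.sum_add_distrib, add_smul]

lemma mulCol_mulCol (D : Matrix ι κ S) (E : Matrix κ τ S) (x : τ → B) :
    mulCol D (mulCol E x) = mulCol (D * E) x := by
  ext p
  simp only [mulCol, Matrix.mul_apply, Finset.smul_sum, Finset.sum_smul, mul_smul]
  exact Finset.sum_comm

lemma map_mulCol {B' : Type*} [AddCommGroup B'] [Module S B'] (f : B →ₗ[S] B') (D : Matrix ι κ S)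
    (x : κ → B) : mulCol D (f ∘ x) = f ∘ mulCol D x := by
  ext p; simp [mulCol]

end Columns

/-! ### Bigraded commutative algebra -/

section Graded

variable {R : Type*} [CommRing R]

variable (R) in
/-- A family of subgroups of a commutative ring, indexed by pairs (weight, degree), with projections
which are linear over homogeneous elements. -/
structure GrRing where
  deg : ℤ × ℤ → AddSubgroup R
  proj : ℤ × ℤ → R →+ R
  one_mem : 1 ∈ deg 0
  mul_mem : ∀ {γ δ r s}, r ∈ deg γ → s ∈ deg δ → r * s ∈ deg (γ + δ)
  proj_mem : ∀ γ r, proj γ r ∈ deg γ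
  proj_mul : ∀ γ δ r {s}, s ∈ deg δ → proj γ (r * s) = proj (γ - δ) r * s
  proj_of_mem : ∀ {γ r}, r ∈ deg γ → proj γ r = r

/-- A module with homogeneous components over a bigraded ring. -/
structure GrMod (𝒢 : GrRing R) (B : Type*) [AddCommGroup B] [Module R B] where
  deg : ℤ × ℤ → AddSubgroup B
  proj : ℤ × ℤ → B →+ B
  proj_smul : ∀ γ δ r {x}, x ∈ deg δ → proj γ (r • x) = 𝒢.proj (γ - δ) r • x
  proj_of_mem : ∀ {γ x}, x ∈ deg γ → proj γ x = x

variable {𝒢 : GrRing R} {B : Type*} [AddCommGroup B] [Module R B]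

/-- A homogeneous submodule. -/
structure GrSub (ℬ : GrMod 𝒢 B) where
  part : ℤ × ℤ → AddSubgroup B
  le : ∀ γ, part γ ≤ ℬ.deg γ
  smul_mem : ∀ {γ δ r x}, r ∈ 𝒢.deg δ → x ∈ part γ → r • x ∈ part (γ + δ)

variable {ℬ : GrMod 𝒢 B}

lemma GrRing.pow_mem {γ r} (h : r ∈ 𝒢.deg γ) (t : ℕ) : r ^ t ∈ 𝒢.deg (t • γ) := by
  induction t with
  | zero => simpa using 𝒢.one_mem
  | succ t ih => rw [pow_succ, succ_nsmul]; exact 𝒢.mul_mem ih h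

lemma GrMod.exists_coeff {ι : Type*} [Fintype ι] (δ : ι → ℤ × ℤ) (x : ι → B)
    (hx : ∀ s, x s ∈ ℬ.deg (δ s)) {γ y} (hy : y ∈ ℬ.deg γ) (h : y ∈ Submodule.span R (Set.range x)) :
    ∃ c : ι → R, (∀ s, c s ∈ 𝒢.deg (γ - δ s)) ∧ y = ∑ s, c s • x s := by
  obtain ⟨c, rfl⟩ := (Submodule.mem_span_range_iff_exists_fun R).1 h
  refine ⟨fun s => 𝒢.proj (γ - δ s) (c s), fun s => 𝒢.proj_mem _ _, ?_⟩
  rw [← ℬ.proj_of_mem hy, map_sum]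
  exact Finset.sum_congr rfl fun s _ => ℬ.proj_smul _ _ _ (hx s)

lemma GrRing.exists_coeff {ι : Type*} [Fintype ι] (δ : ι → ℤ × ℤ) (x : ι → R)
    (hx : ∀ s, x s ∈ 𝒢.deg (δ s)) {γ y} (hy : y ∈ 𝒢.deg γ) (h : y ∈ Ideal.span (Set.range x)) :
    ∃ c : ι → R, (∀ s, c s ∈ 𝒢.deg (γ - δ s)) ∧ y = ∑ s, c s * x s :=
  GrMod.exists_coeff (ℬ := ⟨𝒢.deg, 𝒢.proj, 𝒢.proj_mul, 𝒢.proj_of_mem⟩) δ x hx hy h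

lemma GrSub.exists_generators [IsNoetherian R B] (Λ : GrSub ℬ) :
    ∃ (m : ℕ) (δ : Fin m → ℤ × ℤ) (x : Fin m → B), (∀ s, x s ∈ Λ.part (δ s)) ∧
      ∀ γ, ∀ y ∈ Λ.part γ, ∃ c : Fin m → R, (∀ s, c s ∈ 𝒢.deg (γ - δ s)) ∧ y = ∑ s, c s • x s := by
  have hfg : (Submodule.span R {x | ∃ γ, x ∈ Λ.part γ}).FG := IsNoetherian.noetherian _
  obtain ⟨t, ht, hspan⟩ := Submodule.fg_span_iff_fg_span_finset_subset _ |>.1 hfg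
  choose δ hδ using fun s : Fin t.card => ht (t.equivFin.symm s).2
  refine ⟨t.card, δ, fun s => t.equivFin.symm s, hδ, fun γ y hy => ?_⟩
  refine GrMod.exists_coeff (ℬ := ℬ) δ _ (fun s => Λ.le _ (hδ s)) (Λ.le _ hy) ?_
  have : Set.range (fun s => (t.equivFin.symm s : B)) = t := by
    ext z
    exact ⟨by rintro ⟨s, rfl⟩; exact (t.equivFin.symm s).2,
      fun hz => ⟨t.equivFin ⟨z, hz⟩, by simp⟩⟩
  rw [this, ← hspan]
  exact Submodule.subset_span ⟨γ, hy⟩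

section Generators

variable {r : ℕ} {f : Fin r → R} {φ : Fin r → ℤ × ℤ} (hf : ∀ j, f j ∈ 𝒢.deg (φ j))
  (hgen : ∀ γ, 1 ≤ γ.1 → ∀ c ∈ 𝒢.deg γ, c ∈ Ideal.span (Set.range f))

include hf hgen

/-- Extracting one generator costs at most the maximal weight `N` of the `f j`, so an element of
sufficiently large weight allows `q` extractions. -/
lemma exists_mem_pow (q : ℕ) :
    ∃ n : ℤ, ∀ γ, n ≤ γ.1 → ∀ c ∈ 𝒢.deg γ, c ∈ Ideal.span (Set.range f) ^ q := by
  induction q with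
  | zero => exact ⟨0, fun γ _ c _ => by simp⟩
  | succ q ih =>
    obtain ⟨n, hn⟩ := ih
    obtain ⟨N, hN⟩ := Finset.exists_le (Finset.univ.image fun j => (φ j).1)
    refine ⟨max 1 (n + N), fun γ hγ c hc => ?_⟩
    obtain ⟨a, ha, rfl⟩ := GrRing.exists_coeff φ f hf hc (hgen γ (by lia) c hc)
    rw [pow_succ]
    refine Ideal.sum_mem _ fun j _ => Ideal.mul_mem_mul (hn _ ?_ _ (ha j))
      (Ideal.subset_span ⟨j, rfl⟩)
    have := hN _ (Finset.mem_image_of_mem _ (Finset.mem_univ j))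
    simp only [Prod.fst_sub]
    lia

/-- An element killed by powers of the generators is killed in large weights. -/
lemma exists_weight_mem_span_pow (t : ℕ) :
    ∃ n : ℤ, ∀ γ, n ≤ γ.1 → ∀ c ∈ 𝒢.deg γ, ∃ a : Fin r → R,
      (∀ j, a j ∈ 𝒢.deg (γ - t • φ j)) ∧ c = ∑ j, a j * f j ^ t := by
  have hle : Ideal.span (Set.range f) ≤ (Ideal.span (Set.range fun j => f j ^ t)).radical := by
    rw [Ideal.span_le]
    rintro _ ⟨j, rfl⟩
    exact ⟨t, Ideal.subset_span ⟨j, rfl⟩⟩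
  obtain ⟨q, hq⟩ := Ideal.exists_pow_le_of_le_radical_of_fg hle
    (Submodule.fg_span (Set.finite_range f))
  obtain ⟨n, hn⟩ := exists_mem_pow hf hgen q
  exact ⟨n, fun γ hγ c hc => GrRing.exists_coeff (fun j => t • φ j) _
    (fun j => 𝒢.pow_mem (hf j) t) hc (hq (hn γ hγ c hc))⟩

/-- Finitely many elements generate `Λ'`, and coefficients of large weight carry each of them into
`Λ`, as such coefficients lie in the ideal of high powers of the `f j`. In large weights only such
coefficients occur. -/
lemma GrSub.exists_part_le_of_torsion [IsNoetherian R B] (Λ Λ' : GrSub ℬ)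
    (h : ∀ j γ, ∀ x ∈ Λ'.part γ, ∃ t : ℕ, f j ^ t • x ∈ Λ.part (γ + t • φ j)) :
    ∃ k : ℤ, ∀ γ, k ≤ γ.1 → Λ'.part γ ≤ Λ.part γ := by
  have key : ∀ γ, ∀ x ∈ Λ'.part γ, ∃ n : ℤ, ∀ m, n ≤ m.1 → ∀ c ∈ 𝒢.deg m,
      c • x ∈ Λ.part (γ + m) := by
    intro γ x hx
    choose t ht using fun j => h j γ x hx
    obtain ⟨T, hT⟩ := Finset.exists_le (Finset.univ.image t)
    have hT' : ∀ j, f j ^ T • x ∈ Λ.part (γ + T • φ j) := fun j => by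
      obtain ⟨d, hd⟩ := Nat.exists_eq_add_of_le (hT _ (Finset.mem_image_of_mem t (Finset.mem_univ j)))
      have := Λ.smul_mem (𝒢.pow_mem (hf j) d) (ht j)
      rwa [smul_smul, ← pow_add, add_assoc, ← add_smul, add_comm d, ← hd] at this
    obtain ⟨n, hn⟩ := exists_weight_mem_span_pow hf hgen T
    refine ⟨n, fun m hm c hc => ?_⟩
    obtain ⟨a, ha, rfl⟩ := hn m hm c hc
    rw [Finset.sum_smul]
    refine sum_mem fun j _ => ?_
    have := Λ.smul_mem (ha j) (hT' j)
    rw [mul_smul]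
    convert this using 2
    abel
  obtain ⟨N, δ, x, hx, hspan⟩ := Λ'.exists_generators
  choose n hn using fun s => key _ _ (hx s)
  obtain ⟨T, hT⟩ := Finset.exists_le (Finset.univ.image fun s => n s + (δ s).1)
  refine ⟨T, fun γ hγ y hy => ?_⟩
  obtain ⟨c, hc, rfl⟩ := hspan γ y hy
  refine sum_mem fun s _ => ?_
  have h1 := hT _ (Finset.mem_image_of_mem (fun s => n s + (δ s).1) (Finset.mem_univ s))
  have := hn s _ (by simp only [Prod.fst_sub]; lia) _ (hc s)
  rwa [add_sub_cancel] at this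

end Generators

/-- A complex of free graded modules, written by matrices acting on rows, which is exact in
weights `≥ n`, and whose terms are generated in weights `≥ n` except for the second one. -/
structure GrCpx (𝒢 : GrRing R) (n : ℤ) where
  I : ℕ → ℕ
  b : ∀ j, Fin (I j) → ℤ × ℤ
  D : ∀ j, Matrix (Fin (I (j + 1))) (Fin (I j)) R
  I_zero : I 0 = 0
  nonneg : ∀ j p, 0 ≤ (b j p).1
  le_weight : ∀ j p, n ≤ (b (j + 2) p).1
  D_mem : ∀ j p q, D j p q ∈ 𝒢.deg (b (j + 1) p - b j q)
  comp : ∀ j, D (j + 1) * D j = 0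
  exact : ∀ j γ, n ≤ γ.1 → ∀ x : Fin (I (j + 1)) → R, (∀ p, x p ∈ 𝒢.deg (γ - b _ p)) →
    Matrix.vecMul x (D j) = 0 → ∃ y : Fin (I (j + 2)) → R, (∀ p, y p ∈ 𝒢.deg (γ - b _ p)) ∧
      x = Matrix.vecMul y (D (j + 1))

/-- Multiplication by an element of large weight is homotopic to zero. -/
lemma GrCpx.exists_homotopy {n : ℤ} (K : GrCpx 𝒢 n) {γ c} (hγ : n ≤ γ.1) (hc : c ∈ 𝒢.deg γ) :
    ∃ H : ∀ j, Matrix (Fin (K.I j)) (Fin (K.I (j + 1))) R,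
      (∀ j p q, H j p q ∈ 𝒢.deg (γ + K.b j p - K.b _ q)) ∧
      ∀ j, H (j + 1) * K.D (j + 1) + K.D j * H j = c • (1 : Matrix _ _ R) := by
  have hI : IsEmpty (Fin (K.I 0)) := by rw [K.I_zero]; infer_instance
  -- The homotopy is built from position zero, where the module is zero. The invariant `D H D = c D`
  -- makes the rows of `c - D H` cycles; their weight is at least `n`, since generators have
  -- nonnegative weight, so exactness lifts them.
  have key : ∀ (j : ℕ) (H : Matrix (Fin (K.I j)) (Fin (K.I (j + 1))) R),
      ((∀ p q, H p q ∈ 𝒢.deg (γ + K.b j p - K.b _ q)) ∧ K.D j * (H * K.D j) = c • K.D j) →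
      ∃ H' : Matrix (Fin (K.I (j + 1))) (Fin (K.I (j + 2))) R,
        ((∀ p q, H' p q ∈ 𝒢.deg (γ + K.b _ p - K.b _ q)) ∧
          K.D (j + 1) * (H' * K.D (j + 1)) = c • K.D (j + 1)) ∧
        H' * K.D (j + 1) + K.D j * H = c • (1 : Matrix _ _ R) := by
    rintro j H ⟨hH, hHD⟩
    have hX : (c • (1 : Matrix _ _ R) - K.D j * H) * K.D j = 0 := by
      rw [Matrix.sub_mul, Matrix.mul_assoc, hHD, Matrix.smul_mul, Matrix.one_mul, sub_self]
    have hrow : ∀ p, ∃ y : Fin (K.I (j + 2)) → R,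
        (∀ q, y q ∈ 𝒢.deg (γ + K.b _ p - K.b _ q)) ∧
        (c • (1 : Matrix (Fin (K.I (j + 1))) (Fin (K.I (j + 1))) R) - K.D j * H) p = Matrix.vecMul y (K.D (j + 1)) := fun p => by
      refine K.exact j (γ + K.b _ p) ?_ _ (fun q => ?_) ?_
      · have := K.nonneg _ p
        simp only [Prod.fst_add]
        lia
      · rw [Matrix.sub_apply, Matrix.mul_apply]
        refine sub_mem ?_ (sum_mem fun s _ => ?_)
        · rw [Matrix.smul_apply, Matrix.one_apply]
          split_ifs with h
          · subst h; simpa using hc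
          · simp
        · have := 𝒢.mul_mem (K.D_mem j p s) (hH s q)
          rwa [show K.b (j + 1) p - K.b j s + (γ + K.b j s - K.b _ q) = γ + K.b _ p - K.b _ q by abel]
            at this
      · exact congrFun hX p
    choose H' hH' hrow using (show ∃ H' : Matrix (Fin (K.I (j + 1))) (Fin (K.I (j + 2))) R, ∀ p,
        (∀ q, H' p q ∈ 𝒢.deg (γ + K.b _ p - K.b _ q)) ∧
        (c • (1 : Matrix (Fin (K.I (j + 1))) (Fin (K.I (j + 1))) R) - K.D j * H) p =
          Matrix.vecMul (H' p) (K.D (j + 1)) from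
      ⟨fun p => (hrow p).choose, fun p => (hrow p).choose_spec⟩)
    have h1 : H' * K.D (j + 1) = c • (1 : Matrix _ _ R) - K.D j * H := by
      ext p q
      exact (congrFun (hrow p) q).symm
    refine ⟨H', ⟨hH', ?_⟩, by rw [h1, sub_add_cancel]⟩
    rw [h1, Matrix.mul_sub, ← Matrix.mul_assoc, K.comp, Matrix.zero_mul, sub_zero, Matrix.mul_smul,
      Matrix.mul_one]
  obtain ⟨H, hH, hrel⟩ := exists_dependent_seq _ _
    ⟨0, fun p => isEmptyElim p, by ext p q; exact isEmptyElim q⟩ key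
  exact ⟨H, fun j => (hH j).1, hrel⟩

/-- The columns with entries in `Λ' / Λ` have no cohomology in position `i`, in large levels. -/
def ColVanish (Λ Λ' : GrSub ℬ) (i : ℕ) : Prop :=
  ∃ n₀ : ℤ, ∀ n, n₀ ≤ n → ∀ (K : GrCpx 𝒢 n) (γ : ℤ × ℤ), 0 ≤ γ.1 → ∀ x : Fin (K.I (i + 1)) → B,
    (∀ p, x p ∈ Λ'.part (K.b _ p + γ)) →
    (∀ p, mulCol (K.D (i + 1)) x p ∈ Λ.part (K.b _ p + γ)) →
    ∃ y : Fin (K.I i) → B, (∀ p, y p ∈ Λ'.part (K.b _ p + γ)) ∧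
      ∀ p, x p - mulCol (K.D i) y p ∈ Λ.part (K.b _ p + γ)

lemma GrSub.mulCol_mem (Λ : GrSub ℬ) {n : ℤ} (K : GrCpx 𝒢 n) {j : ℕ} {γ : ℤ × ℤ}
    {x : Fin (K.I j) → B} (hx : ∀ p, x p ∈ Λ.part (K.b _ p + γ)) (q : Fin (K.I (j + 1))) :
    mulCol (K.D j) x q ∈ Λ.part (K.b _ q + γ) :=
  sum_mem fun p _ => by
    have := Λ.smul_mem (K.D_mem j q p) (hx p)
    rwa [show K.b j p + γ + (K.b _ q - K.b j p) = K.b _ q + γ by abel] at this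

/-- Vanishing passes to the middle term of the extension of `Λ'' / Λ'` by `Λ' / Λ`. -/
lemma ColVanish.trans {Λ Λ' Λ'' : GrSub ℬ} {i : ℕ} (h : ∀ γ, Λ.part γ ≤ Λ'.part γ)
    (h' : ∀ γ, Λ'.part γ ≤ Λ''.part γ) (H : ColVanish Λ Λ' i) (H' : ColVanish Λ' Λ'' i) :
    ColVanish Λ Λ'' i := by
  obtain ⟨n₁, h₁⟩ := H
  obtain ⟨n₂, h₂⟩ := H'
  refine ⟨max n₁ n₂, fun n hn K γ hγ x hx hDx => ?_⟩
  obtain ⟨y, hy, hxy⟩ := h₂ n (by lia) K γ hγ x hx fun p => h _ (hDx p)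
  obtain ⟨z, hz, hxz⟩ := h₁ n (by lia) K γ hγ (x - mulCol (K.D i) y) hxy fun p => by
    rw [mulCol_sub, mulCol_mulCol, K.comp, zero_mulCol, sub_zero]
    exact hDx p
  refine ⟨y + z, fun p => add_mem (hy p) (h' _ (hz p)), fun p => ?_⟩
  rw [mulCol_add, Pi.add_apply, ← sub_sub]
  exact hxz p

/-- The submodule of the elements of `Λ'` which are sent to `Λ` by a power of `f`. -/
def GrSub.saturation (Λ Λ' : GrSub ℬ) {f : R} {φ : ℤ × ℤ} (hf : f ∈ 𝒢.deg φ) : GrSub ℬ where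
  part γ :=
    { carrier := {x | x ∈ Λ'.part γ ∧ ∃ t : ℕ, f ^ t • x ∈ Λ.part (γ + t • φ)}
      zero_mem' := ⟨zero_mem _, 0, by simp [zero_mem]⟩
      add_mem' := by
        rintro x y ⟨hx, s, hs⟩ ⟨hy, t, ht⟩
        refine ⟨add_mem hx hy, s + t, ?_⟩
        rw [smul_add]
        refine add_mem ?_ ?_
        · have := Λ.smul_mem (𝒢.pow_mem hf t) hs
          rwa [smul_smul, ← pow_add, add_assoc, ← add_smul, add_comm t] at this
        · have := Λ.smul_mem (𝒢.pow_mem hf s) ht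
          rwa [smul_smul, ← pow_add, add_assoc, ← add_smul, add_comm t] at this
      neg_mem' := by
        rintro x ⟨hx, s, hs⟩
        exact ⟨neg_mem hx, s, by rw [smul_neg]; exact neg_mem hs⟩ }
  le γ _ hx := Λ'.le γ hx.1
  smul_mem := by
    rintro γ δ r x hr ⟨hx, s, hs⟩
    refine ⟨Λ'.smul_mem hr hx, s, ?_⟩
    have := Λ.smul_mem hr hs
    rwa [smul_comm, add_right_comm] at this

/-- The submodule `Λ + f Λ'`. -/
def GrSub.addMul (Λ Λ' : GrSub ℬ) {f : R} {φ : ℤ × ℤ} (hf : f ∈ 𝒢.deg φ) :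
    GrSub ℬ where
  part γ :=
    { carrier := {x | ∃ l ∈ Λ.part γ, ∃ y ∈ Λ'.part (γ - φ), x = l + f • y}
      zero_mem' := ⟨0, zero_mem _, 0, zero_mem _, by simp⟩
      add_mem' := by
        rintro _ _ ⟨l, hl, y, hy, rfl⟩ ⟨l', hl', y', hy', rfl⟩
        exact ⟨l + l', add_mem hl hl', y + y', add_mem hy hy', by rw [smul_add]; abel⟩
      neg_mem' := by
        rintro _ ⟨l, hl, y, hy, rfl⟩
        exact ⟨-l, neg_mem hl, -y, neg_mem hy, by rw [smul_neg]; abel⟩ }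
  le γ := by
    rintro _ ⟨l, hl, y, hy, rfl⟩
    have := Λ'.smul_mem hf hy
    rw [sub_add_cancel] at this
    exact add_mem (Λ.le γ hl) (Λ'.le γ this)
  smul_mem := by
    rintro γ δ r _ hr ⟨l, hl, y, hy, rfl⟩
    refine ⟨r • l, Λ.smul_mem hr hl, r • y, ?_, by rw [smul_add, smul_comm r f y]⟩
    have := Λ'.smul_mem hr hy
    rwa [show γ - φ + δ = γ + δ - φ by abel] at this

/-- If `f` is injective on `Λ' / Λ`, vanishing for `Λ' / (Λ + f Λ')` implies vanishing for
`Λ' / Λ` one position higher. -/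
lemma ColVanish.of_addMul {Λ Λ' : GrSub ℬ} {f : R} {φ : ℤ × ℤ}
    (hf : f ∈ 𝒢.deg φ) (hφ : 1 ≤ φ.1)
    (hinj : ∀ γ, ∀ x ∈ Λ'.part γ, f • x ∈ Λ.part (γ + φ) → x ∈ Λ.part γ) {i : ℕ}
    (H : ColVanish (Λ.addMul Λ' hf) Λ' i) : ColVanish Λ Λ' (i + 1) := by
  obtain ⟨n₀, hn₀⟩ := H
  refine ⟨n₀, fun n hn K γ hγ x hx hDx => ?_⟩
  -- Division by `f`: if `f x` is the coboundary of `y` modulo `Λ`, then `y` is a cocycle modulo `Λ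
  -- + f Λ'`. By hypothesis it can be changed by a coboundary into `l + f y'`, and injectivity of
  -- `f` shows that `x` is the coboundary of `y'`.
  have step : ∀ γ : ℤ × ℤ, 0 ≤ γ.1 → ∀ x : Fin (K.I (i + 2)) → B,
      (∀ p, x p ∈ Λ'.part (K.b _ p + γ)) →
      (∃ y : Fin (K.I (i + 1)) → B, (∀ p, y p ∈ Λ'.part (K.b _ p + (γ + φ))) ∧
        ∀ p, f • x p - mulCol (K.D (i + 1)) y p ∈ Λ.part (K.b _ p + (γ + φ))) →
      ∃ y : Fin (K.I (i + 1)) → B, (∀ p, y p ∈ Λ'.part (K.b _ p + γ)) ∧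
        ∀ p, x p - mulCol (K.D (i + 1)) y p ∈ Λ.part (K.b _ p + γ) := by
    rintro γ hγ x hx ⟨y, hy, hxy⟩
    obtain ⟨z, hz, hyz⟩ := hn₀ n hn K (γ + φ) (by simp only [Prod.fst_add]; lia) y hy fun p =>
      ⟨mulCol (K.D (i + 1)) y p - f • x p, by rw [← neg_sub]; exact neg_mem (hxy p), x p, by
        rw [show K.b (i + 1 + 1) p + (γ + φ) - φ = K.b (i + 1 + 1) p + γ by abel]
        exact hx p, by abel⟩
    choose l hl y' hy' e using hyz
    have e' : y - mulCol (K.D i) z = l + f • y' := funext e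
    have e'' : mulCol (K.D (i + 1)) y = mulCol (K.D (i + 1)) l + f • mulCol (K.D (i + 1)) y' := by
      have := congrArg (mulCol (K.D (i + 1))) e'
      rw [mulCol_sub, mulCol_mulCol, K.comp, zero_mulCol, sub_zero, mulCol_add] at this
      rw [this]
      congr 1
      ext p
      simp [mulCol, Finset.smul_sum, smul_comm f]
    have hy'' : ∀ p, y' p ∈ Λ'.part (K.b _ p + γ) := fun p => by
      have := hy' p
      rwa [show K.b (i + 1) p + (γ + φ) - φ = K.b (i + 1) p + γ by abel] at this
    refine ⟨y', hy'', fun p => hinj _ _ (sub_mem (hx p) (Λ'.mulCol_mem K hy'' p)) ?_⟩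
    have h2 := add_mem (hxy p) (Λ.mulCol_mem K hl p)
    rw [e''] at h2
    rw [add_assoc]
    convert h2 using 1
    simp only [Pi.add_apply, Pi.smul_apply, smul_sub]
    abel
  have hpow : ∀ t : ℕ, ∀ γ : ℤ × ℤ, 0 ≤ γ.1 → ∀ x : Fin (K.I (i + 2)) → B,
      (∀ p, x p ∈ Λ'.part (K.b _ p + γ)) →
      (∃ y : Fin (K.I (i + 1)) → B, (∀ p, y p ∈ Λ'.part (K.b _ p + (γ + t • φ))) ∧
        ∀ p, f ^ t • x p - mulCol (K.D (i + 1)) y p ∈ Λ.part (K.b _ p + (γ + t • φ))) →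
      ∃ y : Fin (K.I (i + 1)) → B, (∀ p, y p ∈ Λ'.part (K.b _ p + γ)) ∧
        ∀ p, x p - mulCol (K.D (i + 1)) y p ∈ Λ.part (K.b _ p + γ) := by
    intro t
    induction t with
    | zero => rintro γ - x - ⟨y, hy⟩; exact ⟨y, by simpa using hy⟩
    | succ t ih =>
      rintro γ hγ x hx ⟨y, hy, hxy⟩
      refine ih γ hγ x hx ?_
      refine step (γ + t • φ) ?_ (fun p => f ^ t • x p) (fun p => ?_) ⟨y, ?_, ?_⟩
      · have := mul_nonneg (Int.natCast_nonneg t) (show 0 ≤ φ.1 by lia)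
        rw [Prod.fst_add, Prod.smul_fst, nsmul_eq_mul]
        lia
      · have := Λ'.smul_mem (𝒢.pow_mem hf t) (hx p)
        rwa [add_assoc] at this
      · rw [add_assoc, ← succ_nsmul]; exact hy
      · rw [add_assoc, ← succ_nsmul]
        intro p
        rw [smul_smul, ← pow_succ']
        exact hxy p
  -- A power of `f` of weight at least `n` is null-homotopic on the complex, so `f ^ t x` is a
  -- coboundary; `hpow` then removes the factors `f` one by one.
  obtain ⟨t, ht⟩ : ∃ t : ℕ, n ≤ t * φ.1 := ⟨n.toNat, by nlinarith [Int.self_le_toNat n]⟩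
  refine hpow t γ hγ x hx ?_
  obtain ⟨H, hH, hHD⟩ := K.exists_homotopy (γ := t • φ) (by simpa using ht) (𝒢.pow_mem hf t)
  have hHmem : ∀ (Λ : GrSub ℬ) (j : ℕ) (x : Fin (K.I (j + 1)) → B),
      (∀ p, x p ∈ Λ.part (K.b _ p + γ)) → ∀ p, mulCol (H j) x p ∈ Λ.part (K.b _ p + (γ + t • φ)) :=
    fun Λ j x hx p => sum_mem fun q _ => by
      have := Λ.smul_mem (hH j p q) (hx q)
      rwa [show K.b _ q + γ + (t • φ + K.b j p - K.b _ q) = K.b j p + (γ + t • φ) by abel] at this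
  refine ⟨mulCol (H (i + 1)) x, hHmem Λ' _ x hx, fun p => ?_⟩
  have h1 := congrFun (congrArg (fun M => mulCol M x) (hHD (i + 1))) p
  have h2 : mulCol (f ^ t • (1 : Matrix (Fin (K.I (i + 2))) (Fin (K.I (i + 2))) R)) x p = f ^ t • x p := by
    simp [mulCol, Matrix.one_apply, ite_smul]
  rw [h2, add_mulCol, ← mulCol_mulCol, ← mulCol_mulCol, Pi.add_apply] at h1
  rw [← h1, add_sub_cancel_right]
  exact hHmem Λ _ _ hDx p

/-- Vanishing of the cohomology of columns above the number of generators. -/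
theorem colVanish_of_le [IsNoetherian R B] {r : ℕ} {f : Fin r → R} {φ : Fin r → ℤ × ℤ}
    (hf : ∀ j, f j ∈ 𝒢.deg (φ j)) (hφ : ∀ j, 1 ≤ (φ j).1)
    (hgen : ∀ γ, 1 ≤ γ.1 → ∀ c ∈ 𝒢.deg γ, c ∈ Ideal.span (Set.range f)) (s : ℕ) (Λ Λ' : GrSub ℬ)
    (h : ∀ γ, Λ.part γ ≤ Λ'.part γ)
    (htors : ∀ j : Fin r, s ≤ j → ∀ γ, ∀ x ∈ Λ'.part γ, ∃ t : ℕ, f j ^ t • x ∈ Λ.part (γ + t • φ j))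
    (i : ℕ) (hi : s + 1 ≤ i) : ColVanish Λ Λ' i := by
  induction s generalizing Λ Λ' i with
  | zero =>
    -- With all generators acting nilpotently, `Λ` and `Λ'` agree in weights at least `k`. From
    -- position two on, the complex is generated in weights at least `n`, so a column in such a
    -- position already has its entries in `Λ`.
    obtain ⟨k, hk⟩ := GrSub.exists_part_le_of_torsion hf hgen Λ Λ' fun j => htors j (Nat.zero_le _)
    obtain ⟨i, rfl⟩ : ∃ i', i = i' + 1 := ⟨i - 1, by lia⟩
    refine ⟨k, fun n hn K γ hγ x hx hDx => ⟨0, fun p => zero_mem _, fun p => ?_⟩⟩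
    rw [mulCol_zero, Pi.zero_apply, sub_zero]
    refine hk _ ?_ (hx p)
    have := K.le_weight i p
    simp only [Prod.fst_add]
    lia
  | succ s ih =>
    by_cases hs : s < r
    · let j : Fin r := ⟨s, hs⟩
      -- The saturation splits the problem. On `S / Λ` the element `f j` acts nilpotently; on `Λ' /
      -- S` it is injective, and it acts as zero on the quotient of `Λ' / S` by its image. In both
      -- pieces one generator fewer remains, and the second one costs one cohomological degree.
      let S := Λ.saturation Λ' (hf j)
      have hS : ∀ γ, Λ.part γ ≤ S.part γ := fun γ x hx => ⟨h γ hx, 0, by simpa using hx⟩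
      have hS' : ∀ γ, S.part γ ≤ Λ'.part γ := fun γ x hx => hx.1
      obtain ⟨i, rfl⟩ : ∃ i', i = i' + 1 := ⟨i - 1, by lia⟩
      have hT : ∀ γ, (S.addMul Λ' (hf j)).part γ ≤ Λ'.part γ := by
        rintro γ _ ⟨l, hl, y, hy, rfl⟩
        have := Λ'.smul_mem (hf j) hy
        rw [sub_add_cancel] at this
        exact add_mem (hS' γ hl) this
      have h₁ : ColVanish Λ S (i + 1) := by
        refine ih Λ S hS (fun j' hj' γ x hx => ?_) _ (by lia)
        rcases eq_or_lt_of_le hj' with e | hlt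
        · obtain rfl : j' = j := Fin.ext e.symm
          exact hx.2
        · exact htors j' hlt γ x hx.1
      have h₂ : ColVanish (S.addMul Λ' (hf j)) Λ' i := by
        refine ih _ _ hT (fun j' hj' γ x hx => ?_) i (by lia)
        rcases eq_or_lt_of_le hj' with e | hlt
        · obtain rfl : j' = j := Fin.ext e.symm
          exact ⟨1, 0, zero_mem _, x, by simpa using hx, by simp⟩
        · obtain ⟨t, ht⟩ := htors j' hlt γ x hx
          exact ⟨t, _, hS _ ht, 0, zero_mem _, by simp⟩
      have hinj : ∀ γ, ∀ x ∈ Λ'.part γ, f j • x ∈ S.part (γ + φ j) → x ∈ S.part γ := by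
        rintro γ x hx ⟨-, t, ht⟩
        refine ⟨hx, t + 1, ?_⟩
        rw [pow_succ, mul_smul, succ_nsmul', ← add_assoc]
        exact ht
      exact h₁.trans hS hS' (ColVanish.of_addMul (hf j) (hφ j) hinj h₂)
    · exact ih Λ Λ' h (fun j hj => absurd j.2 (by lia)) i (by lia)

end Graded

/-! ### Semi-invariants of reductive groups -/

section Reps

variable {G : Type u} [Group G] [AffineAlgebraicGroup G]
variable {V : Type*} [AddCommGroup V] [Module ℂ V] {V' : Type*} [AddCommGroup V'] [Module ℂ V']
  {ρ : Representation ℂ G V} {ρ' : Representation ℂ G V'}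

/-- A subspace which is stable under the group. -/
def IsStable (ρ : Representation ℂ G V) (N : Submodule ℂ V) : Prop := ∀ g, ∀ x ∈ N, ρ g x ∈ N

lemma IsStable.sup {N N' : Submodule ℂ V} (h : IsStable ρ N) (h' : IsStable ρ N') :
    IsStable ρ (N ⊔ N') := fun g x hx => by
  obtain ⟨y, hy, z, hz, rfl⟩ := Submodule.mem_sup.1 hx
  rw [map_add]
  exact add_mem (Submodule.mem_sup_left (h g y hy)) (Submodule.mem_sup_right (h' g z hz))

lemma IsStable.inf {N N' : Submodule ℂ V} (h : IsStable ρ N) (h' : IsStable ρ N') :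
    IsStable ρ (N ⊓ N') := fun g x hx => ⟨h g x hx.1, h' g x hx.2⟩

/-- The restriction of a representation to a stable subspace. -/
def subRep (ρ : Representation ℂ G V) (N : Submodule ℂ V) (h : IsStable ρ N) :
    Representation ℂ G N where
  toFun g := (ρ g).restrict (h g)
  map_one' := by ext; simp
  map_mul' g g' := by ext; simp

lemma subRep_apply {N : Submodule ℂ V} (h : IsStable ρ N) (g : G) (x : N) :
    (subRep ρ N h g x : V) = ρ g x := rfl

lemma exists_expansion {v : V} {ι : Type*} [Fintype ι] (f : ι → CoordRing G) (w : ι → V)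
    (h : ∀ g, ρ g v = ∑ i, (f i).1 g • w i) :
    ∃ (n : ℕ) (f : Fin n → CoordRing G) (w : Fin n → V), IsExpansion ρ v f w := by
  let e := (Fintype.equivFin ι).symm
  exact ⟨_, fun i => f (e i), fun i => w (e i), fun g => by
    rw [h g]
    exact (Equiv.sum_comp e fun i => (f i).1 g • w i).symm⟩

lemma IsRational.subRep (hρ : IsRational ρ) {N : Submodule ℂ V} (h : IsStable ρ N) :
    IsRational (subRep ρ N h) := fun x => by
  obtain ⟨p, hp⟩ := N.subtype.exists_leftInverse_of_injective (by simp)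
  obtain ⟨n, f, w, hf⟩ := hρ x.1
  refine ⟨n, f, fun i => p (w i), fun g => ?_⟩
  have := congrArg p (hf g)
  rw [map_sum] at this
  simp only [map_smul] at this
  rw [← this]
  exact (LinearMap.congr_fun hp (Microlocal.subRep ρ N h g x)).symm

variable (ρ) in
/-- The subspace spanned by the orbits of the elements of `s`. -/
def orbitSpan (s : Set V) : Submodule ℂ V := Submodule.span ℂ {x | ∃ g, ∃ v ∈ s, x = ρ g v}

lemma isStable_span {s : Set V} (h : ∀ g, ∀ v ∈ s, ρ g v ∈ Submodule.span ℂ s) :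
    IsStable ρ (Submodule.span ℂ s) := fun g x hx => by
  have : Submodule.span ℂ s ≤ (Submodule.span ℂ s).comap (ρ g) := Submodule.span_le.2 fun v hv => h g v hv
  exact this hx

lemma isStable_orbitSpan (s : Set V) : IsStable ρ (orbitSpan ρ s) := isStable_span <| by
  rintro g _ ⟨g', v, hv, rfl⟩
  exact Submodule.subset_span ⟨g * g', v, hv, by simp⟩

lemma subset_orbitSpan (s : Set V) : s ⊆ orbitSpan ρ s := fun v hv =>
  Submodule.subset_span ⟨1, v, hv, by simp⟩

lemma orbitSpan_le {s : Set V} {N : Submodule ℂ V} (h : IsStable ρ N) (hs : s ⊆ N) :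
    orbitSpan ρ s ≤ N := Submodule.span_le.2 <| by
  rintro _ ⟨g, v, hv, rfl⟩
  exact h g v (hs hv)

lemma finiteDimensional_orbitSpan (hρ : IsRational ρ) {s : Set V} (hs : s.Finite) :
    FiniteDimensional ℂ (orbitSpan ρ s) := by
  choose n f w h using hρ
  have : orbitSpan ρ s ≤ Submodule.span ℂ (⋃ v ∈ s, Set.range (w v)) := Submodule.span_le.2 <| by
    rintro _ ⟨g, v, hv, rfl⟩
    rw [h v g]
    exact sum_mem fun i _ => Submodule.smul_mem _ _
      (Submodule.subset_span (Set.mem_biUnion hv ⟨i, rfl⟩))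
  have hfd : FiniteDimensional ℂ (Submodule.span ℂ (⋃ v ∈ s, Set.range (w v))) :=
    FiniteDimensional.span_of_finite ℂ (hs.biUnion fun v _ => Set.finite_range _)
  exact Submodule.finiteDimensional_of_le this

/-- Complete reducibility of finite-dimensional stable subspaces. -/
lemma exists_stable_compl (hG : IsReductive G) (hρ : IsRational ρ) {W : Submodule ℂ V}
    [FiniteDimensional ℂ W] (hW : IsStable ρ W) {U : Submodule ℂ V} (hU : IsStable ρ U)
    (hUW : U ≤ W) : ∃ U' : Submodule ℂ V, IsStable ρ U' ∧ U ⊓ U' = ⊥ ∧ U ⊔ U' = W := by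
  let e : W ≃ₗ[ℂ] (Fin (Module.finrank ℂ W) → ℂ) := (Module.finBasis ℂ W).equivFun
  let σ : Representation ℂ G (Fin (Module.finrank ℂ W) → ℂ) :=
    { toFun := fun g => e.toLinearMap ∘ₗ subRep ρ W hW g ∘ₗ e.symm.toLinearMap
      map_one' := by ext; simp
      map_mul' := fun g g' => LinearMap.ext fun x => by simp }
  have hσ : ∀ g x, σ g x = e (subRep ρ W hW g (e.symm x)) := fun _ _ => rfl
  have hσr : IsRational σ := fun x => by
    obtain ⟨n, f, w, h⟩ := hρ.subRep hW (e.symm x)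
    exact ⟨n, f, fun i => e (w i), fun g => by rw [hσ, h g]; simp⟩
  let i : (Fin (Module.finrank ℂ W) → ℂ) →ₗ[ℂ] V := W.subtype ∘ₗ e.symm.toLinearMap
  have hi : ∀ g x, i (σ g x) = ρ g (i x) := fun g x => by
    change ((e.symm (σ g x) : W) : V) = ρ g (e.symm x : W)
    rw [hσ, e.symm_apply_apply]
    rfl
  have hinj : Function.Injective i := Subtype.val_injective.comp e.symm.injective
  have hrange : LinearMap.range i = W := by
    rw [LinearMap.range_comp_of_range_eq_top _ (LinearEquiv.range _), Submodule.range_subtype]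
  obtain ⟨U', hU', hc⟩ := hG _ σ hσr (U.comap i) fun g x hx => by
    rw [Submodule.mem_comap, hi]
    exact hU g _ hx
  have hUi : (U.comap i).map i = U := by
    rw [Submodule.map_comap_eq, hrange, inf_eq_right.2 hUW]
  refine ⟨U'.map i, ?_, ?_, ?_⟩
  · rintro g _ ⟨x, hx, rfl⟩
    exact ⟨σ g x, hU' g x hx, hi g x⟩
  · rw [← hUi, ← Submodule.map_inf i hinj, hc.inf_eq_bot, Submodule.map_bot]
  · rw [← hUi, ← Submodule.map_sup, hc.sup_eq_top, Submodule.map_top, hrange]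

variable (ρ) in
/-- The semi-invariants of weight `ψ`. -/
def semi (ψ : G →* ℂˣ) : Submodule ℂ V where
  carrier := {v | ∀ g, ρ g v = (ψ g : ℂ) • v}
  zero_mem' g := by simp
  add_mem' {x y} hx hy g := by rw [map_add, hx g, hy g, smul_add]
  smul_mem' c x hx g := by rw [map_smul, hx g, smul_comm]

variable (ρ) in
/-- The complement of the semi-invariants, for vectors in `N`. -/
def cosemi (ψ : G →* ℂˣ) (N : Submodule ℂ V) : Submodule ℂ V :=
  Submodule.span ℂ {x | ∃ g, ∃ v ∈ N, x = ρ g v - (ψ g : ℂ) • v}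

lemma cosemi_mono (ψ : G →* ℂˣ) {N N' : Submodule ℂ V} (h : N ≤ N') :
    cosemi ρ ψ N ≤ cosemi ρ ψ N' := Submodule.span_mono <| by
  rintro _ ⟨g, v, hv, rfl⟩
  exact ⟨g, v, h hv, rfl⟩

lemma isStable_semi (ψ : G →* ℂˣ) : IsStable ρ (semi ρ ψ) := fun g x hx => by
  rw [hx g]
  exact Submodule.smul_mem _ _ hx

lemma isStable_cosemi (ψ : G →* ℂˣ) {N : Submodule ℂ V} (hN : IsStable ρ N) :
    IsStable ρ (cosemi ρ ψ N) := isStable_span <| by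
  rintro h _ ⟨g, v, hv, rfl⟩
  refine Submodule.subset_span ⟨h * g * h⁻¹, ρ h v, hN h v hv, ?_⟩
  simp

lemma cosemi_le (ψ : G →* ℂˣ) {N : Submodule ℂ V} (hN : IsStable ρ N) : cosemi ρ ψ N ≤ N :=
  Submodule.span_le.2 <| by
    rintro _ ⟨g, v, hv, rfl⟩
    exact sub_mem (hN g v hv) (Submodule.smul_mem _ _ hv)

/-- Let `U₁` be a stable complement of the semi-invariants in `W`. A stable complement of `cosemi ρ
ψ U₁` in `U₁` consists of semi-invariants, because there `ρ g x - ψ g x` lies in both summands;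
hence it is zero, and `U₁` is spanned by the vectors `ρ g v - ψ g v`. -/
lemma semi_cosemi_of_finiteDimensional (hG : IsReductive G) (hρ : IsRational ρ) (ψ : G →* ℂˣ)
    {W : Submodule ℂ V} [FiniteDimensional ℂ W] (hW : IsStable ρ W) :
    W ≤ (semi ρ ψ ⊓ W) ⊔ cosemi ρ ψ W ∧ semi ρ ψ ⊓ cosemi ρ ψ W = ⊥ := by
  obtain ⟨U₁, hU₁, hb₁, ht₁⟩ := exists_stable_compl hG hρ hW ((isStable_semi ψ).inf hW) inf_le_right
  have hle : U₁ ≤ W := ht₁ ▸ le_sup_right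
  have : FiniteDimensional ℂ U₁ := Submodule.finiteDimensional_of_le hle
  obtain ⟨U₃, hU₃, hb₃, ht₃⟩ := exists_stable_compl hG hρ hU₁ (isStable_cosemi ψ hU₁)
    (cosemi_le ψ hU₁)
  have h0 : U₃ = ⊥ := by
    rw [eq_bot_iff, ← hb₁]
    intro x hx
    have hx₁ : x ∈ U₁ := ht₃ ▸ Submodule.mem_sup_right hx
    refine ⟨⟨fun g => ?_, hle hx₁⟩, hx₁⟩
    rw [← sub_eq_zero, ← Submodule.mem_bot ℂ, ← hb₃]
    exact ⟨Submodule.subset_span ⟨g, x, hx₁, rfl⟩,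
      sub_mem (hU₃ g x hx) (Submodule.smul_mem _ _ hx)⟩
  have hU : cosemi ρ ψ U₁ = U₁ := by rwa [h0, sup_bot_eq] at ht₃
  have hc : cosemi ρ ψ W ≤ U₁ := Submodule.span_le.2 <| by
    rintro _ ⟨g, v, hv, rfl⟩
    rw [← ht₁] at hv
    obtain ⟨y, hy, z, hz, rfl⟩ := Submodule.mem_sup.1 hv
    rw [map_add, hy.1 g, smul_add, add_sub_add_left_eq_sub]
    exact sub_mem (hU₁ g z hz) (Submodule.smul_mem _ _ hz)
  constructor
  · nth_rw 1 [← ht₁]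
    refine sup_le_sup le_rfl ?_
    rw [← hU]
    exact cosemi_mono ψ hle
  · rw [eq_bot_iff, ← hb₁]
    exact fun x hx => ⟨⟨hx.1, hle (hc hx.2)⟩, hc hx.2⟩

/-- A rational representation is the union of its finite-dimensional stable subspaces, and both
summands are compatible with enlarging the subspace. -/
lemma isCompl_semi_cosemi (hG : IsReductive G) (hρ : IsRational ρ) (ψ : G →* ℂˣ) :
    IsCompl (semi ρ ψ) (cosemi ρ ψ ⊤) := by
  constructor
  · rw [disjoint_iff, eq_bot_iff]
    rintro x ⟨hx, hx'⟩
    obtain ⟨W, hW, hWs, hxW⟩ : ∃ W : Submodule ℂ V, FiniteDimensional ℂ W ∧ IsStable ρ W ∧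
        x ∈ cosemi ρ ψ W := by
      clear hx
      induction hx' using Submodule.span_induction with
      | mem x hx =>
        obtain ⟨g, v, -, rfl⟩ := hx
        exact ⟨_, finiteDimensional_orbitSpan hρ (Set.finite_singleton v), isStable_orbitSpan _,
          Submodule.subset_span ⟨g, v, subset_orbitSpan _ rfl, rfl⟩⟩
      | zero => exact ⟨⊥, inferInstance, fun g x hx => by simp_all, zero_mem _⟩
      | add x y _ _ hx hy =>
        obtain ⟨W, hW, hWs, hxW⟩ := hx
        obtain ⟨W', hW', hWs', hxW'⟩ := hy
        exact ⟨W ⊔ W', inferInstance, hWs.sup hWs', add_mem (cosemi_mono ψ le_sup_left hxW)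
          (cosemi_mono ψ le_sup_right hxW')⟩
      | smul c x _ hx =>
        obtain ⟨W, hW, hWs, hxW⟩ := hx
        exact ⟨W, hW, hWs, Submodule.smul_mem _ _ hxW⟩
    rw [← (semi_cosemi_of_finiteDimensional hG hρ ψ hWs).2]
    exact ⟨hx, hxW⟩
  · rw [codisjoint_iff, eq_top_iff]
    intro x _
    have := finiteDimensional_orbitSpan hρ (Set.finite_singleton x)
    have h := (semi_cosemi_of_finiteDimensional hG hρ ψ (isStable_orbitSpan {x})).1
      (subset_orbitSpan _ rfl)
    obtain ⟨y, hy, z, hz, rfl⟩ := Submodule.mem_sup.1 h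
    exact add_mem (Submodule.mem_sup_left hy.1)
      (Submodule.mem_sup_right (cosemi_mono ψ le_top hz))

/-- The projection onto the semi-invariants of weight `ψ`. -/
def semiProj (hG : IsReductive G) (hρ : IsRational ρ) (ψ : G →* ℂˣ) : V →ₗ[ℂ] V :=
  (semi ρ ψ).subtype ∘ₗ Submodule.projectionOnto _ _ (isCompl_semi_cosemi hG hρ ψ)

lemma semiProj_mem (hG : IsReductive G) (hρ : IsRational ρ) (ψ : G →* ℂˣ) (v : V) :
    semiProj hG hρ ψ v ∈ semi ρ ψ := Subtype.property _

lemma semiProj_of_mem (hG : IsReductive G) (hρ : IsRational ρ) {ψ : G →* ℂˣ} {v : V}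
    (hv : v ∈ semi ρ ψ) : semiProj hG hρ ψ v = v :=
  congrArg Subtype.val (Submodule.projectionOnto_apply_left (isCompl_semi_cosemi hG hρ ψ) ⟨v, hv⟩)

lemma semiProj_of_mem_cosemi (hG : IsReductive G) (hρ : IsRational ρ) {ψ : G →* ℂˣ} {v : V}
    (hv : v ∈ cosemi ρ ψ ⊤) : semiProj hG hρ ψ v = 0 :=
  congrArg Subtype.val (Submodule.projectionOnto_apply_right (isCompl_semi_cosemi hG hρ ψ) ⟨v, hv⟩)

/-- The projections onto the semi-invariants are natural for semi-equivariant maps. -/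
lemma semiProj_map (hG : IsReductive G) (hρ : IsRational ρ) (hρ' : IsRational ρ') {ψ ψ' η : G →* ℂˣ}
    (hψ : ψ' = η * ψ) (T : V →ₗ[ℂ] V') (hT : ∀ g v, ρ' g (T v) = (η g : ℂ) • T (ρ g v)) (v : V) :
    semiProj hG hρ' ψ' (T v) = T (semiProj hG hρ ψ v) := by
  subst hψ
  have hv : v ∈ semi ρ ψ ⊔ cosemi ρ ψ ⊤ := by
    rw [(isCompl_semi_cosemi hG hρ ψ).sup_eq_top]; trivial
  obtain ⟨y, hy, z, hz, rfl⟩ := Submodule.mem_sup.1 hv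
  have hTy : T y ∈ semi ρ' (η * ψ) := fun g => by
    rw [hT, hy g, map_smul, smul_smul]
    simp
  have hTz : T z ∈ cosemi ρ' (η * ψ) ⊤ := by
    have : cosemi ρ ψ ⊤ ≤ (cosemi ρ' (η * ψ) ⊤).comap T := Submodule.span_le.2 <| by
      rintro _ ⟨g, v, -, rfl⟩
      have h : T (ρ g v - (ψ g : ℂ) • v) =
          (↑(η g)⁻¹ : ℂ) • (ρ' g (T v) - ((η * ψ) g : ℂ) • T v) := by
        rw [hT, smul_sub, smul_smul, smul_smul]
        simp
      change T _ ∈ cosemi ρ' (η * ψ) ⊤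
      rw [h]
      exact Submodule.smul_mem _ _ (Submodule.subset_span ⟨g, T v, trivial, rfl⟩)
    exact this hz
  rw [map_add, map_add, map_add, map_add, semiProj_of_mem hG hρ' hTy, semiProj_of_mem hG hρ hy,
    semiProj_of_mem_cosemi hG hρ' hTz, semiProj_of_mem_cosemi hG hρ hz, map_zero]

lemma semiProj_mem_of_isStable (hG : IsReductive G) (hρ : IsRational ρ) (ψ : G →* ℂˣ)
    {N : Submodule ℂ V} (hN : IsStable ρ N) {v : V} (hv : v ∈ N) : semiProj hG hρ ψ v ∈ N := by
  rw [show v = N.subtype ⟨v, hv⟩ from rfl, semiProj_map hG (hρ.subRep hN) hρ (one_mul ψ).symm N.subtype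
    (fun g v => by simp [subRep_apply])]
  exact Subtype.property _

/-- Semi-invariants lift along equivariant maps defined on a stable subspace. -/
lemma exists_semi_lift (hG : IsReductive G) (hρ : IsRational ρ) (hρ' : IsRational ρ') {ψ : G →* ℂˣ}
    {N : Submodule ℂ V} (hN : IsStable ρ N) (T : N →ₗ[ℂ] V')
    (hT : ∀ g (v : N), ρ' g (T v) = T ⟨ρ g v, hN g v v.2⟩) (v : N) (hv : T v ∈ semi ρ' ψ) :
    ∃ v' : N, v'.1 ∈ semi ρ ψ ∧ T v' = T v := by
  refine ⟨semiProj hG (hρ.subRep hN) ψ v, fun g => ?_, ?_⟩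
  · exact congrArg Subtype.val (semiProj_mem hG (hρ.subRep hN) ψ v g)
  · rw [← semiProj_map hG (hρ.subRep hN) hρ' (one_mul ψ).symm T (fun g v => by rw [hT]; simp; rfl),
      semiProj_of_mem hG hρ' hv]

end Reps

/-! ### Matrix representations -/

section MatRep

variable {G : Type u} [Group G] [AffineAlgebraicGroup G]

variable (G) in
/-- A rational representation by matrices. -/
structure MatRep (κ : Type*) [Fintype κ] [DecidableEq κ] where
  hom : G →* Matrix κ κ ℂ
  regular : ∀ a b, (fun g => hom g a b) ∈ AffineAlgebraicGroup.coord (G := G)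

variable {κ τ : Type*} [Fintype κ] [DecidableEq κ] [Fintype τ] [DecidableEq τ]

/-- The dual representation. -/
def MatRep.dual (r : MatRep G κ) : MatRep G κ where
  hom :=
    { toFun := fun g => (r.hom g⁻¹).transpose
      map_one' := by simp
      map_mul' := fun g h => by rw [mul_inv_rev, map_mul, Matrix.transpose_mul] }
  regular a b := AffineAlgebraicGroup.inv_regular _ (r.regular b a)

/-- The tensor product. -/
def MatRep.tensor (r : MatRep G κ) (s : MatRep G τ) : MatRep G (κ × τ) where
  hom :=
    { toFun := fun g => Matrix.kroneckerMap (· * ·) (r.hom g) (s.hom g)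
      map_one' := by rw [map_one, map_one]; exact Matrix.one_kronecker_one
      map_mul' := fun g h => by rw [map_mul, map_mul]; exact Matrix.mul_kronecker_mul _ _ _ _ }
  regular a b := mul_mem (r.regular a.1 b.1) (s.regular a.2 b.2)

lemma MatRep.tensor_apply (r : MatRep G κ) (s : MatRep G τ) (g : G) (a b : κ × τ) :
    (r.tensor s).hom g a b = r.hom g a.1 b.1 * s.hom g a.2 b.2 := rfl

/-- The character `θ ^ k`. -/
def wtChar {G : Type*} [Group G] (θ : G →* ℂˣ) (k : ℤ) : G →* ℂˣ where
  toFun g := θ g ^ k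
  map_one' := by simp
  map_mul' g h := by rw [map_mul, mul_zpow]

lemma wtChar_apply {G : Type*} [Group G] (θ : G →* ℂˣ) (k : ℤ) (g : G) :
    (wtChar θ k g : ℂ) = (θ g : ℂ) ^ k := by simp [wtChar]

lemma wtChar_zero {G : Type*} [Group G] (θ : G →* ℂˣ) : wtChar θ 0 = 1 := by
  ext g; simp [wtChar_apply]

lemma wtChar_add {G : Type*} [Group G] (θ : G →* ℂˣ) (k l : ℤ) :
    wtChar θ (k + l) = wtChar θ k * wtChar θ l := by
  ext g; simp [wtChar_apply, zpow_add₀]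

lemma wtChar_regular {θ : G →* ℂˣ}
    (hθ : (fun g => (θ g : ℂ)) ∈ AffineAlgebraicGroup.coord (G := G)) (k : ℤ) :
    (fun g => (wtChar θ k g : ℂ)) ∈ AffineAlgebraicGroup.coord (G := G) := by
  simp only [wtChar_apply]
  have hpow : ∀ n : ℕ, (fun g => (θ g : ℂ) ^ n) ∈ AffineAlgebraicGroup.coord (G := G) :=
    fun n => pow_mem hθ n
  obtain ⟨n, rfl | rfl⟩ := k.eq_nat_or_neg
  · simpa using hpow n
  · have := AffineAlgebraicGroup.inv_regular _ (hpow n)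
    convert this using 1
    ext g
    simp

/-- The sum of the characters `wtChar θ (w p)`. -/
def MatRep.diag (θ : G →* ℂˣ) (hθ : (fun g => (θ g : ℂ)) ∈ AffineAlgebraicGroup.coord (G := G))
    (w : κ → ℤ) : MatRep G κ where
  hom :=
    { toFun := fun g => Matrix.diagonal fun p => (wtChar θ (w p) g : ℂ)
      map_one' := by simp
      map_mul' := fun g h => by
        rw [Matrix.diagonal_mul_diagonal]
        simp only [map_mul, Units.val_mul] }
  regular a b := by
    by_cases h : a = b
    · subst h
      simpa using wtChar_regular hθ (w a)
    · simp [Matrix.diagonal_apply_ne _ h]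
      exact zero_mem _

lemma MatRep.diag_apply (θ : G →* ℂˣ) (hθ) (w : κ → ℤ) (g : G) (p q : κ) :
    (MatRep.diag θ hθ w).hom g p q = if p = q then (wtChar θ (w p) g : ℂ) else 0 := rfl

variable {V : Type*} [AddCommGroup V] [Module ℂ V] {V' : Type*} [AddCommGroup V'] [Module ℂ V']

/-- The representation `ℂ ^ κ ⊗ V` on tuples with entries in `V`. -/
def tupleRep (r : MatRep G κ) (ρ : Representation ℂ G V) : Representation ℂ G (κ → V) where
  toFun g :=
    { toFun := fun x b => ∑ a, r.hom g b a • ρ g (x a)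
      map_add' := fun x y => by ext b; simp [Finset.sum_add_distrib]
      map_smul' := fun c x => by ext b; simp [Finset.smul_sum, smul_comm c] }
  map_one' := by
    ext x b
    simp [Matrix.one_apply, ite_smul]
  map_mul' g h := by
    refine LinearMap.ext fun x => funext fun b => ?_
    simp only [map_mul, Matrix.mul_apply, LinearMap.coe_mk, AddHom.coe_mk, Module.End.mul_apply,
      map_sum, map_smul, Finset.sum_smul, Finset.smul_sum, mul_smul]
    rw [Finset.sum_comm]

lemma tupleRep_apply (r : MatRep G κ) (ρ : Representation ℂ G V) (g : G) (x : κ → V) (b : κ) :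
    tupleRep r ρ g x b = ∑ a, r.hom g b a • ρ g (x a) := rfl

lemma isRational_tupleRep (r : MatRep G κ) {ρ : Representation ℂ G V} (hρ : IsRational ρ) :
    IsRational (tupleRep r ρ) := fun x => by
  choose n f w h using fun a => hρ (x a)
  refine exists_expansion (ι := κ × Σ a, Fin (n a))
    (fun p => ⟨_, r.regular p.1 p.2.1⟩ * f p.2.1 p.2.2) (fun p => Pi.single p.1 (w p.2.1 p.2.2))
    fun g => funext fun b => ?_
  rw [tupleRep_apply, Finset.sum_apply, Fintype.sum_prod_type, Finset.sum_comm, Fintype.sum_sigma]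
  refine Finset.sum_congr rfl fun a _ => ?_
  rw [h a g, Finset.smul_sum]
  refine Finset.sum_congr rfl fun i _ => ?_
  rw [Finset.sum_eq_single b]
  · simp [smul_smul]
  · intro b' _ hb
    simp [Pi.single_eq_of_ne' hb]
  · simp

/-- Finitely many vectors of a rational representation lie in the span of a finite independent
family which is stable under the group. -/
lemma exists_matRep {ρ : Representation ℂ G V} (hρ : IsRational ρ) {s : Set V} (hs : s.Finite) :
    ∃ (n : ℕ) (v : Fin n → V) (r : MatRep G (Fin n)), LinearIndependent ℂ v ∧
      (∀ g a, ρ g (v a) = ∑ b, r.hom g b a • v b) ∧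
      Submodule.span ℂ (Set.range v) = orbitSpan ρ s := by
  have := finiteDimensional_orbitSpan hρ hs
  have hW := isStable_orbitSpan (ρ := ρ) s
  let β := Module.finBasis ℂ (orbitSpan ρ s)
  obtain ⟨p, hp⟩ := (orbitSpan ρ s).subtype.exists_leftInverse_of_injective (by simp)
  have hreg : ∀ a b, (fun g => β.repr (subRep ρ _ hW g (β b)) a) ∈
      AffineAlgebraicGroup.coord (G := G) := fun a b => by
    obtain ⟨n, f, w, h⟩ := hρ (β b)
    have : (fun g => β.repr (subRep ρ _ hW g (β b)) a) =
        (∑ i, β.coord a (p (w i)) • f i : CoordRing G).1 := by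
      funext g
      have h1 : subRep ρ _ hW g (β b) = ∑ i, (f i).1 g • p (w i) := by
        have := congrArg p (h g)
        rw [map_sum] at this
        simp only [map_smul] at this
        rw [← this]
        exact (LinearMap.congr_fun hp (subRep ρ _ hW g (β b))).symm
      rw [h1]
      simp [mul_comm, Finsupp.finsetSum_apply]
    exact this ▸ Subtype.property _
  let r : MatRep G (Fin (Module.finrank ℂ (orbitSpan ρ s))) :=
    { hom :=
        { toFun := fun g => LinearMap.toMatrixAlgEquiv β (subRep ρ _ hW g)
          map_one' := by rw [map_one, map_one]
          map_mul' := fun g h => by rw [map_mul, map_mul] }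
      regular := fun a b => by
        convert hreg a b using 2 with g
        exact LinearMap.toMatrixAlgEquiv_apply β _ a b }
  have hr : ∀ g b a, r.hom g b a = β.repr (subRep ρ _ hW g (β a)) b := fun g b a =>
    LinearMap.toMatrixAlgEquiv_apply β _ b a
  refine ⟨_, fun a => β a, r, β.linearIndependent.map' (Submodule.subtype _) (by simp),
    fun g a => ?_, ?_⟩
  · have h2 := congrArg Subtype.val (β.sum_repr (subRep ρ _ hW g (β a))).symm
    rw [subRep_apply] at h2
    refine h2.trans ?_
    rw [← Submodule.coe_subtype, map_sum]
    exact Finset.sum_congr rfl fun b _ => by rw [hr, map_smul]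
  · have := congrArg (Submodule.map (orbitSpan ρ s).subtype) β.span_eq
    rw [Submodule.map_span, Submodule.map_top, Submodule.range_subtype, ← Set.range_comp] at this
    exact this

end MatRep

/-! ### Homogeneous semi-invariants in a filtered quantization -/

section Symbols

variable {G : Type u} [Group G] [AffineAlgebraicGroup G]
variable {R : Type u} [CommRing R] [Algebra ℂ R] [MulSemiringAction G R] [SMulCommClass G ℂ R]
  {W : HamiltonianSpace G R}
variable {A : Type u} [Ring A] [Algebra ℂ A] [MulSemiringAction G A] [SMulCommClass G ℂ A]
  (Q : FilteredQuantization W A)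

open Classical in
/-- The symbol of degree `i`, extended by zero. -/
def sym (i : ℤ) (a : A) : R := if h : a ∈ Q.F i then Q.symbol i ⟨a, h⟩ else 0

variable {Q}

lemma sym_eq {i : ℤ} {a : A} (h : a ∈ Q.F i) : sym Q i a = Q.symbol i ⟨a, h⟩ := dif_pos h

lemma sym_add {i : ℤ} {a b : A} (ha : a ∈ Q.F i) (hb : b ∈ Q.F i) :
    sym Q i (a + b) = sym Q i a + sym Q i b := by
  rw [sym_eq ha, sym_eq hb, sym_eq (add_mem ha hb), ← map_add]
  rfl

lemma sym_sub {i : ℤ} {a b : A} (ha : a ∈ Q.F i) (hb : b ∈ Q.F i) :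
    sym Q i (a - b) = sym Q i a - sym Q i b := by
  rw [sym_eq ha, sym_eq hb, sym_eq (sub_mem ha hb), ← map_sub]
  rfl

lemma sym_zero (i : ℤ) : sym Q i 0 = 0 := by
  rw [sym_eq (zero_mem _)]
  exact map_zero (Q.symbol i)

lemma sym_neg {i : ℤ} {a : A} (ha : a ∈ Q.F i) : sym Q i (-a) = - sym Q i a := by
  rw [← zero_sub, sym_sub (zero_mem _) ha, sym_zero, zero_sub]

lemma sym_sum {ι : Type*} (s : Finset ι) {i : ℤ} {a : ι → A} (ha : ∀ j ∈ s, a j ∈ Q.F i) :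
    sym Q i (∑ j ∈ s, a j) = ∑ j ∈ s, sym Q i (a j) := by
  classical
  induction s using Finset.induction_on with
  | empty => simp [sym_zero]
  | insert j s hj ih =>
    rw [Finset.sum_insert hj, Finset.sum_insert hj, sym_add (ha j (Finset.mem_insert_self _ _))
      (sum_mem fun k hk => ha k (Finset.mem_insert_of_mem hk)),
      ih fun k hk => ha k (Finset.mem_insert_of_mem hk)]

lemma sym_mul {i j : ℤ} {a b : A} (ha : a ∈ Q.F i) (hb : b ∈ Q.F j) :
    sym Q (i + j) (a * b) = sym Q i a * sym Q j b := by
  rw [sym_eq ha, sym_eq hb, sym_eq (Q.mul_mem ha hb), ← Q.symbol_mul]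

lemma sym_one : sym Q 0 1 = 1 := by rw [sym_eq Q.one_mem, Q.symbol_one]

lemma sym_eq_zero {i : ℤ} {a : A} (ha : a ∈ Q.F i) : sym Q i a = 0 ↔ a ∈ Q.F (i - 1) := by
  rw [sym_eq ha, Q.symbol_eq_zero_iff]

lemma commutator_mem {i j : ℤ} {a b : A} (ha : a ∈ Q.F i) (hb : b ∈ Q.F j) :
    a * b - b * a ∈ Q.F (i + j - 1) := (Q.symbol_commutator i j ⟨a, ha⟩ ⟨b, hb⟩).1

variable (Q)

/-- The decomposition of `R` into homogeneous components. -/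
def degEquiv : DirectSum ℤ (fun i => LinearMap.range (Q.symbol i)) ≃ₗ[ℂ] R :=
  LinearEquiv.ofBijective (DirectSum.coeLinearMap fun i => LinearMap.range (Q.symbol i))
    Q.symbol_isInternal

/-- The projection of `R` onto its component of degree `i`. -/
def degProj (i : ℤ) : R →ₗ[ℂ] R :=
  (LinearMap.range (Q.symbol i)).subtype ∘ₗ
    DirectSum.component ℂ ℤ (fun i => LinearMap.range (Q.symbol i)) i ∘ₗ (degEquiv Q).symm.toLinearMap

lemma degProj_mem (i : ℤ) (r : R) : degProj Q i r ∈ LinearMap.range (Q.symbol i) :=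
  Subtype.property _

variable {Q}

lemma degProj_of_mem {i j : ℤ} {r : R} (h : r ∈ LinearMap.range (Q.symbol j)) :
    degProj Q i r = if j = i then r else 0 := by
  have e : (degEquiv Q).symm r =
      DirectSum.lof ℂ ℤ (fun i => LinearMap.range (Q.symbol i)) j ⟨r, h⟩ := by
    rw [LinearEquiv.symm_apply_eq]
    exact (DirectSum.coeLinearMap_lof (R := ℂ) (fun i => LinearMap.range (Q.symbol i)) j ⟨r, h⟩).symm
  have e' : degProj Q i r =
      (DirectSum.component ℂ ℤ (fun i => LinearMap.range (Q.symbol i)) i ((degEquiv Q).symm r) : R) := rfl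
  rw [e', e]
  by_cases hij : j = i
  · subst hij
    rw [if_pos rfl, DirectSum.component.lof_self]
  · rw [if_neg hij, DirectSum.component.of, dif_neg hij]
    rfl

variable (Q) in
lemma induction_degree {p : R → Prop} (h : ∀ i, ∀ r ∈ LinearMap.range (Q.symbol i), p r) (h₀ : p 0)
    (hadd : ∀ r s, p r → p s → p (r + s)) (r : R) : p r := by
  have hr : r ∈ ⨆ i, LinearMap.range (Q.symbol i) := by
    rw [Q.symbol_isInternal.submodule_iSup_eq_top]; trivial
  exact Submodule.iSup_induction _ (motive := p) hr h h₀ hadd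

lemma mul_mem_range {i j : ℤ} {r s : R} (hr : r ∈ LinearMap.range (Q.symbol i))
    (hs : s ∈ LinearMap.range (Q.symbol j)) : r * s ∈ LinearMap.range (Q.symbol (i + j)) := by
  obtain ⟨a, rfl⟩ := hr
  obtain ⟨b, rfl⟩ := hs
  exact ⟨_, Q.symbol_mul i j a b⟩

lemma degProj_mul (i : ℤ) {j : ℤ} (r : R) {s : R} (hs : s ∈ LinearMap.range (Q.symbol j)) :
    degProj Q i (r * s) = degProj Q (i - j) r * s := by
  refine induction_degree Q (p := fun r => degProj Q i (r * s) = degProj Q (i - j) r * s)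
    (fun k r hr => ?_) (by simp) (fun r r' h h' => ?_) r
  · rw [degProj_of_mem hr, degProj_of_mem (mul_mem_range hr hs), ite_mul, zero_mul]
    exact if_congr (by constructor <;> intro <;> lia) rfl rfl
  · rw [add_mul, map_add, h, h', map_add, add_mul]

lemma smul_mem_range (g : G) {i : ℤ} {r : R} (hr : r ∈ LinearMap.range (Q.symbol i)) :
    g • r ∈ LinearMap.range (Q.symbol i) := by
  obtain ⟨a, rfl⟩ := hr
  exact ⟨_, Q.symbol_smul g i a⟩

lemma degProj_smul (g : G) (i : ℤ) (r : R) : degProj Q i (g • r) = g • degProj Q i r := by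
  refine induction_degree Q (p := fun r => degProj Q i (g • r) = g • degProj Q i r)
    (fun k r hr => ?_) (by simp) (fun r r' h h' => ?_) r
  · rw [degProj_of_mem hr, degProj_of_mem (smul_mem_range g hr)]
    split_ifs <;> simp
  · rw [smul_add, map_add, map_add, h, h', smul_add]

variable (Q) (θ : G →* ℂˣ)

/-- The semi-invariants of `A` of weight `γ.1` and filtration `γ.2`. -/
def biA (γ : ℤ × ℤ) : Submodule ℂ A :=
  semi (Representation.ofDistribMulAction ℂ G A) (wtChar θ γ.1) ⊓ Q.F γ.2

variable {Q θ}

lemma mem_biA {γ : ℤ × ℤ} {a : A} :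
    a ∈ biA Q θ γ ↔ (∀ g : G, g • a = (wtChar θ γ.1 g : ℂ) • a) ∧ a ∈ Q.F γ.2 := Iff.rfl

lemma one_mem_biA : (1 : A) ∈ biA Q θ 0 := mem_biA.2 ⟨fun g => by simp [wtChar_zero], Q.one_mem⟩

lemma mul_mem_biA {γ δ : ℤ × ℤ} {a b : A} (ha : a ∈ biA Q θ γ) (hb : b ∈ biA Q θ δ) :
    a * b ∈ biA Q θ (γ + δ) := mem_biA.2 ⟨fun g => by
  rw [smul_mul', (mem_biA.1 ha).1 g, (mem_biA.1 hb).1 g, smul_mul_smul_comm, Prod.fst_add, wtChar_add]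
  simp, Q.mul_mem ha.2 hb.2⟩

lemma pow_mem_biA {γ : ℤ × ℤ} {a : A} (ha : a ∈ biA Q θ γ) (n : ℕ) : a ^ n ∈ biA Q θ (n • γ) := by
  induction n with
  | zero => simpa using one_mem_biA
  | succ n ih => rw [pow_succ, succ_nsmul]; exact mul_mem_biA ih ha

lemma isStable_F (i : ℤ) : IsStable (Representation.ofDistribMulAction ℂ G A) (Q.F i) :=
  fun g _ h => Q.smul_mem g h

lemma isStable_range (i : ℤ) :
    IsStable (Representation.ofDistribMulAction ℂ G R) (LinearMap.range (Q.symbol i)) :=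
  fun g _ h => smul_mem_range g h

/-- Reductivity enters here: the symbol map is equivariant, so semi-invariant symbols are symbols of
semi-invariants. -/
lemma exists_lift_biA (hG : IsReductive G) {γ : ℤ × ℤ} {r : R}
    (hr : r ∈ semi (Representation.ofDistribMulAction ℂ G R) (wtChar θ γ.1))
    (hr' : r ∈ LinearMap.range (Q.symbol γ.2)) : ∃ a ∈ biA Q θ γ, sym Q γ.2 a = r := by
  obtain ⟨a, rfl⟩ := hr'
  obtain ⟨a', ha', h⟩ := exists_semi_lift hG Q.rational W.rational (isStable_F γ.2) (Q.symbol γ.2)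
    (fun g v => (Q.symbol_smul g γ.2 v).symm) a hr
  exact ⟨a', ⟨ha', a'.2⟩, (sym_eq a'.2).trans h⟩

lemma sym_mem_semi {γ : ℤ × ℤ} {a : A} (ha : a ∈ biA Q θ γ) :
    sym Q γ.2 a ∈ semi (Representation.ofDistribMulAction ℂ G R) (wtChar θ γ.1) := fun g => by
  rw [sym_eq ha.2, Representation.ofDistribMulAction_apply_apply, ← Q.symbol_smul, ← map_smul]
  congr 1
  exact Subtype.ext ((mem_biA.1 ha).1 g)

lemma sym_mem_range {i : ℤ} {a : A} (ha : a ∈ Q.F i) : sym Q i a ∈ LinearMap.range (Q.symbol i) := by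
  rw [sym_eq ha]; exact ⟨_, rfl⟩

variable (Q θ)

/-- The bigrading of `R` by symbols of semi-invariants. -/
def grRing (hG : IsReductive G) : GrRing R where
  deg γ :=
    { carrier := {r | ∃ a ∈ biA Q θ γ, sym Q γ.2 a = r}
      zero_mem' := ⟨0, zero_mem _, sym_zero _⟩
      add_mem' := by
        rintro _ _ ⟨a, ha, rfl⟩ ⟨b, hb, rfl⟩
        exact ⟨a + b, add_mem ha hb, sym_add ha.2 hb.2⟩
      neg_mem' := by
        rintro _ ⟨a, ha, rfl⟩
        exact ⟨-a, neg_mem ha, sym_neg ha.2⟩ }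
  proj γ := ((semiProj hG W.rational (wtChar θ γ.1)) ∘ₗ degProj Q γ.2).toAddMonoidHom
  one_mem := ⟨1, one_mem_biA, sym_one⟩
  mul_mem := by
    rintro γ δ _ _ ⟨a, ha, rfl⟩ ⟨b, hb, rfl⟩
    exact ⟨a * b, mul_mem_biA ha hb, sym_mul ha.2 hb.2⟩
  proj_mem γ r := exists_lift_biA hG (semiProj_mem hG W.rational _ _)
    (semiProj_mem_of_isStable hG W.rational _ (isStable_range γ.2) (degProj_mem Q γ.2 r))
  proj_mul := by
    rintro γ δ r _ ⟨a, ha, rfl⟩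
    change semiProj hG W.rational _ (degProj Q γ.2 (r * _)) = semiProj hG W.rational _ _ * _
    rw [degProj_mul _ _ (sym_mem_range ha.2)]
    refine semiProj_map hG W.rational W.rational (η := wtChar θ δ.1) ?_
      (LinearMap.mulRight ℂ (sym Q δ.2 a)) (fun g v => ?_) _
    · rw [← wtChar_add]; congr 1; simp
    · have := sym_mem_semi ha g
      simp only [Representation.ofDistribMulAction_apply_apply, LinearMap.mulRight_apply] at this ⊢
      rw [smul_mul', this, mul_smul_comm]
  proj_of_mem := by
    rintro γ _ ⟨a, ha, rfl⟩
    change semiProj hG W.rational _ (degProj Q γ.2 _) = _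
    rw [degProj_of_mem (sym_mem_range ha.2), if_pos rfl, semiProj_of_mem _ _ (sym_mem_semi ha)]

end Symbols

/-! ### Tuples of elements of a filtered quantization -/

section Tuples

variable {G : Type u} [Group G] [AffineAlgebraicGroup G]
variable {R : Type u} [CommRing R] [Algebra ℂ R] [MulSemiringAction G R] [SMulCommClass G ℂ R]
  {W : HamiltonianSpace G R}
variable {A : Type u} [Ring A] [Algebra ℂ A] [MulSemiringAction G A] [SMulCommClass G ℂ A]
  (Q : FilteredQuantization W A) (θ : G →* ℂˣ)

variable (G) in
/-- The representation given by an action. -/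
abbrev actRep (V : Type*) [AddCommGroup V] [Module ℂ V] [DistribMulAction G V] [SMulCommClass G ℂ V] :
    Representation ℂ G V := Representation.ofDistribMulAction ℂ G V

lemma sym_smul {i : ℤ} {a : A} (ha : a ∈ Q.F i) (c : ℂ) : sym Q i (c • a) = c • sym Q i a := by
  rw [sym_eq ha, sym_eq (Submodule.smul_mem _ c ha), ← map_smul]
  rfl

lemma sym_act {i : ℤ} {a : A} (ha : a ∈ Q.F i) (g : G) : sym Q i (g • a) = g • sym Q i a := by
  rw [sym_eq ha, sym_eq (Q.smul_mem g ha)]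
  exact Q.symbol_smul g i ⟨a, ha⟩

variable {κ τ : Type*} [Fintype κ] [DecidableEq κ] [Fintype τ] [DecidableEq τ]
  (r : MatRep G κ) (δ : κ → ℤ)

/-- The filtration of the free module with shifts `δ`. -/
def filtK (e : ℤ) : Submodule ℂ (κ → A) := Submodule.pi Set.univ fun v => Q.F (e - δ v)

variable {Q δ} in
lemma mem_filtK {e : ℤ} {x : κ → A} : x ∈ filtK Q δ e ↔ ∀ v, x v ∈ Q.F (e - δ v) := by
  simp [filtK]

/-- The symbols of a tuple. -/
def symK (e : ℤ) (x : κ → A) : κ → R := fun v => sym Q (e - δ v) (x v)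

/-- The semi-invariant tuples of weight `γ.1` and filtration `γ.2`. -/
def biK (γ : ℤ × ℤ) : Submodule ℂ (κ → A) :=
  semi (tupleRep r (actRep G A)) (wtChar θ γ.1) ⊓ filtK Q δ γ.2

variable {Q δ}

lemma symK_add {e : ℤ} {x y : κ → A} (hx : x ∈ filtK Q δ e) (hy : y ∈ filtK Q δ e) :
    symK Q δ e (x + y) = symK Q δ e x + symK Q δ e y :=
  funext fun v => sym_add (mem_filtK.1 hx v) (mem_filtK.1 hy v)

lemma symK_sub {e : ℤ} {x y : κ → A} (hx : x ∈ filtK Q δ e) (hy : y ∈ filtK Q δ e) :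
    symK Q δ e (x - y) = symK Q δ e x - symK Q δ e y :=
  funext fun v => sym_sub (mem_filtK.1 hx v) (mem_filtK.1 hy v)

lemma symK_zero (e : ℤ) : symK Q δ e (0 : κ → A) = 0 := funext fun _ => sym_zero _

lemma symK_neg {e : ℤ} {x : κ → A} (hx : x ∈ filtK Q δ e) : symK Q δ e (-x) = - symK Q δ e x :=
  funext fun v => sym_neg (mem_filtK.1 hx v)

lemma symK_eq_zero {e : ℤ} {x : κ → A} (hx : x ∈ filtK Q δ e) :
    symK Q δ e x = 0 ↔ x ∈ filtK Q δ (e - 1) := by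
  rw [mem_filtK, funext_iff]
  refine forall_congr' fun v => ?_
  rw [sub_right_comm]
  exact sym_eq_zero (mem_filtK.1 hx v)

lemma symK_smul {i e : ℤ} {a : A} {x : κ → A} (ha : a ∈ Q.F i) (hx : x ∈ filtK Q δ e) :
    symK Q δ (i + e) (a • x) = sym Q i a • symK Q δ e x :=
  funext fun v => by
    change sym Q (i + e - δ v) (a * x v) = sym Q i a * sym Q _ (x v)
    rw [add_sub_assoc, sym_mul ha (mem_filtK.1 hx v)]

lemma smul_mem_filtK {i e : ℤ} {a : A} {x : κ → A} (ha : a ∈ Q.F i) (hx : x ∈ filtK Q δ e) :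
    a • x ∈ filtK Q δ (i + e) := mem_filtK.2 fun v => by
  rw [add_sub_assoc]
  exact Q.mul_mem ha (mem_filtK.1 hx v)

lemma filtK_mono {e e' : ℤ} (h : e ≤ e') : filtK Q δ e ≤ filtK Q δ e' := fun _ hx =>
  mem_filtK.2 fun v => Q.mono (by lia) (mem_filtK.1 hx v)

lemma exists_mem_filtK (x : κ → A) : ∃ e, x ∈ filtK Q δ e := by
  choose i hi using fun v => Q.exhaustive (x v)
  obtain ⟨N, hN⟩ := Finset.exists_le (Finset.univ.image fun v => i v + δ v)
  exact ⟨N, mem_filtK.2 fun v => Q.mono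
    (by have := hN _ (Finset.mem_image_of_mem _ (Finset.mem_univ v)); lia) (hi v)⟩

lemma exists_filtK_eq_zero : ∃ e₀ : ℤ, ∀ x ∈ filtK Q δ e₀, x = 0 := by
  obtain ⟨N, hN⟩ := Finset.exists_le (Finset.univ.image fun v => - δ v)
  refine ⟨- N - 1, fun x hx => funext fun v => ?_⟩
  have h := mem_filtK.1 hx v
  have := hN _ (Finset.mem_image_of_mem _ (Finset.mem_univ v))
  rw [Q.neg _ (by lia)] at h
  exact h

lemma tupleRep_smul {V : Type*} [AddCommGroup V] [Module ℂ V] {S : Type*} [Ring S] [Algebra ℂ S]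
    [MulSemiringAction G S] [SMulCommClass G ℂ S] [Module S V] [IsScalarTower ℂ S V]
    {ρ : Representation ℂ G V} (hρ : ∀ g (a : S) v, ρ g (a • v) = (g • a) • ρ g v)
    (g : G) (a : S) (x : κ → V) : tupleRep r ρ g (a • x) = (g • a) • tupleRep r ρ g x :=
  funext fun b => by
    have : SMulCommClass ℂ S V := inferInstance
    simp only [tupleRep_apply, Pi.smul_apply, hρ, Finset.smul_sum]
    exact Finset.sum_congr rfl fun c _ => smul_comm _ _ _

lemma actRep_mul {S : Type*} [Ring S] [Algebra ℂ S] [MulSemiringAction G S] [SMulCommClass G ℂ S]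
    (g : G) (a b : S) : actRep G S g (a • b) = (g • a) • actRep G S g b := smul_mul' g a b

variable {r θ}

lemma smul_mem_semi {S : Type*} [Ring S] [Algebra ℂ S] [MulSemiringAction G S] [SMulCommClass G ℂ S]
    {k l : ℤ} {a : S} {x : κ → S} (ha : a ∈ semi (actRep G S) (wtChar θ k))
    (hx : x ∈ semi (tupleRep r (actRep G S)) (wtChar θ l)) :
    a • x ∈ semi (tupleRep r (actRep G S)) (wtChar θ (k + l)) := fun g => by
  rw [tupleRep_smul r actRep_mul, show g • a = _ from ha g, hx g, wtChar_add]
  funext b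
  simp [smul_smul, mul_comm]

lemma smul_mem_biK {β γ : ℤ × ℤ} {a : A} {x : κ → A} (ha : a ∈ biA Q θ β) (hx : x ∈ biK Q θ r δ γ) :
    a • x ∈ biK Q θ r δ (β + γ) :=
  ⟨smul_mem_semi ha.1 hx.1, smul_mem_filtK ha.2 hx.2⟩

variable (hδ : ∀ g a b, r.hom g b a ≠ 0 → δ a = δ b)
include hδ

/-- The condition `hδ` says that the matrices of `r` mix only generators with equal degree shifts.
-/
lemma isStable_filtK (e : ℤ) : IsStable (tupleRep r (actRep G A)) (filtK Q δ e) := fun g x hx =>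
  mem_filtK.2 fun b => sum_mem fun a _ => by
    by_cases h : r.hom g b a = 0
    · rw [h, zero_smul]; exact zero_mem _
    · rw [← hδ g a b h]
      exact Submodule.smul_mem _ _ (Q.smul_mem g (mem_filtK.1 hx a))

lemma symK_tupleRep {e : ℤ} {x : κ → A} (hx : x ∈ filtK Q δ e) (g : G) :
    symK Q δ e (tupleRep r (actRep G A) g x) = tupleRep r (actRep G R) g (symK Q δ e x) :=
  funext fun b => by
    have key : ∀ a, r.hom g b a • actRep G A g (x a) ∈ Q.F (e - δ b) ∧
        sym Q (e - δ b) (r.hom g b a • actRep G A g (x a)) =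
          r.hom g b a • actRep G R g (symK Q δ e x a) := fun a => by
      by_cases h : r.hom g b a = 0
      · rw [h, zero_smul, zero_smul]; exact ⟨zero_mem _, sym_zero _⟩
      · rw [← hδ g a b h]
        have := Q.smul_mem g (mem_filtK.1 hx a)
        refine ⟨Submodule.smul_mem _ _ this, (sym_smul Q this _).trans (congrArg _ ?_)⟩
        exact sym_act Q (mem_filtK.1 hx a) g
    change sym Q (e - δ b) (∑ a, _) = ∑ a, _
    rw [sym_sum _ fun a _ => (key a).1]
    exact Finset.sum_congr rfl fun a _ => (key a).2

lemma symK_mem_semi {γ : ℤ × ℤ} {x : κ → A} (hx : x ∈ biK Q θ r δ γ) :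
    symK Q δ γ.2 x ∈ semi (tupleRep r (actRep G R)) (wtChar θ γ.1) := fun g => by
  rw [← symK_tupleRep hδ hx.2, hx.1 g]
  exact funext fun v => sym_smul Q (mem_filtK.1 hx.2 v) _

variable (Q θ)

/-- The bigraded module of symbols of tuples. -/
def grMod (hG : IsReductive G) : GrMod (grRing Q θ hG) (κ → R) where
  deg γ :=
    { carrier := {y | ∃ x ∈ biK Q θ r δ γ, symK Q δ γ.2 x = y}
      zero_mem' := ⟨0, zero_mem _, symK_zero _⟩
      add_mem' := by
        rintro _ _ ⟨a, ha, rfl⟩ ⟨b, hb, rfl⟩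
        exact ⟨a + b, add_mem ha hb, symK_add ha.2 hb.2⟩
      neg_mem' := by
        rintro _ ⟨a, ha, rfl⟩
        exact ⟨-a, neg_mem ha, symK_neg ha.2⟩ }
  proj γ := (semiProj hG (isRational_tupleRep r W.rational) (wtChar θ γ.1) ∘ₗ
    LinearMap.pi fun v => degProj Q (γ.2 - δ v) ∘ₗ LinearMap.proj v).toAddMonoidHom
  proj_smul := by
    rintro γ β c _ ⟨x, hx, rfl⟩
    change semiProj hG (isRational_tupleRep r W.rational) _
        (fun v => degProj Q (γ.2 - δ v) (c * sym Q (β.2 - δ v) (x v))) =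
      semiProj hG W.rational _ (degProj Q (γ.2 - β.2) c) • symK Q δ β.2 x
    have e : (fun v => degProj Q (γ.2 - δ v) (c * sym Q (β.2 - δ v) (x v))) =
        degProj Q (γ.2 - β.2) c • symK Q δ β.2 x := funext fun v => by
      rw [degProj_mul _ _ (sym_mem_range (mem_filtK.1 hx.2 v)), sub_sub_sub_cancel_right]
      rfl
    rw [e]
    refine semiProj_map hG W.rational (isRational_tupleRep r W.rational) (η := wtChar θ β.1) ?_
      (LinearMap.toSpanSingleton R (κ → R) (symK Q δ β.2 x) |>.restrictScalars ℂ) (fun g v => ?_) _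
    · rw [← wtChar_add]; congr 1; simp
    · change tupleRep r (actRep G R) g (v • _) = _ • (g • v) • symK Q δ β.2 x
      rw [tupleRep_smul r actRep_mul, symK_mem_semi hδ hx g, smul_comm]
  proj_of_mem := by
    rintro γ _ ⟨x, hx, rfl⟩
    change semiProj hG (isRational_tupleRep r W.rational) _ (fun v => degProj Q (γ.2 - δ v) (sym Q (γ.2 - δ v) (x v))) = _
    have e : (fun v => degProj Q (γ.2 - δ v) (sym Q (γ.2 - δ v) (x v))) = symK Q δ γ.2 x :=
      funext fun v => by rw [degProj_of_mem (sym_mem_range (mem_filtK.1 hx.2 v)), if_pos rfl]; rfl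
    rw [e, semiProj_of_mem _ _ (symK_mem_semi hδ hx)]

/-- The bigraded module of symbols of a submodule. -/
def grSub (hG : IsReductive G) (L : Submodule A (κ → A)) : GrSub (grMod Q θ hδ hG) where
  part γ :=
    { carrier := {y | ∃ x ∈ biK Q θ r δ γ, x ∈ L ∧ symK Q δ γ.2 x = y}
      zero_mem' := ⟨0, zero_mem _, zero_mem _, symK_zero _⟩
      add_mem' := by
        rintro _ _ ⟨a, ha, ha', rfl⟩ ⟨b, hb, hb', rfl⟩
        exact ⟨a + b, add_mem ha hb, add_mem ha' hb', symK_add ha.2 hb.2⟩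
      neg_mem' := by
        rintro _ ⟨a, ha, ha', rfl⟩
        exact ⟨-a, neg_mem ha, neg_mem ha', symK_neg ha.2⟩ }
  le γ := by
    rintro _ ⟨a, ha, ha', rfl⟩
    exact ⟨a, ha, rfl⟩
  smul_mem := by
    rintro γ β _ _ ⟨a, ha, rfl⟩ ⟨x, hx, hxL, rfl⟩
    rw [add_comm]
    exact ⟨a • x, smul_mem_biK ha hx, L.smul_mem a hxL, symK_smul ha.2 hx.2⟩

variable {Q θ}

/-- Subtract from `x` an element of `L` with the same symbol and repeat. The filtration order drops
each time, and it is bounded below on tuples. -/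
lemma mem_of_part_le (hG : IsReductive G) {L L' : Submodule A (κ → A)} (hL : L ≤ L') {k : ℤ}
    (h : ∀ γ, k ≤ γ.1 → (grSub Q θ hδ hG L').part γ ≤ (grSub Q θ hδ hG L).part γ)
    {γ : ℤ × ℤ} (hγ : k ≤ γ.1) {x : κ → A} (hx : x ∈ biK Q θ r δ γ) (hxL : x ∈ L') : x ∈ L := by
  obtain ⟨e₀, he₀⟩ := exists_filtK_eq_zero (Q := Q) (δ := δ)
  obtain ⟨w, e⟩ := γ
  obtain ⟨N, hN⟩ : ∃ N : ℕ, e ≤ e₀ + N := ⟨(e - e₀).toNat, by lia⟩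
  induction N generalizing e x with
  | zero => rw [he₀ x (filtK_mono (by lia) hx.2)]; exact zero_mem _
  | succ N ih =>
    obtain ⟨y, hy, hyL, hxy⟩ := h _ hγ ⟨x, hx, hxL, rfl⟩
    have hs : x - y ∈ filtK Q δ (e - 1) := by
      refine (symK_eq_zero (sub_mem hx.2 hy.2)).1 ?_
      exact (symK_sub hx.2 hy.2).trans (sub_eq_zero.2 hxy.symm)
    have := ih (x := x - y) (sub_mem hxL (hL hyL)) (e - 1) hγ ⟨sub_mem hx.1 hy.1, hs⟩ (by lia)
    have h' := add_mem this hyL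
    rwa [sub_add_cancel] at h'

end Tuples

section Generators

variable {R : Type*} [CommRing R] {𝒢 : GrRing R} {B : Type*} [AddCommGroup B] [Module R B]
  {ℬ : GrMod 𝒢 B}

variable (𝒢) in
/-- A bigraded ring as a module over itself. -/
def GrRing.self : GrMod 𝒢 R := ⟨𝒢.deg, 𝒢.proj, 𝒢.proj_mul, 𝒢.proj_of_mem⟩

lemma GrMod.exists_weight_generators [IsNoetherian R B] (part : ℤ × ℤ → Set B)
    (hle : ∀ γ, part γ ⊆ ℬ.deg γ) (n : ℤ) :
    ∃ (m : ℕ) (δ : Fin m → ℤ × ℤ) (x : Fin m → B), (∀ s, n ≤ (δ s).1 ∧ x s ∈ part (δ s)) ∧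
      ∀ γ, n ≤ γ.1 → ∀ y ∈ part γ,
        ∃ c : Fin m → R, (∀ s, c s ∈ 𝒢.deg (γ - δ s)) ∧ y = ∑ s, c s • x s := by
  have hfg : (Submodule.span R {x | ∃ γ : ℤ × ℤ, n ≤ γ.1 ∧ x ∈ part γ}).FG := IsNoetherian.noetherian _
  obtain ⟨t, ht, hspan⟩ := Submodule.fg_span_iff_fg_span_finset_subset _ |>.1 hfg
  choose δ hδ using fun s : Fin t.card => ht (t.equivFin.symm s).2
  refine ⟨t.card, δ, fun s => t.equivFin.symm s, hδ, fun γ hγ y hy => ?_⟩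
  refine GrMod.exists_coeff (ℬ := ℬ) δ _ (fun s => hle _ (hδ s).2) (hle _ hy) ?_
  have : Set.range (fun s => (t.equivFin.symm s : B)) = t := by
    ext z
    exact ⟨by rintro ⟨s, rfl⟩; exact (t.equivFin.symm s).2,
      fun hz => ⟨t.equivFin ⟨z, hz⟩, by simp⟩⟩
  rw [this, ← hspan]
  exact Submodule.subset_span ⟨γ, hγ, hy⟩

end Generators

/-! ### Torsion with respect to semi-invariants of large weight. -/

section Torsion

variable {G : Type u} [Group G] [AffineAlgebraicGroup G]
variable {R : Type u} [CommRing R] [Algebra ℂ R] [MulSemiringAction G R] [SMulCommClass G ℂ R]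
  {W : HamiltonianSpace G R}
variable {A : Type u} [Ring A] [Algebra ℂ A] [MulSemiringAction G A] [SMulCommClass G ℂ A]
  {Q : FilteredQuantization W A} {θ : G →* ℂˣ}
variable {κ τ : Type*} [Fintype κ] [DecidableEq κ] [Fintype τ] [DecidableEq τ]
  {r : MatRep G κ} {δ : κ → ℤ}

lemma exists_generators_grRing (hG : IsReductive G) [IsNoetherianRing R] :
    ∃ (m : ℕ) (φ : Fin m → ℤ × ℤ) (f : Fin m → R), (∀ j, f j ∈ (grRing Q θ hG).deg (φ j)) ∧
      (∀ j, 1 ≤ (φ j).1) ∧ ∀ γ, 1 ≤ γ.1 → ∀ c ∈ (grRing Q θ hG).deg γ, c ∈ Ideal.span (Set.range f) := by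
  obtain ⟨m, φ, f, hf, hgen⟩ := GrMod.exists_weight_generators (ℬ := (grRing Q θ hG).self)
    (fun γ => (grRing Q θ hG).deg γ) (fun γ => subset_rfl) 1
  refine ⟨m, φ, f, fun j => (hf j).2, fun j => (hf j).1, fun γ hγ c hc => ?_⟩
  obtain ⟨a, -, rfl⟩ := hgen γ hγ c hc
  exact Ideal.sum_mem _ fun s _ => Ideal.mul_mem_left _ _ (Ideal.subset_span ⟨s, rfl⟩)

lemma sym_pow {β : ℤ × ℤ} {a : A} (ha : a ∈ biA Q θ β) (q : ℕ) :
    sym Q (q • β).2 (a ^ q) = sym Q β.2 a ^ q := by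
  induction q with
  | zero => simp only [zero_smul, pow_zero]; exact sym_one
  | succ q ih =>
    rw [pow_succ, pow_succ, ← ih, succ_nsmul]
    exact sym_mul (pow_mem_biA ha q).2 ha.2

/-- The hypothesis `h` is about approximate membership, in every order of the filtration. It makes
the symbols of `L'` torsion modulo the symbols of `L` for the finitely many generators of the graded
ring, and such torsion is bounded in weight. -/
lemma exists_part_le (hG : IsReductive G) [IsNoetherianRing R]
    (hδ : ∀ g a b, r.hom g b a ≠ 0 → δ a = δ b) {L L' : Submodule A (κ → A)}
    (hL : ∀ g, ∀ x ∈ L, tupleRep r (actRep G A) g x ∈ L) {n : ℤ}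
    (h : ∀ β : ℤ × ℤ, n ≤ β.1 → ∀ a ∈ biA Q θ β, ∀ e, ∀ x ∈ L', x ∈ filtK Q δ e →
      ∃ (N : ℕ), ∃ l ∈ L, a ^ N • x - l ∈ filtK Q δ ((N • β).2 + e - 1)) :
    ∃ k : ℤ, ∀ γ, k ≤ γ.1 → (grSub Q θ hδ hG L').part γ ≤ (grSub Q θ hδ hG L).part γ := by
  obtain ⟨m, φ, f, hf, hφ, hgen⟩ := exists_generators_grRing (Q := Q) (θ := θ) hG
  refine GrSub.exists_part_le_of_torsion hf hgen _ _ ?_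
  rintro j γ _ ⟨x, hx, hxL, rfl⟩
  obtain ⟨a, ha, hfa⟩ := (grRing Q θ hG).pow_mem (hf j) n.toNat
  have hn : n ≤ (n.toNat • φ j).1 := by
    rw [Prod.smul_fst, nsmul_eq_mul]
    have h1 := hφ j
    have h2 : n ≤ (n.toNat : ℤ) := Int.self_le_toNat n
    nlinarith
  obtain ⟨N, l, hl, hal⟩ := h _ hn a ha γ.2 x hxL hx.2
  refine ⟨n.toNat * N, ?_⟩
  rw [pow_mul, ← hfa, ← sym_pow ha, mul_comm, mul_smul, add_comm]
  have hb := pow_mem_biA ha N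
  have hax := smul_mem_biK hb hx
  have hrat := isRational_tupleRep r Q.rational
  -- The approximating element `l` need not be semi-invariant. Its projection still lies in the
  -- stable submodule `L`, and the error keeps its lower order since the filtration is stable.
  set p := semiProj hG hrat (wtChar θ (N • n.toNat • φ j + γ).1) with hp
  have hpl : p l ∈ L := semiProj_mem_of_isStable hG hrat _ (N := L.restrictScalars ℂ) hL hl
  have hpy : p (a ^ N • x - l) ∈ filtK Q δ ((N • n.toNat • φ j + γ).2 - 1) :=
    semiProj_mem_of_isStable hG hrat _ (isStable_filtK hδ _) hal
  have hsum : p l = a ^ N • x - p (a ^ N • x - l) := by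
    rw [map_sub, hp, semiProj_of_mem hG hrat hax.1]
    abel
  have hpy' := filtK_mono (show (N • n.toNat • φ j + γ).2 - 1 ≤ (N • n.toNat • φ j + γ).2 by lia) hpy
  refine ⟨p l, ⟨semiProj_mem hG hrat _ _, ?_⟩, hpl, ?_⟩
  · rw [hsum]; exact sub_mem hax.2 hpy'
  · rw [hsum, symK_sub hax.2 hpy', (symK_eq_zero hpy').2 hpy, sub_zero]
    exact symK_smul hb.2 hx.2

/-- Tuples of elements of a submodule of `κ → A`. -/
def tupleSub (τ : Type*) (L : Submodule A (κ → A)) : Submodule A (κ × τ → A) where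
  carrier := {X | ∀ t, (fun v => X (v, t)) ∈ L}
  zero_mem' _ := L.zero_mem
  add_mem' hX hY t := L.add_mem (hX t) (hY t)
  smul_mem' a _ hX t := L.smul_mem a (hX t)

lemma tupleRep_tensor (r : MatRep G κ) (s : MatRep G τ) {V : Type*} [AddCommGroup V] [Module ℂ V]
    (ρ : Representation ℂ G V) (g : G) (X : κ × τ → V) (b : κ) (t : τ) :
    tupleRep (r.tensor s) ρ g X (b, t) =
      ∑ t', s.hom g t t' • tupleRep r ρ g (fun v => X (v, t')) b := by
  rw [tupleRep_apply, Fintype.sum_prod_type, Finset.sum_comm]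
  refine Finset.sum_congr rfl fun t' _ => ?_
  rw [tupleRep_apply, Finset.smul_sum]
  refine Finset.sum_congr rfl fun a _ => ?_
  rw [MatRep.tensor_apply, smul_smul, mul_comm]

lemma tupleRep_mem_tupleSub {L : Submodule A (κ → A)}
    (hL : ∀ g, ∀ x ∈ L, tupleRep r (actRep G A) g x ∈ L) (s : MatRep G τ) (g : G) (X : κ × τ → A)
    (hX : X ∈ tupleSub τ L) : tupleRep (r.tensor s) (actRep G A) g X ∈ tupleSub τ L := fun t => by
  have e : (fun v => tupleRep (r.tensor s) (actRep G A) g X (v, t)) =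
      ∑ t', s.hom g t t' • tupleRep r (actRep G A) g (fun v => X (v, t')) := funext fun b => by
    rw [tupleRep_tensor]; simp
  rw [e]
  exact sum_mem fun t' _ => (L.restrictScalars ℂ).smul_mem _ (hL g _ (hX t'))

/-- A basis of a finite-dimensional representation is an invariant of its product with the dual. -/
lemma tupleRep_dual_basis {V : Type*} [AddCommGroup V] [Module ℂ V] (ρ : Representation ℂ G V)
    {s : MatRep G τ} {v : τ → κ → V}
    (hv : ∀ g a, tupleRep r ρ g (v a) = ∑ b, s.hom g b a • v b) (g : G) :
    tupleRep (r.tensor s.dual) ρ g (fun p => v p.2 p.1) = fun p => v p.2 p.1 := by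
  funext ⟨b, t⟩
  rw [tupleRep_tensor]
  simp only [hv]
  have e : ∀ x, (∑ y, s.hom g y x • v y) b = ∑ y, s.hom g y x • v y b := fun x => by simp
  simp only [e, Finset.smul_sum, smul_smul]
  rw [Finset.sum_comm]
  simp only [← Finset.sum_smul]
  have h1 : ∀ y, ∑ x, s.dual.hom g t x * s.hom g y x = (1 : Matrix τ τ ℂ) y t := fun y => by
    have : s.hom g * s.hom g⁻¹ = 1 := by rw [← map_mul]; simp
    rw [← this, Matrix.mul_apply]
    exact Finset.sum_congr rfl fun x _ => mul_comm _ _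
  simp only [h1, Matrix.one_apply, ite_smul, one_smul, zero_smul]
  simp

/-- For semi-invariant elements this is `exists_part_le` with `mem_of_part_le`. A general `x`
generates a finite-dimensional representation, and a basis of it, seen as an element of its product
with the dual, is invariant. Applying the graded statement to tuples multiplies the whole basis, and
hence `x`, into `L`. -/
theorem exists_smul_mem (hG : IsReductive G) [IsNoetherianRing R]
    (hδ : ∀ g a b, r.hom g b a ≠ 0 → δ a = δ b) {L L' : Submodule A (κ → A)} (hLL : L ≤ L')
    (hL : ∀ g, ∀ x ∈ L, tupleRep r (actRep G A) g x ∈ L)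
    (hL' : ∀ g, ∀ x ∈ L', tupleRep r (actRep G A) g x ∈ L') {n : ℤ}
    (h : ∀ β : ℤ × ℤ, n ≤ β.1 → ∀ a ∈ biA Q θ β, ∀ e, ∀ x ∈ L', x ∈ filtK Q δ e →
      ∃ (N : ℕ), ∃ l ∈ L, a ^ N • x - l ∈ filtK Q δ ((N • β).2 + e - 1)) (x : κ → A) (hx : x ∈ L') :
    ∃ k : ℤ, ∀ β : ℤ × ℤ, k ≤ β.1 → ∀ a ∈ biA Q θ β, a • x ∈ L := by
  obtain ⟨d, v, s, -, hv, hspan⟩ := exists_matRep (isRational_tupleRep r Q.rational)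
    (Set.finite_singleton x)
  have hvL : ∀ t, v t ∈ L' := fun t => by
    have h1 : v t ∈ orbitSpan (tupleRep r (actRep G A)) {x} := hspan ▸ Submodule.subset_span ⟨t, rfl⟩
    exact orbitSpan_le (N := L'.restrictScalars ℂ) hL' (by simpa using hx) h1
  have hδ' : ∀ g (a b : κ × Fin d), (r.tensor s.dual).hom g b a ≠ 0 → δ a.1 = δ b.1 :=
    fun g a b hab => hδ g _ _ (left_ne_zero_of_mul hab)
  obtain ⟨k, hk⟩ := exists_part_le (Q := Q) (θ := θ) hG hδ' (L := tupleSub (Fin d) L)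
    (L' := tupleSub (Fin d) L') (tupleRep_mem_tupleSub hL s.dual) (n := n)
    fun β hβ a ha e X hX hXe => by
      choose N l hl hle using fun t => h β hβ a ha e _ (hX t) (mem_filtK.2 fun v => mem_filtK.1 hXe (v, t))
      obtain ⟨T, hT⟩ := Finset.exists_le (Finset.univ.image N)
      choose d hd using fun t => Nat.exists_eq_add_of_le'
        (hT _ (Finset.mem_image_of_mem N (Finset.mem_univ t)))
      refine ⟨T, fun p => (a ^ d p.2 • l p.2) p.1, fun t => L.smul_mem (a ^ d t) (hl t), mem_filtK.2 fun p => ?_⟩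
      have h1 := mem_filtK.1 (smul_mem_filtK (pow_mem_biA ha (d p.2)).2 (hle p.2)) p.1
      rw [smul_sub, smul_smul, ← pow_add, ← hd] at h1
      refine Q.mono ?_ h1
      have h2 : (T • β).2 = (d p.2 • β).2 + (N p.2 • β).2 := by
        rw [← Prod.snd_add, ← add_smul, ← hd]
      rw [h2]
      lia
  obtain ⟨e, he⟩ := exists_mem_filtK (Q := Q) (δ := fun p : κ × Fin d => δ p.1) fun p => v p.2 p.1
  refine ⟨k, fun β hβ a ha => ?_⟩
  have hX : (fun p => v p.2 p.1) ∈ biK Q θ (r.tensor s.dual) (fun p : κ × Fin d => δ p.1) (0, e) :=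
    ⟨fun g => by rw [tupleRep_dual_basis _ hv]; simp [wtChar_zero], he⟩
  have haX := mem_of_part_le hδ' hG (L := tupleSub (Fin d) L) (L' := tupleSub (Fin d) L')
    (fun X hX t => hLL (hX t)) hk (by simpa using hβ) (smul_mem_biK ha hX)
    (Submodule.smul_mem _ _ fun t => hvL t)
  have hxs : x ∈ Submodule.span ℂ (Set.range v) := hspan ▸ subset_orbitSpan _ (Set.mem_singleton x)
  obtain ⟨c, rfl⟩ := (Submodule.mem_span_range_iff_exists_fun ℂ).1 hxs
  rw [Finset.smul_sum]
  refine sum_mem fun t _ => ?_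
  rw [smul_comm]
  exact (L.restrictScalars ℂ).smul_mem _ (haX t)

/-! ### Torsion elements of equivariant modules -/

variable {M : Type*} [AddCommGroup M] [Module A M] [Module ℂ M] [IsScalarTower ℂ A M]
  {ρ : Representation ℂ G M}

variable (Q θ) in
/-- Elements killed by all semi-invariants of large weight. -/
def IsTors (m : M) : Prop := ∃ k : ℤ, ∀ β : ℤ × ℤ, k ≤ β.1 → ∀ a ∈ biA Q θ β, a • m = 0

lemma IsTors.zero : IsTors Q θ (0 : M) := ⟨0, fun _ _ a _ => smul_zero a⟩

lemma IsTors.add {m m' : M} (h : IsTors Q θ m) (h' : IsTors Q θ m') : IsTors Q θ (m + m') := by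
  obtain ⟨k, hk⟩ := h
  obtain ⟨k', hk'⟩ := h'
  refine ⟨max k k', fun β hβ a ha => ?_⟩
  rw [smul_add, hk β (by lia) a ha, hk' β (by lia) a ha, add_zero]

lemma IsTors.smulC {m : M} (h : IsTors Q θ m) (c : ℂ) : IsTors Q θ (c • m) := by
  obtain ⟨k, hk⟩ := h
  refine ⟨k, fun β hβ a ha => ?_⟩
  have : SMulCommClass ℂ A M := inferInstance
  rw [smul_comm, hk β hβ a ha, smul_zero]

lemma IsTors.rep (hρ : ∀ g (a : A) m, ρ g (a • m) = (g • a) • ρ g m) {m : M} (h : IsTors Q θ m)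
    (g : G) : IsTors Q θ (ρ g m) := by
  obtain ⟨k, hk⟩ := h
  refine ⟨k, fun β hβ a ha => ?_⟩
  have h1 := hρ g (g⁻¹ • a) m
  rw [smul_inv_smul, (mem_biA.1 ha).1 g⁻¹, smul_assoc, hk β hβ a ha, smul_zero, map_zero] at h1
  exact h1.symm

lemma IsTors.map {M' : Type*} [AddCommGroup M'] [Module A M'] (f : M →+ M')
    (hf : ∀ (a : A) m, f (a • m) = a • f m) {m : M} (h : IsTors Q θ m) : IsTors Q θ (f m) := by
  obtain ⟨k, hk⟩ := h
  exact ⟨k, fun β hβ a ha => by rw [← hf, hk β hβ a ha, map_zero]⟩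

/-- The relations between elements of a module. -/
def relSub (v : κ → M) : Submodule A (κ → A) :=
  LinearMap.ker (Fintype.linearCombination A v)

lemma mem_relSub {v : κ → M} {x : κ → A} : x ∈ relSub v ↔ ∑ a, x a • v a = 0 := by
  simp [relSub, Fintype.linearCombination_apply]

lemma linearCombination_tupleRep (hρ : ∀ g (a : A) m, ρ g (a • m) = (g • a) • ρ g m) {v : κ → M}
    (hv : ∀ g a, ρ g (v a) = ∑ b, r.hom g b a • v b) (g : G) (x : κ → A) :
    ∑ b, tupleRep r (actRep G A) g x b • v b = ρ g (∑ a, x a • v a) := by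
  rw [map_sum]
  simp only [hρ, hv, tupleRep_apply, Finset.sum_smul, Finset.smul_sum]
  rw [Finset.sum_comm]
  refine Finset.sum_congr rfl fun a _ => Finset.sum_congr rfl fun b _ => ?_
  have : SMulCommClass ℂ A M := inferInstance
  rw [smul_assoc, smul_comm]
  rfl

lemma tupleRep_mem_relSub (hρ : ∀ g (a : A) m, ρ g (a • m) = (g • a) • ρ g m) {v : κ → M}
    (hv : ∀ g a, ρ g (v a) = ∑ b, r.hom g b a • v b) (g : G) (x : κ → A) (hx : x ∈ relSub v) :
    tupleRep r (actRep G A) g x ∈ relSub (A := A) v := by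
  rw [mem_relSub, linearCombination_tupleRep hρ hv, mem_relSub.1 hx, map_zero]

/-- Modulo lower order `a` commutes with the coefficients `x b` and agrees with an annihilator `y`
of `v b`. Thus `a • x` is approximated by the relation with entries `x b * y b`, and
`exists_smul_mem` turns approximation into membership in the relations. -/
lemma isTors_of_symbols (hG : IsReductive G) [IsNoetherianRing R]
    (hρ : ∀ g (a : A) m, ρ g (a • m) = (g • a) • ρ g m) {v : κ → M}
    (hv : ∀ g a, ρ g (v a) = ∑ b, r.hom g b a • v b) {n : ℤ}
    (h : ∀ β : ℤ × ℤ, n ≤ β.1 → ∀ a ∈ biA Q θ β, ∀ b, ∃ y ∈ Q.F β.2, y • v b = 0 ∧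
      a - y ∈ Q.F (β.2 - 1)) (x : κ → A) : IsTors Q θ (∑ a, x a • v a) := by
  obtain ⟨k, hk⟩ := exists_smul_mem (Q := Q) (θ := θ) (r := r) (δ := fun _ => 0) hG
    (fun _ _ _ _ => rfl) (L := relSub v) (L' := ⊤) le_top (tupleRep_mem_relSub hρ hv)
    (fun _ _ _ => Submodule.mem_top) (n := n) (fun β hβ a ha e x _ hx => by
      choose y hy hyv hya using h β hβ a ha
      refine ⟨1, fun b => x b * y b, mem_relSub.2 ?_, mem_filtK.2 fun b => ?_⟩
      · exact Finset.sum_eq_zero fun b _ => by rw [mul_smul, hyv, smul_zero]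
      · have h1 := commutator_mem ha.2 (mem_filtK.1 hx b)
        have h2 := Q.mul_mem (mem_filtK.1 hx b) (hya b)
        rw [one_smul, pow_one, show β.2 + e - 1 - 0 = β.2 + (e - 0) - 1 by lia]
        rw [show e - 0 + (β.2 - 1) = β.2 + (e - 0) - 1 by lia] at h2
        have := add_mem h1 h2
        have e : a * x b - x b * a + x b * (a - y b) = a * x b - x b * y b := by
          rw [mul_sub]; abel
        rwa [e] at this) x Submodule.mem_top
  refine ⟨k, fun β hβ a ha => ?_⟩
  rw [Finset.smul_sum]
  simpa only [Pi.smul_apply, smul_eq_mul, mul_smul] using mem_relSub.1 (hk β hβ a ha)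

/-- This is not immediate, since semi-invariants do not commute with `b`. The representation
generated by `m` consists of torsion elements, so a semi-invariant of large weight is itself an
annihilator of its basis and `isTors_of_symbols` applies. -/
lemma IsTors.smul (hG : IsReductive G) [IsNoetherianRing R] (hrat : IsRational ρ)
    (hρ : ∀ g (a : A) m, ρ g (a • m) = (g • a) • ρ g m) {m : M} (h : IsTors Q θ m) (b : A) :
    IsTors Q θ (b • m) := by
  obtain ⟨d, v, s, -, hv, hspan⟩ := exists_matRep hrat (Set.finite_singleton m)
  have hvt : ∀ t, IsTors Q θ (v t) := fun t => by
    let N : Submodule ℂ M :=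
      { carrier := {m | IsTors Q θ m}
        zero_mem' := IsTors.zero
        add_mem' := IsTors.add
        smul_mem' := fun c _ h => h.smulC c }
    have h1 : v t ∈ orbitSpan ρ {m} := hspan ▸ Submodule.subset_span ⟨t, rfl⟩
    exact orbitSpan_le (N := N) (fun g x hx => IsTors.rep hρ hx g) (Set.singleton_subset_iff.2 (show m ∈ N from h)) h1
  choose k hk using hvt
  obtain ⟨K, hK⟩ := Finset.exists_le (Finset.univ.image k)
  have hms : m ∈ Submodule.span ℂ (Set.range v) := hspan ▸ subset_orbitSpan _ (Set.mem_singleton m)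
  obtain ⟨c, rfl⟩ := (Submodule.mem_span_range_iff_exists_fun ℂ).1 hms
  have := isTors_of_symbols (Q := Q) (θ := θ) hG hρ hv (n := K) (fun β hβ a ha t =>
    ⟨a, ha.2, hk t β ((hK _ (Finset.mem_image_of_mem _ (Finset.mem_univ t))).trans hβ) a ha,
      by rw [sub_self]; exact zero_mem _⟩) (fun t => b * algebraMap ℂ A (c t))
  rw [Finset.smul_sum]
  simpa only [mul_smul, algebraMap_smul] using this

/-! ### Torsion and singular support -/

lemma mem_of_degProj_mem {I : Ideal R} {f : R} (h : ∀ e, degProj Q e f ∈ I) : f ∈ I := by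
  classical
  have : f = ∑ e ∈ ((degEquiv Q).symm f).support, degProj Q e f := by
    conv_lhs => rw [← (degEquiv Q).apply_symm_apply f]
    exact DirectSum.coeLinearMap_eq_dfinsuppSum _ _
  rw [this]
  exact Ideal.sum_mem _ fun e _ => h e

/-- The annihilator of `v` is a left ideal, so its symbols are stable under multiplication by
homogeneous elements. A homogeneous member of the ideal they generate is thus itself such a symbol.
-/
lemma exists_annihilator (v : M) {e : ℤ} {c : R} (hc : c ∈ LinearMap.range (Q.symbol e))
    (h : c ∈ Ideal.span {s | ∃ i, ∃ y ∈ Q.F i, y • v = 0 ∧ s = sym Q i y}) :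
    ∃ y ∈ Q.F e, y • v = 0 ∧ sym Q e y = c := by
  have key : ∀ c ∈ Ideal.span {s | ∃ i, ∃ y ∈ Q.F i, y • v = 0 ∧ s = sym Q i y},
      ∀ b : R, ∃ y ∈ Q.F e, y • v = 0 ∧ sym Q e y = degProj Q e (b * c) := by
    intro c hc
    induction hc using Submodule.span_induction with
    | mem x hx =>
      intro b
      obtain ⟨i, y, hy, hyv, rfl⟩ := hx
      obtain ⟨z, hz⟩ := degProj_mem Q (e - i) b
      have hzy := Q.mul_mem z.2 hy
      have hs := sym_mul z.2 hy
      rw [sub_add_cancel] at hzy hs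
      refine ⟨z.1 * y, hzy, by rw [mul_smul, hyv, smul_zero], ?_⟩
      rw [hs, degProj_mul _ _ (sym_mem_range hy), ← hz, sym_eq z.2]
    | zero => exact fun b => ⟨0, zero_mem _, zero_smul _ _, by rw [sym_zero, mul_zero, map_zero]⟩
    | add x x' _ _ h h' =>
      intro b
      obtain ⟨y, hy, hyv, hyx⟩ := h b
      obtain ⟨y', hy', hyv', hyx'⟩ := h' b
      exact ⟨y + y', add_mem hy hy', by rw [add_smul, hyv, hyv', add_zero],
        by rw [sym_add hy hy', hyx, hyx', mul_add, map_add]⟩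
    | smul b' x _ hx => exact fun b => by rw [smul_eq_mul, ← mul_assoc]; exact hx _
  obtain ⟨y, hy, hyv, hyc⟩ := key c h 1
  exact ⟨y, hy, hyv, by rw [hyc, one_mul, degProj_of_mem hc, if_pos rfl]⟩

/-- A function with `f (g x) = χ(g)^ℓ f(x)` has weight `ℓ` for `χ⁻¹`, which explains the inverse.
Its homogeneous components lift to semi-invariants of `A`; a power of the lift has weight large
enough to kill `m`, so the power of the component lies in the prime, and so does the component. -/
lemma singularSupport_subset_of_isTors {χ : G →* ℂˣ} (h : ∀ m : M, IsTors Q χ⁻¹ m)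
    (hG : IsReductive G) : singularSupport Q M ⊆ unstableLocus R χ := by
  intro p hp ℓ hℓ f hf
  obtain ⟨m, hm⟩ := (mem_singularSupport_iff Q p).1 hp
  obtain ⟨k, hk⟩ := h m
  have hf' : ∀ g : G, g • f = (wtChar χ⁻¹ ℓ g : ℂ) • f := fun g => by
    have := hf g⁻¹
    rw [inv_inv] at this
    rw [this]
    simp [wtChar_apply]
  refine mem_of_degProj_mem (Q := Q) fun e => ?_
  obtain ⟨a, ha, hae⟩ := exists_lift_biA (Q := Q) (θ := χ⁻¹) hG (γ := (ℓ, e))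
    (r := degProj Q e f) (fun g => by
      rw [Representation.ofDistribMulAction_apply_apply, ← degProj_smul, hf', map_smul])
    (degProj_mem Q e f)
  have hq : k ≤ (k.toNat • ((ℓ, e) : ℤ × ℤ)).1 := by
    rw [Prod.smul_fst, nsmul_eq_mul]
    have h2 : k ≤ (k.toNat : ℤ) := Int.self_le_toNat k
    have h3 : (1 : ℤ) ≤ ℓ := by exact_mod_cast hℓ
    nlinarith
  have haq := pow_mem_biA ha k.toNat
  have h1 := hm _ ⟨_, haq.2⟩ (hk _ hq _ haq)
  rw [← sym_eq haq.2, sym_pow ha, hae] at h1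
  exact p.isPrime.mem_of_pow_mem _ h1

/-- A prime containing all symbols of annihilators of `v t` lies in the singular support, so it
contains the generators `f j` of positive weight. The `f j` are therefore in the radical of that
ideal of symbols, which contains every symbol of sufficiently large weight; then `isTors_of_symbols`
applies. -/
lemma isTors_of_singularSupport_subset {χ : G →* ℂˣ} (hG : IsReductive G) [IsNoetherianRing R]
    (hrat : IsRational ρ) (hρ : ∀ g (a : A) m, ρ g (a • m) = (g • a) • ρ g m)
    (h : singularSupport Q M ⊆ unstableLocus R χ) (m : M) : IsTors Q χ⁻¹ m := by
  obtain ⟨d, v, s, -, hv, hspan⟩ := exists_matRep hrat (Set.finite_singleton m)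
  obtain ⟨q, φ, f, hf, hφ, hgen⟩ := exists_generators_grRing (Q := Q) (θ := χ⁻¹) hG
  have hrad : ∀ j t, f j ∈ (Ideal.span {s | ∃ i, ∃ y ∈ Q.F i, y • v t = 0 ∧ s = sym Q i y}).radical := by
    intro j t
    rw [Ideal.radical_eq_sInf, Ideal.mem_sInf]
    rintro I ⟨hI, hIp⟩
    obtain ⟨a, ha, hfa⟩ := hf j
    have hp := h ((mem_singularSupport_iff Q ⟨I, hIp⟩).2 ⟨v t, fun i y hy => by
      rw [← sym_eq y.2]
      exact hI (Ideal.subset_span ⟨i, y, y.2, hy, rfl⟩)⟩)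
    refine hp (φ j).1.toNat (by have := hφ j; lia) _ fun g => ?_
    have h1 := sym_mem_semi ha g⁻¹
    rw [hfa] at h1
    refine h1.trans (congrArg (· • f j) ?_)
    have h2 : (φ j).1 = ((φ j).1.toNat : ℤ) := by have := hφ j; lia
    rw [wtChar_apply, h2, zpow_natCast]
    simp only [Int.toNat_natCast, MonoidHom.inv_apply, map_inv, inv_inv, MonoidHom.pow_apply,
      Units.val_pow_eq_pow_val]
  choose T hT using hrad
  obtain ⟨N, hN⟩ := Finset.exists_le (Finset.univ.image fun p : Fin q × Fin d => T p.1 p.2)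
  obtain ⟨n, hn⟩ := exists_weight_mem_span_pow hf hgen N
  have hms : m ∈ Submodule.span ℂ (Set.range v) := hspan ▸ subset_orbitSpan _ (Set.mem_singleton m)
  obtain ⟨c, rfl⟩ := (Submodule.mem_span_range_iff_exists_fun ℂ).1 hms
  have := isTors_of_symbols (Q := Q) (θ := χ⁻¹) hG hρ hv (n := n) (fun β hβ a ha t => by
    have hJ : sym Q β.2 a ∈ Ideal.span {s | ∃ i, ∃ y ∈ Q.F i, y • v t = 0 ∧ s = sym Q i y} := by
      obtain ⟨b, -, hb⟩ := hn β hβ _ ⟨a, ha, rfl⟩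
      rw [hb]
      refine Ideal.sum_mem _ fun j _ => Ideal.mul_mem_left _ _ ?_
      exact Ideal.pow_mem_of_pow_mem _ (hT j t)
        (hN _ (Finset.mem_image_of_mem _ (Finset.mem_univ (j, t))))
    obtain ⟨y, hy, hyv, hya⟩ := exists_annihilator (v t) (sym_mem_range ha.2) hJ
    exact ⟨y, hy, hyv, (sym_eq_zero (sub_mem ha.2 hy)).1 (by rw [sym_sub ha.2 hy, hya, sub_self])⟩)
    (fun t => algebraMap ℂ A (c t))
  simpa only [algebraMap_smul] using this

end Torsion

/-! ### Complexes of homogeneous semi-invariants -/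

section Complexes

/-- The free module with generators in prescribed bidegrees. -/
def GrRing.free {R : Type*} [CommRing R] (𝒢 : GrRing R) {κ : Type*} (b : κ → ℤ × ℤ) :
    GrMod 𝒢 (κ → R) where
  deg γ :=
    { carrier := {x | ∀ p, x p ∈ 𝒢.deg (γ - b p)}
      zero_mem' := fun _ => zero_mem _
      add_mem' := fun hx hy p => add_mem (hx p) (hy p)
      neg_mem' := fun hx p => neg_mem (hx p) }
  proj γ :=
    { toFun := fun x p => 𝒢.proj (γ - b p) (x p)
      map_zero' := funext fun p => map_zero _
      map_add' := fun x y => funext fun p => map_add _ _ _ }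
  proj_smul γ δ r x hx := funext fun p => by
    have := 𝒢.proj_mul (γ - b p) _ r (hx p)
    rwa [sub_sub_sub_cancel_right] at this
  proj_of_mem hx := funext fun p => 𝒢.proj_of_mem (hx p)

variable {G : Type u} [Group G] [AffineAlgebraicGroup G]
variable {R : Type u} [CommRing R] [Algebra ℂ R] [MulSemiringAction G R] [SMulCommClass G ℂ R]
  {W : HamiltonianSpace G R}
variable {A : Type u} [Ring A] [Algebra ℂ A] [MulSemiringAction G A] [SMulCommClass G ℂ A]
  (Q : FilteredQuantization W A) (θ : G →* ℂˣ) (hG : IsReductive G)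

/-- The symbols of a matrix. -/
def symMat {ι κ : Type*} (b : ι → ℤ × ℤ) (b' : κ → ℤ × ℤ) (D : Matrix ι κ A) : Matrix ι κ R :=
  fun p q => sym Q (b p - b' q).2 (D p q)

/-- The symbols of a row. -/
def symRow {κ : Type*} (γ : ℤ × ℤ) (b : κ → ℤ × ℤ) (x : κ → A) : κ → R :=
  fun p => sym Q (γ - b p).2 (x p)

variable {Q θ}

section Rows

variable {ι κ : Type*} [Fintype ι] [Fintype κ] {b : ι → ℤ × ℤ} {b' : κ → ℤ × ℤ}
  {D : Matrix ι κ A} {γ : ℤ × ℤ} {x : ι → A}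

lemma vecMul_mem_biA (hD : ∀ p q, D p q ∈ biA Q θ (b p - b' q)) (hx : ∀ p, x p ∈ biA Q θ (γ - b p))
    (q : κ) : Matrix.vecMul x D q ∈ biA Q θ (γ - b' q) := sum_mem fun p _ => by
  have := mul_mem_biA (hx p) (hD p q)
  rwa [sub_add_sub_cancel] at this

lemma symRow_vecMul (hD : ∀ p q, D p q ∈ biA Q θ (b p - b' q)) (hx : ∀ p, x p ∈ biA Q θ (γ - b p)) :
    symRow Q γ b' (Matrix.vecMul x D) = Matrix.vecMul (symRow Q γ b x) (symMat Q b b' D) :=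
  funext fun q => by
    have key : ∀ p, x p * D p q ∈ Q.F (γ - b' q).2 ∧ sym Q (γ - b' q).2 (x p * D p q) =
        symRow Q γ b x p * symMat Q b b' D p q := fun p => by
      rw [show (γ - b' q).2 = (γ - b p).2 + (b p - b' q).2 by simp]
      exact ⟨Q.mul_mem (hx p).2 (hD p q).2, sym_mul (hx p).2 (hD p q).2⟩
    change sym Q _ (∑ p, x p * D p q) = ∑ p, _
    rw [sym_sum _ fun p _ => (key p).1]
    exact Finset.sum_congr rfl fun p _ => (key p).2

lemma symRow_sub {y : ι → A} (hx : ∀ p, x p ∈ biA Q θ (γ - b p)) (hy : ∀ p, y p ∈ biA Q θ (γ - b p)) :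
    symRow Q γ b (x - y) = symRow Q γ b x - symRow Q γ b y :=
  funext fun p => sym_sub (hx p).2 (hy p).2

lemma mem_biA_of_symRow_eq_zero (hx : ∀ p, x p ∈ biA Q θ (γ - b p)) (h : symRow Q γ b x = 0) (p : ι) :
    x p ∈ biA Q θ ((γ.1, γ.2 - 1) - b p) := ⟨(hx p).1, by
  have := (sym_eq_zero (hx p).2).1 (congrFun h p)
  rwa [show (γ - b p).2 - 1 = ((γ.1, γ.2 - 1) - b p).2 by simp; ring] at this⟩

lemma symRow_eq_zero_of_mem {x : ι → A} (hx : ∀ p, x p ∈ biA Q θ ((γ.1, γ.2 - 1) - b p)) :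
    symRow Q γ b x = 0 := funext fun p => by
  have h := (hx p).2
  rw [show ((γ.1, γ.2 - 1) - b p).2 = (γ - b p).2 - 1 by simp; ring] at h
  exact (sym_eq_zero (Q.mono (by lia) h)).2 h

lemma mem_biA_of_le {γ γ' : ℤ × ℤ} {a : A} (h : γ.1 = γ'.1) (h' : γ.2 ≤ γ'.2) (ha : a ∈ biA Q θ γ) :
    a ∈ biA Q θ γ' := ⟨h ▸ ha.1, Q.mono h' ha.2⟩

variable (Q θ b) in
lemma exists_row_eq_zero :
    ∃ e₀ : ℤ, ∀ γ : ℤ × ℤ, γ.2 ≤ e₀ → ∀ x : ι → A, (∀ p, x p ∈ biA Q θ (γ - b p)) → x = 0 := by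
  obtain ⟨N, hN⟩ := Finset.exists_le (Finset.univ.image fun p => - (b p).2)
  refine ⟨- N - 1, fun γ hγ x hx => funext fun p => ?_⟩
  have h := (hx p).2
  have := hN _ (Finset.mem_image_of_mem _ (Finset.mem_univ p))
  rw [Q.neg _ (by simp only [Prod.snd_sub]; lia)] at h
  exact h

end Rows

/-- Generators of the syzygies of the symbols are lifted to genuine syzygies. A first lift is a
syzygy up to lower order, and strictness `hs` provides a correction of lower order with the same
image. By induction on the filtration the lifted syzygies generate all syzygies of weight at least
`n`. -/
lemma exists_next_differential [IsNoetherianRing R] {I J : ℕ} (n : ℤ) (bI : Fin I → ℤ × ℤ)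
    (bJ : Fin J → ℤ × ℤ) (D : Matrix (Fin J) (Fin I) A) (hD : ∀ p q, D p q ∈ biA Q θ (bJ p - bI q))
    (hs : ∀ γ : ℤ × ℤ, n ≤ γ.1 → ∀ x : Fin J → A, (∀ p, x p ∈ biA Q θ (γ - bJ p)) →
      (∀ q, Matrix.vecMul x D q ∈ biA Q θ ((γ.1, γ.2 - 1) - bI q)) →
      ∃ x' : Fin J → A, (∀ p, x' p ∈ biA Q θ ((γ.1, γ.2 - 1) - bJ p)) ∧
        Matrix.vecMul x' D = Matrix.vecMul x D) :
    ∃ (K : ℕ) (b : Fin K → ℤ × ℤ) (E : Matrix (Fin K) (Fin J) A), (∀ p, n ≤ (b p).1) ∧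
      (∀ p q, E p q ∈ biA Q θ (b p - bJ q)) ∧ E * D = 0 ∧
      (∀ γ : ℤ × ℤ, n ≤ γ.1 → ∀ x : Fin J → A, (∀ p, x p ∈ biA Q θ (γ - bJ p)) →
        Matrix.vecMul x D = 0 → ∃ y : Fin K → A, (∀ p, y p ∈ biA Q θ (γ - b p)) ∧
          x = Matrix.vecMul y E) ∧
      (∀ γ : ℤ × ℤ, n ≤ γ.1 → ∀ x : Fin J → R, (∀ p, x p ∈ (grRing Q θ hG).deg (γ - bJ p)) →
        Matrix.vecMul x (symMat Q bJ bI D) = 0 →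
          ∃ y : Fin K → R, (∀ p, y p ∈ (grRing Q θ hG).deg (γ - b p)) ∧
          x = Matrix.vecMul y (symMat Q b bJ E)) := by
  obtain ⟨K, b, z, hz, hgen⟩ := GrMod.exists_weight_generators (ℬ := (grRing Q θ hG).free bJ)
    (fun γ => {x | (∀ p, x p ∈ (grRing Q θ hG).deg (γ - bJ p)) ∧
      Matrix.vecMul x (symMat Q bJ bI D) = 0}) (fun γ x hx => hx.1) n
  have hlift : ∀ s, ∃ x : Fin J → A, (∀ p, x p ∈ biA Q θ (b s - bJ p)) ∧ symRow Q (b s) bJ x = z s ∧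
      Matrix.vecMul x D = 0 := by
    intro s
    choose ξ hξ hξz using (hz s).2.1
    have h1 : symRow Q (b s) bJ ξ = z s := funext hξz
    have h2 := mem_biA_of_symRow_eq_zero (γ := b s) (vecMul_mem_biA hD hξ)
      (by rw [symRow_vecMul hD hξ, h1, (hz s).2.2])
    obtain ⟨x', hx', hx'D⟩ := hs _ (hz s).1 ξ hξ h2
    have hx'' : ∀ p, x' p ∈ biA Q θ (b s - bJ p) := fun p =>
      mem_biA_of_le (by simp) (by simp) (hx' p)
    exact ⟨ξ - x', fun p => sub_mem (hξ p) (hx'' p),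
      by rw [symRow_sub hξ hx'', h1, symRow_eq_zero_of_mem hx', sub_zero],
      by rw [Matrix.sub_vecMul, hx'D, sub_self]⟩
  choose E hE hEz hED using hlift
  have hEz' : symMat Q b bJ E = z := funext hEz
  have hED' : Matrix.of E * D = 0 := Matrix.ext fun p q => congrFun (hED p) q
  refine ⟨K, b, Matrix.of E, fun p => (hz p).1, hE, hED', ?_, ?_⟩
  · obtain ⟨e₀, he₀⟩ := exists_row_eq_zero Q θ bJ
    rintro ⟨k, e⟩ hγ x hx hxD
    obtain ⟨N, hN⟩ : ∃ N : ℕ, e ≤ e₀ + N := ⟨(e - e₀).toNat, by lia⟩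
    induction N generalizing e x with
    | zero =>
      rw [he₀ _ (by simpa using hN) x hx]
      exact ⟨0, fun p => zero_mem _, by simp⟩
    | succ N ih =>
      obtain ⟨c, hc, hcx⟩ := hgen _ hγ (symRow Q (k, e) bJ x)
        ⟨fun p => ⟨x p, hx p, rfl⟩, by
          rw [← symRow_vecMul hD hx, hxD]; exact funext fun q => sym_zero _⟩
      choose y hy hyc using hc
      have hyE := vecMul_mem_biA (D := Matrix.of E) hE hy
      have hsub := mem_biA_of_symRow_eq_zero (fun p => sub_mem (hx p) (hyE p)) (by
        change symRow Q (k, e) bJ (x - Matrix.vecMul y (Matrix.of E)) = 0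
        rw [symRow_sub hx hyE, symRow_vecMul (D := Matrix.of E) hE hy, hcx, sub_eq_zero]
        funext p
        rw [Finset.sum_apply]
        refine Finset.sum_congr rfl fun s _ => ?_
        rw [Pi.smul_apply, smul_eq_mul, ← hyc, ← hEz']
        rfl)
      obtain ⟨y', hy', hyx⟩ := ih (e - 1) hγ (x - Matrix.vecMul y (Matrix.of E)) hsub (by
        rw [Matrix.sub_vecMul, Matrix.vecMul_vecMul, hED', hxD, Matrix.vecMul_zero, sub_zero])
        (by push_cast at hN; lia)
      refine ⟨y + y', fun p => add_mem (hy p) (mem_biA_of_le (by simp) (by simp) (hy' p)), ?_⟩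
      rw [Matrix.add_vecMul, ← hyx]
      abel
  · intro γ hγ x hx hxD
    obtain ⟨c, hc, rfl⟩ := hgen γ hγ x ⟨hx, hxD⟩
    refine ⟨c, hc, funext fun p => ?_⟩
    rw [Finset.sum_apply]
    exact Finset.sum_congr rfl fun s _ => by rw [← hEz']; rfl

variable (Q θ)

/-- A complex of free modules over the semi-invariants, with one generator in degree one, which is
exact in weights at least `n` and whose symbols are exact in weights at least `n`. -/
structure FiltCpx (n : ℤ) where
  I : ℕ → ℕ
  b : ∀ j, Fin (I j) → ℤ × ℤ
  D : ∀ j, Matrix (Fin (I (j + 1))) (Fin (I j)) A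
  I_zero : I 0 = 0
  I_one : I 1 = 1
  b_one : ∀ p, b 1 p = 0
  nonneg : ∀ j p, 0 ≤ (b j p).1
  le_weight : ∀ j p, n ≤ (b (j + 2) p).1
  D_mem : ∀ j p q, D j p q ∈ biA Q θ (b (j + 1) p - b j q)
  comp : ∀ j, D (j + 1) * D j = 0
  exact : ∀ j γ, n ≤ γ.1 → ∀ x : Fin (I (j + 1)) → A, (∀ p, x p ∈ biA Q θ (γ - b _ p)) →
    Matrix.vecMul x (D j) = 0 → ∃ y : Fin (I (j + 2)) → A, (∀ p, y p ∈ biA Q θ (γ - b _ p)) ∧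
      x = Matrix.vecMul y (D (j + 1))
  sym_exact : ∀ j γ, n ≤ γ.1 → ∀ x : Fin (I (j + 1)) → R,
    (∀ p, x p ∈ (grRing Q θ hG).deg (γ - b _ p)) → Matrix.vecMul x (symMat Q (b _) (b _) (D j)) = 0 →
    ∃ y : Fin (I (j + 2)) → R, (∀ p, y p ∈ (grRing Q θ hG).deg (γ - b _ p)) ∧
      x = Matrix.vecMul y (symMat Q (b _) (b _) (D (j + 1)))

variable {Q θ hG}

variable (Q θ) in
/-- Two consecutive terms of a complex under construction. -/
structure FiltCpx.State (n : ℤ) where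
  I : ℕ
  J : ℕ
  bI : Fin I → ℤ × ℤ
  bJ : Fin J → ℤ × ℤ
  D : Matrix (Fin J) (Fin I) A
  nonneg : ∀ p, 0 ≤ (bI p).1
  nonneg' : ∀ p, 0 ≤ (bJ p).1
  D_mem : ∀ p q, D p q ∈ biA Q θ (bJ p - bI q)
  strict : ∀ γ : ℤ × ℤ, n ≤ γ.1 → ∀ x : Fin J → A, (∀ p, x p ∈ biA Q θ (γ - bJ p)) →
      (∀ q, Matrix.vecMul x D q ∈ biA Q θ ((γ.1, γ.2 - 1) - bI q)) →
      ∃ x' : Fin J → A, (∀ p, x' p ∈ biA Q θ ((γ.1, γ.2 - 1) - bJ p)) ∧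
        Matrix.vecMul x' D = Matrix.vecMul x D

variable (hG) in
-- The construction starts with one generator in bidegree zero and no relations to satisfy, so the
-- first step chooses generators of the semi-invariants of weight at least `n`. The later steps
-- iterate `exists_next_differential`.
theorem exists_filtCpx [IsNoetherianRing R] {n : ℤ} (hn : 0 ≤ n) : Nonempty (FiltCpx Q θ hG n) := by
  have key := fun s : FiltCpx.State Q θ n =>
    exists_next_differential hG n s.bI s.bJ s.D s.D_mem s.strict
  choose K b E hb hE hED hex hex' using key
  let next : FiltCpx.State Q θ n → FiltCpx.State Q θ n := fun s =>
    { I := s.J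
      J := K s
      bI := s.bJ
      bJ := b s
      D := E s
      nonneg := s.nonneg'
      nonneg' := fun p => hn.trans (hb s p)
      D_mem := hE s
      -- Strictness is inherited: an image of lower order is a cycle of lower order, so exactness in
      -- that order gives a preimage of lower order.
      strict := fun γ hγ x hx hxE => by
        obtain ⟨y, hy, hyx⟩ := hex s (γ.1, γ.2 - 1) hγ _ hxE (by
          rw [Matrix.vecMul_vecMul, hED, Matrix.vecMul_zero])
        exact ⟨y, hy, hyx.symm⟩ }
  let s₀ : FiltCpx.State Q θ n :=
    { I := 0
      J := 1
      bI := Fin.elim0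
      bJ := fun _ => 0
      D := 0
      nonneg := fun p => p.elim0
      nonneg' := fun _ => le_rfl
      D_mem := fun _ q => q.elim0
      strict := fun γ _ x _ _ => ⟨0, fun _ => zero_mem _, funext fun q => q.elim0⟩ }
  let S : ℕ → FiltCpx.State Q θ n := fun j => Nat.rec s₀ (fun _ s => next s) j
  exact ⟨{
    I := fun j => (S j).I
    b := fun j => (S j).bI
    D := fun j => (S j).D
    I_zero := rfl
    I_one := rfl
    b_one := fun _ => rfl
    nonneg := fun j => (S j).nonneg
    le_weight := fun j p => hb (S j) p
    D_mem := fun j => (S j).D_mem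
    comp := fun j => hED (S j)
    exact := fun j γ hγ x hx hxD => hex (S j) γ hγ x hx hxD
    sym_exact := fun j γ hγ x hx hxD => hex' (S j) γ hγ x hx hxD }⟩

namespace FiltCpx

variable {n : ℤ}

/-- The complex of symbols. -/
def gr (𝒟 : FiltCpx Q θ hG n) : GrCpx (grRing Q θ hG) n where
  I := 𝒟.I
  b := 𝒟.b
  D j := symMat Q (𝒟.b _) (𝒟.b _) (𝒟.D j)
  I_zero := 𝒟.I_zero
  nonneg := 𝒟.nonneg
  le_weight := 𝒟.le_weight
  D_mem j p q := ⟨_, 𝒟.D_mem j p q, rfl⟩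
  comp j := by
    ext p q
    have := congrFun (symRow_vecMul (γ := 𝒟.b _ p) (x := 𝒟.D (j + 1) p) (𝒟.D_mem j)
      (𝒟.D_mem (j + 1) p)) q
    refine this.symm.trans ?_
    have h0 : Matrix.vecMul (𝒟.D (j + 1) p) (𝒟.D j) = 0 := funext fun q => congrFun (congrFun (𝒟.comp j) p) q
    rw [h0]
    exact sym_zero _
  exact := 𝒟.sym_exact

/-- Chain maps which are the identity on the root. -/
structure Ref {m n : ℤ} (𝒟' : FiltCpx Q θ hG m) (𝒟 : FiltCpx Q θ hG n) where
  Θ : ∀ j, Matrix (Fin (𝒟'.I j)) (Fin (𝒟.I j)) A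
  mem : ∀ j p q, Θ j p q ∈ biA Q θ (𝒟'.b j p - 𝒟.b j q)
  one : ∀ p q, Θ 1 p q = 1
  comm : ∀ j, Θ (j + 1) * 𝒟.D j = 𝒟'.D j * Θ j

/-- Comparison of resolutions, extended step by step from the identity of the root. It goes from the
higher level to the lower one, since the generators of `𝒟'` have weight at least `m ≥ n`, where `𝒟`
is exact. -/
lemma exists_ref {m n : ℤ} (hmn : n ≤ m) (𝒟' : FiltCpx Q θ hG m) (𝒟 : FiltCpx Q θ hG n) :
    Nonempty (Ref 𝒟' 𝒟) := by
  have h0 : IsEmpty (Fin (𝒟.I 0)) := by rw [𝒟.I_zero]; infer_instance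
  have h0' : IsEmpty (Fin (𝒟'.I 0)) := by rw [𝒟'.I_zero]; infer_instance
  obtain ⟨Θ, hΘ, hΘ'⟩ := exists_dependent_seq
    (α := fun j => Matrix (Fin (𝒟'.I j)) (Fin (𝒟.I j)) A × Matrix (Fin (𝒟'.I (j + 1))) (Fin (𝒟.I (j + 1))) A)
    (fun j T => (∀ p q, T.1 p q ∈ biA Q θ (𝒟'.b j p - 𝒟.b j q)) ∧
      (∀ p q, T.2 p q ∈ biA Q θ (𝒟'.b (j + 1) p - 𝒟.b (j + 1) q)) ∧ T.2 * 𝒟.D j = 𝒟'.D j * T.1 ∧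
      (∀ h : j = 0, ∀ p q, T.2 p q = 1))
    (fun j T T' => T'.1 = T.2)
    ⟨(0, fun _ _ => 1), fun p => isEmptyElim p, fun p q => by
      rw [𝒟.b_one, 𝒟'.b_one, sub_self]; exact one_mem_biA, by ext p q; exact isEmptyElim q,
      fun _ _ _ => rfl⟩
    (by
      rintro j ⟨T, T'⟩ ⟨hT, hT', hc, -⟩
      have : ∀ p, ∃ y : Fin (𝒟.I (j + 2)) → A, (∀ q, y q ∈ biA Q θ (𝒟'.b _ p - 𝒟.b _ q)) ∧
          (𝒟'.D (j + 1) * T') p = Matrix.vecMul y (𝒟.D (j + 1)) := fun p => by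
        refine 𝒟.exact j _ (hmn.trans (𝒟'.le_weight j p)) _
          (fun q => vecMul_mem_biA (x := 𝒟'.D (j + 1) p) hT' (𝒟'.D_mem (j + 1) p) q) ?_
        have e : (𝒟'.D (j + 1) * T') * 𝒟.D j = 0 := by
          rw [Matrix.mul_assoc, hc, ← Matrix.mul_assoc, 𝒟'.comp, Matrix.zero_mul]
        exact funext fun q => congrFun (congrFun e p) q
      choose y hy hyD using this
      exact ⟨(T', y), ⟨hT', hy, Matrix.ext fun p q => (congrFun (hyD p) q).symm, fun h => by lia⟩, rfl⟩)
  exact ⟨{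
    Θ := fun j => (Θ j).1
    mem := fun j => (hΘ j).1
    one := fun p q => by
      have := (hΘ 0).2.2.2 rfl p q
      rwa [← hΘ' 0] at this
    comm := fun j => by rw [hΘ' j]; exact (hΘ j).2.2.1 }⟩

/-- Composition of refinements. -/
def Ref.trans {l m n : ℤ} {𝒟'' : FiltCpx Q θ hG l} {𝒟' : FiltCpx Q θ hG m} {𝒟 : FiltCpx Q θ hG n}
    (h' : Ref 𝒟'' 𝒟') (h : Ref 𝒟' 𝒟) : Ref 𝒟'' 𝒟 where
  Θ j := h'.Θ j * h.Θ j
  mem j p q := vecMul_mem_biA (x := h'.Θ j p) (h.mem j) (h'.mem j p) q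
  one p q := by
    have : Subsingleton (Fin (𝒟'.I 1)) := by rw [𝒟'.I_one]; infer_instance
    have i : Fin (𝒟'.I 1) := by rw [𝒟'.I_one]; exact 0
    rw [Matrix.mul_apply, Fintype.sum_subsingleton _ i, h'.one, h.one, one_mul]
  comm j := by
    rw [Matrix.mul_assoc, h.comm, ← Matrix.mul_assoc, h'.comm, Matrix.mul_assoc]

end FiltCpx

end Complexes

/-! ### Vanishing of local cohomology, by refinement of complexes -/

section Vanishing

variable {G : Type u} [Group G] [AffineAlgebraicGroup G]
variable {R : Type u} [CommRing R] [Algebra ℂ R] [MulSemiringAction G R] [SMulCommClass G ℂ R]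
  {W : HamiltonianSpace G R}
variable {A : Type u} [Ring A] [Algebra ℂ A] [MulSemiringAction G A] [SMulCommClass G ℂ A]
  {Q : FilteredQuantization W A} {θ : G →* ℂˣ} {hG : IsReductive G}
variable {M M₁ M₂ : Type*} [AddCommGroup M] [Module A M] [AddCommGroup M₁] [Module A M₁]
  [AddCommGroup M₂] [Module A M₂]

namespace FiltCpx

variable {n m : ℤ} {𝒟 : FiltCpx Q θ hG n} {𝒟' : FiltCpx Q θ hG m}

lemma mulCol_D_D (𝒟 : FiltCpx Q θ hG n) {j : ℕ} (φ : Fin (𝒟.I j) → M) :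
    mulCol (𝒟.D (j + 1)) (mulCol (𝒟.D j) φ) = 0 := by
  rw [mulCol_mulCol, 𝒟.comp, zero_mulCol]

lemma Ref.mulCol_comm (Θ : Ref 𝒟' 𝒟) {j : ℕ} (φ : Fin (𝒟.I j) → M) :
    mulCol (Θ.Θ (j + 1)) (mulCol (𝒟.D j) φ) = mulCol (𝒟'.D j) (mulCol (Θ.Θ j) φ) := by
  rw [mulCol_mulCol, mulCol_mulCol, Θ.comm]

lemma Ref.cocycle (Θ : Ref 𝒟' 𝒟) {j : ℕ} {φ : Fin (𝒟.I j) → M} (h : mulCol (𝒟.D j) φ = 0) :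
    mulCol (𝒟'.D j) (mulCol (Θ.Θ j) φ) = 0 := by
  rw [← Θ.mulCol_comm, h, mulCol_zero]

lemma exists_root (𝒟 : FiltCpx Q θ hG n) : ∃ _ : Unique (Fin (𝒟.I 1)), True :=
  ⟨by rw [𝒟.I_one]; infer_instance, trivial⟩

/-- Semi-invariants of large weight are finitely generated. -/
lemma exists_eq_sum (𝒟 : FiltCpx Q θ hG n) (p₀ : Fin (𝒟.I 1)) {β : ℤ × ℤ} (hβ : n ≤ β.1) {a : A}
    (ha : a ∈ biA Q θ β) : ∃ y : Fin (𝒟.I 2) → A, (∀ p, y p ∈ biA Q θ (β - 𝒟.b 2 p)) ∧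
      a = ∑ p, y p * 𝒟.D 1 p p₀ := by
  have h0 : IsEmpty (Fin (𝒟.I 0)) := by rw [𝒟.I_zero]; infer_instance
  obtain ⟨y, hy, h⟩ := 𝒟.exact 0 β hβ (fun _ => a) (fun p => by rwa [𝒟.b_one, sub_zero])
    (funext fun q => isEmptyElim q)
  exact ⟨y, hy, congrFun h p₀⟩

lemma D_one_mem (𝒟 : FiltCpx Q θ hG n) (p : Fin (𝒟.I 2)) (p₀ : Fin (𝒟.I 1)) :
    𝒟.D 1 p p₀ ∈ biA Q θ (𝒟.b 2 p) := by
  have := 𝒟.D_mem 1 p p₀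
  rwa [𝒟.b_one, sub_zero] at this

end FiltCpx

/-- The semi-invariants of weight at least `k` are left combinations of finitely many. Each of these
sends `m` to a torsion element, and in large weights the remaining coefficients kill it. The
quotient by the torsion is therefore torsion-free. -/
lemma isTors_of_isTors_smul (hG : IsReductive G) [IsNoetherianRing R] {m : M} {k : ℤ}
    (h : ∀ β : ℤ × ℤ, k ≤ β.1 → ∀ a ∈ biA Q θ β, IsTors Q θ (a • m)) : IsTors Q θ m := by
  obtain ⟨𝒟⟩ := exists_filtCpx (Q := Q) (θ := θ) hG (le_max_right k 0)
  obtain ⟨_, -⟩ := 𝒟.exists_root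
  choose l hl using fun p => h (𝒟.b 2 p) ((le_max_left _ _).trans (𝒟.le_weight 0 p)) _
    (𝒟.D_one_mem p default)
  obtain ⟨N, hN⟩ := Finset.exists_le (Finset.univ.image fun p => l p + (𝒟.b 2 p).1)
  refine ⟨max N (max k 0), fun β hβ a ha => ?_⟩
  obtain ⟨y, hy, rfl⟩ := 𝒟.exists_eq_sum default ((le_max_right _ _).trans hβ) ha
  rw [Finset.sum_smul]
  refine Finset.sum_eq_zero fun p _ => ?_
  rw [mul_smul]
  refine hl p _ ?_ _ (hy p)
  have := hN _ (Finset.mem_image_of_mem _ (Finset.mem_univ p))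
  rw [Prod.fst_sub]
  lia

variable (Q θ hG) in
/-- Cocycles of degree `i` become coboundaries after a refinement. -/
def Van (i : ℕ) (M : Type*) [AddCommGroup M] [Module A M] : Prop :=
  ∀ n : ℤ, 0 ≤ n → ∀ (𝒟 : FiltCpx Q θ hG n) (φ : Fin (𝒟.I (i + 1)) → M),
    mulCol (𝒟.D (i + 1)) φ = 0 → ∃ m : ℤ, n ≤ m ∧ ∃ (𝒟' : FiltCpx Q θ hG m)
      (Θ : FiltCpx.Ref 𝒟' 𝒟) (ψ : Fin (𝒟'.I i) → M), mulCol (Θ.Θ (i + 1)) φ = mulCol (𝒟'.D i) ψ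

variable {i : ℕ}

/-- Refinements are composed, and a coboundary remains one after a further refinement. -/
lemma Van.finset {J : Type*} {X : J → Type*} [∀ j, AddCommGroup (X j)] [∀ j, Module A (X j)]
    (h : ∀ j, Van Q θ hG i (X j)) (s : Finset J) {n : ℤ} (hn : 0 ≤ n) (𝒟 : FiltCpx Q θ hG n)
    (φ : ∀ j, Fin (𝒟.I (i + 1)) → X j) (hφ : ∀ j, mulCol (𝒟.D (i + 1)) (φ j) = 0) :
    ∃ m : ℤ, n ≤ m ∧ ∃ (𝒟' : FiltCpx Q θ hG m) (Θ : FiltCpx.Ref 𝒟' 𝒟), ∀ j ∈ s,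
      ∃ ψ : Fin (𝒟'.I i) → X j, mulCol (Θ.Θ (i + 1)) (φ j) = mulCol (𝒟'.D i) ψ := by
  classical
  induction s using Finset.induction_on with
  | empty =>
    obtain ⟨Θ⟩ := FiltCpx.exists_ref le_rfl 𝒟 𝒟
    exact ⟨n, le_rfl, 𝒟, Θ, by simp⟩
  | insert j s _ ih =>
    obtain ⟨m, hm, 𝒟', Θ, hΘ⟩ := ih
    obtain ⟨m', hm', 𝒟'', Θ', ψ, hψ⟩ := h j m (hn.trans hm) 𝒟' _ (Θ.cocycle (hφ j))
    refine ⟨m', hm.trans hm', 𝒟'', Θ'.trans Θ, fun j' hj' => ?_⟩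
    rcases Finset.mem_insert.1 hj' with rfl | hj'
    · exact ⟨ψ, by rw [← hψ, mulCol_mulCol]; rfl⟩
    · obtain ⟨ψ', hψ'⟩ := hΘ j' hj'
      refine ⟨mulCol (Θ'.Θ i) ψ', ?_⟩
      rw [← Θ'.mulCol_comm, ← hψ', mulCol_mulCol]
      rfl

lemma mulCol_sum {S B ι κ J : Type*} [Ring S] [AddCommGroup B] [Module S B] [Fintype κ]
    (s : Finset J) (D : Matrix ι κ S) (x : J → κ → B) :
    mulCol D (∑ j ∈ s, x j) = ∑ j ∈ s, mulCol D (x j) := by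
  classical
  induction s using Finset.induction_on with
  | empty => simp [mulCol_zero]
  | insert j s hj ih => rw [Finset.sum_insert hj, Finset.sum_insert hj, mulCol_add, ih]

/-- The vanishing passes to retracts of sums. -/
lemma Van.of_sum {J : Type*} {X : J → Type*} [∀ j, AddCommGroup (X j)] [∀ j, Module A (X j)]
    (h : ∀ j, Van Q θ hG i (X j)) (s : ∀ j, X j →ₗ[A] M) (r : ∀ j, M →ₗ[A] X j)
    (hsr : ∀ x, ∃ t : Finset J, ∀ t', t ⊆ t' → x = ∑ j ∈ t', s j (r j x)) : Van Q θ hG i M := by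
  classical
  intro n hn 𝒟 φ hφ
  choose t ht using hsr
  let T : Finset J := Finset.univ.biUnion fun p => t (φ p)
  have hT : φ = ∑ j ∈ T, s j ∘ (r j ∘ φ) := funext fun p => by
    rw [Finset.sum_apply]
    exact ht (φ p) T fun j hj => Finset.mem_biUnion.2 ⟨p, Finset.mem_univ p, hj⟩
  obtain ⟨m, hm, 𝒟', Θ, hΘ⟩ := Van.finset h T hn 𝒟 (fun j => r j ∘ φ) fun j => by
    rw [map_mulCol, hφ]; exact funext fun p => map_zero _
  choose! ψ hψ using hΘ
  refine ⟨m, hm, 𝒟', Θ, ∑ j ∈ T, s j ∘ ψ j, ?_⟩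
  rw [hT, mulCol_sum, mulCol_sum]
  exact Finset.sum_congr rfl fun j hj => by
    rw [map_mulCol (s j), hψ j hj, map_mulCol (s j)]

lemma Van.retract (s : M₁ →ₗ[A] M) (r : M →ₗ[A] M₁) (hsr : ∀ x, r (s x) = x) (h : Van Q θ hG i M) :
    Van Q θ hG i M₁ :=
  Van.of_sum (J := Unit) (X := fun _ => M) (fun _ => h) (fun _ => r) (fun _ => s) fun x =>
    ⟨{()}, fun t' ht' => by
      rw [show t' = {()} from Finset.eq_singleton_iff_unique_mem.2 ⟨ht' (by simp), fun _ _ => rfl⟩]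
      simp [hsr]⟩

section Exact

variable (f : M₁ →ₗ[A] M) (g : M →ₗ[A] M₂) (hf : Function.Injective f) (hg : Function.Surjective g)
  (hfg : ∀ y, g y = 0 ↔ ∃ x, f x = y)

include hfg in
lemma exists_lift_of_exact {κ : Type*} {φ : κ → M} (h : g ∘ φ = 0) : ∃ ψ : κ → M₁, f ∘ ψ = φ := by
  choose ψ hψ using fun p => (hfg (φ p)).1 (congrFun h p)
  exact ⟨ψ, funext hψ⟩

include hfg in
lemma comp_eq_zero {κ : Type*} (φ : κ → M₁) : g ∘ (f ∘ φ) = 0 :=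
  funext fun p => (hfg _).2 ⟨φ p, rfl⟩

include hg in
lemma exists_comp_eq {κ : Type*} (φ : κ → M₂) : ∃ ψ : κ → M, g ∘ ψ = φ := by
  choose ψ hψ using fun p => hg (φ p)
  exact ⟨ψ, funext hψ⟩

include hf in
lemma mulCol_eq_zero_of_comp {ι κ : Type*} [Fintype κ] {D : Matrix ι κ A} {φ : κ → M₁}
    (h : mulCol D (f ∘ φ) = 0) : mulCol D φ = 0 := by
  rw [map_mulCol] at h
  exact funext fun p => hf ((congrFun h p).trans (map_zero f).symm)

include hf hg hfg

/-- This lemma and the two following ones are the exactness of the long sequence of local cohomology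
at its three kinds of terms. Each chase uses two refinements. -/
lemma Van.ext (h₁ : Van Q θ hG i M₁) (h₂ : Van Q θ hG i M₂) : Van Q θ hG i M := by
  intro n hn 𝒟 φ hφ
  obtain ⟨m, hm, 𝒟', Θ, ψ', hψ'⟩ := h₂ n hn 𝒟 (g ∘ φ) (by
    rw [map_mulCol, hφ]; exact funext fun p => map_zero _)
  obtain ⟨ψ, rfl⟩ := exists_comp_eq g hg ψ'
  obtain ⟨ξ, hξ⟩ := exists_lift_of_exact f g hfg (φ := mulCol (Θ.Θ (i + 1)) φ - mulCol (𝒟'.D i) ψ) (by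
    rw [map_mulCol, map_mulCol] at hψ'
    funext p
    have := congrFun hψ' p
    simp only [Function.comp_apply, Pi.sub_apply, map_sub] at this ⊢
    rw [this, sub_self]; rfl)
  obtain ⟨m', hm', 𝒟'', Θ', ω, hω⟩ := h₁ m (hn.trans hm) 𝒟' ξ (mulCol_eq_zero_of_comp f hf (by
    rw [hξ, mulCol_sub, Θ.cocycle hφ, 𝒟'.mulCol_D_D, sub_zero]))
  refine ⟨m', hm.trans hm', 𝒟'', Θ'.trans Θ, mulCol (Θ'.Θ i) ψ + f ∘ ω, ?_⟩
  have h1 : mulCol (Θ'.Θ (i + 1)) (f ∘ ξ) = mulCol (𝒟''.D i) (f ∘ ω) := by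
    rw [map_mulCol, map_mulCol, hω]
  rw [hξ, mulCol_sub, sub_eq_iff_eq_add, Θ'.mulCol_comm] at h1
  rw [mulCol_add, add_comm (mulCol _ _) (mulCol _ _), ← h1, mulCol_mulCol]
  rfl

lemma Van.quot (h : Van Q θ hG i M) (h₁ : Van Q θ hG (i + 1) M₁) : Van Q θ hG i M₂ := by
  intro n hn 𝒟 φ' hφ
  obtain ⟨φ, rfl⟩ := exists_comp_eq g hg φ'
  obtain ⟨ξ, hξ⟩ := exists_lift_of_exact f g hfg (φ := mulCol (𝒟.D (i + 1)) φ) (by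
    rw [← map_mulCol, hφ])
  obtain ⟨m, hm, 𝒟', Θ, ψ, hψ⟩ := h₁ n hn 𝒟 ξ (mulCol_eq_zero_of_comp f hf (by
    rw [hξ, 𝒟.mulCol_D_D]))
  have h1 : mulCol (Θ.Θ (i + 2)) (f ∘ ξ) = mulCol (𝒟'.D (i + 1)) (f ∘ ψ) := by
    rw [map_mulCol, map_mulCol]; exact congrArg _ hψ
  rw [hξ, Θ.mulCol_comm] at h1
  obtain ⟨m', hm', 𝒟'', Θ', ω, hω⟩ := h m (hn.trans hm) 𝒟' (mulCol (Θ.Θ (i + 1)) φ - f ∘ ψ) (by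
    rw [mulCol_sub, h1, sub_self])
  refine ⟨m', hm.trans hm', 𝒟'', Θ'.trans Θ, g ∘ ω, ?_⟩
  have h2 : mulCol (Θ'.Θ (i + 1)) (g ∘ (mulCol (Θ.Θ (i + 1)) φ - f ∘ ψ)) =
      mulCol (𝒟''.D i) (g ∘ ω) := by rw [map_mulCol, map_mulCol, hω]
  rw [← h2]
  have h3 : g ∘ (mulCol (Θ.Θ (i + 1)) φ - f ∘ ψ) = mulCol (Θ.Θ (i + 1)) (g ∘ φ) := by
    rw [map_mulCol]
    funext p
    have := congrFun (comp_eq_zero f g hfg ψ) p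
    simp only [Function.comp_apply, Pi.sub_apply, map_sub] at this ⊢
    rw [this]; exact sub_zero _
  rw [h3, mulCol_mulCol]
  rfl

lemma Van.ker (h : Van Q θ hG (i + 1) M) (h₂ : Van Q θ hG i M₂) : Van Q θ hG (i + 1) M₁ := by
  intro n hn 𝒟 φ hφ
  obtain ⟨m, hm, 𝒟', Θ, ψ, hψ⟩ := h n hn 𝒟 (f ∘ φ) (by
    rw [map_mulCol, hφ]; exact funext fun p => map_zero _)
  obtain ⟨m', hm', 𝒟'', Θ', ω', hω⟩ := h₂ m (hn.trans hm) 𝒟' (g ∘ ψ) (by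
    rw [map_mulCol, ← hψ, map_mulCol]; exact comp_eq_zero f g hfg _)
  obtain ⟨ω, rfl⟩ := exists_comp_eq g hg ω'
  obtain ⟨ξ, hξ⟩ := exists_lift_of_exact f g hfg
    (φ := mulCol (Θ'.Θ (i + 1)) ψ - mulCol (𝒟''.D i) ω) (by
    rw [map_mulCol, map_mulCol] at hω
    funext p
    have := congrFun hω p
    simp only [Function.comp_apply, Pi.sub_apply, map_sub] at this ⊢
    rw [this, sub_self]; rfl)
  refine ⟨m', hm.trans hm', 𝒟'', Θ'.trans Θ, ξ, ?_⟩
  have h1 : mulCol ((Θ'.trans Θ).Θ (i + 2)) (f ∘ φ) = mulCol (𝒟''.D (i + 1)) (f ∘ ξ) := by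
    rw [hξ, mulCol_sub, 𝒟''.mulCol_D_D, sub_zero, ← Θ'.mulCol_comm, ← hψ, mulCol_mulCol]
    rfl
  rw [map_mulCol, map_mulCol] at h1
  exact funext fun p => hf (congrFun h1 p)

end Exact

/-- A refinement of high level has entries of large weight in positions from two on, and these kill
the finitely many entries of `φ`. In position one, the root, the refinement is the identity; this is
why degree zero is excluded. -/
lemma Van.of_isTors [IsNoetherianRing R] (h : ∀ x : M, IsTors Q θ x) (i : ℕ) : Van Q θ hG (i + 1) M := by
  intro n hn 𝒟 φ _
  choose k hk using fun p => h (φ p)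
  obtain ⟨N, hN⟩ := Finset.exists_le (Finset.univ.image fun p => k p + (𝒟.b _ p).1)
  obtain ⟨𝒟'⟩ := exists_filtCpx (Q := Q) (θ := θ) hG (hn.trans (le_max_left n N))
  obtain ⟨Θ⟩ := FiltCpx.exists_ref (le_max_left n N) 𝒟' 𝒟
  refine ⟨_, le_max_left n N, 𝒟', Θ, 0, ?_⟩
  rw [mulCol_zero]
  refine funext fun p => Finset.sum_eq_zero fun q _ => hk q _ ?_ _ (Θ.mem _ p q)
  have h1 := hN _ (Finset.mem_image_of_mem _ (Finset.mem_univ q))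
  have h2 := 𝒟'.le_weight i p
  rw [Prod.fst_sub]
  lia

/-- In degree zero there are no coboundaries, and refinements act as the identity on the root. A
cocycle is an element killed by the generators of the semi-invariants of weight at least `n`. -/
lemma van_zero_iff [IsNoetherianRing R] :
    Van Q θ hG 0 M ↔ ∀ x : M, IsTors Q θ x → x = 0 := by
  constructor
  · rintro h x ⟨k, hk⟩
    obtain ⟨𝒟⟩ := exists_filtCpx (Q := Q) (θ := θ) hG (le_max_right k 0)
    obtain ⟨m, hm, 𝒟', Θ, ψ, hψ⟩ := h _ (le_max_right k 0) 𝒟 (fun _ => x) (funext fun p =>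
      Finset.sum_eq_zero fun q _ => hk _ ((le_max_left _ _).trans (𝒟.le_weight 0 p)) _
        (𝒟.D_one_mem p q))
    have h0 : IsEmpty (Fin (𝒟'.I 0)) := by rw [𝒟'.I_zero]; infer_instance
    obtain ⟨_, -⟩ := 𝒟'.exists_root
    obtain ⟨_, -⟩ := 𝒟.exists_root
    have h1 := congrFun hψ default
    simp only [mulCol, Finset.univ_eq_empty, Finset.sum_empty] at h1
    rw [Fintype.sum_unique] at h1
    change Θ.Θ 1 default default • x = 0 at h1
    rwa [Θ.one, one_smul] at h1
  · intro h n hn 𝒟 φ hφ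
    obtain ⟨Θ⟩ := FiltCpx.exists_ref le_rfl 𝒟 𝒟
    refine ⟨n, le_rfl, 𝒟, Θ, 0, ?_⟩
    have : φ = 0 := by
      obtain ⟨_, -⟩ := 𝒟.exists_root
      refine funext fun p => h _ ⟨n, fun β hβ a ha => ?_⟩
      obtain ⟨y, -, rfl⟩ := 𝒟.exists_eq_sum p hβ ha
      rw [Finset.sum_smul]
      refine Finset.sum_eq_zero fun q _ => ?_
      have h1 := congrFun hφ q
      change ∑ p', 𝒟.D 1 q p' • φ p' = 0 at h1
      have hs : Subsingleton (Fin (𝒟.I 1)) := Unique.instSubsingleton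
      rw [Fintype.sum_subsingleton _ p] at h1
      rw [mul_smul, h1, smul_zero]
    rw [this, mulCol_zero, mulCol_zero]

end Vanishing

/-! ### Cohomological dimension -/

section Bound

variable {G : Type u} [Group G] [AffineAlgebraicGroup G]
variable {R : Type u} [CommRing R] [Algebra ℂ R] [MulSemiringAction G R] [SMulCommClass G ℂ R]
  {W : HamiltonianSpace G R}
variable {A : Type u} [Ring A] [Algebra ℂ A] [MulSemiringAction G A] [SMulCommClass G ℂ A]
  {Q : FilteredQuantization W A} {θ : G →* ℂˣ}

section MulCol

variable {κ : Type*} [Fintype κ] [DecidableEq κ] {r : MatRep G κ} {δ : κ → ℤ}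
  {ι ι' : Type*} [Fintype ι'] {b : ι → ℤ × ℤ} {b' : ι' → ℤ × ℤ} {D : Matrix ι ι' A} {γ : ℤ × ℤ}
  {X : ι' → κ → A}

lemma mulCol_mem_biK (hD : ∀ p q, D p q ∈ biA Q θ (b p - b' q))
    (hX : ∀ q, X q ∈ biK Q θ r δ (b' q + γ)) (p : ι) : mulCol D X p ∈ biK Q θ r δ (b p + γ) :=
  sum_mem fun q _ => by
    have := smul_mem_biK (hD p q) (hX q)
    rwa [← add_assoc, sub_add_cancel] at this

lemma symK_sum {ι : Type*} (s : Finset ι) {e : ℤ} {x : ι → κ → A} (hx : ∀ i ∈ s, x i ∈ filtK Q δ e) :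
    symK Q δ e (∑ i ∈ s, x i) = ∑ i ∈ s, symK Q δ e (x i) := by
  classical
  induction s using Finset.induction_on with
  | empty => simp [symK_zero]
  | insert j s hj ih =>
    rw [Finset.sum_insert hj, Finset.sum_insert hj, symK_add (hx j (Finset.mem_insert_self _ _))
      (sum_mem fun k hk => hx k (Finset.mem_insert_of_mem hk)),
      ih fun k hk => hx k (Finset.mem_insert_of_mem hk)]

lemma mulCol_symMat (hD : ∀ p q, D p q ∈ biA Q θ (b p - b' q))
    (hX : ∀ q, X q ∈ biK Q θ r δ (b' q + γ)) (p : ι) :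
    mulCol (symMat Q b b' D) (fun q => symK Q δ (b' q + γ).2 (X q)) p =
      symK Q δ (b p + γ).2 (mulCol D X p) := by
  have e : ∀ q, (b p + γ).2 = (b p - b' q).2 + (b' q + γ).2 := fun q => by simp; ring
  rw [mulCol, mulCol, symK_sum _ fun q _ => by
    rw [e q]; exact smul_mem_filtK (hD p q).2 (hX q).2]
  exact Finset.sum_congr rfl fun q _ => by rw [e q, symK_smul (hD p q).2 (hX q).2]; rfl

lemma mulCol_mem_sub {L : Submodule A (κ → A)} (hX : ∀ q, X q ∈ L) (p : ι) : mulCol D X p ∈ L :=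
  sum_mem fun q _ => L.smul_mem _ (hX q)

end MulCol

variable {hG : IsReductive G}

/-- The vanishing on symbols gives `Y` with the right leading term modulo `L`. The remainder has
lower order and is again a cocycle modulo `L`, so the construction repeats until the order is too
small. -/
lemma exists_coboundary {κ : Type*} [Fintype κ] [DecidableEq κ] {r : MatRep G κ} {δ : κ → ℤ}
    (hδ : ∀ g a b, r.hom g b a ≠ 0 → δ a = δ b) (L : Submodule A (κ → A)) {i : ℕ}
    (hc : ColVanish (grSub Q θ hδ hG L) (grSub Q θ hδ hG ⊤) i) :
    ∃ n₀ : ℤ, ∀ n, n₀ ≤ n → ∀ (𝒟 : FiltCpx Q θ hG n) (E : ℤ) (X : Fin (𝒟.I (i + 1)) → κ → A),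
      (∀ p, X p ∈ biK Q θ r δ (𝒟.b _ p + (0, E))) → (∀ p, mulCol (𝒟.D (i + 1)) X p ∈ L) →
      ∃ Y : Fin (𝒟.I i) → κ → A, ∀ p, X p - mulCol (𝒟.D i) Y p ∈ L := by
  obtain ⟨n₀, hn₀⟩ := hc
  refine ⟨n₀, fun n hn 𝒟 E X hX hDX => ?_⟩
  obtain ⟨e₀, he₀⟩ := exists_filtK_eq_zero (Q := Q) (δ := δ)
  obtain ⟨B, hB⟩ := Finset.exists_le (Finset.univ.image fun p => (𝒟.b (i + 1) p).2)
  obtain ⟨N, hN⟩ : ∃ N : ℕ, B + E ≤ e₀ + N := ⟨(B + E - e₀).toNat, by lia⟩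
  induction N generalizing E X with
  | zero =>
    refine ⟨0, fun p => ?_⟩
    have h1 := hB _ (Finset.mem_image_of_mem _ (Finset.mem_univ p))
    rw [he₀ _ (filtK_mono (by simp only [Prod.snd_add]; push_cast at hN; lia) (hX p).2), mulCol_zero, Pi.zero_apply,
      sub_zero]
    exact zero_mem _
  | succ N ih =>
    have hx : ∀ p, symK Q δ (𝒟.b (i + 1) p + (0, E)).2 (X p) ∈
        (grSub Q θ hδ hG ⊤).part (𝒟.b (i + 1) p + (0, E)) := fun p => ⟨X p, hX p, trivial, rfl⟩
    have hDx : ∀ p, mulCol (symMat Q (𝒟.b _) (𝒟.b _) (𝒟.D (i + 1)))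
        (fun p => symK Q δ (𝒟.b (i + 1) p + (0, E)).2 (X p)) p ∈
        (grSub Q θ hδ hG L).part (𝒟.b (i + 2) p + (0, E)) := fun p => by
      rw [mulCol_symMat (𝒟.D_mem (i + 1)) hX p]
      exact ⟨_, mulCol_mem_biK (𝒟.D_mem (i + 1)) hX p, hDX p, rfl⟩
    have key : ∃ (Y : Fin (𝒟.I i) → κ → A) (l : Fin (𝒟.I (i + 1)) → κ → A),
        (∀ p, Y p ∈ biK Q θ r δ (𝒟.b i p + (0, E))) ∧
        ∀ p, l p ∈ biK Q θ r δ (𝒟.b (i + 1) p + (0, E)) ∧ l p ∈ L ∧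
          symK Q δ (𝒟.b (i + 1) p + (0, E)).2 (l p) =
            symK Q δ (𝒟.b (i + 1) p + (0, E)).2 (X p) - mulCol (symMat Q (𝒟.b _) (𝒟.b _) (𝒟.D i))
              (fun q => symK Q δ (𝒟.b i q + (0, E)).2 (Y q)) p := by
      obtain ⟨y, hy, hxy⟩ := hn₀ n hn 𝒟.gr (0, E) le_rfl _ hx hDx
      choose Y hY _ hYy using hy
      choose l hl hlL hlx using hxy
      refine ⟨Y, l, hY, fun p => ⟨hl p, hlL p, (hlx p).trans ?_⟩⟩
      exact congrArg (fun z => _ - mulCol _ z p) (funext fun q => (hYy q).symm)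
    obtain ⟨Y, l, hY, hl'⟩ := key
    have hl := fun p => (hl' p).1
    have hlL := fun p => (hl' p).2.1
    have hDY := mulCol_mem_biK (𝒟.D_mem i) hY
    have hsub : ∀ p, X p - mulCol (𝒟.D i) Y p - l p ∈ biK Q θ r δ (𝒟.b _ p + (0, E - 1)) := fun p => by
      have h1 := sub_mem (sub_mem (hX p) (hDY p)) (hl p)
      have h2 := (symK_eq_zero h1.2).1 (by
        rw [symK_sub (sub_mem (hX p).2 (hDY p).2) (hl p).2, symK_sub (hX p).2 (hDY p).2, sub_eq_zero]
        rw [(hl' p).2.2, mulCol_symMat (𝒟.D_mem i) hY p])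
      refine ⟨h1.1, ?_⟩
      have e : (𝒟.b (i + 1) p + (0, E - 1)).2 = (𝒟.b (i + 1) p + (0, E)).2 - 1 := by
        rw [Prod.snd_add, Prod.snd_add]; ring
      rwa [e]
    obtain ⟨Y', hY'⟩ := ih (E - 1) (X - mulCol (𝒟.D i) Y - l) hsub (fun p => by
      rw [mulCol_sub, mulCol_sub, 𝒟.mulCol_D_D, sub_zero]
      exact sub_mem (hDX p) (mulCol_mem_sub hlL p)) (by push_cast at hN; lia)
    refine ⟨Y + Y', fun p => ?_⟩
    have := add_mem (hY' p) (hlL p)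
    rw [mulCol_add]
    convert this using 1
    simp only [Pi.sub_apply, Pi.add_apply]
    abel

variable {M : Type*} [AddCommGroup M] [Module A M] [Module ℂ M] [IsScalarTower ℂ A M]
  {ρ : Representation ℂ G M}

/-- The weight shift of the action on columns. -/
abbrev colRep (hθ : (fun g => (θ g : ℂ)) ∈ AffineAlgebraicGroup.coord (G := G)) {κ : Type*} [Fintype κ]
    [DecidableEq κ] (b : κ → ℤ × ℤ) : MatRep G κ := MatRep.diag θ hθ fun p => - (b p).1

section ColRep

variable (hθ : (fun g => (θ g : ℂ)) ∈ AffineAlgebraicGroup.coord (G := G))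
variable {κ : Type*} [Fintype κ] [DecidableEq κ] {b : κ → ℤ × ℤ}

lemma mulCol_smulC {ι : Type*} (D : Matrix ι κ A) (c : ℂ) (x : κ → M) :
    mulCol D (c • x) = c • mulCol D x := by
  have : SMulCommClass ℂ A M := inferInstance
  ext p
  simp [mulCol, Finset.smul_sum, smul_comm c]

lemma colRep_apply (ρ : Representation ℂ G M) (g : G) (φ : κ → M) (p : κ) :
    tupleRep (colRep hθ b) ρ g φ p = (wtChar θ (-(b p).1) g : ℂ) • ρ g (φ p) := by
  simp [tupleRep_apply, MatRep.diag_apply, ite_smul]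

lemma rep_eq_smul_colRep (ρ : Representation ℂ G M) (g : G) (φ : κ → M) (p : κ) :
    ρ g (φ p) = (wtChar θ (b p).1 g : ℂ) • tupleRep (colRep hθ b) ρ g φ p := by
  rw [colRep_apply, smul_smul, ← Units.val_mul, ← MonoidHom.mul_apply, ← wtChar_add, add_neg_cancel,
    wtChar_zero]
  simp

lemma mulCol_colRep (hρ : ∀ g (a : A) m, ρ g (a • m) = (g • a) • ρ g m) {ι : Type*} [Fintype ι]
    [DecidableEq ι] {b' : ι → ℤ × ℤ} {D : Matrix ι κ A} (hD : ∀ p q, D p q ∈ biA Q θ (b' p - b q))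
    (g : G) (φ : κ → M) :
    mulCol D (tupleRep (colRep hθ b) ρ g φ) = tupleRep (colRep hθ b') ρ g (mulCol D φ) :=
  funext fun p => by
    have : SMulCommClass ℂ A M := inferInstance
    rw [colRep_apply, mulCol, mulCol, map_sum, Finset.smul_sum]
    refine Finset.sum_congr rfl fun q _ => ?_
    rw [hρ, (mem_biA.1 (hD p q)).1 g, colRep_apply, smul_comm, smul_assoc, smul_smul]
    congr 1
    rw [← Units.val_mul, ← MonoidHom.mul_apply, ← wtChar_add]
    congr 3
    rw [Prod.fst_sub]
    ring

/-- The translates of a cocycle span a finite-dimensional representation. -/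
lemma exists_cocycle_matRep (hrat : IsRational ρ) (hρ : ∀ g (a : A) m, ρ g (a • m) = (g • a) • ρ g m)
    {ι : Type*} [Fintype ι] [DecidableEq ι] {b' : ι → ℤ × ℤ} {D : Matrix ι κ A}
    (hD : ∀ p q, D p q ∈ biA Q θ (b' p - b q)) {φ : κ → M} (hφ : mulCol D φ = 0) :
    ∃ (d : ℕ) (w : Fin d → κ → M) (s : MatRep G (Fin d)),
      (∀ g t, tupleRep (colRep hθ b) ρ g (w t) = ∑ t', s.hom g t' t • w t') ∧
      Submodule.span ℂ (Set.range w) = orbitSpan (tupleRep (colRep hθ b) ρ) {φ} ∧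
      ∀ t, mulCol D (w t) = 0 := by
  obtain ⟨d, w, s, -, hw, hws⟩ := exists_matRep (isRational_tupleRep (colRep hθ b) hrat)
    (Set.finite_singleton φ)
  refine ⟨d, w, s, hw, hws, fun t => ?_⟩
  let Z : Submodule ℂ (κ → M) :=
    { carrier := {x | mulCol D x = 0}
      zero_mem' := mulCol_zero _
      add_mem' := fun {x y} hx hy => by
        change mulCol _ (x + y) = 0
        rw [mulCol_add, show mulCol _ x = 0 from hx, show mulCol _ y = 0 from hy, add_zero]
      smul_mem' := fun c x hx => by
        change mulCol _ (c • x) = 0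
        rw [mulCol_smulC, show mulCol _ x = 0 from hx, smul_zero] }
  have h1 : w t ∈ orbitSpan (tupleRep (colRep hθ b) ρ) {φ} := hws ▸ Submodule.subset_span ⟨t, rfl⟩
  refine orbitSpan_le (N := Z) (fun g x hx => ?_) (Set.singleton_subset_iff.2 hφ) h1
  change mulCol _ _ = 0
  rw [mulCol_colRep hθ hρ hD, show mulCol _ x = 0 from hx, map_zero]

end ColRep

/-- A cocycle with values in `M` is lifted to a cocycle, modulo a submodule of relations, in a free
module of tuples over `A`, where symbols are available. Semi-invariance is obtained by treating
simultaneously a finite family spanning the translates of the cocycle. The bound involves only the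
graded ring of symbols and not `M`. -/
theorem exists_van_of_le (hθ : (fun g => (θ g : ℂ)) ∈ AffineAlgebraicGroup.coord (G := G))
    (hG : IsReductive G) [IsNoetherianRing R] : ∃ N : ℕ,
      ∀ (M : Type u) [AddCommGroup M] [Module A M] [Module ℂ M] [IsScalarTower ℂ A M]
        (ρ : Representation ℂ G M), IsRational ρ → (∀ g (a : A) m, ρ g (a • m) = (g • a) • ρ g m) →
        ∀ i, N ≤ i → Van Q θ hG i M := by
  obtain ⟨N, ϕ, f, hf, hϕ, hgen⟩ := exists_generators_grRing (Q := Q) (θ := θ) hG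
  refine ⟨N + 1, fun M _ _ _ _ ρ hrat hρ i hi n hn 𝒟 φ hφ => ?_⟩
  have hcomm : SMulCommClass ℂ A M := inferInstance
  obtain ⟨d, w, s, hw, hws, hwD⟩ := exists_cocycle_matRep hθ hrat hρ (𝒟.D_mem (i + 1)) hφ
  obtain ⟨d₀, v, s₀, hvi, hv, hvs⟩ := exists_matRep hrat
    (Set.finite_range fun p : Fin d × Fin (𝒟.I (i + 1)) => w p.1 p.2)
  have hmem : ∀ p t, w t p ∈ Submodule.span ℂ (Set.range v) := fun p t => by
    rw [hvs]; exact subset_orbitSpan _ ⟨(t, p), rfl⟩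
  choose C hC using fun p t => (Submodule.mem_span_range_iff_exists_fun ℂ).1 (hmem p t)
  -- The coordinates of the entries of the translates satisfy an equivariance relation, read off by
  -- comparing coefficients on the independent family `v`. It makes the entries of the column `X`
  -- below semi-invariant of the weights of the complex.
  have hCw : ∀ g p t b, ∑ a, s₀.hom g b a * C p t a =
      (wtChar θ (𝒟.b (i + 1) p).1 g : ℂ) * ∑ t', s.hom g t' t * C p t' b := by
    intro g p t
    have h1 : ∑ b, (∑ a, s₀.hom g b a * C p t a) • v b =
        ∑ b, ((wtChar θ (𝒟.b (i + 1) p).1 g : ℂ) * ∑ t', s.hom g t' t * C p t' b) • v b := by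
      have e1 : ∑ b, (∑ a, s₀.hom g b a * C p t a) • v b = ρ g (w t p) := by
        rw [← hC p t, map_sum]
        simp only [map_smul, hv, Finset.smul_sum, Finset.sum_smul, smul_smul]
        rw [Finset.sum_comm]
        simp only [mul_comm]
      have e2 : ∑ b, ((wtChar θ (𝒟.b (i + 1) p).1 g : ℂ) * ∑ t', s.hom g t' t * C p t' b) • v b =
          (wtChar θ (𝒟.b (i + 1) p).1 g : ℂ) • ∑ t', s.hom g t' t • w t' p := by
        simp only [← hC, Finset.smul_sum, Finset.sum_smul, smul_smul, Finset.mul_sum]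
        rw [Finset.sum_comm]
      rw [e1, e2, rep_eq_smul_colRep hθ (b := 𝒟.b (i + 1)) ρ g (w t) p, hw]
      simp
    have h2 := Fintype.linearIndependent_iff.1 hvi
      (fun b => (∑ a, s₀.hom g b a * C p t a) -
        ((wtChar θ (𝒟.b (i + 1) p).1 g : ℂ) * ∑ t', s.hom g t' t * C p t' b))
      (by simp only [sub_smul, Finset.sum_sub_distrib]; rw [h1, sub_self])
    exact fun b => sub_eq_zero.1 (h2 b)
  -- A column of scalars in a free module. The evaluation `ev t` sends it to `w t`, so it is a
  -- cocycle modulo the tuples of relations `L`.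
  let X : Fin (𝒟.I (i + 1)) → Fin d₀ × Fin d → A := fun p k => algebraMap ℂ A (C p k.2 k.1)
  have hδ : ∀ g (a b : Fin d₀ × Fin d), (s₀.tensor s.dual).hom g b a ≠ 0 → (0 : ℤ) = 0 :=
    fun _ _ _ _ => rfl
  let L : Submodule A (Fin d₀ × Fin d → A) := tupleSub (Fin d) (relSub v)
  obtain ⟨n₀, hn₀⟩ := exists_coboundary (Q := Q) (θ := θ) (hG := hG) (δ := fun _ => 0) hδ L
    -- All `N` generators are used, so the torsion hypothesis is void and only the condition `N + 1
    -- ≤ i` remains.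
    (colVanish_of_le hf hϕ hgen N _ _ (by
      rintro γ _ ⟨x, hx, _, rfl⟩
      exact ⟨x, hx, trivial, rfl⟩) (fun j hj => absurd j.2 (by lia)) i hi)
  obtain ⟨𝒟'⟩ := exists_filtCpx (Q := Q) (θ := θ) hG (hn.trans (le_max_left n n₀))
  obtain ⟨Θ⟩ := FiltCpx.exists_ref (le_max_left n n₀) 𝒟' 𝒟
  obtain ⟨B, hB⟩ := Finset.exists_le (Finset.univ.image fun p => - (𝒟.b (i + 1) p).2)
  have hX : ∀ p, X p ∈ biK Q θ (s₀.tensor s.dual) (fun _ => 0) (𝒟.b _ p + (0, B)) := fun p => by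
    refine ⟨fun g => funext fun ⟨b, t⟩ => ?_, mem_filtK.2 fun k => ?_⟩
    · rw [tupleRep_tensor]
      have e : ∀ t', tupleRep s₀ (actRep G A) g (fun a => X p (a, t')) b =
          algebraMap ℂ A (∑ a, s₀.hom g b a * C p t' a) := fun t' => by
        rw [tupleRep_apply, map_sum]
        refine Finset.sum_congr rfl fun a _ => ?_
        change s₀.hom g b a • g • algebraMap ℂ A (C p t' a) = _
        rw [Algebra.algebraMap_eq_smul_one, smul_comm g, smul_one, smul_smul,
          Algebra.algebraMap_eq_smul_one]
      simp only [e, hCw]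
      rw [Pi.smul_apply, Prod.fst_add, add_zero]
      simp only [Algebra.algebraMap_eq_smul_one, smul_smul,
        ← Finset.sum_smul, X]
      congr 1
      have e2 : ∀ t', s.dual.hom g t t' * ((wtChar θ (𝒟.b (i + 1) p).1 g : ℂ) *
          ∑ x, s.hom g x t' * C p x b) = (wtChar θ (𝒟.b (i + 1) p).1 g : ℂ) *
          ∑ x, (s.hom g x t' * s.hom g⁻¹ t' t) * C p x b := fun t' => by
        rw [Finset.mul_sum, Finset.mul_sum, Finset.mul_sum]
        refine Finset.sum_congr rfl fun x _ => ?_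
        change s.hom g⁻¹ t' t * _ = _
        ring
      simp only [e2, ← Finset.mul_sum]
      congr 1
      rw [Finset.sum_comm]
      simp only [← Finset.sum_mul, ← Matrix.mul_apply, ← map_mul]
      simp [Matrix.one_apply]
    · have h1 := hB _ (Finset.mem_image_of_mem _ (Finset.mem_univ p))
      refine Q.mono (show (0 : ℤ) ≤ _ by simp only [Prod.snd_add]; lia) ?_
      change algebraMap ℂ A _ ∈ _
      rw [Algebra.algebraMap_eq_smul_one]
      exact Submodule.smul_mem _ _ Q.one_mem
  have hev : ∀ p t, ∑ a, X p (a, t) • v a = w t p := fun p t => by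
    rw [← hC p t]
    exact Finset.sum_congr rfl fun a _ => algebraMap_smul A (C p t a) (v a)
  let ev : Fin d → (Fin d₀ × Fin d → A) →ₗ[A] M := fun t =>
    Fintype.linearCombination A v ∘ₗ LinearMap.funLeft A A fun a => (a, t)
  have hev_apply : ∀ t x, ev t x = ∑ a, x (a, t) • v a := fun t x => by
    simp [ev, Fintype.linearCombination_apply, LinearMap.funLeft_apply]
  have hev' : ∀ t, ev t ∘ X = w t := fun t => funext fun p => (hev_apply t _).trans (hev p t)
  have hL : ∀ x, x ∈ L ↔ ∀ t, ev t x = 0 := fun x => Iff.rfl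
  obtain ⟨Y, hY⟩ := hn₀ _ (le_max_right n n₀) 𝒟' B (mulCol (Θ.Θ (i + 1)) X)
    (mulCol_mem_biK (Θ.mem _) hX) (fun p => by
      rw [← Θ.mulCol_comm]
      refine mulCol_mem_sub (fun q => (hL _).2 fun t => ?_) p
      have := congrFun (map_mulCol (ev t) (𝒟.D (i + 1)) X) q
      rw [hev', hwD] at this
      exact this.symm)
  have hw' : ∀ t, mulCol (Θ.Θ (i + 1)) (w t) = mulCol (𝒟'.D i) (ev t ∘ Y) := fun t => by
    rw [← hev', map_mulCol, map_mulCol]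
    refine funext fun p => ?_
    have := (hL _).1 (hY p) t
    rw [map_sub, sub_eq_zero] at this
    exact this
  have hφs : φ ∈ Submodule.span ℂ (Set.range w) := hws ▸ subset_orbitSpan _ (Set.mem_singleton φ)
  obtain ⟨k, rfl⟩ := (Submodule.mem_span_range_iff_exists_fun ℂ).1 hφs
  refine ⟨_, le_max_left n n₀, 𝒟', Θ, ∑ t, algebraMap ℂ A (k t) • (ev t ∘ Y), ?_⟩
  have hsm : ∀ {ι κ : Type} [Fintype κ] (E : Matrix ι κ A) (c : ℂ) (x : κ → M),
      mulCol E (algebraMap ℂ A c • x) = algebraMap ℂ A c • mulCol E x := fun E c x => by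
    ext p
    simp [mulCol, Finset.smul_sum, algebraMap_smul, smul_comm c]
  rw [mulCol_sum, mulCol_sum]
  refine Finset.sum_congr rfl fun t _ => ?_
  rw [show k t • w t = algebraMap ℂ A (k t) • w t from funext fun p => (algebraMap_smul A (k t) _).symm,
    hsm, hsm, hw']

end Bound

/-! ### Derivatives of rational representations -/

section Derivative

variable {G : Type u} [Group G] [AffineAlgebraicGroup G]
variable {V V' : Type*} [AddCommGroup V] [Module ℂ V] [AddCommGroup V'] [Module ℂ V']
  {ρ : Representation ℂ G V} {ρ' : Representation ℂ G V'}

lemma infAct_eq_sum (hρ : IsRational ρ) {v : V} {ι : Type*} [Fintype ι] (f : ι → CoordRing G) (w : ι → V)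
    (h : ∀ g, ρ g v = ∑ i, (f i).1 g • w i) (z : LieAlg G) :
    infAct hρ z v = ∑ i, atOne z (f i) • w i := by
  let e := (Fintype.equivFin ι).symm
  rw [infAct_eq hρ (f := fun i => f (e i)) (w := fun i => w (e i)) (fun g => by
    rw [h g]
    exact (Equiv.sum_comp e fun i => (f i).1 g • w i).symm)]
  exact Equiv.sum_comp e fun i => atOne z (f i) • w i

lemma atOne_mul (z : LieAlg G) (a b : CoordRing G) :
    atOne z (a * b) = a.1 1 * atOne z b + b.1 1 * atOne z a := by
  change (z.1 (a * b)).1 1 = _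
  rw [Derivation.leibniz]
  rfl

lemma infAct_map (hρ : IsRational ρ) (hρ' : IsRational ρ') {η : CoordRing G} (T : V →ₗ[ℂ] V')
    (hη : η.1 1 = 1) (hT : ∀ g v, ρ' g (T v) = η.1 g • T (ρ g v)) (z : LieAlg G) (v : V) :
    infAct hρ' z (T v) = T (infAct hρ z v) + atOne z η • T v := by
  obtain ⟨n, f, w, h⟩ := hρ v
  have h1 := h 1
  rw [map_one, Module.End.one_apply] at h1
  rw [infAct_eq hρ h, infAct_eq_sum hρ' (fun i => η * f i) (fun i => T (w i)) fun g => by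
    rw [hT, h g, map_sum, Finset.smul_sum]
    exact Finset.sum_congr rfl fun i _ => by
      rw [map_smul, smul_smul]; rfl]
  simp only [atOne_mul, hη, one_mul, add_smul, Finset.sum_add_distrib, map_sum, map_smul]
  congr 1
  conv_rhs => rw [h1, map_sum, Finset.smul_sum]
  exact Finset.sum_congr rfl fun i _ => by rw [map_smul, smul_smul, mul_comm]

lemma infAct_mem_of_isStable (hρ : IsRational ρ) {N : Submodule ℂ V} (hN : IsStable ρ N)
    (z : LieAlg G) {v : V} (hv : v ∈ N) : infAct hρ z v ∈ N := by
  have := infAct_map (hρ.subRep hN) hρ (η := 1) N.subtype rfl (fun g x => by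
    change _ = (1 : ℂ) • _
    rw [one_smul]; rfl) z ⟨v, hv⟩
  have h0 : atOne z (1 : CoordRing G) = 0 := by
    change (z.1 1).1 1 = 0
    rw [Derivation.map_one_eq_zero]
    rfl
  rw [h0, zero_smul, add_zero] at this
  exact (show infAct hρ z v = _ from this) ▸ Subtype.property _

lemma rep_infAct (hρ : IsRational ρ) (g : G) (z : LieAlg G) (v : V) :
    ρ g (infAct hρ z v) = infAct hρ (Ad g z) (ρ g v) := by
  obtain ⟨n, f, w, h⟩ := hρ v
  rw [infAct_eq hρ h, infAct_eq_sum hρ (fun i => leftTranslate g⁻¹ (rightTranslate g (f i)))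
    (fun i => ρ g (w i)) fun x => ?_, map_sum]
  · refine Finset.sum_congr rfl fun i _ => ?_
    rw [map_smul]
    congr 1
    have hz : ∀ g f, z.1 (leftTranslate g f) = leftTranslate g (z.1 f) := z.2
    have e : rightTranslate g⁻¹ (rightTranslate g (leftTranslate g⁻¹ (f i))) = leftTranslate g⁻¹ (f i) := by
      have := rightTranslate_comp g⁻¹ (leftTranslate g⁻¹ (f i))
      rwa [inv_inv] at this
    change (z.1 (f i)).1 1 = (rightTranslate g (z.1 (rightTranslate g⁻¹
      (leftTranslate g⁻¹ (rightTranslate g (f i)))))).1 1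
    rw [leftTranslate_rightTranslate, e, hz]
    change _ = (z.1 (f i)).1 (g⁻¹ * (1 * g))
    simp
  · have e : ρ x (ρ g v) = ρ g (ρ (g⁻¹ * x * g) v) := by
      rw [← Module.End.mul_apply, ← Module.End.mul_apply, ← map_mul, ← map_mul]
      congr 2
      group
    rw [e, h, map_sum]
    exact Finset.sum_congr rfl fun i _ => map_smul _ _ _

variable {R : Type u} [CommRing R] [Algebra ℂ R] [MulSemiringAction G R] [SMulCommClass G ℂ R]
  {W : HamiltonianSpace G R}
variable {A : Type u} [Ring A] [Algebra ℂ A] [MulSemiringAction G A] [SMulCommClass G ℂ A]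
  (Q : FilteredQuantization W A)
variable [Module A V] [IsScalarTower ℂ A V] [Module A V'] [IsScalarTower ℂ A V']

lemma infAct_smul (hρ : IsRational ρ) (hc : ∀ g (a : A) v, ρ g (a • v) = (g • a) • ρ g v)
    (z : LieAlg G) (a : A) (v : V) :
    infAct hρ z (a • v) = infAct Q.rational z a • v + a • infAct hρ z v := by
  have hcomm : SMulCommClass ℂ A V := inferInstance
  obtain ⟨n, f, w, h⟩ := hρ v
  obtain ⟨m, f', w', h'⟩ := Q.rational a
  have h1 := h 1
  have h1' := h' 1
  rw [map_one, Module.End.one_apply] at h1 h1'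
  rw [infAct_eq hρ h, infAct_eq Q.rational h', infAct_eq_sum hρ
    (fun p : Fin m × Fin n => f' p.1 * f p.2) (fun p => w' p.1 • w p.2) fun g => ?_]
  · simp only [atOne_mul, add_smul, Finset.sum_add_distrib]
    rw [add_comm]
    conv_rhs => rw [h1, h1']
    congr 1
    · rw [Finset.sum_smul, Fintype.sum_prod_type]
      refine Finset.sum_congr rfl fun i _ => ?_
      rw [Finset.smul_sum]
      refine Finset.sum_congr rfl fun j _ => ?_
      rw [smul_assoc, smul_comm (w' i), smul_smul, mul_comm]
    · rw [Finset.sum_smul, Fintype.sum_prod_type]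
      refine Finset.sum_congr rfl fun i _ => ?_
      rw [Finset.smul_sum]
      refine Finset.sum_congr rfl fun j _ => ?_
      rw [smul_assoc, smul_comm (w' i), smul_smul]
  · rw [hc, h g, show g • a = _ from h' g, Finset.sum_smul, Fintype.sum_prod_type]
    refine Finset.sum_congr rfl fun i _ => ?_
    rw [Finset.smul_sum]
    refine Finset.sum_congr rfl fun j _ => ?_
    rw [smul_assoc, smul_comm (w' i), smul_smul]
    rfl

/-- The defect of twisted equivariance. -/
def tau (hρ : IsRational ρ) (z : LieAlg G) (s : ℂ) (v : V) : V :=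
  infAct hρ z v - (Q.moment z + algebraMap ℂ A s) • v

lemma tau_add (hρ : IsRational ρ) (z : LieAlg G) (s : ℂ) (v v' : V) :
    tau Q hρ z s (v + v') = tau Q hρ z s v + tau Q hρ z s v' := by
  rw [tau, tau, tau, infAct_add, smul_add]
  abel

/-- On `A` the derivative of the action is the commutator with the moment map, so the extra term of
the Leibniz rule for `infAct` cancels and the defect is `A`-linear. -/
lemma tau_smul (hρ : IsRational ρ) (hc : ∀ g (a : A) v, ρ g (a • v) = (g • a) • ρ g v)
    (z : LieAlg G) (s : ℂ) (a : A) (v : V) : tau Q hρ z s (a • v) = a • tau Q hρ z s v := by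
  rw [tau, tau, infAct_smul Q hρ hc, ← Q.moment_commutator, smul_sub, smul_smul, smul_smul, sub_smul,
    mul_add, add_mul, add_smul, add_smul, Algebra.commutes s a]
  abel

lemma rep_tau (hρ : IsRational ρ) (hc : ∀ g (a : A) v, ρ g (a • v) = (g • a) • ρ g v)
    (g : G) (z : LieAlg G) (s : ℂ) (v : V) :
    ρ g (tau Q hρ z s v) = tau Q hρ (Ad g z) s (ρ g v) := by
  rw [tau, tau, map_sub, rep_infAct, hc, smul_add, Q.moment_equivariant,
    show g • algebraMap ℂ A s = algebraMap ℂ A s by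
      rw [Algebra.algebraMap_eq_smul_one, smul_comm, smul_one]]

lemma tau_map (hρ : IsRational ρ) (hρ' : IsRational ρ') {η : CoordRing G} (T : V →ₗ[A] V')
    (hη : η.1 1 = 1) (hT : ∀ g v, ρ' g (T v) = η.1 g • T (ρ g v)) (z : LieAlg G) (s : ℂ) (v : V) :
    T (tau Q hρ z s v) = tau Q hρ' z s (T v) - atOne z η • T v := by
  rw [tau, tau, map_sub, map_smul, show infAct hρ' z (T v) = T (infAct hρ z v) + atOne z η • T v from
    infAct_map hρ hρ' (T.restrictScalars ℂ) hη hT z v]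
  abel

variable {Q} {θ : G →* ℂˣ} {κ κ' : Type*} [Fintype κ] [DecidableEq κ] [Fintype κ'] [DecidableEq κ']
  {r : MatRep G κ} {r' : MatRep G κ'} {δ : κ → ℤ}

/-- Right multiplication of a tuple by an element. -/
def mulRight (a : A) : (κ → A) →ₗ[A] (κ → A) :=
  LinearMap.pi fun v => LinearMap.toSpanSingleton A A a ∘ₗ LinearMap.proj v

lemma mulRight_apply (a : A) (x : κ → A) (v : κ) : mulRight a x v = x v * a := rfl

lemma mulRight_rep {β : ℤ × ℤ} {a : A} (ha : a ∈ biA Q θ β) (g : G) (x : κ → A) :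
    tupleRep r (actRep G A) g (mulRight a x) =
      (wtChar θ β.1 g : ℂ) • mulRight a (tupleRep r (actRep G A) g x) := funext fun b => by
  rw [Pi.smul_apply, mulRight_apply, tupleRep_apply, tupleRep_apply, Finset.sum_mul, Finset.smul_sum]
  refine Finset.sum_congr rfl fun v _ => ?_
  change r.hom g b v • g • (x v * a) = (wtChar θ β.1 g : ℂ) • ((r.hom g b v • g • x v) * a)
  rw [smul_mul', (mem_biA.1 ha).1 g, smul_mul_assoc (r.hom g b v), mul_smul_comm (wtChar θ β.1 g : ℂ),
    smul_comm (r.hom g b v)]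

lemma sub_mulRight_mem {i e : ℤ} {a : A} (ha : a ∈ Q.F i) {x : κ → A} (hx : x ∈ filtK Q δ e) :
    a • x - mulRight a x ∈ filtK Q δ (i + e - 1) := mem_filtK.2 fun v => by
  have := commutator_mem ha (mem_filtK.1 hx v)
  rwa [show i + e - 1 - δ v = i + (e - δ v) - 1 by lia]

/-- Symbols commute, so the leading symbol of `a • l` is that of `l * a`. As long as `l` exceeds the
expected order by a positive amount, this symbol vanishes, and each multiplication by `a` lowers the
excess `s` by one. -/
lemma exists_pow_smul_mem {β : ℤ × ℤ} {a : A} (ha : a ∈ biA Q θ β) (s : ℕ) {e : ℤ} {l : κ → A}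
    (hl : mulRight a l ∈ filtK Q δ (e + β.2)) (hls : l ∈ filtK Q δ (e + s)) :
    ∃ M : ℕ, a ^ M • l ∈ filtK Q δ ((M • β).2 + e) := by
  induction s generalizing e l with
  | zero => exact ⟨0, by simpa using hls⟩
  | succ s ih =>
    have h1 : a • l ∈ filtK Q δ (e + β.2 + s) := mem_filtK.2 fun v => by
      have h2 := mem_filtK.1 hls v
      have h3 := Q.mul_mem ha.2 h2
      have h4 := (sym_eq_zero h3).1 (by
        rw [sym_mul ha.2 h2, mul_comm, ← sym_mul h2 ha.2]
        refine (sym_eq_zero (Q.mul_mem h2 ha.2)).2 (Q.mono ?_ (mem_filtK.1 hl v))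
        push_cast
        lia)
      refine Q.mono ?_ h4
      push_cast
      lia
    obtain ⟨M, hM⟩ := ih (e := e + β.2) (l := a • l) (by
      rw [map_smul, add_comm]; exact smul_mem_filtK ha.2 hl) h1
    refine ⟨M + 1, ?_⟩
    rw [pow_succ, mul_smul, succ_nsmul, Prod.snd_add, add_assoc, add_comm β.2]
    exact hM

lemma tau_mem_filtK (hδ : ∀ g a b, r.hom g b a ≠ 0 → δ a = δ b) (z : LieAlg G) (s : ℂ) {e : ℤ}
    {x : κ → A} (hx : x ∈ filtK Q δ e) :
    tau Q (isRational_tupleRep r Q.rational) z s x ∈ filtK Q δ (e + 1) := by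
  have h1 := infAct_mem_of_isStable (isRational_tupleRep r Q.rational) (isStable_filtK hδ e) z hx
  have h2 : Q.moment z + algebraMap ℂ A s ∈ Q.F 1 := by
    refine add_mem (Q.moment_mem z) (Q.mono zero_le_one ?_)
    rw [Algebra.algebraMap_eq_smul_one]
    exact Submodule.smul_mem _ _ Q.one_mem
  have h3 := smul_mem_filtK h2 hx
  rw [add_comm] at h3
  exact sub_mem (filtK_mono (by lia) h1) h3

/-- A twisted-equivariant map preserves the relations of twisted equivariance up to a power of `a` and
terms of lower order. -/
lemma exists_relation (hθ : (fun g => (θ g : ℂ)) ∈ AffineAlgebraicGroup.coord (G := G))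
    (hδ : ∀ g a b, r.hom g b a ≠ 0 → δ a = δ b) {β : ℤ × ℤ} {a : A} (ha : a ∈ biA Q θ β)
    (T : (κ' → A) →ₗ[A] (κ → A)) (hT : ∀ g y, tupleRep r (actRep G A) g (T y) =
      (wtChar θ β.1 g : ℂ) • T (tupleRep r' (actRep G A) g y))
    (Γ : Submodule A (κ → A)) {ι : Type*} [Fintype ι] (z : ι → LieAlg G) (s : ι → ℂ) (m : ι → κ' → A)
    (hΓ : ∀ i n, tau Q (isRational_tupleRep r Q.rational) (z i) (s i) n ∈ Γ) {e : ℤ} {y : κ' → A}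
    (hy : y = ∑ i, tau Q (isRational_tupleRep r' Q.rational) (z i) (s i) (m i))
    (hTy : T y ∈ filtK Q δ (e + β.2)) :
    ∃ K : ℕ, ∃ l ∈ Γ, a ^ K • T y - l ∈ filtK Q δ ((K • β).2 + (e + β.2) - 1) := by
  have hcomm : SMulCommClass ℂ A (κ → A) := inferInstance
  let η : CoordRing G := ⟨_, wtChar_regular hθ β.1⟩
  have hη : η.1 1 = 1 := by change (wtChar θ β.1 1 : ℂ) = 1; simp
  have hc : ∀ g (a : A) (v : κ → A), tupleRep r (actRep G A) g (a • v) =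
    (g • a) • tupleRep r (actRep G A) g v := tupleRep_smul r actRep_mul
  let hr := isRational_tupleRep r Q.rational
  -- Both `T` and right multiplication by `a` transform by the character of weight `β.1`, so each of
  -- them carries the defect `tau` to `σ`, which is `tau` corrected by the derivative of this
  -- character. Consequently `T y` is a sum of values of `σ`, while `σ (n a) = tau(n) a` is an
  -- element of `Γ` multiplied by `a` on the right.
  let σ : ι → (κ → A) → (κ → A) := fun i n => tau Q hr (z i) (s i) n - atOne (z i) η • n
  have hσs : ∀ i (b : A) n, σ i (b • n) = b • σ i n := fun i b n => by
    change tau Q hr _ _ (b • n) - _ = b • (tau Q hr _ _ n - _)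
    rw [tau_smul Q hr hc, smul_sub, smul_comm b]
  have hσa : ∀ i n n', σ i (n + n') = σ i n + σ i n' := fun i n n' => by
    change tau Q hr _ _ (n + n') - _ = (tau Q hr _ _ n - _) + (tau Q hr _ _ n' - _)
    rw [tau_add, smul_add]
    abel
  have hσm : ∀ i n, mulRight a (tau Q hr (z i) (s i) n) = σ i (mulRight a n) := fun i n =>
    tau_map Q hr hr (η := η) (mulRight a) hη (fun g x => mulRight_rep ha g x) _ _ _
  have hσT : T y = ∑ i, σ i (T (m i)) := by
    rw [hy, map_sum]
    exact Finset.sum_congr rfl fun i _ => tau_map Q _ hr (η := η) T hη hT _ _ _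
  let ad : (κ → A) → (κ → A) := fun x => a • x - mulRight a x
  -- Since `σ` is `A`-linear, `a σ(n) = σ(ad n) + σ(n a)`, where `ad` is the commutator with `a`.
  -- Iterating, `a ^ N σ(n)` is an element of `Γ` times `a` on the right, up to `σ (ad^N n)`.
  have hl : ∀ i (N : ℕ) (n : κ → A), ∃ l ∈ Γ, mulRight a l = a ^ N • σ i n - σ i (ad^[N] n) := by
    intro i N n
    induction N with
    | zero => exact ⟨0, zero_mem _, by simp⟩
    | succ N ih =>
      obtain ⟨l, hl, h⟩ := ih
      refine ⟨a • l + tau Q hr (z i) (s i) (ad^[N] n), add_mem (Γ.smul_mem _ hl) (hΓ i _), ?_⟩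
      have key : a • σ i (ad^[N] n) = σ i (ad (ad^[N] n)) + σ i (mulRight a (ad^[N] n)) := by
        rw [← hσs, ← hσa]
        exact congrArg _ (sub_add_cancel _ _).symm
      rw [map_add, map_smul, h, hσm, Function.iterate_succ_apply', smul_sub, smul_smul, ← pow_succ', key]
      abel
  choose l hlΓ hlm using hl
  choose E hE using fun i => exists_mem_filtK (Q := Q) (δ := δ) (T (m i))
  obtain ⟨B, hB⟩ := Finset.exists_le (Finset.univ.image E)
  have hE' : ∀ i (N : ℕ), ad^[N] (T (m i)) ∈ filtK Q δ ((N • β).2 + B - N) := fun i N => by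
    induction N with
    | zero => simpa using filtK_mono (hB _ (Finset.mem_image_of_mem _ (Finset.mem_univ i))) (hE i)
    | succ N ih =>
      rw [Function.iterate_succ_apply']
      refine filtK_mono ?_ (sub_mulRight_mem ha.2 ih)
      rw [succ_nsmul, Prod.snd_add]
      push_cast
      lia
  -- Each application of `ad` gains one order over multiplication by `a`, while `σ` loses at most
  -- one; `N` is chosen so that the remainder drops below the order of `a ^ N • T y`.
  obtain ⟨N, hN⟩ : ∃ N : ℕ, B + 1 - N ≤ e + β.2 - 1 := ⟨(B + 2 - e - β.2).toNat, by lia⟩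
  let L := ∑ i, l i N (T (m i))
  have hL : L ∈ Γ := sum_mem fun i _ => hlΓ i N _
  have hlow : a ^ N • T y - mulRight a L ∈ filtK Q δ ((N • β).2 + (e + β.2) - 1) := by
    have h1 : a ^ N • T y - mulRight a L = ∑ i, σ i (ad^[N] (T (m i))) := by
      rw [map_sum, hσT, Finset.smul_sum, ← Finset.sum_sub_distrib]
      exact Finset.sum_congr rfl fun i _ => by rw [hlm, sub_sub_cancel]
    rw [h1]
    refine sum_mem fun i _ => filtK_mono (e := (N • β).2 + B - N + 1) (by lia) ?_
    exact sub_mem (tau_mem_filtK hδ _ _ (hE' i N)) (Submodule.smul_mem _ _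
      (filtK_mono (by lia) (hE' i N)))
  have haN := smul_mem_filtK (pow_mem_biA ha N).2 hTy
  have hLa : mulRight a L ∈ filtK Q δ ((N • β).2 + e + β.2) := by
    have := sub_mem haN (filtK_mono (by lia) hlow)
    rwa [sub_sub_cancel, ← add_assoc] at this
  obtain ⟨E₁, hE₁⟩ := exists_mem_filtK (Q := Q) (δ := δ) L
  -- So far the order of `L` is controlled only after multiplication by `a` on the right. A further
  -- power of `a` on the left brings `L` itself down, after which right and left multiplication by
  -- `a` agree up to lower order.
  obtain ⟨M, hM⟩ := exists_pow_smul_mem ha (E₁ - ((N • β).2 + e)).toNat hLa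
    (filtK_mono (by lia) hE₁)
  refine ⟨M + N, a • a ^ M • L, Γ.smul_mem _ (Γ.smul_mem _ hL), ?_⟩
  have h1 := smul_mem_filtK (pow_mem_biA ha M).2 hlow
  have h2 := sub_mulRight_mem ha.2 hM
  have h3 : a ^ (M + N) • T y - a • a ^ M • L = a ^ M • (a ^ N • T y - mulRight a L) -
      (a • a ^ M • L - mulRight a (a ^ M • L)) := by
    rw [pow_add, mul_smul, smul_sub, map_smul]
    abel
  rw [h3, add_smul, Prod.snd_add]
  exact sub_mem (filtK_mono (by lia) h1) (filtK_mono (by lia) h2)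

end Derivative

/-! ### Relations of twisted equivariance -/

section Relations

variable {G : Type u} [Group G] [AffineAlgebraicGroup G]
variable {R : Type u} [CommRing R] [Algebra ℂ R] [MulSemiringAction G R] [SMulCommClass G ℂ R]
  {W : HamiltonianSpace G R}
variable {A : Type u} [Ring A] [Algebra ℂ A] [MulSemiringAction G A] [SMulCommClass G ℂ A]
  (Q : FilteredQuantization W A) (c : LieAlgebra.LieCharacter ℂ (LieAlg G))
variable {V V' : Type*} [AddCommGroup V] [Module ℂ V] [AddCommGroup V'] [Module ℂ V']
  {ρ : Representation ℂ G V} {ρ' : Representation ℂ G V'}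
variable [Module A V] [IsScalarTower ℂ A V] [Module A V'] [IsScalarTower ℂ A V']

/-- The submodule generated by the relations of twisted equivariance. -/
def relMod (hρ : IsRational ρ) : Submodule A V :=
  Submodule.span A {x | ∃ g z v, x = ρ g (tau Q hρ z (c z) v)}

variable {Q c}

/-- The scalar is `c z` and not `c (Ad g z)`: the relations are generated by all translates, which
makes them stable without an appeal to the invariance of `c` under the adjoint action. -/
lemma tau_mem_relMod (hρ : IsRational ρ) (hc : ∀ g (a : A) v, ρ g (a • v) = (g • a) • ρ g v)
    (g : G) (z : LieAlg G) (v : V) : tau Q hρ (Ad g z) (c z) v ∈ relMod Q c hρ :=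
  Submodule.subset_span ⟨g, z, ρ g⁻¹ v, by
    rw [rep_tau Q hρ hc, ← Module.End.mul_apply, ← map_mul, mul_inv_cancel, map_one,
      Module.End.one_apply]⟩

lemma exists_eq_sum_tau (hρ : IsRational ρ) (hc : ∀ g (a : A) v, ρ g (a • v) = (g • a) • ρ g v)
    {x : V} (hx : x ∈ relMod Q c hρ) : ∃ (n : ℕ) (g : Fin n → G) (z : Fin n → LieAlg G) (m : Fin n → V),
      x = ∑ i, tau Q hρ (Ad (g i) (z i)) (c (z i)) (m i) := by
  induction hx using Submodule.span_induction with
  | mem x hx =>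
    obtain ⟨g, z, v, rfl⟩ := hx
    exact ⟨1, fun _ => g, fun _ => z, fun _ => ρ g v, by rw [rep_tau Q hρ hc]; simp⟩
  | zero => exact ⟨0, Fin.elim0, Fin.elim0, Fin.elim0, by simp⟩
  | add x y _ _ h h' =>
    obtain ⟨n, g, z, m, rfl⟩ := h
    obtain ⟨n', g', z', m', rfl⟩ := h'
    exact ⟨n + n', Fin.append g g', Fin.append z z', Fin.append m m', by
      rw [Fin.sum_univ_add]; simp⟩
  | smul a x _ h =>
    obtain ⟨n, g, z, m, rfl⟩ := h
    exact ⟨n, g, z, fun i => a • m i, by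
      rw [Finset.smul_sum]
      exact Finset.sum_congr rfl fun i _ => (tau_smul Q hρ hc _ _ _ _).symm⟩

lemma rep_mem_relMod (hρ : IsRational ρ) (hc : ∀ g (a : A) v, ρ g (a • v) = (g • a) • ρ g v)
    (g : G) {x : V} (hx : x ∈ relMod Q c hρ) : ρ g x ∈ relMod Q c hρ := by
  induction hx using Submodule.span_induction with
  | mem x hx =>
    obtain ⟨g', z, v, rfl⟩ := hx
    exact Submodule.subset_span ⟨g * g', z, v, by rw [map_mul]; rfl⟩
  | zero => rw [map_zero]; exact zero_mem _
  | add x y _ _ h h' => rw [map_add]; exact add_mem h h'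
  | smul a x _ h => rw [hc]; exact Submodule.smul_mem _ _ h

lemma map_tau (hρ : IsRational ρ) (hρ' : IsRational ρ') (T : V →ₗ[A] V')
    (hT : ∀ g v, ρ' g (T v) = T (ρ g v)) (z : LieAlg G) (s : ℂ) (v : V) :
    T (tau Q hρ z s v) = tau Q hρ' z s (T v) := by
  have h0 : atOne z (1 : CoordRing G) = 0 := by
    change (z.1 1).1 1 = 0
    rw [Derivation.map_one_eq_zero]
    rfl
  have := tau_map Q hρ hρ' (η := 1) T rfl (fun g v => by
    change _ = (1 : ℂ) • _
    rw [one_smul, hT]) z s v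
  rwa [h0, zero_smul, sub_zero] at this

lemma map_mem_relMod (hρ : IsRational ρ) (hρ' : IsRational ρ') (T : V →ₗ[A] V')
    (hT : ∀ g v, ρ' g (T v) = T (ρ g v)) {x : V} (hx : x ∈ relMod Q c hρ) : T x ∈ relMod Q c hρ' := by
  induction hx using Submodule.span_induction with
  | mem x hx =>
    obtain ⟨g, z, v, rfl⟩ := hx
    rw [← hT, map_tau hρ hρ' T hT]
    exact Submodule.subset_span ⟨g, z, T v, rfl⟩
  | zero => rw [map_zero]; exact zero_mem _
  | add x y _ _ h h' => rw [map_add]; exact add_mem h h'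
  | smul a x _ h => rw [map_smul]; exact Submodule.smul_mem _ _ h

/-! ### Homology of a complex of free equivariant modules -/

variable {θ : G →* ℂˣ} (hθ : (fun g => (θ g : ℂ)) ∈ AffineAlgebraicGroup.coord (G := G))
variable {ι ι' ι'' τ : Type*} [Fintype ι] [DecidableEq ι] [Fintype ι'] [DecidableEq ι']
  [Fintype ι''] [DecidableEq ι''] [Fintype τ] [DecidableEq τ]

/-- Right multiplication of tuples of rows by a matrix. -/
def rowMul (τ : Type*) (H : Matrix ι ι' A) : (ι × τ → A) →ₗ[A] (ι' × τ → A) where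
  toFun x p := ∑ q, x (q, p.2) * H q p.1
  map_add' x y := funext fun p => by simp [add_mul, Finset.sum_add_distrib]
  map_smul' a x := funext fun p => by simp [mul_assoc, Finset.mul_sum]

lemma rowMul_apply (H : Matrix ι ι' A) (x : ι × τ → A) (p : ι' × τ) :
    rowMul τ H x p = ∑ q, x (q, p.2) * H q p.1 := rfl

lemma rowMul_rowMul (H : Matrix ι ι' A) (H' : Matrix ι' ι'' A) (x : ι × τ → A) :
    rowMul τ H' (rowMul τ H x) = rowMul τ (H * H') x := funext fun p => by
  simp only [rowMul_apply, Matrix.mul_apply, Finset.sum_mul, Finset.mul_sum, mul_assoc]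
  exact Finset.sum_comm

/-- The representation on the tuples of rows of a complex. -/
abbrev rowRep (b : ι → ℤ × ℤ) (s : MatRep G τ) : MatRep G (ι × τ) :=
  (MatRep.diag θ hθ fun p => (b p).1).tensor s

/-- The degree shifts on tuples of rows. -/
abbrev rowDeg (τ : Type*) (b : ι → ℤ × ℤ) : ι × τ → ℤ := fun p => (b p.1).2

lemma rowDeg_eq (b : ι → ℤ × ℤ) (s : MatRep G τ) (g : G) (p q : ι × τ)
    (h : (rowRep hθ b s).hom g q p ≠ 0) : rowDeg τ b p = rowDeg τ b q := by
  rw [MatRep.tensor_apply, MatRep.diag_apply] at h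
  have : q.1 = p.1 := by
    by_contra hne
    rw [if_neg hne, zero_mul] at h
    exact h rfl
  simp only [rowDeg, this]

lemma tupleRep_rowRep (b : ι → ℤ × ℤ) (s : MatRep G τ) {M : Type*} [AddCommGroup M] [Module ℂ M]
    (ρ : Representation ℂ G M) (g : G) (x : ι × τ → M) (p : ι) (t : τ) :
    tupleRep (rowRep hθ b s) ρ g x (p, t) =
      (wtChar θ (b p).1 g : ℂ) • ∑ t', s.hom g t t' • ρ g (x (p, t')) := by
  rw [tupleRep_tensor, Finset.smul_sum]
  refine Finset.sum_congr rfl fun t' _ => ?_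
  rw [tupleRep_apply, smul_comm]
  simp [MatRep.diag_apply, ite_smul]

variable {b : ι → ℤ × ℤ} {b' : ι' → ℤ × ℤ} {γ : ℤ × ℤ} {H : Matrix ι ι' A}

lemma tupleRep_rowMul (s : MatRep G τ) (hH : ∀ p q, H p q ∈ biA Q θ (γ + b p - b' q)) (g : G)
    (x : ι × τ → A) : tupleRep (rowRep hθ b' s) (actRep G A) g (rowMul τ H x) =
      (wtChar θ γ.1 g : ℂ) • rowMul τ H (tupleRep (rowRep hθ b s) (actRep G A) g x) :=
  funext fun ⟨q, t⟩ => by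
    rw [tupleRep_rowRep, Pi.smul_apply, rowMul_apply]
    simp only [tupleRep_rowRep, rowMul_apply, map_sum, Finset.smul_sum, Finset.sum_mul]
    rw [Finset.sum_comm]
    refine Finset.sum_congr rfl fun p _ => Finset.sum_congr rfl fun t' _ => ?_
    change _ • s.hom g t t' • g • (x (p, t') * H p q) = (wtChar θ γ.1 g : ℂ) •
      (((wtChar θ (b p).1 g : ℂ) • s.hom g t t' • g • x (p, t')) * H p q)
    rw [smul_mul', (mem_biA.1 (hH p q)).1 g]
    have key : ∀ (w₁ w₂ w₃ w₄ σ : ℂ) (X Y : A), w₁ * w₂ = w₃ * w₄ →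
        w₁ • σ • (X * (w₂ • Y)) = w₃ • ((w₄ • σ • X) * Y) := fun w₁ w₂ w₃ w₄ σ X Y h => by
      rw [Algebra.mul_smul_comm, Algebra.smul_mul_assoc, Algebra.smul_mul_assoc, smul_comm σ w₂,
        smul_smul, smul_smul w₃, h]
    refine key _ _ _ _ _ _ _ ?_
    rw [← Units.val_mul, ← Units.val_mul, ← MonoidHom.mul_apply, ← MonoidHom.mul_apply,
      ← wtChar_add, ← wtChar_add]
    congr 3
    simp

lemma tupleRep_rowMul_of_mem (s : MatRep G τ) (hH : ∀ p q, H p q ∈ biA Q θ (b p - b' q)) (g : G)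
    (x : ι × τ → A) : tupleRep (rowRep hθ b' s) (actRep G A) g (rowMul τ H x) =
      rowMul τ H (tupleRep (rowRep hθ b s) (actRep G A) g x) := by
  rw [tupleRep_rowMul (Q := Q) hθ (γ := 0) s (fun p q => by rw [zero_add]; exact hH p q)]
  rw [Prod.fst_zero, wtChar_zero]
  exact one_smul _ _

lemma rowMul_mem_filtK (hH : ∀ p q, H p q ∈ Q.F (γ + b p - b' q).2) {e : ℤ} {x : ι × τ → A}
    (hx : x ∈ filtK Q (rowDeg τ b) e) : rowMul τ H x ∈ filtK Q (rowDeg τ b') (e + γ.2) :=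
  mem_filtK.2 fun p => sum_mem fun q _ => Q.mono (by
    simp only [Prod.snd_sub, Prod.snd_add, rowDeg]; lia) (Q.mul_mem (mem_filtK.1 hx (q, p.2)) (hH q p.1))

lemma sym_matMul {u : ι → ℤ} {v : ι' → ℤ} {w : ι'' → ℤ} {X : Matrix ι ι' A} {Y : Matrix ι' ι'' A}
    (hX : ∀ p k, X p k ∈ Q.F (u p - v k)) (hY : ∀ k q, Y k q ∈ Q.F (v k - w q)) (p : ι) (q : ι'') :
    (X * Y) p q ∈ Q.F (u p - w q) ∧
      sym Q (u p - w q) ((X * Y) p q) = ∑ k, sym Q (u p - v k) (X p k) * sym Q (v k - w q) (Y k q) := by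
  have key : ∀ k, X p k * Y k q ∈ Q.F (u p - w q) ∧ sym Q (u p - w q) (X p k * Y k q) =
      sym Q (u p - v k) (X p k) * sym Q (v k - w q) (Y k q) := fun k => by
    have e : u p - w q = (u p - v k) + (v k - w q) := by ring
    rw [e]
    exact ⟨Q.mul_mem (hX p k) (hY k q), sym_mul (hX p k) (hY k q)⟩
  rw [Matrix.mul_apply]
  exact ⟨sum_mem fun k _ => (key k).1, (sym_sum _ fun k _ => (key k).1).trans
    (Finset.sum_congr rfl fun k _ => (key k).2)⟩

/-- The contracting homotopy for the symbol of `a` exists on the complex of symbols. Lifting its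
entries to semi-invariants keeps the homotopy equation up to lower order. -/
lemma exists_lift_homotopy {hG : IsReductive G} {n : ℤ} (𝒟 : FiltCpx Q θ hG n) {β : ℤ × ℤ} (hβ : n ≤ β.1)
    {a : A} (ha : a ∈ biA Q θ β) (i : ℕ) :
    ∃ (h : Matrix (Fin (𝒟.I (i + 1))) (Fin (𝒟.I (i + 2))) A)
      (h' : Matrix (Fin (𝒟.I i)) (Fin (𝒟.I (i + 1))) A),
      (∀ p q, h p q ∈ biA Q θ (β + 𝒟.b _ p - 𝒟.b _ q)) ∧
      (∀ p q, h' p q ∈ biA Q θ (β + 𝒟.b _ p - 𝒟.b _ q)) ∧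
      ∀ p q, (1 : Matrix _ _ A) p q * a - (h * 𝒟.D (i + 1) + 𝒟.D i * h') p q ∈
        Q.F ((β + 𝒟.b (i + 1) p - 𝒟.b _ q).2 - 1) := by
  obtain ⟨H, hH, hHD⟩ := 𝒟.gr.exists_homotopy hβ ⟨a, ha, rfl⟩
  have key : ∀ j, ∃ h : Matrix (Fin (𝒟.I j)) (Fin (𝒟.I (j + 1))) A,
      (∀ p q, h p q ∈ biA Q θ (β + 𝒟.b _ p - 𝒟.b _ q)) ∧
      ∀ p q, sym Q (β + 𝒟.b _ p - 𝒟.b _ q).2 (h p q) = H j p q := fun j => by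
    choose h hh hs using hH j
    exact ⟨h, hh, hs⟩
  choose h hh hs using key
  refine ⟨h (i + 1), h i, hh _, hh _, fun p q => ?_⟩
  have h1 := sym_matMul (Q := Q) (u := fun p => (β + 𝒟.b (i + 1) p).2) (v := fun k => (𝒟.b (i + 2) k).2)
    (w := fun q => (𝒟.b (i + 1) q).2) (fun p k => (hh (i + 1) p k).2)
    (fun k q => (𝒟.D_mem (i + 1) k q).2) p q
  have e : ∀ k, (β + 𝒟.b (i + 1) p).2 - (β + 𝒟.b i k).2 = (𝒟.b (i + 1) p - 𝒟.b i k).2 := fun k => by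
    simp
  have h2 := sym_matMul (Q := Q) (u := fun p => (β + 𝒟.b (i + 1) p).2) (v := fun k => (β + 𝒟.b i k).2)
    (w := fun q => (𝒟.b (i + 1) q).2) (fun p k => by
      have := (𝒟.D_mem i p k).2
      rwa [show (β + 𝒟.b (i + 1) p).2 - (β + 𝒟.b i k).2 = (𝒟.b (i + 1) p - 𝒟.b i k).2 by simp])
    (fun k q => (hh i k q).2) p q
  have h3 : (1 : Matrix _ _ A) p q * a ∈ Q.F ((β + 𝒟.b (i + 1) p).2 - (𝒟.b (i + 1) q).2) ∧
      sym Q ((β + 𝒟.b (i + 1) p).2 - (𝒟.b (i + 1) q).2) ((1 : Matrix _ _ A) p q * a) =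
        (sym Q β.2 a • (1 : Matrix (Fin (𝒟.I (i + 1))) (Fin (𝒟.I (i + 1))) R)) p q := by
    by_cases hpq : p = q
    · subst hpq
      rw [show (β + 𝒟.b (i + 1) p).2 - (𝒟.b (i + 1) p).2 = β.2 by simp]
      rw [Matrix.one_apply_eq, one_mul, Matrix.smul_apply, Matrix.one_apply_eq, smul_eq_mul, mul_one]
      exact ⟨ha.2, rfl⟩
    · simp [Matrix.one_apply_ne hpq, sym_zero]
  refine (sym_eq_zero (sub_mem h3.1 (add_mem h1.1 h2.1))).1 ?_
  rw [sym_sub h3.1 (add_mem h1.1 h2.1), sym_add h1.1 h2.1, h1.2, h2.2, h3.2, sub_eq_zero]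
  have h4 := congrFun (congrFun (hHD i) p) q
  refine h4.symm.trans ?_
  change (∑ k, H (i + 1) p k * sym Q (𝒟.b (i + 2) k - 𝒟.b (i + 1) q).2 (𝒟.D (i + 1) k q)) +
    (∑ k, sym Q (𝒟.b (i + 1) p - 𝒟.b i k).2 (𝒟.D i p k) * H i k q) = _
  refine congr (congrArg _ (Finset.sum_congr rfl fun k _ => ?_)) (Finset.sum_congr rfl fun k _ => ?_)
  · exact congrArg (· * _) (hs (i + 1) p k).symm
  · exact congr (congrArg HMul.hMul (congrArg (fun j => sym Q j _) (e k).symm)) (hs i k q).symm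

/-- The complex of free modules remains exact up to torsion after imposing the relations of twisted
equivariance, although this operation is only right exact. By `exists_smul_mem` it is enough to
approximate: the lifted homotopy writes `a • y` as a boundary plus `h'` of the differential of `y`,
up to lower order, and `exists_relation` moves the second term into the relations. -/
theorem exists_smul_mem_homology (c : LieAlgebra.LieCharacter ℂ (LieAlg G)) {hG : IsReductive G}
    [IsNoetherianRing R] {n : ℤ} (𝒟 : FiltCpx Q θ hG n) (s : MatRep G τ) (i : ℕ)
    (x : Fin (𝒟.I (i + 1)) × τ → A) (hx : rowMul τ (𝒟.D i) x ∈
      relMod Q c (isRational_tupleRep (rowRep hθ (𝒟.b i) s) Q.rational)) :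
    ∃ k : ℤ, ∀ β : ℤ × ℤ, k ≤ β.1 → ∀ a ∈ biA Q θ β, a • x ∈
      relMod Q c (isRational_tupleRep (rowRep hθ (𝒟.b (i + 1)) s) Q.rational) ⊔
        LinearMap.range (rowMul τ (𝒟.D (i + 1))) := by
  have hc : ∀ j g (a : A) v, tupleRep (rowRep hθ (𝒟.b j) s) (actRep G A) g (a • v) =
    (g • a) • tupleRep (rowRep hθ (𝒟.b j) s) (actRep G A) g v := fun j => tupleRep_smul _ actRep_mul
  have hrat := fun j => isRational_tupleRep (rowRep hθ (𝒟.b j) s) Q.rational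
  have hd := fun j g x => tupleRep_rowMul_of_mem hθ s (𝒟.D_mem j) g x
  refine exists_smul_mem (Q := Q) (θ := θ) (κ := Fin (𝒟.I (i + 1)) × τ)
    (r := rowRep hθ (𝒟.b (i + 1)) s)
    (δ := rowDeg τ (𝒟.b (i + 1))) hG (rowDeg_eq hθ _ s)
    (L := relMod Q c (hrat (i + 1)) ⊔ LinearMap.range (rowMul τ (𝒟.D (i + 1))))
    (L' := (relMod Q c (hrat i)).comap (rowMul τ (𝒟.D i))) ?_ ?_ ?_ (n := n) ?_ x hx
  · refine sup_le (fun y hy => ?_) ?_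
    · exact map_mem_relMod (hrat _) (hrat _) _ (hd i) hy
    · rintro _ ⟨y, rfl⟩
      change rowMul τ (𝒟.D i) (rowMul τ (𝒟.D (i + 1)) y) ∈ relMod Q c (hrat i)
      have : rowMul τ (0 : Matrix (Fin (𝒟.I (i + 2))) (Fin (𝒟.I i)) A) y = 0 :=
        funext fun p => by simp [rowMul_apply]
      rw [rowMul_rowMul, 𝒟.comp, this]
      exact zero_mem _
  · intro g y hy
    obtain ⟨y₁, h₁, _, ⟨y₂, rfl⟩, rfl⟩ := Submodule.mem_sup.1 hy
    rw [map_add]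
    refine add_mem (Submodule.mem_sup_left (rep_mem_relMod (hrat _) (hc _) g h₁))
      (Submodule.mem_sup_right ⟨_, (hd (i + 1) g y₂).symm⟩)
  · intro g y hy
    change rowMul τ (𝒟.D i) (tupleRep (rowRep hθ (𝒟.b (i + 1)) s) (actRep G A) g y) ∈
      relMod Q c (hrat i)
    rw [← hd]
    exact rep_mem_relMod (hrat _) (hc _) g hy
  · intro β hβ a ha e y hy hye
    obtain ⟨h, h', hh, hh', hhD⟩ := exists_lift_homotopy 𝒟 hβ ha i
    have hyD : rowMul τ (𝒟.D i) y ∈ filtK Q (rowDeg τ (𝒟.b i)) e := by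
      have := rowMul_mem_filtK (γ := 0) (fun p q => by rw [zero_add]; exact (𝒟.D_mem i p q).2) hye
      simpa using this
    obtain ⟨m, g, z, v, hv⟩ := exists_eq_sum_tau (hrat i) (hc i) hy
    obtain ⟨K, l, hl, hK⟩ := exists_relation hθ (rowDeg_eq hθ _ s) ha (rowMul τ h')
      (tupleRep_rowMul hθ s hh') (relMod Q c (hrat (i + 1))) (fun k => Ad (g k) (z k))
      (fun k => c (z k)) v (fun k y' => tau_mem_relMod (hrat _) (hc _) _ _ _) hv
      (rowMul_mem_filtK (fun p q => (hh' p q).2) hyD)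
    refine ⟨K + 1, a ^ K • rowMul τ (𝒟.D (i + 1)) (rowMul τ h y) + l, add_mem
      (Submodule.smul_mem _ _ (Submodule.mem_sup_right ⟨_, rfl⟩)) (Submodule.mem_sup_left hl), ?_⟩
    -- Modulo lower order, left and right multiplication of `y` by `a` agree, and the homotopy
    -- decomposes the right multiplication.
    have h1 : a • y - rowMul τ (𝒟.D (i + 1)) (rowMul τ h y) - rowMul τ h' (rowMul τ (𝒟.D i) y) ∈
        filtK Q (rowDeg τ (𝒟.b (i + 1))) (β.2 + e - 1) := by
      refine mem_filtK.2 fun ⟨q, t⟩ => ?_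
      have h2 : (a • y - rowMul τ (𝒟.D (i + 1)) (rowMul τ h y) - rowMul τ h' (rowMul τ (𝒟.D i) y)) (q, t) =
          (a • y - mulRight a y) (q, t) + ∑ p, y (p, t) * ((1 : Matrix _ _ A) p q * a -
            (h * 𝒟.D (i + 1) + 𝒟.D i * h') p q) := by
        simp only [rowMul_rowMul, Pi.sub_apply, rowMul_apply, Matrix.add_apply, mul_sub, mul_add,
          Finset.sum_sub_distrib, Finset.sum_add_distrib, mulRight_apply]
        simp [Matrix.one_apply]
        abel
      rw [h2]
      refine add_mem (mem_filtK.1 (sub_mulRight_mem ha.2 hye) (q, t)) (sum_mem fun p _ => ?_)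
      refine Q.mono ?_ (Q.mul_mem (mem_filtK.1 hye (p, t)) (hhD p q))
      simp only [Prod.snd_sub, Prod.snd_add, rowDeg]
      lia
    have h3 := smul_mem_filtK (pow_mem_biA ha K).2 h1
    have h4 : a ^ (K + 1) • y - (a ^ K • rowMul τ (𝒟.D (i + 1)) (rowMul τ h y) + l) =
        a ^ K • (a • y - rowMul τ (𝒟.D (i + 1)) (rowMul τ h y) - rowMul τ h' (rowMul τ (𝒟.D i) y)) +
          (a ^ K • rowMul τ h' (rowMul τ (𝒟.D i) y) - l) := by
      rw [pow_succ, mul_smul, smul_sub, smul_sub]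
      abel
    rw [h4, succ_nsmul, Prod.snd_add]
    exact add_mem (filtK_mono (by lia) h3) (filtK_mono (by lia) hK)

end Relations

/-! ### Hereditary pretorsion classes of modules -/

section Pretorsion

variable {S : Type u} [Ring S] (P : ObjectProperty (ModuleCat.{u} S))

/-- The elements of `M` that belong to the image of an object of `P`. -/
def IsPart (M : ModuleCat.{u} S) (m : M) : Prop :=
  ∃ (X : ModuleCat.{u} S) (f : X ⟶ M) (x : X), P X ∧ f.hom x = m

/-- `P` can be checked elementwise. -/
def IsElementwise : Prop := ∀ M : ModuleCat.{u} S, (∀ m : M, IsPart P M m) → P M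

variable [P.ContainsZero] [P.IsClosedUnderSubobjects] [P.IsClosedUnderQuotients]
  [P.IsClosedUnderFiniteProducts]

/-- The largest subobject of `M` in `P`. -/
def part (M : ModuleCat.{u} S) : Submodule S M where
  carrier := {m | IsPart P M m}
  zero_mem' := by
    obtain ⟨X, -, hX⟩ := ObjectProperty.ContainsZero.exists_zero (P := P)
    exact ⟨X, 0, 0, hX, rfl⟩
  add_mem' := by
    rintro _ _ ⟨X, f, x, hX, rfl⟩ ⟨Y, g, y, hY, rfl⟩
    refine ⟨X ⊞ Y, biprod.desc f g, (biprod.inl : X ⟶ X ⊞ Y).hom x + (biprod.inr : Y ⟶ X ⊞ Y).hom y,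
      P.prop_of_mono (biprod.isoProd X Y).hom (P.prop_limit _ ?_), ?_⟩
    · rintro ⟨⟨⟩⟩
      exacts [hX, hY]
    · rw [map_add, ← LinearMap.comp_apply, ← LinearMap.comp_apply, ← ModuleCat.hom_comp,
        ← ModuleCat.hom_comp, biprod.inl_desc, biprod.inr_desc]
  smul_mem' := by
    rintro s _ ⟨X, f, x, hX, rfl⟩
    exact ⟨X, f, s • x, hX, map_smul f.hom s x⟩

variable {P}

/-- The linear map underlying a morphism. -/
abbrev lin {M N : P.FullSubcategory} (f : M ⟶ N) : M.obj →ₗ[S] N.obj := f.hom.hom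

/-- The morphism given by a linear map. -/
abbrev homOf {M N : P.FullSubcategory} (f : M.obj →ₗ[S] N.obj) : M ⟶ N :=
  ObjectProperty.homMk (ModuleCat.ofHom f)

lemma lin_injective {M N : P.FullSubcategory} (f : M ⟶ N) [Mono f] : Function.Injective (lin f) := by
  have : PreservesFiniteLimits P.ι := preservesFiniteLimits_ι _
  exact (ModuleCat.mono_iff_injective _).1 (inferInstanceAs (Mono (P.ι.map f)))

lemma mono_of_injective {M N : P.FullSubcategory} {f : M ⟶ N} (h : Function.Injective (lin f)) : Mono f :=
  P.ι.mono_of_mono_map ((ModuleCat.mono_iff_injective (P.ι.map f)).2 h)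

lemma epi_of_surjective {M N : P.FullSubcategory} {f : M ⟶ N} (h : Function.Surjective (lin f)) : Epi f :=
  P.ι.epi_of_epi_map ((ModuleCat.epi_iff_surjective (P.ι.map f)).2 h)

lemma lin_surjective {M N : P.FullSubcategory} (f : M ⟶ N) [Epi f] : Function.Surjective (lin f) := by
  have : PreservesFiniteColimits P.ι := preservesFiniteColimits_ι _
  exact (ModuleCat.epi_iff_surjective _).1 (inferInstanceAs (Epi (P.ι.map f)))

lemma lin_exact {X : ShortComplex P.FullSubcategory} (hX : X.Exact) (y : X.X₂.obj) :
    lin X.g y = 0 ↔ ∃ x, lin X.f x = y := by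
  have : PreservesFiniteLimits P.ι := preservesFiniteLimits_ι _
  have : PreservesFiniteColimits P.ι := preservesFiniteColimits_ι _
  exact (ShortComplex.ShortExact.moduleCat_exact_iff_function_exact _).1 (hX.map P.ι) y

/-- The subobject given by a submodule. -/
def subObj (M : P.FullSubcategory) (N : Submodule S M.obj) : P.FullSubcategory :=
  ⟨ModuleCat.of S N, by
    have : Mono (ModuleCat.ofHom N.subtype) := (ModuleCat.mono_iff_injective _).2 N.injective_subtype
    exact P.prop_of_mono (ModuleCat.ofHom N.subtype) M.property⟩

/-- The quotient by a submodule. -/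
def quotObj (M : P.FullSubcategory) (N : Submodule S M.obj) : P.FullSubcategory :=
  ⟨ModuleCat.of S (M.obj ⧸ N), by
    have : Epi (ModuleCat.ofHom N.mkQ) := (ModuleCat.epi_iff_surjective _).2 N.mkQ_surjective
    exact P.prop_of_epi (ModuleCat.ofHom N.mkQ) M.property⟩

lemma prop_part (hP : IsElementwise P) (M : ModuleCat.{u} S) : P (ModuleCat.of S (part P M)) :=
  hP _ fun ⟨_, X, f, x, hX, h⟩ =>
    ⟨X, ModuleCat.ofHom (f.hom.codRestrict (part P M) fun y => ⟨X, f, y, hX, rfl⟩), x, hX, Subtype.ext h⟩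

/-- There are enough injectives. -/
lemma exists_mono_injective (hP : IsElementwise P) (M : P.FullSubcategory) :
    ∃ (E : P.FullSubcategory) (f : M ⟶ E), Mono f ∧ Injective E := by
  obtain ⟨J, i, hi, hJ⟩ : ∃ (J : ModuleCat.{u} S) (i : M.obj ⟶ J), Mono i ∧ Injective J :=
    ⟨_, Injective.ι M.obj, inferInstance, inferInstance⟩
  -- A map into `J` from an object of `P` lands in the `P`-part of `J`, so this part inherits
  -- injectivity within `P`.
  let E : P.FullSubcategory := ⟨ModuleCat.of S (part P J), prop_part hP J⟩
  refine ⟨E, homOf (i.hom.codRestrict _ fun y => ⟨_, i, y, M.property, rfl⟩),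
    mono_of_injective fun x y h => ?_, ⟨fun {X Y} g f _ => ?_⟩⟩
  · exact (ModuleCat.mono_iff_injective i).1 inferInstance (congrArg Subtype.val h)
  · have hf : Mono f.hom := (ModuleCat.mono_iff_injective _).2 (lin_injective f)
    obtain ⟨h, hh⟩ := Injective.factors (J := J)
      (ModuleCat.ofHom ((part P J).subtype ∘ₗ lin g)) f.hom
    refine ⟨homOf (h.hom.codRestrict _ fun y => ⟨_, h, y, Y.property, rfl⟩), ?_⟩
    ext x
    exact congrArg (fun k : X.obj ⟶ J => k.hom x) hh

lemma exists_maximal_disjoint {E : Type*} [AddCommGroup E] [Module S E] {N T : Submodule S E}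
    (h : Disjoint N T) : ∃ N', N ≤ N' ∧ Disjoint N' T ∧ ∀ N'', N' ≤ N'' → Disjoint N'' T → N'' ≤ N' := by
  obtain ⟨N', h₁, h₂⟩ := zorn_le_nonempty₀ {N' : Submodule S E | Disjoint N' T} (fun c hc hch y hy =>
    ⟨sSup c, (DirectedOn.disjoint_sSup_left hch.directedOn).2 fun _ hb => hc hb, fun _ => le_sSup⟩) N h
  exact ⟨N', h₁, h₂.1, fun N'' h3 h4 => h₂.2 h4 h3⟩

/-- A submodule of an injective object that avoids `T` is contained in an injective submodule that
avoids `T`. -/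
lemma exists_injective_disjoint (E : P.FullSubcategory) [Injective E] {N T : Submodule S E.obj}
    (h : Disjoint N T) : ∃ E', N ≤ E' ∧ Disjoint E' T ∧ Injective (subObj E E') := by
  -- With `E'` maximal avoiding `T`, and `K` maximal containing `T` and avoiding `E'`, the module
  -- `E'` embeds in `E / K`. Injectivity of `E` extends its inclusion to `r : E → E`, which kills
  -- `K`.
  obtain ⟨E', hNE, hE', hmax⟩ := exists_maximal_disjoint h
  obtain ⟨K, hTK, hK, hmaxK⟩ := exists_maximal_disjoint hE'.symm
  have hmono : Mono (homOf (M := subObj E E') (N := quotObj E K) (K.mkQ ∘ₗ E'.subtype)) :=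
    mono_of_injective fun x y hxy => by
      have h1 : x.1 - y.1 ∈ K := (Submodule.Quotient.eq K).1 hxy
      exact Subtype.ext (sub_eq_zero.1 (Submodule.disjoint_def.1 hK _ h1 (sub_mem x.2 y.2)))
  obtain ⟨r', hr'⟩ := Injective.factors (homOf (M := subObj E E') (N := E) E'.subtype)
    (homOf (M := subObj E E') (N := quotObj E K) (K.mkQ ∘ₗ E'.subtype))
  let r : E.obj →ₗ[S] E.obj := lin r' ∘ₗ K.mkQ
  have hr : ∀ x ∈ E', r x = x := fun x hx =>
    congrArg (fun k : subObj E E' ⟶ E => lin k ⟨x, hx⟩) hr'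
  have hrK : ∀ x ∈ K, r x = 0 := fun x hx =>
    (congrArg (lin r') ((Submodule.Quotient.mk_eq_zero K).2 hx)).trans (map_zero (lin r'))
  -- The preimage of `T` contains `K` and avoids `E'`, so it equals `K`. Hence the image of `r`
  -- avoids `T`; it contains `E'`, so by maximality it is `E'`, and `r` is a retraction of `E` onto
  -- `E'`.
  have hrT : T.comap r ≤ K := hmaxK _ (fun x hx => by
      change r x ∈ T
      rw [hrK x hx]; exact zero_mem _) <| Submodule.disjoint_def.2 fun x hx hx' => by
    refine Submodule.disjoint_def.1 hE' x hx' ?_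
    rw [← hr x hx']; exact hx
  have hrE : ∀ x, r x ∈ E' := fun x => hmax (LinearMap.range r) (fun y hy => ⟨y, hr y hy⟩)
    (Submodule.disjoint_def.2 (by
      rintro _ ⟨y, rfl⟩ hy
      exact hrK y (hrT hy))) ⟨x, rfl⟩
  refine ⟨E', hNE, hE', Retract.injective (Y := E)
    { i := homOf E'.subtype, r := homOf (r.codRestrict E' hrE), retract := ?_ }⟩
  ext x
  exact Subtype.ext (hr x.1 x.2)

variable {J : Type w}

/-- The quotient of the coproduct by its `P`-part receives the zero map from each summand, hence its
projection is zero. -/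
lemma isClosedUnderColimitsOfShape_discrete (hP : IsElementwise P) :
    P.IsClosedUnderColimitsOfShape (Discrete J) where
  colimitsOfShape_le := by
    rintro Z ⟨h⟩
    refine hP _ fun m => ?_
    have key : ModuleCat.ofHom (part P Z).mkQ = 0 := h.isColimit.hom_ext fun j => by
      ext x
      exact (Submodule.Quotient.mk_eq_zero _).2 ⟨_, h.ι.app j, x, h.prop_diag_obj j, rfl⟩
    exact (Submodule.Quotient.mk_eq_zero (part P Z)).1 (congrArg (fun k => k.hom m) key)

variable [HasColimitsOfShape (Discrete J) (ModuleCat.{u} S)]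

lemma hasColimitsOfShape_discrete (hP : IsElementwise P) :
    HasColimitsOfShape (Discrete J) P.FullSubcategory := by
  have := isClosedUnderColimitsOfShape_discrete (J := J) hP
  infer_instance

lemma preservesColimitsOfShape_discrete (hP : IsElementwise P) :
    PreservesColimitsOfShape (Discrete J) P.ι := by
  have := isClosedUnderColimitsOfShape_discrete (J := J) hP
  infer_instance

lemma hasExactColimitsOfShape_discrete [HasColimitsOfShape (Discrete J) P.FullSubcategory]
    [HasExactColimitsOfShape (Discrete J) (ModuleCat.{u} S)] (hP : IsElementwise P) :
    HasExactColimitsOfShape (Discrete J) P.FullSubcategory := by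
  have := preservesColimitsOfShape_discrete (J := J) hP
  have : PreservesFiniteLimits P.ι := preservesFiniteLimits_ι _
  exact HasExactColimitsOfShape.domain_of_functor _ P.ι

/-- The elements of a coproduct. -/
lemma exists_coproduct_projections {X : J → P.FullSubcategory} {Z : P.FullSubcategory} {i : ∀ j, X j ⟶ Z}
    (h : IsColimit (Cofan.mk Z i)) : ∃ p : ∀ j, Z ⟶ X j, ∀ z : Z.obj, ∃ t : Finset J, ∀ t', t ⊆ t' →
      z = ∑ j ∈ t', lin (i j) (lin (p j) z) := by
  classical
  let p : ∀ j, Z ⟶ X j := fun j => Cofan.IsColimit.desc h fun k =>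
    if e : k = j then eqToHom (congrArg X e) else 0
  have hp : ∀ k j, i k ≫ p j = if e : k = j then eqToHom (congrArg X e) else 0 := fun k j =>
    Cofan.IsColimit.fac h _ k
  refine ⟨p, ?_⟩
  let N : Submodule S Z.obj :=
    { carrier := {z | ∃ t : Finset J, ∀ t', t ⊆ t' → z = ∑ j ∈ t', lin (i j) (lin (p j) z)}
      zero_mem' := ⟨∅, fun _ _ => by simp⟩
      add_mem' := by
        rintro x y ⟨t, ht⟩ ⟨s, hs⟩
        refine ⟨t ∪ s, fun t' h' => ?_⟩
        simp only [map_add, Finset.sum_add_distrib]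
        rw [← ht t' (Finset.union_subset_left h'), ← hs t' (Finset.union_subset_right h')]
      smul_mem' := by
        rintro a x ⟨t, ht⟩
        refine ⟨t, fun t' h' => ?_⟩
        simp only [map_smul, ← Finset.smul_sum]
        rw [← ht t' h'] }
  have hN : ∀ k x, lin (i k) x ∈ N := fun k x => ⟨{k}, fun t' h' => by
    have e : ∀ j, lin (i j) (lin (p j) (lin (i k) x)) = lin (i k ≫ p j ≫ i j) x := fun _ => rfl
    rw [Finset.sum_eq_single_of_mem k (h' (Finset.mem_singleton_self k))]
    · rw [e, ← Category.assoc, hp, dif_pos rfl, eqToHom_refl, Category.id_comp]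
    · intro j _ hj
      rw [e, ← Category.assoc, hp, dif_neg hj.symm, zero_comp]
      rfl⟩
  -- The elements that are finite sums of their components form a submodule containing every
  -- summand, so by the universal property the quotient map by it is zero.
  have key : homOf (M := Z) (N := quotObj Z N) N.mkQ = 0 := Cofan.IsColimit.hom_ext h _ _ fun k => by
    ext x
    exact (Submodule.Quotient.mk_eq_zero _).2 (hN k x)
  exact fun z => (Submodule.Quotient.mk_eq_zero N).1
    (congrArg (fun k : Z ⟶ quotObj Z N => lin k z) key)

end Pretorsion

/-! ### Equivariant modules -/

section Equivariant

variable {G : Type u} [Group G] [AffineAlgebraicGroup G]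
variable {A : Type u} [Ring A] [Algebra ℂ A] [MulSemiringAction G A] [SMulCommClass G ℂ A]

section Basic

variable {M N : ModuleCat.{u} (SkewMonoidAlgebra A G)}

lemma repOf_smul (g : G) (a : A) (m : M) : repOf M g (a • m) = (g • a) • repOf M g m := by
  change SkewMonoidAlgebra.single g (1 : A) • SkewMonoidAlgebra.single (1 : G) a • m =
    SkewMonoidAlgebra.single (1 : G) (g • a) • SkewMonoidAlgebra.single g (1 : A) • m
  rw [← mul_smul, ← mul_smul, SkewMonoidAlgebra.single_mul_single, SkewMonoidAlgebra.single_mul_single]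
  simp

lemma single_smul (g : G) (a : A) (m : M) : SkewMonoidAlgebra.single g a • m = a • repOf M g m := by
  change _ = SkewMonoidAlgebra.single (1 : G) a • SkewMonoidAlgebra.single g (1 : A) • m
  rw [← mul_smul, SkewMonoidAlgebra.single_mul_single]
  simp

/-- An equivariant linear map is linear over the smash product. -/
def homOfLinear (f : M →ₗ[A] N) (hf : ∀ g m, f (repOf M g m) = repOf N g (f m)) :
    M →ₗ[SkewMonoidAlgebra A G] N where
  toFun := f
  map_add' := f.map_add
  map_smul' s m := by
    induction s using SkewMonoidAlgebra.induction_on with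
    | zero => simp
    | single g a => simp only [single_smul, map_smul, hf, RingHom.id_apply]
    | add s t h h' => simp only [add_smul, map_add, h, h', RingHom.id_apply]

/-- A stable submodule is a submodule over the smash product. -/
def stableSub (L : Submodule A M) (h : ∀ g, ∀ x ∈ L, repOf M g x ∈ L) :
    Submodule (SkewMonoidAlgebra A G) M where
  carrier := L
  zero_mem' := L.zero_mem
  add_mem' := L.add_mem
  smul_mem' s m hm := by
    induction s using SkewMonoidAlgebra.induction_on with
    | zero => rw [zero_smul]; exact L.zero_mem
    | single g a => rw [single_smul]; exact L.smul_mem _ (h g m hm)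
    | add s t h h' => rw [add_smul]; exact L.add_mem h h'

/-- The `A`-linear map underlying a morphism. -/
def linA (f : M ⟶ N) : M →ₗ[A] N :=
  { homC f with map_smul' := hom_smulA f }

/-- A module with a compatible action is a module over the smash product. -/
lemma exists_moduleCat {V : Type u} [AddCommGroup V] [Module ℂ V] [Module A V] [IsScalarTower ℂ A V]
    (ρ : Representation ℂ G V) (hρ : ∀ g (a : A) v, ρ g (a • v) = (g • a) • ρ g v) :
    ∃ (X : ModuleCat.{u} (SkewMonoidAlgebra A G)) (e : X ≃ₗ[A] V), ∀ g x, e (repOf X g x) = ρ g (e x) := by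
  obtain ⟨φ, hφ⟩ : ∃ φ : SkewMonoidAlgebra A G →+* AddMonoid.End V,
      ∀ g a v, φ (SkewMonoidAlgebra.single g a) v = a • ρ g v := ⟨SkewMonoidAlgebra.liftNCRingHom
    (Module.toAddMonoidEnd A V)
    { toFun := fun g => (ρ g).toAddMonoidHom
      map_one' := by ext v; rw [map_one]; rfl
      map_mul' := fun g h => by ext v; rw [map_mul]; rfl }
    (fun {a g} => by ext v; exact (hρ g a v).symm), fun g a v =>
      DFunLike.congr_fun (SkewMonoidAlgebra.liftNC_single _ _ g a) v⟩
  obtain ⟨X, e, he⟩ : ∃ (X : ModuleCat.{u} (SkewMonoidAlgebra A G)) (e : X ≃+ V),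
      ∀ s x, e (s • x) = φ s (e x) := by
    let : Module (SkewMonoidAlgebra A G) V := Module.compHom V φ
    exact ⟨ModuleCat.of _ V, AddEquiv.refl V, fun _ _ => rfl⟩
  refine ⟨X, e.toLinearEquiv fun a x => ?_, fun g x => ?_⟩
  · rw [smulA_def, he, hφ, map_one]
    rfl
  · exact (he _ x).trans ((hφ g 1 _).trans (one_smul _ _))

end Basic

lemma isElementwise_weaklyEquivariant : IsElementwise (weaklyEquivariant G A) := fun M h m => by
  obtain ⟨X, f, x, hX, rfl⟩ := h m
  obtain ⟨n, a, w, e⟩ := hX x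
  exact ⟨n, a, fun i => homC f (w i), fun g => by
    change repOf M g (homC f x) = _
    rw [← homC_repOf, e g]
    simp⟩

variable {κ : Type} [Fintype κ] [DecidableEq κ] (r : MatRep G κ)

/-! #### Free modules -/

section Free

variable (hA : IsRational (actRep G A))

include hA in
lemma exists_freeMod : ∃ (F : WeakMod G A) (e : F.obj ≃ₗ[A] (κ → A)),
    ∀ g x, e (repOf F.obj g x) = tupleRep r (actRep G A) g (e x) := by
  obtain ⟨X, e, he⟩ := exists_moduleCat (V := κ → A) (tupleRep r (actRep G A))
    fun g a x => tupleRep_smul (S := A) (V := A) r actRep_mul g a x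
  refine ⟨⟨X, fun x => ?_⟩, e, he⟩
  obtain ⟨n, a, w, h⟩ := isRational_tupleRep r hA (e x)
  refine ⟨n, a, fun i => e.symm (w i), fun g => e.injective ?_⟩
  rw [he, h g, map_sum]
  refine Finset.sum_congr rfl fun i _ => ?_
  rw [smulC_def, map_smul, e.apply_symm_apply, algebraMap_smul]

/-- The equivariant module of tuples. -/
def freeMod : WeakMod G A := (exists_freeMod r hA).choose

/-- The underlying module of the equivariant module of tuples. -/
def freeEquiv : (freeMod r hA).obj ≃ₗ[A] (κ → A) := (exists_freeMod r hA).choose_spec.choose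

lemma freeEquiv_repOf (g : G) (x : (freeMod r hA).obj) :
    freeEquiv r hA (repOf _ g x) = tupleRep r (actRep G A) g (freeEquiv r hA x) :=
  (exists_freeMod r hA).choose_spec.choose_spec g x

/-- The generators of the module of tuples. -/
def freeGen (a : κ) : (freeMod r hA).obj := (freeEquiv r hA).symm (Pi.single a 1)

variable {M : WeakMod G A}

/-- The morphism given by the images of the generators. -/
def freeDesc (v : κ → M.obj) (hv : ∀ g a, repOf M.obj g (v a) = ∑ b, r.hom g b a • v b) :
    freeMod r hA ⟶ M :=
  homOf <| homOfLinear
    { toFun := fun x => ∑ a, freeEquiv r hA x a • v a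
      map_add' := fun x y => by simp [add_smul, Finset.sum_add_distrib]
      map_smul' := fun a x => by simp [mul_smul, Finset.smul_sum] } fun g x => by
    change ∑ b, freeEquiv r hA (repOf _ g x) b • v b = repOf M.obj g (∑ a, freeEquiv r hA x a • v a)
    simp only [freeEquiv_repOf, tupleRep_apply, map_sum, repOf_smul, hv, Finset.sum_smul, Finset.smul_sum]
    rw [Finset.sum_comm]
    have : SMulCommClass ℂ A M.obj := inferInstance
    refine Finset.sum_congr rfl fun a _ => Finset.sum_congr rfl fun b _ => ?_
    rw [smul_assoc]
    exact smul_comm (r.hom g b a) (g • freeEquiv r hA x a) (v b)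

lemma freeDesc_apply (v : κ → M.obj) (hv : ∀ g a, repOf M.obj g (v a) = ∑ b, r.hom g b a • v b)
    (x : (freeMod r hA).obj) : lin (freeDesc r hA v hv) x = ∑ a, freeEquiv r hA x a • v a := rfl

lemma freeDesc_gen (v : κ → M.obj) (hv : ∀ g a, repOf M.obj g (v a) = ∑ b, r.hom g b a • v b)
    (a : κ) : lin (freeDesc r hA v hv) (freeGen r hA a) = v a := by
  rw [freeDesc_apply, freeGen, LinearEquiv.apply_symm_apply, Finset.sum_eq_single a]
  · rw [Pi.single_eq_same, one_smul]
  · intro b _ hb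
    rw [Pi.single_eq_of_ne hb, zero_smul]
  · simp

lemma eq_sum_freeGen (x : (freeMod r hA).obj) : x = ∑ a, freeEquiv r hA x a • freeGen r hA a :=
  (freeEquiv r hA).injective <| by
    rw [map_sum]
    funext b
    simp [freeGen, Pi.single_apply]

lemma freeMod_hom_ext {f f' : freeMod r hA ⟶ M} (h : ∀ a, lin f (freeGen r hA a) = lin f' (freeGen r hA a)) :
    f = f' := by
  ext x
  change linA f.hom x = linA f'.hom x
  rw [eq_sum_freeGen r hA x, map_sum, map_sum]
  refine Finset.sum_congr rfl fun a _ => ?_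
  rw [map_smul, map_smul]
  exact congrArg _ (h a)

lemma repOf_lin_freeGen (f : freeMod r hA ⟶ M) (g : G) (a : κ) :
    repOf M.obj g (lin f (freeGen r hA a)) = ∑ b, r.hom g b a • lin f (freeGen r hA b) := by
  have h1 : repOf _ g (freeGen r hA a) = ∑ b, r.hom g b a • freeGen r hA b :=
    (freeEquiv r hA).injective <| by
      rw [freeEquiv_repOf, freeGen, LinearEquiv.apply_symm_apply, map_sum]
      funext b
      simp only [Finset.sum_apply, smulC_def, map_smul, freeGen, LinearEquiv.apply_symm_apply,
        tupleRep_apply, Pi.smul_apply, smul_eq_mul]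
      rw [Finset.sum_eq_single a, Finset.sum_eq_single b]
      · simp [Algebra.algebraMap_eq_smul_one]
      · intro c _ hc
        rw [Pi.single_eq_of_ne hc.symm, mul_zero]
      · simp
      · intro c _ hc
        rw [Pi.single_eq_of_ne hc, map_zero, smul_zero]
      · simp
  change repOf M.obj g (homC f.hom _) = ∑ b, r.hom g b a • homC f.hom _
  rw [← homC_repOf, h1, map_sum]
  simp only [map_smul]

/-- Equivariant maps out of the representation `r` are the invariants of its dual tensored with the
target. -/
lemma mem_semi_dual_iff {V : Type*} [AddCommGroup V] [Module ℂ V] {ρ : Representation ℂ G V} {v : κ → V} :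
    v ∈ semi (tupleRep r.dual ρ) 1 ↔ ∀ g a, ρ g (v a) = ∑ b, r.hom g b a • v b := by
  have h0 : ∀ g a b, ∑ c, r.hom g a c * r.hom g⁻¹ c b = if a = b then 1 else 0 := fun g a b => by
    rw [← Matrix.mul_apply, ← map_mul, mul_inv_cancel, map_one, Matrix.one_apply]
  have h1 : ∀ g a b, ∑ c, r.hom g⁻¹ a c * r.hom g c b = if a = b then 1 else 0 := fun g a b => by
    rw [← Matrix.mul_apply, ← map_mul, inv_mul_cancel, map_one, Matrix.one_apply]
  constructor
  · intro h g a
    have h2 : ∀ b, ∑ c, r.hom g⁻¹ c b • ρ g (v c) = v b := fun b =>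
      (congrFun (h g) b).trans (one_smul ℂ _)
    have h3 : ∀ b, r.hom g b a • v b = ∑ c, (r.hom g⁻¹ c b * r.hom g b a) • ρ g (v c) := fun b =>
      (congrArg _ (h2 b).symm).trans (by simp only [Finset.smul_sum, smul_smul, mul_comm])
    simp only [h3]
    rw [Finset.sum_comm]
    simp only [← Finset.sum_smul, h1, ite_smul, zero_smul, one_smul]
    simp
  · intro h g
    funext b
    change ∑ a, r.hom g⁻¹ a b • ρ g (v a) = (1 : ℂ) • v b
    simp only [h, Finset.smul_sum, smul_smul]
    rw [Finset.sum_comm, one_smul]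
    simp only [← Finset.sum_smul, mul_comm (r.hom g⁻¹ _ b), h0]
    simp

/-- Morphisms out of the free module are invariants of the tuples with the dual action, and
reductivity lifts invariants along surjections. -/
lemma projective_freeMod (hG : IsReductive G) : Projective (freeMod r hA) where
  factors {X Y} f e _ := by
    let v : κ → Y.obj := fun a => lin f (freeGen r hA a)
    have hv : v ∈ semi (tupleRep r.dual (repOf Y.obj)) 1 :=
      (mem_semi_dual_iff r).2 (repOf_lin_freeGen r hA f)
    choose w₀ hw₀ using fun a => lin_surjective e (v a)
    obtain ⟨w, hw, hwv⟩ := exists_semi_lift hG (isRational_tupleRep r.dual X.property)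
      (isRational_tupleRep r.dual Y.property) (ψ := 1) (N := ⊤) (fun _ _ _ => Submodule.mem_top)
      ((homC e.hom).compLeft κ ∘ₗ Submodule.subtype ⊤) (fun g x => funext fun b => by
        change ∑ a, r.dual.hom g b a • repOf Y.obj g (homC e.hom (x.1 a)) =
          homC e.hom (∑ a, r.dual.hom g b a • repOf X.obj g (x.1 a))
        simp only [map_sum, map_smul, homC_repOf]) ⟨w₀, Submodule.mem_top⟩ (by
        convert hv using 1
        exact funext hw₀)
    refine ⟨freeDesc r hA w.1 ((mem_semi_dual_iff r).1 hw), freeMod_hom_ext r hA fun a => ?_⟩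
    change lin e (lin (freeDesc r hA w.1 _) (freeGen r hA a)) = _
    rw [freeDesc_gen]
    exact (congrFun hwv a).trans (hw₀ a)

/-- The modules of tuples generate. -/
lemma exists_freeMod_hom (m : M.obj) : ∃ (n : ℕ) (r : MatRep G (Fin n)) (f : freeMod r hA ⟶ M)
    (x : (freeMod r hA).obj), lin f x = m := by
  obtain ⟨n, v, r, -, hv, hs⟩ := exists_matRep M.property (Set.finite_singleton m)
  have hm : m ∈ Submodule.span ℂ (Set.range v) := hs ▸ subset_orbitSpan _ (Set.mem_singleton m)
  obtain ⟨c, rfl⟩ := (Submodule.mem_span_range_iff_exists_fun ℂ).1 hm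
  refine ⟨n, r, freeDesc r hA v hv, (freeEquiv r hA).symm fun a => algebraMap ℂ A (c a), ?_⟩
  rw [freeDesc_apply, LinearEquiv.apply_symm_apply]
  rfl

include hA in
lemma enoughProjectives_weakMod (hG : IsReductive G) [HasCoproducts.{u} (WeakMod G A)] :
    EnoughProjectives (WeakMod G A) := ⟨fun M => by
  let J := Σ (r : Σ n : ℕ, MatRep G (Fin n)), freeMod r.2 hA ⟶ M
  have := fun j : J => projective_freeMod j.1.2 hA hG
  refine ⟨{ p := ∐ fun j : J => freeMod j.1.2 hA, f := Sigma.desc fun j => j.2, epi := ?_ }⟩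
  refine epi_of_surjective fun m => ?_
  obtain ⟨n, r, f, x, rfl⟩ := exists_freeMod_hom hA m
  exact ⟨lin (Sigma.ι (fun j : J => freeMod j.1.2 hA) ⟨⟨n, r⟩, f⟩) x,
    congrArg (fun k : freeMod r hA ⟶ M => lin k x)
      (Sigma.ι_desc (fun j : J => j.2) ⟨⟨n, r⟩, f⟩)⟩⟩

end Free

end Equivariant

/-! ### The categories of a quantization -/

section Quantized

variable {G : Type u} [Group G] [AffineAlgebraicGroup G]
variable {R : Type u} [CommRing R] [Algebra ℂ R] [MulSemiringAction G R] [SMulCommClass G ℂ R]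
  {W : HamiltonianSpace G R}
variable {A : Type u} [Ring A] [Algebra ℂ A] [MulSemiringAction G A] [SMulCommClass G ℂ A]
  (Q : FilteredQuantization W A) (c : LieAlgebra.LieCharacter ℂ (LieAlg G))

lemma isElementwise_twistedEquivariant : IsElementwise (twistedEquivariant Q c) := fun M h => by
  have hM : IsRational (repOf M) := isElementwise_weaklyEquivariant M fun m => by
    obtain ⟨X, f, x, hX, hx⟩ := h m
    exact ⟨X, f, x, hX.1, hx⟩
  exact ⟨hM, fun z m => by
    obtain ⟨X, f, x, ⟨hX, k⟩, rfl⟩ := h m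
    change infAct _ z (homC f x) - _ • homC f x = 0
    rw [← infAct_hom f hX, ← homC_smulA, ← map_sub, k, map_zero]⟩

/-! #### The left adjoint of the forgetful functor -/

/-- The relations of twisted equivariance, as a subobject. -/
def twistRel (M : WeakMod G A) : Submodule (SkewMonoidAlgebra A G) M.obj :=
  stableSub (relMod Q c M.property) fun g _ hx => rep_mem_relMod M.property repOf_smul g hx

lemma relMod_eq_bot (Y : TwistedMod Q c) : relMod Q c Y.property.1 = ⊥ := by
  refine (Submodule.span_eq_bot).2 ?_
  rintro _ ⟨g, z, v, rfl⟩
  rw [show tau Q Y.property.1 z (c z) v = 0 from Y.property.2 z v, map_zero]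

/-- The largest twisted equivariant quotient of an equivariant module. -/
def twist (M : WeakMod G A) : TwistedMod Q c where
  obj := (quotObj M (twistRel Q c M)).obj
  property := by
    have hN : IsRational (repOf (quotObj M (twistRel Q c M)).obj) := (quotObj M _).property
    refine ⟨hN, fun z x => ?_⟩
    let q : M ⟶ quotObj M (twistRel Q c M) := homOf (Submodule.mkQ _)
    obtain ⟨m, rfl⟩ := (twistRel Q c M).mkQ_surjective x
    change infAct _ z (homC q.hom m) - _ • homC q.hom m = 0
    rw [← infAct_hom q.hom M.property, ← homC_smulA, ← map_sub]
    exact (Submodule.Quotient.mk_eq_zero _).2 (Submodule.subset_span ⟨1, z, m, by rw [map_one]; rfl⟩)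

/-- The projection to the largest twisted equivariant quotient. -/
def toTwist (M : WeakMod G A) : M ⟶ (sap Q c).obj (twist Q c M) :=
  homOf (N := (sap Q c).obj (twist Q c M)) (Submodule.mkQ (twistRel Q c M))

lemma toTwist_surjective (M : WeakMod G A) : Function.Surjective (lin (toTwist Q c M)) :=
  Submodule.mkQ_surjective _

variable {Q c}

lemma toTwist_eq_zero {M : WeakMod G A} {m : M.obj} :
    lin (toTwist Q c M) m = 0 ↔ m ∈ relMod Q c M.property :=
  Submodule.Quotient.mk_eq_zero (twistRel Q c M)

lemma map_relMod_eq_zero {M : WeakMod G A} {Y : TwistedMod Q c} (f : M ⟶ (sap Q c).obj Y) {x : M.obj}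
    (hx : x ∈ relMod Q c M.property) : lin f x = 0 := by
  have h := map_mem_relMod M.property Y.property.1 (linA f.hom) (fun g v => (homC_repOf f.hom g v).symm) hx
  rwa [relMod_eq_bot, Submodule.mem_bot] at h

/-- The universal property of the largest twisted equivariant quotient. -/
def twistDesc {M : WeakMod G A} {Y : TwistedMod Q c} (f : M ⟶ (sap Q c).obj Y) : twist Q c M ⟶ Y :=
  homOf (M := twist Q c M) ((twistRel Q c M).liftQ (lin f) fun _ hx => map_relMod_eq_zero f hx)

lemma toTwist_twistDesc {M : WeakMod G A} {Y : TwistedMod Q c} (f : M ⟶ (sap Q c).obj Y) :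
    toTwist Q c M ≫ (sap Q c).map (twistDesc f) = f := rfl

lemma twist_hom_ext {M : WeakMod G A} {Y : TwistedMod Q c} {f f' : twist Q c M ⟶ Y}
    (h : toTwist Q c M ≫ (sap Q c).map f = toTwist Q c M ≫ (sap Q c).map f') : f = f' := by
  ext x
  obtain ⟨m, rfl⟩ := toTwist_surjective Q c M x
  exact congrArg (fun k : M ⟶ (sap Q c).obj Y => lin k m) h

/-- The universal property, as a bijection. -/
def twistEquiv (M : WeakMod G A) (Y : TwistedMod Q c) : (twist Q c M ⟶ Y) ≃ (M ⟶ (sap Q c).obj Y) where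
  toFun f := toTwist Q c M ≫ (sap Q c).map f
  invFun f := twistDesc f
  left_inv _ := twist_hom_ext (toTwist_twistDesc _)
  right_inv f := toTwist_twistDesc f

lemma exists_leftAdjoint_sap : ∃ (Φ : WeakMod G A ⥤ TwistedMod Q c) (_ : Φ ⊣ sap Q c),
    ∀ M, Φ.obj M = twist Q c M :=
  ⟨_, Adjunction.adjunctionOfEquivLeft (G := sap Q c) (F_obj := twist Q c) twistEquiv
    fun _ _ _ _ _ => rfl, fun _ => rfl⟩

section Generators

variable {κ : Type} [Fintype κ] [DecidableEq κ] (r : MatRep G κ)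

/-- Morphisms from the generators of the twisted category. -/
lemma twist_freeMod_hom_ext {Y : TwistedMod Q c} {f f' : twist Q c (freeMod r Q.rational) ⟶ Y}
    (h : ∀ a, lin f (lin (toTwist Q c _) (freeGen r Q.rational a)) =
      lin f' (lin (toTwist Q c _) (freeGen r Q.rational a))) : f = f' :=
  twist_hom_ext (freeMod_hom_ext r Q.rational h)

/-- A morphism is determined by the images of finitely many generators, and these involve only
finitely many summands. -/
lemma isFinitary_twist_freeMod : IsFinitary.{u} (twist Q c (freeMod r Q.rational)) := by
  classical
  intro J X Z i hZ f
  obtain ⟨p, hp⟩ := exists_coproduct_projections hZ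
  choose t ht using fun a => hp (lin f (lin (toTwist Q c _) (freeGen r Q.rational a)))
  let T : Finset J := Finset.univ.biUnion t
  refine ⟨T, fun j => f ≫ p j, twist_freeMod_hom_ext r fun a => ?_⟩
  have h1 := ht a T (Finset.subset_biUnion_of_mem t (Finset.mem_univ a))
  have h2 : ∀ (s : Finset J) (x : (twist Q c (freeMod r Q.rational)).obj),
      lin (∑ j ∈ s, (f ≫ p j) ≫ i j) x = ∑ j ∈ s, lin (i j) (lin (p j) (lin f x)) := fun s x => by
    induction s using Finset.induction_on with
    | empty => rfl
    | insert j s hj ih =>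
      rw [Finset.sum_insert hj, Finset.sum_insert hj, ← ih]
      rfl
  exact h1.trans (h2 _ _).symm

lemma isZero_of_twist_freeMod {M : TwistedMod Q c} (h : ∀ (n : ℕ) (r : MatRep G (Fin n))
    (f : twist Q c (freeMod r Q.rational) ⟶ M), f = 0) : IsZero M := by
  refine (IsZero.iff_id_eq_zero M).2 ?_
  ext m
  obtain ⟨n, r, f, x, hx⟩ := exists_freeMod_hom (M := (sap Q c).obj M) Q.rational m
  have h1 : f = 0 := by
    rw [← toTwist_twistDesc f, h n r (twistDesc f), Functor.map_zero, comp_zero]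
  rw [h1] at hx
  exact hx.symm

end Generators

/-! #### Local cohomology -/

variable (Q c) in
/-- The vanishing of local cohomology on the category of twisted equivariant modules. -/
def van (χ : G →* ℂˣ) (hG : IsReductive G) (i : ℕ) : ObjectProperty (TwistedMod Q c) :=
  fun M => Van Q χ⁻¹ hG i M.obj

variable {χ : G →* ℂˣ} (hG : IsReductive G) [IsNoetherianRing R]

include hG in
lemma unstableTwisted_iff (M : TwistedMod Q c) :
    unstableTwisted Q c χ M ↔ ∀ m : M.obj, IsTors Q χ⁻¹ m :=
  ⟨fun h m => isTors_of_singularSupport_subset hG M.property.1 repOf_smul h m,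
    fun h => singularSupport_subset_of_isTors h hG⟩

variable (χ) in
/-- The torsion subobject. -/
def torsSub (M : TwistedMod Q c) : Submodule (SkewMonoidAlgebra A G) M.obj :=
  stableSub
    { carrier := {m | IsTors Q χ⁻¹ m}
      zero_mem' := IsTors.zero
      add_mem' := IsTors.add
      smul_mem' := fun b _ hm => IsTors.smul hG M.property.1 repOf_smul hm b } fun g _ hx =>
    IsTors.rep repOf_smul hx g

lemma isTors_map {M N : TwistedMod Q c} (f : M ⟶ N) {m : M.obj} (h : IsTors Q χ⁻¹ m) :
    IsTors Q χ⁻¹ (lin f m) := IsTors.map (linA f.hom).toAddMonoidHom (linA f.hom).map_smul h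

lemma isTors_of_injective {M N : TwistedMod Q c} (f : M ⟶ N) (hf : Function.Injective (lin f)) {m : M.obj}
    (h : IsTors Q χ⁻¹ (lin f m)) : IsTors Q χ⁻¹ m := by
  obtain ⟨k, hk⟩ := h
  exact ⟨k, fun β hβ a ha => hf (((linA f.hom).map_smul a m).trans ((hk β hβ a ha).trans (map_zero _).symm))⟩

lemma exists_torsionFree_quotient (M : TwistedMod Q c) : ∃ (F : TwistedMod Q c) (p : M ⟶ F), Epi p ∧
    unstableTwisted Q c χ (kernel p) ∧ van Q c χ hG 0 F := by
  let q : M ⟶ quotObj M (torsSub χ hG M) := homOf (Submodule.mkQ _)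
  have hq : ∀ m, lin q m = 0 ↔ IsTors Q χ⁻¹ m := fun m => Submodule.Quotient.mk_eq_zero (torsSub χ hG M)
  have hqs : Function.Surjective (lin q) := Submodule.mkQ_surjective _
  refine ⟨_, q, epi_of_surjective hqs, (unstableTwisted_iff hG _).2 fun x => ?_,
    van_zero_iff.2 fun y hy => ?_⟩
  · exact isTors_of_injective (kernel.ι q) (lin_injective _) ((hq _).1
      (congrArg (fun k : kernel q ⟶ _ => lin k x) (kernel.condition q)))
  · obtain ⟨m, rfl⟩ := hqs y
    obtain ⟨k, hk⟩ := hy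
    exact (hq m).2 (isTors_of_isTors_smul hG (k := k) fun β hβ a ha =>
      (hq _).1 (((linA q.hom).map_smul a m).trans (hk β hβ a ha)))

/-- In an injective `E` containing `M`, the image of `M` avoids the torsion of `E`. By
`exists_injective_disjoint` it lies in an injective submodule with the same property, so no
stability of torsion under injective hulls is used. -/
lemma exists_torsionFree_injective (M : TwistedMod Q c) (h : van Q c χ hG 0 M) :
    ∃ (E : TwistedMod Q c) (f : M ⟶ E), Mono f ∧ Injective E ∧ van Q c χ hG 0 E := by
  obtain ⟨E, f, hf, hE⟩ := exists_mono_injective (isElementwise_twistedEquivariant Q c) M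
  obtain ⟨E', hfE, hT, hE'⟩ := exists_injective_disjoint E (N := LinearMap.range (lin f))
    (T := torsSub χ hG E) <| Submodule.disjoint_def.2 <| by
      rintro _ ⟨y, rfl⟩ hy
      rw [van_zero_iff.1 h y (isTors_of_injective f (lin_injective f) hy), map_zero]
  let ι : subObj E E' ⟶ E := homOf E'.subtype
  refine ⟨subObj E E', homOf ((lin f).codRestrict E' fun y => hfE ⟨y, rfl⟩),
    mono_of_injective fun x y hxy => lin_injective f (congrArg Subtype.val hxy), hE',
    van_zero_iff.2 fun x hx => ?_⟩
  exact Subtype.ext (Submodule.disjoint_def.1 hT x.1 x.2 (isTors_map ι hx))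

end Quantized

section Acyclic

variable {G : Type u} [Group G] [AffineAlgebraicGroup G]
variable {R : Type u} [CommRing R] [Algebra ℂ R] [MulSemiringAction G R] [SMulCommClass G ℂ R]
  {W : HamiltonianSpace G R}
variable {A : Type u} [Ring A] [Algebra ℂ A] [MulSemiringAction G A] [SMulCommClass G ℂ A]
  {Q : FilteredQuantization W A} {c : LieAlgebra.LieCharacter ℂ (LieAlg G)}

/-! #### Injective objects -/

section FreeComplex

variable {θ : G →* ℂˣ} (hθ : (fun g => (θ g : ℂ)) ∈ AffineAlgebraicGroup.coord (G := G))
variable {ι ι' τ : Type} [Fintype ι] [DecidableEq ι] [Fintype ι'] [DecidableEq ι'] [Fintype τ]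
  [DecidableEq τ] {b : ι → ℤ × ℤ} {b' : ι' → ℤ × ℤ} (s : MatRep G τ) {D : Matrix ι' ι A}

variable (Q) in
/-- Right multiplication by a matrix of semi-invariants. -/
def freeMap (hD : ∀ p q, D p q ∈ biA Q θ (b' p - b q)) :
    freeMod (rowRep hθ b' s) Q.rational ⟶ freeMod (rowRep hθ b s) Q.rational :=
  homOf <| homOfLinear ((freeEquiv _ Q.rational).symm.toLinearMap ∘ₗ rowMul τ D ∘ₗ
      (freeEquiv (rowRep hθ b' s) Q.rational).toLinearMap) fun g m => by
    refine (freeEquiv (rowRep hθ b s) Q.rational).injective ?_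
    simp only [LinearMap.comp_apply, LinearEquiv.coe_coe, freeEquiv_repOf, LinearEquiv.apply_symm_apply]
    rw [tupleRep_rowMul_of_mem (Q := Q) hθ s hD]

lemma freeEquiv_freeMap (hD : ∀ p q, D p q ∈ biA Q θ (b' p - b q))
    (x : (freeMod (rowRep hθ b' s) Q.rational).obj) :
    freeEquiv _ Q.rational (lin (freeMap Q hθ s hD) x) = rowMul τ D (freeEquiv _ Q.rational x) :=
  LinearEquiv.apply_symm_apply _ _

lemma freeMap_freeGen (hD : ∀ p q, D p q ∈ biA Q θ (b' p - b q)) (p : ι') (t : τ) :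
    lin (freeMap Q hθ s hD) (freeGen _ Q.rational (p, t)) =
      ∑ q, D p q • freeGen (rowRep hθ b s) Q.rational (q, t) := by
  refine (freeEquiv (rowRep hθ b s) Q.rational).injective ?_
  rw [freeEquiv_freeMap, map_sum]
  funext ⟨q, t'⟩
  simp only [freeGen, LinearEquiv.apply_symm_apply, rowMul_apply, map_smul, Finset.sum_apply,
    Pi.smul_apply, smul_eq_mul, Pi.single_apply, Prod.mk.injEq, ite_mul, mul_ite, one_mul, mul_one,
    zero_mul, mul_zero]
  by_cases h : t' = t
  · simp [h]
  · simp [h]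

lemma hom_rowRep_sum {M : Type*} [AddCommGroup M] [Module ℂ M] {ρ : Representation ℂ G M}
    {w : τ → ι → M} (hw : ∀ g t, tupleRep (colRep hθ b) ρ g (w t) = ∑ t', s.hom g t' t • w t')
    (g : G) (k : ι × τ) :
    ρ g (w k.2 k.1) = ∑ l, (rowRep hθ b s).hom g l k • w l.2 l.1 := by
  rw [rep_eq_smul_colRep hθ (b := b) ρ g (w k.2) k.1, hw, Fintype.sum_prod_type,
    Finset.sum_eq_single k.1]
  · simp only [MatRep.tensor_apply, MatRep.diag_apply, if_true, mul_smul, ← Finset.smul_sum]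
    simp
  · intro q _ hq
    refine Finset.sum_eq_zero fun t _ => ?_
    rw [MatRep.tensor_apply, MatRep.diag_apply, if_neg hq, zero_mul, zero_smul]
  · simp

end FreeComplex

variable {χ : G →* ℂˣ} (hθ : (fun g => (χ⁻¹ g : ℂ)) ∈ AffineAlgebraicGroup.coord (G := G))
  (hG : IsReductive G) [IsNoetherianRing R]

include hθ hG in
-- Semi-invariants of large weight carry `x` into relations plus boundaries, where `u` vanishes. So
-- `u x` is a torsion element of the torsion-free module `E`.
lemma lin_eq_zero_of_mem_relMod {E : TwistedMod Q c} (h0 : van Q c χ hG 0 E) {n : ℤ}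
    (𝒟 : FiltCpx Q χ⁻¹ hG n) {d i : ℕ} (s : MatRep G (Fin d))
    (u : freeMod (rowRep hθ (𝒟.b (i + 1)) s) Q.rational ⟶ (sap Q c).obj E)
    (hu : freeMap Q hθ s (𝒟.D_mem (i + 1)) ≫ u = 0)
    (x : (freeMod (rowRep hθ (𝒟.b (i + 1)) s) Q.rational).obj)
    (hx : lin (freeMap Q hθ s (𝒟.D_mem i)) x ∈ relMod Q c
      (freeMod (rowRep hθ (𝒟.b i) s) Q.rational).property) : lin u x = 0 := by
  have h1 := map_mem_relMod (Q := Q) (c := c) (freeMod _ Q.rational).property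
    (isRational_tupleRep _ Q.rational) (freeEquiv _ Q.rational).toLinearMap
    (fun g v => (freeEquiv_repOf _ Q.rational g v).symm) hx
  obtain ⟨k, hk⟩ := exists_smul_mem_homology hθ c 𝒟 s i (freeEquiv _ Q.rational x)
    (by rw [← freeEquiv_freeMap hθ s (𝒟.D_mem i)]; exact h1)
  refine van_zero_iff.1 h0 _ ⟨k, fun β hβ a ha => ?_⟩
  obtain ⟨y, hy, _, ⟨z, rfl⟩, hyz⟩ := Submodule.mem_sup.1 (hk β hβ a ha)
  have h2 := map_mem_relMod (Q := Q) (c := c)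
    (ρ' := repOf (freeMod (rowRep hθ (𝒟.b (i + 1)) s) Q.rational).obj)
    (isRational_tupleRep _ Q.rational) (freeMod _ Q.rational).property
    (freeEquiv _ Q.rational).symm.toLinearMap (fun g v => by
      refine (freeEquiv _ Q.rational).injective ?_
      rw [freeEquiv_repOf]
      simp) hy
  have h3 : a • x = (freeEquiv _ Q.rational).symm y +
      lin (freeMap Q hθ s (𝒟.D_mem (i + 1))) ((freeEquiv _ Q.rational).symm z) := by
    refine (freeEquiv _ Q.rational).injective ?_
    rw [map_smul, map_add, freeEquiv_freeMap, LinearEquiv.apply_symm_apply, LinearEquiv.apply_symm_apply,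
      hyz]
  refine ((linA u.hom).map_smul a x).symm.trans ?_
  rw [h3, map_add]
  exact (congrArg₂ (· + ·) (map_relMod_eq_zero u h2)
    (congrArg (fun k : _ ⟶ (sap Q c).obj E => lin k _) hu)).trans (add_zero 0)

/-- Injectivity is applied to the morphism of twisted quotients induced by `f`, which need not be
mono; the hypothesis says that `u` vanishes on its kernel. -/
lemma exists_comp_eq_of_injective {E : TwistedMod Q c} [Injective E] {M N : WeakMod G A} (f : M ⟶ N)
    (u : M ⟶ (sap Q c).obj E) (h : ∀ x, lin f x ∈ relMod Q c N.property → lin u x = 0) :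
    ∃ v : N ⟶ (sap Q c).obj E, f ≫ v = u := by
  let g : twist Q c M ⟶ twist Q c N := twistDesc (f ≫ toTwist Q c N)
  have hg : kernel.ι g ≫ twistDesc u = 0 := by
    ext y
    obtain ⟨x, hx⟩ := toTwist_surjective Q c M (lin (kernel.ι g) y)
    have h1 : lin g (lin (toTwist Q c _) x) = 0 := by
      rw [hx]
      exact congrArg (fun k : kernel g ⟶ _ => lin k y) (kernel.condition g)
    exact (congrArg (lin (twistDesc u)) hx.symm).trans (h x (toTwist_eq_zero.1 h1))
  have hex : (ShortComplex.mk (kernel.ι g) g (kernel.condition g)).Exact :=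
    ShortComplex.exact_of_f_is_kernel _ (kernelIsKernel g)
  refine ⟨toTwist Q c N ≫ (sap Q c).map (hex.descToInjective (twistDesc u) hg), ?_⟩
  have h1 : g ≫ hex.descToInjective (twistDesc u) hg = twistDesc u := hex.comp_descToInjective _ hg
  rw [← Category.assoc, ← toTwist_twistDesc (f ≫ toTwist Q c N), Category.assoc, ← Functor.map_comp,
    show twistDesc (f ≫ toTwist Q c N) = g from rfl, h1, toTwist_twistDesc]

include hθ in
-- The translates of a cocycle define a morphism from a free module that kills the incoming
-- differential. It extends along the outgoing one, and the values of the extension on the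
-- generators form a column whose coboundary is the cocycle.
theorem van_of_injective {E : TwistedMod Q c} [Injective E] (h0 : van Q c χ hG 0 E) (i : ℕ) :
    van Q c χ hG i E := by
  intro n hn 𝒟 φ hφ
  obtain ⟨d, w, s, hw, hws, hwD⟩ := exists_cocycle_matRep (b := 𝒟.b (i + 1)) hθ E.property.1 repOf_smul
    (𝒟.D_mem (i + 1)) hφ
  let u : freeMod (rowRep hθ (𝒟.b (i + 1)) s) Q.rational ⟶ (sap Q c).obj E :=
    freeDesc (M := (sap Q c).obj E) _ Q.rational (fun k => w k.2 k.1) (hom_rowRep_sum hθ s hw)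
  have hu : ∀ k, lin u (freeGen _ Q.rational k) = w k.2 k.1 := fun k => freeDesc_gen _ _ _ _ k
  have hfu : freeMap Q hθ s (𝒟.D_mem (i + 1)) ≫ u = 0 := freeMod_hom_ext _ _ fun ⟨p, t⟩ => by
    change linA u.hom (lin (freeMap Q hθ s (𝒟.D_mem (i + 1))) (freeGen _ Q.rational (p, t))) = 0
    rw [freeMap_freeGen, map_sum]
    simp only [map_smul]
    refine Eq.trans (Finset.sum_congr rfl fun q _ => ?_) (congrFun (hwD t) p)
    exact congrArg _ (hu (q, t))
  obtain ⟨v, hv⟩ := exists_comp_eq_of_injective (freeMap Q hθ s (𝒟.D_mem i)) u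
    (lin_eq_zero_of_mem_relMod hθ hG h0 𝒟 s u hfu)
  let ψ : Fin d → Fin (𝒟.I i) → E.obj := fun t q => lin v (freeGen _ Q.rational (q, t))
  have hψ : ∀ t, mulCol (𝒟.D i) (ψ t) = w t := fun t => funext fun p => by
    have h1 : linA v.hom (lin (freeMap Q hθ s (𝒟.D_mem i)) (freeGen _ Q.rational (p, t))) = w t p :=
      (congrArg (fun k => lin k (freeGen _ Q.rational (p, t))) hv).trans (hu (p, t))
    rw [freeMap_freeGen, map_sum] at h1
    simp only [map_smul] at h1
    exact h1
  have hφw : φ ∈ Submodule.span ℂ (Set.range w) := hws ▸ subset_orbitSpan _ (Set.mem_singleton φ)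
  obtain ⟨a, ha⟩ := (Submodule.mem_span_range_iff_exists_fun ℂ).1 hφw
  have hφψ : φ = mulCol (𝒟.D i) (∑ t, a t • ψ t) := by
    rw [mulCol_sum, ← ha]
    exact Finset.sum_congr rfl fun t _ => by rw [mulCol_smulC, hψ]
  -- The cocycle is already a coboundary at the given level, so a refinement of `𝒟` by itself
  -- suffices.
  obtain ⟨Θ⟩ := FiltCpx.exists_ref le_rfl 𝒟 𝒟
  exact ⟨n, le_rfl, 𝒟, Θ, _, by rw [hφψ, Θ.mulCol_comm]⟩

/-! #### The formal properties of local cohomology -/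

include hθ in
lemma localVanishing_van : LocalVanishing (unstableTwisted Q c χ) (van Q c χ hG) where
  retract s r h hY := Van.retract (linA s.hom) (linA r.hom) (fun x => congrArg (fun k => lin k x) h) hY
  sub f _ h := van_zero_iff.2 fun x hx => lin_injective f
    ((van_zero_iff.1 h _ (isTors_map f hx)).trans (map_zero (lin f)).symm)
  ext {S} hS _ h₁ h₃ := by
    have := hS.mono_f
    have := hS.epi_g
    exact Van.ext (linA S.f.hom) (linA S.g.hom) (lin_injective S.f) (lin_surjective S.g)
      (lin_exact hS.exact) h₁ h₃
  quot {S} hS _ h₂ h₁ := by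
    have := hS.mono_f
    have := hS.epi_g
    exact Van.quot (linA S.f.hom) (linA S.g.hom) (lin_injective S.f) (lin_surjective S.g)
      (lin_exact hS.exact) h₂ h₁
  ker {S} hS _ h₂ h₃ := by
    have := hS.mono_f
    have := hS.epi_g
    exact Van.ker (linA S.f.hom) (linA S.g.hom) (lin_injective S.f) (lin_surjective S.g)
      (lin_exact hS.exact) h₂ h₃
  torsion hT i := Van.of_isTors ((unstableTwisted_iff hG _).1 hT) i
  torsionFree h T f hT := by
    ext x
    exact van_zero_iff.1 h _ (isTors_map f ((unstableTwisted_iff hG T).1 hT x))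
  torsionSub := exists_torsionFree_quotient hG
  embed := exists_torsionFree_injective hG
  injective {E} hE h := van_of_injective hθ hG h

lemma van_coproduct {J : Type u} {X : J → TwistedMod Q c} {Z : TwistedMod Q c} {k : ∀ j, X j ⟶ Z}
    (hZ : IsColimit (Cofan.mk Z k)) {i : ℕ} (h : ∀ j, van Q c χ hG i (X j)) : van Q c χ hG i Z := by
  obtain ⟨p, hp⟩ := exists_coproduct_projections hZ
  exact Van.of_sum h (fun j => linA (k j).hom) (fun j => linA (p j).hom) hp

end Acyclic

end Microlocal

end

/-! ### The theorem for a filtered quantization. -/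

open Microlocal in
theorem mainTheorem9
    {G : Type u} [Group G] [AffineAlgebraicGroup G] [ConnectedSpace (PrimeSpectrum (CoordRing G))]
    (hG : IsReductive G)
    {R : Type u} [CommRing R] [Algebra ℂ R] [Algebra.Smooth ℂ R] [ConnectedSpace (PrimeSpectrum R)]
    [MulSemiringAction G R] [SMulCommClass G ℂ R]
    (W : HamiltonianSpace G R) (hW : W.IsFlat)
    {A : Type u} [Ring A] [Algebra ℂ A] [MulSemiringAction G A] [SMulCommClass G ℂ A]
    (Q : FilteredQuantization W A)
    (c : LieAlgebra.LieCharacter ℂ (LieAlg G))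
    (χ : G →* ℂˣ) (hχ : (fun g => (χ g : ℂ)) ∈ AffineAlgebraicGroup.coord (G := G))
    [HasDerivedCategory.{w₁} (WeakMod G A)] [HasDerivedCategory.{w₂} (TwistedMod Q c)]
    [HasDerivedCategory.{w₃} (MicroMod Q c χ)] :
    (HasCoproducts.{u} (DerivedCategory (WeakMod G A)) ∧
      HasCoproducts.{u} (DerivedCategory (TwistedMod Q c)) ∧
      HasCoproducts.{u} (DerivedCategory (MicroMod Q c χ))) ∧
    (∃ (Φ : WeakMod G A ⥤ TwistedMod Q c) (_ : Φ ⊣ sap Q c) (_ : Φ.Additive)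
      (LΦ : DerivedCategory (WeakMod G A) ⥤ DerivedCategory (TwistedMod Q c))
      (α : DerivedCategory.Q ⋙ LΦ ⟶
        Φ.mapHomologicalComplex (ComplexShape.up ℤ) ⋙ DerivedCategory.Q)
      (_ : LΦ.IsLeftDerivedFunctor α (HomologicalComplex.quasiIso _ (ComplexShape.up ℤ))),
      Nonempty (LΦ ⊣ (sap Q c).mapDerivedCategory)) ∧
    PreservesColimitsOfSize.{u, u} (sap Q c).mapDerivedCategory ∧
    (∃ (Γ : MicroMod Q c χ ⥤ TwistedMod Q c) (_ : proj Q c χ ⊣ Γ) (_ : Γ.Additive)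
      (RΓ : DerivedCategory (MicroMod Q c χ) ⥤ DerivedCategory (TwistedMod Q c))
      (α : Γ.mapHomologicalComplex (ComplexShape.up ℤ) ⋙ DerivedCategory.Q ⟶
        DerivedCategory.Q ⋙ RΓ)
      (_ : RΓ.IsRightDerivedFunctor α (HomologicalComplex.quasiIso _ (ComplexShape.up ℤ))),
      Nonempty ((proj Q c χ).mapDerivedCategory ⊣ RΓ) ∧ PreservesColimitsOfSize.{u, u} RΓ) ∧
    IsCompactlyGenerated.{u} (DerivedCategory (MicroMod Q c χ)) := by
  have hR : IsNoetherianRing R := Algebra.FiniteType.isNoetherianRing ℂ R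
  -- The group acts on functions through inverses, so the weights of the relevant semi-invariants
  -- are powers of `χ⁻¹`.
  have hθ : (fun g => (χ⁻¹ g : ℂ)) ∈ AffineAlgebraicGroup.coord (G := G) := by
    convert AffineAlgebraicGroup.inv_regular _ hχ using 2
    rw [map_inv, MonoidHom.inv_apply]
  have hw := isElementwise_weaklyEquivariant (G := G) (A := A)
  have hT := isElementwise_twistedEquivariant Q c
  have cW : HasCoproducts.{u} (WeakMod G A) := fun _ => hasColimitsOfShape_discrete hw
  have cT : HasCoproducts.{u} (TwistedMod Q c) := fun _ => hasColimitsOfShape_discrete hT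
  have eW : ∀ J : Type u, HasExactColimitsOfShape (Discrete J) (WeakMod G A) := fun _ =>
    hasExactColimitsOfShape_discrete hw
  have eT : ∀ J : Type u, HasExactColimitsOfShape (Discrete J) (TwistedMod Q c) := fun _ =>
    hasExactColimitsOfShape_discrete hT
  -- The telescopes of the K-projective resolutions are indexed by `ℕ`, which lives in universe
  -- zero; exactness is transported along `ULift`.
  have cN : HasColimitsOfShape (Discrete ℕ) (WeakMod G A) := hasColimitsOfShape_discrete hw
  have eN : HasExactColimitsOfShape (Discrete ℕ) (WeakMod G A) :=
    HasExactColimitsOfShape.of_domain_equivalence _ (Discrete.equivalence Equiv.ulift.{u})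
  have hproj := enoughProjectives_weakMod Q.rational hG
  have hsap : ∀ J : Type u, PreservesColimitsOfShape (Discrete J) (sap Q c) := fun J => by
    have : PreservesColimitsOfShape (Discrete J) (sap Q c ⋙ (weaklyEquivariant G A).ι) :=
      preservesColimitsOfShape_discrete hT
    have := isClosedUnderColimitsOfShape_discrete (J := J) hw
    exact preservesColimitsOfShape_of_reflects_of_preserves (sap Q c) (weaklyEquivariant G A).ι
  obtain ⟨Φ, adj, hΦ⟩ := exists_leftAdjoint_sap (Q := Q) (c := c)
  have hΦa : Φ.Additive := adj.left_adjoint_additive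
  -- One bound for all modules is essential here, since the resolutions concern unbounded complexes.
  obtain ⟨N, hN⟩ := exists_van_of_le (Q := Q) hθ hG
  have hP : ∀ r : Σ n : ℕ, MatRep G (Fin n), Projective (twist Q c (freeMod r.2 Q.rational)) := fun r =>
    hΦ _ ▸ adj.map_projective _ (projective_freeMod r.2 Q.rational hG)
  obtain ⟨h1, h2, h3⟩ := exists_rightDerived_localization (unstableTwisted Q c χ) (proj Q c χ)
    (localVanishing_van hθ hG) (fun J X h i => van_coproduct hG (coproductIsCoproduct X) fun j => h j i) N
    (fun M i hi => hN M.obj (repOf M.obj) M.property.1 repOf_smul i hi)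
    (fun r : Σ n : ℕ, MatRep G (Fin n) => twist Q c (freeMod r.2 Q.rational)) hP
    (fun r => isFinitary_twist_freeMod r.2)
    (fun M h => isZero_of_twist_freeMod fun n r f => h ⟨n, r⟩ f)
  obtain ⟨LΦ, α, hα, hLΦ⟩ := exists_left_derived_adjoint_of_enoughProjectives adj
  exact ⟨⟨hasCoproducts_derivedCategory, hasCoproducts_derivedCategory, h1⟩,
    ⟨Φ, adj, hΦa, LΦ, α, hα, hLΦ⟩,
    preservesColimits_mapDerivedCategory (sap Q c) hsap, h2, h3⟩
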